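/- Let $X$ be a nonsingular variety of dimension $n$ over an algebraically closed field $k$ of characteristic $0$, and let $D\subset X$ be a reduced effective divisor, with inclusion $i:D\to X$. Let $\mathrm{Der}_X$ be the sheaf of $k$-derivations of $\mathcal O_X$, and let $\mathrm{Der}_X(-\log D)\subseteq \mathrm{Der}_X$ be the subsheaf of the derivations $\theta$ with $\theta(\mathcal O_X(-D))\subseteq \mathcal O_X(-D)$. Let $\tilde{\mathcal I}\subseteq\mathcal O_X$ be the Jacobian ideal of $D$, locally generated by an equation $h$ of $D$ and the derivatives $\theta h$, $\theta\in\mathrm{Der}_X$, and let $\mathcal I=\tilde{\mathcal I}\,\mathcal O_D$. The homomorphism $\theta\mapsto(h\mapsto \theta h \bmod \mathcal O_X(-D))$ from $\mathrm{Der}_X$ to $\mathcal Hom(\mathcal O_X(-D),i_*\mathcal O_D)=i_*\mathcal O_D(D)$ has kernel $\mathrm{Der}_X(-\log D)$ and image $i_*\mathcal I(D)$. Put $$E=\mathrm{Spec}\,\mathrm{Sym}_{\mathcal O_X}(\mathrm{Der}_X),\qquad F=\mathrm{Spec}\,\mathrm{Sym}_{\mathcal O_X}(\mathrm{Der}_X(-\log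 D)),\qquad C=\mathrm{Spec}\,\mathrm{Sym}_{\mathcal O_X}(i_*\mathcal I(D)),$$ and $P(E)=\mathrm{Proj}\,\mathrm{Sym}_{\mathcal O_X}(\mathrm{Der}_X)$, $P(C)=\mathrm{Proj}\,\mathrm{Sym}_{\mathcal O_X}(i_*\mathcal I(D))$. Let $\sigma:E\to F$ be the morphism induced by the inclusion $\mathrm{Der}_X(-\log D)\to\mathrm{Der}_X$; the surjection $\mathrm{Der}_X\to i_*\mathcal I(D)$ induces morphisms $C\to E$ and $P(C)\to P(E)$ over $X$. Assume that $D$ is free, i.e. $\mathrm{Der}_X(-\log D)$ is locally free of rank $n$, and that its Jacobian ideal is of linear type, i.e. the canonical homomorphism $\mathrm{Sym}_{\mathcal O_X}(\tilde{\mathcal I})\to\mathrm{Rees}_{\mathcal O_X}(\tilde{\mathcal I})$ is an isomorphism. Then: 1. $P(C)\to P(E)$ is a closed immersion over $X$, and $P(C)$ is a local complete intersection in $P(E)$ of codimension $n$: its ideal is locally generated by a regular sequence of length $n$. 2. The normal bundle of $P(C)$ in $P(E)$ is isomorphic to $p^*F\otimes\mathcal O(1)$, where $p:P(C)\to X$ is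 the projection, $F$ is identified with its sheaf of sections $\mathrm{Der}_X(-\log D)^\vee$, and $\mathcal O(1)$ is the twisting sheaf of $P(C)=\mathrm{Proj}\,\mathrm{Sym}_{\mathcal O_X}(i_*\mathcal I(D))$. 3. $C$ is the kernel cone of $\sigma$: it is the scheme-theoretic inverse image under $\sigma$ of the zero section of $F$, i.e. the square formed by $C\to E$, $C\to X$, $\sigma:E\to F$ and the zero section $X\to F$ is Cartesian. Thus $P(C)$ is the projectivized kernel cone of $\sigma$. -/

import Mathlib

universe u

noncomputable section

namespace SymmetricAlgebra

section Grading

variable (A : Type*) (M : Type*) [CommRing A] [AddCommGroup M] [Module A M]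

/-- The grading of the symmetric algebra: `Symⁱ M` is the `i`-th power of the image of `M`. -/
def grading (i : ℕ) : Submodule A (SymmetricAlgebra A M) :=
  LinearMap.range (ι A M) ^ i

/-- The canonical map from `M` to the direct sum of the graded pieces. -/
def toGrading : M →ₗ[A] DirectSum ℕ fun i => grading A M i :=
  DirectSum.lof A ℕ (fun i => grading A M i) 1 ∘ₗ
    (ι A M).codRestrict _ fun m => by
      simpa only [grading, pow_one] using LinearMap.mem_range_self _ m

instance gradedMonoid : SetLike.GradedMonoid (grading A M) :=
  Submodule.nat_power_gradedMonoid (LinearMap.range (ι A M))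

instance gradedAlgebra : GradedAlgebra (grading A M) :=
  GradedAlgebra.ofAlgHom _ (lift (toGrading A M))
    (by
      apply algHom_ext
      ext m
      simp [toGrading, DirectSum.lof_eq_of, DirectSum.coeAlgHom_of])
    fun i x => by
      obtain ⟨x, hx⟩ := x
      dsimp only [Subtype.coe_mk, DirectSum.lof_eq_of]
      unfold grading at hx
      induction hx using Submodule.pow_induction_on_left' with
      | algebraMap r =>
        rw [AlgHom.commutes, DirectSum.algebraMap_apply]; rfl
      | add x y i hx hy ihx ihy =>
        rw [map_add, ihx, ihy, ← map_add]
        rfl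
      | mem_mul m hm i x hx ih =>
        obtain ⟨_, rfl⟩ := hm
        rw [map_mul, ih, lift_ι_apply]
        simp only [toGrading, LinearMap.comp_apply, DirectSum.lof_eq_of]
        rw [DirectSum.of_mul_of]
        exact DirectSum.of_eq_of_gradedMonoid_eq (Sigma.subtype_ext (add_comm _ _) rfl)

end Grading

section Map

variable {A B C : Type*} [CommRing A] [CommRing B] [CommRing C]
  {M N P : Type*} [AddCommGroup M] [Module A M] [AddCommGroup N] [Module B N]
  [AddCommGroup P] [Module C P]

/-- The ring homomorphism `Sym_A M → Sym_B N` induced by a semilinear map `M → N`. -/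
def mapₛ (φ : A →+* B) (g : M →ₛₗ[φ] N) : SymmetricAlgebra A M →+* SymmetricAlgebra B N :=
  letI : Algebra A (SymmetricAlgebra B N) :=
    ((algebraMap B (SymmetricAlgebra B N)).comp φ).toAlgebra
  (lift (R := A) (A := SymmetricAlgebra B N)
    { toFun := fun m => ι B N (g m)
      map_add' := fun x y => by simp
      map_smul' := fun a m => by
        rw [LinearMap.map_smulₛₗ, map_smul, Algebra.smul_def, Algebra.smul_def]; rfl }).toRingHom

@[simp]
lemma mapₛ_ι (φ : A →+* B) (g : M →ₛₗ[φ] N) (m : M) : mapₛ φ g (ι A M m) = ι B N (g m) := by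
  let : Algebra A (SymmetricAlgebra B N) :=
    ((algebraMap B (SymmetricAlgebra B N)).comp φ).toAlgebra
  exact lift_ι_apply (R := A) (A := SymmetricAlgebra B N) _ m

@[simp]
lemma mapₛ_algebraMap (φ : A →+* B) (g : M →ₛₗ[φ] N) (a : A) :
    mapₛ φ g (algebraMap A _ a) = algebraMap B _ (φ a) := by
  let : Algebra A (SymmetricAlgebra B N) :=
    ((algebraMap B (SymmetricAlgebra B N)).comp φ).toAlgebra
  exact AlgHom.commutes (R := A) (B := SymmetricAlgebra B N) _ a

lemma ringHom_ext' {R : Type*} [CommRing R] {F G : SymmetricAlgebra A M →+* R}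
    (h : ∀ a, F (algebraMap A _ a) = G (algebraMap A _ a))
    (h' : ∀ m, F (ι A M m) = G (ι A M m)) : F = G := by
  refine RingHom.ext fun x => ?_
  induction x using SymmetricAlgebra.induction with
  | algebraMap r => exact h r
  | ι x => exact h' x
  | mul a b ha hb => rw [map_mul, map_mul, ha, hb]
  | add a b ha hb => rw [map_add, map_add, ha, hb]

lemma mapₛ_mem (φ : A →+* B) (g : M →ₛₗ[φ] N) {i : ℕ} {x : SymmetricAlgebra A M}
    (hx : x ∈ grading A M i) : mapₛ φ g x ∈ grading B N i := by
  unfold grading at hx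
  induction hx using Submodule.pow_induction_on_left' with
  | algebraMap r =>
    rw [mapₛ_algebraMap]
    simp only [grading, pow_zero, Submodule.mem_one]
    exact ⟨_, rfl⟩
  | add x y i hx hy ihx ihy => rw [map_add]; exact add_mem ihx ihy
  | mem_mul m hm i x hx ih =>
    obtain ⟨m, rfl⟩ := hm
    rw [map_mul, mapₛ_ι]
    simp only [grading, pow_succ']
    exact Submodule.mul_mem_mul ⟨_, rfl⟩ ih

/-- The graded ring homomorphism `Sym_A M → Sym_B N` induced by a semilinear map `M → N`. -/
def gradedMap (φ : A →+* B) (g : M →ₛₗ[φ] N) : grading A M →+*ᵍ grading B N where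
  __ := mapₛ φ g
  map_mem := mapₛ_mem φ g

@[simp]
lemma gradedMap_apply (φ : A →+* B) (g : M →ₛₗ[φ] N) (x : SymmetricAlgebra A M) :
    gradedMap φ g x = mapₛ φ g x := rfl

lemma algebraMap_mem_grading (a : A) : algebraMap A (SymmetricAlgebra A M) a ∈ grading A M 0 := by
  simp only [grading, pow_zero, Submodule.mem_one]
  exact ⟨_, rfl⟩

end Map

section Localization

variable {A B : Type*} [CommRing A] [CommRing B] {M N : Type*} [AddCommGroup M] [Module A M]
  [AddCommGroup N] [Module B N] (φ : A →+* B) (g : M →ₛₗ[φ] N) (f : A)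

lemma mapₛ_surj (hφ : ∀ b : B, ∃ (n : ℕ) (a : A), φ a = φ f ^ n * b)
    (hg : ∀ y : N, ∃ (n : ℕ) (x : M), g x = φ f ^ n • y) (y : SymmetricAlgebra B N) :
    ∃ (n : ℕ) (x : SymmetricAlgebra A M), mapₛ φ g x = algebraMap B _ (φ f) ^ n * y := by
  induction y using SymmetricAlgebra.induction with
  | algebraMap r =>
    obtain ⟨n, a, h⟩ := hφ r
    exact ⟨n, algebraMap A _ a, by rw [mapₛ_algebraMap, h, map_mul, map_pow]⟩
  | ι x =>
    obtain ⟨n, a, h⟩ := hg x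
    exact ⟨n, ι A M a, by rw [mapₛ_ι, h, map_smul, Algebra.smul_def, map_pow]⟩
  | mul a b ha hb =>
    obtain ⟨n, x, hx⟩ := ha
    obtain ⟨m, y, hy⟩ := hb
    exact ⟨n + m, x * y, by rw [map_mul, hx, hy]; ring⟩
  | add a b ha hb =>
    obtain ⟨n, x, hx⟩ := ha
    obtain ⟨m, y, hy⟩ := hb
    refine ⟨n + m, algebraMap A _ f ^ m * x + algebraMap A _ f ^ n * y, ?_⟩
    rw [map_add, map_mul, map_mul, hx, hy, map_pow, map_pow, mapₛ_algebraMap]; ring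

lemma mapₛ_inj (hfu : IsUnit (φ f)) (hφ : ∀ b : B, ∃ (n : ℕ) (a : A), φ a = φ f ^ n * b)
    (hφ' : ∀ a : A, φ a = 0 → ∃ n : ℕ, f ^ n * a = 0)
    (hg : ∀ y : N, ∃ (n : ℕ) (x : M), g x = φ f ^ n • y)
    (hg' : ∀ x : M, g x = 0 → ∃ n : ℕ, f ^ n • x = 0)
    (x : SymmetricAlgebra A M) (hx : mapₛ φ g x = 0) :
    ∃ n : ℕ, algebraMap A _ f ^ n * x = 0 := by
  let : Algebra A B := φ.toAlgebra
  let : Module A N := Module.compHom N φ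
  have tow : IsScalarTower A B N := ⟨fun a b n => mul_smul (φ a) b n⟩
  let g' : M →ₗ[A] N := { toFun := g, map_add' := g.map_add, map_smul' := g.map_smulₛₗ }
  have locB : IsLocalization.Away f B := by
    refine ⟨?_, ?_, ?_⟩
    · rintro ⟨_, n, rfl⟩
      change IsUnit (φ (f ^ n))
      rw [map_pow]
      exact hfu.pow n
    · intro b
      obtain ⟨n, a, h⟩ := hφ b
      refine ⟨⟨a, ⟨f ^ n, n, rfl⟩⟩, ?_⟩
      change b * φ (f ^ n) = φ a
      rw [h, map_pow, mul_comm]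
    · intro a b hab
      obtain ⟨n, h⟩ := hφ' (a - b) (by rw [map_sub, sub_eq_zero]; exact hab)
      exact ⟨⟨f ^ n, n, rfl⟩, by rw [mul_sub, sub_eq_zero] at h; exact h⟩
  have locN : IsLocalizedModule (Submonoid.powers f) g' := by
    refine ⟨?_, ?_, ?_⟩
    · rintro ⟨_, n, rfl⟩
      rw [Module.End.isUnit_iff]
      have hu : IsUnit (φ (f ^ n)) := by rw [map_pow]; exact hfu.pow n
      constructor
      · intro a b hab
        exact hu.smul_left_cancel.mp hab
      · intro b
        obtain ⟨c, hc⟩ := hu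
        refine ⟨(↑c⁻¹ : B) • b, ?_⟩
        change φ (f ^ n) • (↑c⁻¹ : B) • b = b
        rw [← hc, smul_smul, Units.mul_inv, one_smul]
    · intro y
      obtain ⟨n, a, h⟩ := hg y
      refine ⟨⟨a, ⟨f ^ n, n, rfl⟩⟩, ?_⟩
      change φ (f ^ n) • y = g a
      rw [h, map_pow]
    · intro a b hab
      obtain ⟨n, h⟩ := hg' (a - b) (by rw [map_sub, sub_eq_zero]; exact hab)
      exact ⟨⟨f ^ n, n, rfl⟩, by rw [smul_sub, sub_eq_zero] at h; exact h⟩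
  let s : SymmetricAlgebra A M := algebraMap A _ f
  let Lo := Localization.Away s
  have hs : IsUnit (algebraMap (SymmetricAlgebra A M) Lo s) :=
    IsLocalization.Away.algebraMap_isUnit s
  let ψ : B →+* Lo := IsLocalization.Away.lift (S := B) f
    (g := (algebraMap (SymmetricAlgebra A M) Lo).comp (algebraMap A _)) hs
  have hψ : ∀ a, ψ (φ a) = algebraMap (SymmetricAlgebra A M) Lo (algebraMap A _ a) :=
    fun a => IsLocalization.Away.lift_eq (S := B) f
      (g := (algebraMap (SymmetricAlgebra A M) Lo).comp (algebraMap A _)) hs a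
  let : Algebra B Lo := ψ.toAlgebra
  have towL : IsScalarTower A B Lo := IsScalarTower.of_algebraMap_eq fun a => by
    rw [IsScalarTower.algebraMap_apply A (SymmetricAlgebra A M) Lo]
    exact (hψ a).symm
  let h₀ : M →ₗ[A] Lo := (Algebra.linearMap (SymmetricAlgebra A M) Lo).restrictScalars A ∘ₗ ι A M
  let h₁ : N →ₗ[A] Lo := IsLocalizedModule.lift (Submonoid.powers f) g' h₀ (by
    rintro ⟨_, n, rfl⟩
    rw [Module.End.isUnit_iff]
    have hu : IsUnit (algebraMap A Lo (f ^ n)) := by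
      rw [map_pow, IsScalarTower.algebraMap_apply A (SymmetricAlgebra A M) Lo]; exact hs.pow n
    have : ⇑(algebraMap A (Module.End A Lo) (f ^ n)) = fun x : Lo => algebraMap A Lo (f ^ n) * x :=
      funext fun x => by rw [Module.algebraMap_end_apply, Algebra.smul_def]
    change Function.Bijective ⇑(algebraMap A (Module.End A Lo) (f ^ n))
    rw [this]
    exact IsUnit.isUnit_iff_mulLeft_bijective.mp hu)
  have hh₁ : ∀ m, h₁ (g m) = algebraMap (SymmetricAlgebra A M) Lo (ι A M m) := fun m =>
    IsLocalizedModule.lift_apply (Submonoid.powers f) g' h₀ _ m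
  let h₂ : N →ₗ[B] Lo := h₁.extendScalarsOfIsLocalization (Submonoid.powers f) B
  let Ψ : SymmetricAlgebra B N →ₐ[B] Lo := lift h₂
  have key : Ψ.toRingHom.comp (mapₛ φ g) = algebraMap (SymmetricAlgebra A M) Lo := by
    apply ringHom_ext'
    · intro a
      rw [RingHom.comp_apply, mapₛ_algebraMap]
      exact (Ψ.commutes (φ a)).trans (hψ a)
    · intro m
      rw [RingHom.comp_apply, mapₛ_ι]
      exact (lift_ι_apply h₂ (g m)).trans (hh₁ m)
  have hx0 : algebraMap (SymmetricAlgebra A M) Lo x = 0 := by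
    rw [← key, RingHom.comp_apply, hx, map_zero]
  obtain ⟨⟨_, n, rfl⟩, hn⟩ := (IsLocalization.map_eq_zero_iff (Submonoid.powers s) Lo x).mp hx0
  exact ⟨n, hn⟩

end Localization

end SymmetricAlgebra

end

noncomputable section

open CategoryTheory CategoryTheory.Limits AlgebraicGeometry Opposite

namespace AlgebraicGeometry.Scheme

/-- The restriction map of the structure sheaf between affine opens. -/
abbrev ringRes (X : Scheme.{u}) {U V : X.AffineZariskiSite} (h : U ≤ V) :
    Γ(X, V.toOpens) →+* Γ(X, U.toOpens) :=
  (X.presheaf.map (homOfLE (AffineZariskiSite.toOpens_mono h)).op).hom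

lemma ringRes_refl (X : Scheme.{u}) (U : X.AffineZariskiSite) :
    X.ringRes (le_refl U) = RingHom.id _ := by
  ext x
  change X.presheaf.map (𝟙 _) x = x
  simp

lemma ringRes_trans (X : Scheme.{u}) {U V W : X.AffineZariskiSite} (h : U ≤ V) (h' : V ≤ W) :
    X.ringRes (h.trans h') = (X.ringRes h).comp (X.ringRes h') := by
  ext x
  rw [RingHom.comp_apply]
  change X.presheaf.map _ x = X.presheaf.map _ (X.presheaf.map _ x)
  rw [← CommRingCat.comp_apply, ← X.presheaf.map_comp]
  rfl

/-- A quasi-coherent `𝒪_X`-module, given by its sections on the affine opens: modules `M(U)` over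
`Γ(X, U)` with restriction maps to basic opens `D(f) ⊆ V`, such that
`M(V) → M(D(f))` is the localization at `f`. -/
structure AffMod (X : Scheme.{u}) where
  /-- the sections over an affine open -/
  obj : X.AffineZariskiSite → Type u
  [addCommGroup : ∀ U, AddCommGroup (obj U)]
  [module : ∀ U, Module Γ(X, U.toOpens) (obj U)]
  /-- the restriction maps -/
  res : ∀ {U V : X.AffineZariskiSite} (h : U ≤ V), obj V →ₛₗ[X.ringRes h] obj U
  res_refl : ∀ (U : X.AffineZariskiSite) (x : obj U), res (le_refl U) x = x
  res_trans : ∀ {U V W : X.AffineZariskiSite} (h : U ≤ V) (h' : V ≤ W) (x : obj W),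
    res (h.trans h') x = res h (res h' x)
  res_surj : ∀ (V : X.AffineZariskiSite) (f : Γ(X, V.toOpens)) (y : obj (V.basicOpen f)),
    ∃ (n : ℕ) (x : obj V),
      res (V.basicOpen_le f) x = X.ringRes (V.basicOpen_le f) f ^ n • y
  res_inj : ∀ (V : X.AffineZariskiSite) (f : Γ(X, V.toOpens)) (x : obj V),
    res (V.basicOpen_le f) x = 0 → ∃ n : ℕ, f ^ n • x = 0

attribute [instance] AffMod.addCommGroup AffMod.module

/-- A homomorphism of quasi-coherent modules given on affine opens. -/
structure AffMod.Hom {X : Scheme.{u}} (M N : X.AffMod) where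
  /-- the map on sections over an affine open -/
  app : ∀ U : X.AffineZariskiSite, M.obj U →ₗ[Γ(X, U.toOpens)] N.obj U
  naturality : ∀ {U V : X.AffineZariskiSite} (h : U ≤ V) (x : M.obj V),
    app U (M.res h x) = N.res h (app V x)

section RingFacts

variable {X : Scheme.{u}} (V : X.AffineZariskiSite) (f : Γ(X, V.toOpens))

lemma isUnit_ringRes : IsUnit (X.ringRes (V.basicOpen_le f) f) := by
  let := (X.ringRes (V.basicOpen_le f)).toAlgebra
  have : IsLocalization.Away f Γ(X, (V.basicOpen f).toOpens) := V.2.isLocalization_basicOpen f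
  exact IsLocalization.Away.algebraMap_isUnit f

lemma ringRes_surj (b : Γ(X, (V.basicOpen f).toOpens)) : ∃ (n : ℕ) (a : Γ(X, V.toOpens)),
    X.ringRes (V.basicOpen_le f) a = X.ringRes (V.basicOpen_le f) f ^ n * b := by
  let := (X.ringRes (V.basicOpen_le f)).toAlgebra
  have : IsLocalization.Away f Γ(X, (V.basicOpen f).toOpens) := V.2.isLocalization_basicOpen f
  obtain ⟨⟨a, ⟨_, n, rfl⟩⟩, h⟩ := IsLocalization.surj (Submonoid.powers f) b
  refine ⟨n, a, ?_⟩
  rw [← map_pow, mul_comm]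
  exact h.symm

lemma ringRes_inj (a : Γ(X, V.toOpens)) (h : X.ringRes (V.basicOpen_le f) a = 0) :
    ∃ n : ℕ, f ^ n * a = 0 := by
  let := (X.ringRes (V.basicOpen_le f)).toAlgebra
  have : IsLocalization.Away f Γ(X, (V.basicOpen f).toOpens) := V.2.isLocalization_basicOpen f
  obtain ⟨⟨_, n, rfl⟩, hn⟩ := (IsLocalization.map_eq_zero_iff (Submonoid.powers f)
    Γ(X, (V.basicOpen f).toOpens) a).mp h
  exact ⟨n, hn⟩

end RingFacts

namespace AffMod

variable {X : Scheme.{u}} (M : X.AffMod)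

/-- The symmetric algebra `Sym M(U)` on an affine open. -/
abbrev Sym (U : X.AffineZariskiSite) : Type u := SymmetricAlgebra Γ(X, U.toOpens) (M.obj U)

/-- The restriction maps of the symmetric algebra. -/
abbrev symRes {U V : X.AffineZariskiSite} (h : U ≤ V) : M.Sym V →+* M.Sym U :=
  SymmetricAlgebra.mapₛ (X.ringRes h) (M.res h)

lemma symRes_refl (U : X.AffineZariskiSite) : M.symRes (le_refl U) = RingHom.id _ := by
  apply SymmetricAlgebra.ringHom_ext'
  · intro a
    rw [symRes, SymmetricAlgebra.mapₛ_algebraMap, ringRes_refl]; rfl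
  · intro m
    rw [symRes, SymmetricAlgebra.mapₛ_ι, M.res_refl]; rfl

lemma symRes_trans {U V W : X.AffineZariskiSite} (h : U ≤ V) (h' : V ≤ W) :
    M.symRes (h.trans h') = (M.symRes h).comp (M.symRes h') := by
  apply SymmetricAlgebra.ringHom_ext'
  · intro a
    rw [RingHom.comp_apply, symRes, symRes, symRes, SymmetricAlgebra.mapₛ_algebraMap,
      SymmetricAlgebra.mapₛ_algebraMap, SymmetricAlgebra.mapₛ_algebraMap, ringRes_trans]; rfl
  · intro m
    rw [RingHom.comp_apply, symRes, symRes, symRes, SymmetricAlgebra.mapₛ_ι,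
      SymmetricAlgebra.mapₛ_ι, SymmetricAlgebra.mapₛ_ι, M.res_trans]

lemma symRes_surj (V : X.AffineZariskiSite) (f : Γ(X, V.toOpens)) (y : M.Sym (V.basicOpen f)) :
    ∃ (n : ℕ) (x : M.Sym V), M.symRes (V.basicOpen_le f) x =
      M.symRes (V.basicOpen_le f) (algebraMap _ _ f) ^ n * y := by
  rw [symRes, SymmetricAlgebra.mapₛ_algebraMap]
  exact SymmetricAlgebra.mapₛ_surj _ _ f (ringRes_surj V f) (M.res_surj V f) y

lemma symRes_inj (V : X.AffineZariskiSite) (f : Γ(X, V.toOpens)) (x : M.Sym V)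
    (hx : M.symRes (V.basicOpen_le f) x = 0) : ∃ n : ℕ, algebraMap _ (M.Sym V) f ^ n * x = 0 :=
  SymmetricAlgebra.mapₛ_inj _ _ f (isUnit_ringRes V f) (ringRes_surj V f) (ringRes_inj V f)
    (M.res_surj V f) (M.res_inj V f) x hx

lemma isUnit_symRes (V : X.AffineZariskiSite) (f : Γ(X, V.toOpens)) :
    IsUnit (M.symRes (V.basicOpen_le f) (algebraMap _ _ f)) := by
  rw [symRes, SymmetricAlgebra.mapₛ_algebraMap]
  exact (isUnit_ringRes V f).map _

/-- `Sym M` as a presheaf of rings on the affine opens. -/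
def symFunctor : X.AffineZariskiSiteᵒᵖ ⥤ CommRingCat.{u} where
  obj U := .of (M.Sym U.unop)
  map i := CommRingCat.ofHom (M.symRes i.unop.le)
  map_id U := by
    ext1
    exact M.symRes_refl U.unop
  map_comp i j := by
    ext1
    exact M.symRes_trans j.unop.le i.unop.le

/-- The structure map `𝒪_X → Sym M`. -/
def symUnit : (AffineZariskiSite.toOpensFunctor X).op ⋙ X.presheaf ⟶ M.symFunctor where
  app U := CommRingCat.ofHom (algebraMap Γ(X, U.unop.toOpens) (M.Sym U.unop))
  naturality U V i := by
    ext a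
    exact (SymmetricAlgebra.mapₛ_algebraMap _ (M.res i.unop.le) a).symm

lemma symUnit_coequifibered : M.symUnit.Coequifibered := by
  rw [AffineZariskiSite.coequifibered_iff_forall_isLocalizationAway]
  intro V f
  let := (M.symRes (V.basicOpen_le f)).toAlgebra
  change @IsLocalization (M.Sym V) _ (Submonoid.powers (algebraMap _ (M.Sym V) f))
    (M.Sym (V.basicOpen f)) _ (M.symRes (V.basicOpen_le f)).toAlgebra
  refine ⟨?_, ?_, ?_⟩
  · rintro ⟨_, n, rfl⟩
    change IsUnit (M.symRes _ _)
    rw [map_pow]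
    exact (M.isUnit_symRes V f).pow n
  · intro b
    obtain ⟨n, a, h⟩ := M.symRes_surj V f b
    refine ⟨⟨a, ⟨_, n, rfl⟩⟩, ?_⟩
    change b * M.symRes _ _ = M.symRes _ _
    rw [h, map_pow, mul_comm]
  · intro a b hab
    obtain ⟨n, h⟩ := M.symRes_inj V f (a - b) (by rw [map_sub, sub_eq_zero]; exact hab)
    exact ⟨⟨_, n, rfl⟩, by rw [mul_sub, sub_eq_zero] at h; exact h⟩

/-- The gluing datum of the affine schemes `Spec (Sym M(U))`. -/
def coneGluing : (AffineZariskiSite.directedCover X).RelativeGluingData :=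
  AffineZariskiSite.relativeGluingData M.symUnit_coequifibered

instance : (M.coneGluing.functor ⋙ Scheme.forget).IsLocallyDirected :=
  Cover.RelativeGluingData.instIsLocallyDirectedI₀CompFunctorForgetOfIsThin ..

/-- The cone `Spec (Sym M)` over `X`; it is a vector bundle if `M` is locally free. -/
def cone : Scheme.{u} := M.coneGluing.glued

/-- The projection `Spec (Sym M) ⟶ X`. -/
def coneProj : M.cone ⟶ X := M.coneGluing.toBase

/-- The open immersion `Spec (Sym M(U)) ⟶ Spec (Sym M)`. -/
def coneChart (U : X.AffineZariskiSite) : Spec (.of (M.Sym U)) ⟶ M.cone :=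
  colimit.ι M.coneGluing.functor U

lemma coneChart_res {U V : X.AffineZariskiSite} (h : U ≤ V) :
    Spec.map (CommRingCat.ofHom (M.symRes h)) ≫ M.coneChart V = M.coneChart U :=
  colimit.w M.coneGluing.functor (homOfLE h)

/-- The ring homomorphism `Sym M(U) → Γ(X, U)` which kills `M(U)`. -/
def symZero (U : X.AffineZariskiSite) : M.Sym U →+* Γ(X, U.toOpens) :=
  (SymmetricAlgebra.algebraMapInv : M.Sym U →ₐ[Γ(X, U.toOpens)] Γ(X, U.toOpens)).toRingHom

lemma zeroSection_aux {U V : X.AffineZariskiSite} (h : U ≤ V) :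
    Spec.map (CommRingCat.ofHom (X.ringRes h)) ≫
      Spec.map (CommRingCat.ofHom (M.symZero V)) ≫ M.coneChart V =
    Spec.map (CommRingCat.ofHom (M.symZero U)) ≫ M.coneChart U := by
  rw [← M.coneChart_res h, ← Category.assoc, ← Category.assoc, ← Spec.map_comp, ← Spec.map_comp,
    ← CommRingCat.ofHom_comp, ← CommRingCat.ofHom_comp]
  congr 3
  apply SymmetricAlgebra.ringHom_ext'
  · intro a
    rw [RingHom.comp_apply, RingHom.comp_apply, symRes, SymmetricAlgebra.mapₛ_algebraMap]
    exact (congrArg _ (SymmetricAlgebra.algebraMap_leftInverse (M.obj V) a)).trans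
      (SymmetricAlgebra.algebraMap_leftInverse (M.obj U) _).symm
  · intro m
    rw [RingHom.comp_apply, RingHom.comp_apply, symRes, SymmetricAlgebra.mapₛ_ι]
    refine ((congrArg _ (SymmetricAlgebra.algebraMapInv_ι m)).trans ?_).trans
      (SymmetricAlgebra.algebraMapInv_ι _).symm
    exact map_zero _

/-- The zero section `X ⟶ Spec (Sym M)`, given on an affine open `U` by the ring homomorphism
`Sym M(U) → Γ(X, U)` which kills `M(U)`. -/
def zeroSection : X ⟶ M.cone :=
  (AffineZariskiSite.isColimitCocone X).desc
    { pt := M.cone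
      ι :=
        { app := fun U => Spec.map (CommRingCat.ofHom (M.symZero U)) ≫ M.coneChart U
          naturality := fun _ _ i => (M.zeroSection_aux i.le).trans (Category.comp_id _).symm } }

variable {M} {N : X.AffMod}

lemma Hom.symMap_naturality (φ : M.Hom N) {U V : X.AffineZariskiSite} (h : U ≤ V) :
    (SymmetricAlgebra.mapₛ (RingHom.id _) (φ.app U)).comp (M.symRes h) =
      (N.symRes h).comp (SymmetricAlgebra.mapₛ (RingHom.id _) (φ.app V)) := by
  apply SymmetricAlgebra.ringHom_ext'
  · intro a
    simp [symRes]
  · intro m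
    simp [symRes, φ.naturality]

/-- The ring homomorphism `Sym M(U) → Sym N(U)` induced by `M → N`. -/
abbrev Hom.symMap (φ : M.Hom N) (U : X.AffineZariskiSite) : M.Sym U →+* N.Sym U :=
  SymmetricAlgebra.mapₛ (RingHom.id _) (φ.app U)

lemma Hom.coneMap_aux (φ : M.Hom N) {U V : X.AffineZariskiSite} (h : U ≤ V) :
    Spec.map (CommRingCat.ofHom (N.symRes h)) ≫
      Spec.map (CommRingCat.ofHom (φ.symMap V)) ≫ M.coneChart V =
    Spec.map (CommRingCat.ofHom (φ.symMap U)) ≫ M.coneChart U := by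
  rw [← M.coneChart_res h, ← Category.assoc, ← Category.assoc, ← Spec.map_comp, ← Spec.map_comp,
    ← CommRingCat.ofHom_comp, ← CommRingCat.ofHom_comp]
  congr 3
  exact (φ.symMap_naturality h).symm

/-- The morphism of cones `Spec (Sym N) ⟶ Spec (Sym M)` induced by `M → N`. -/
def Hom.coneMap (φ : M.Hom N) : N.cone ⟶ M.cone :=
  colimit.desc N.coneGluing.functor
    { pt := M.cone
      ι :=
        { app := fun U => Spec.map (CommRingCat.ofHom (φ.symMap U)) ≫ M.coneChart U
          naturality := fun _ _ i => (φ.coneMap_aux i.le).trans (Category.comp_id _).symm } }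

end AffMod

end AlgebraicGeometry.Scheme
end

noncomputable section

open CategoryTheory CategoryTheory.Limits AlgebraicGeometry Opposite

namespace AlgebraicGeometry.Proj

open HomogeneousLocalization HomogeneousIdeal

/-! If `φ : 𝒜 → ℬ` is the localization of a graded ring at an element of degree zero, then `Proj ℬ`
is an open subscheme of `Proj 𝒜`. -/

section

variable {A B : Type u} [CommRing A] [CommRing B] {σ τ : Type u} [SetLike σ A]
  [AddSubgroupClass σ A] [SetLike τ B] [AddSubgroupClass τ B]
  {𝒜 : ℕ → σ} {ℬ : ℕ → τ} [GradedRing 𝒜] [GradedRing ℬ] (φ : 𝒜 →+*ᵍ ℬ) {f : A}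

/-- `φ` is the localization at the homogeneous element `f` of degree zero. -/
structure IsLocAt (φ : 𝒜 →+*ᵍ ℬ) (f : A) : Prop where
  mem : f ∈ 𝒜 0
  isUnit : IsUnit (φ f)
  surj : ∀ b : B, ∃ (n : ℕ) (a : A), φ a = φ f ^ n * b
  inj : ∀ a : A, φ a = 0 → ∃ n : ℕ, f ^ n * a = 0

variable {φ}

lemma IsLocAt.mem' (h : IsLocAt φ f) (d : ℕ) : f ∈ 𝒜 (0 • d) := by
  simpa using h.mem

lemma IsLocAt.surj_graded (h : IsLocAt φ f) {i : ℕ} {b : B} (hb : b ∈ ℬ i) :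
    ∃ (n : ℕ) (a : A), a ∈ 𝒜 i ∧ φ a = φ f ^ n * b := by
  obtain ⟨n, a, ha⟩ := h.surj b
  refine ⟨n, DirectSum.decompose 𝒜 a i, SetLike.coe_mem _, ?_⟩
  have h1 : φ f ^ n * b ∈ ℬ i := by
    have := SetLike.mul_mem_graded (SetLike.pow_mem_graded n (φ.map_mem h.mem)) hb
    simpa using this
  have h2 := DirectSum.decompose_of_mem_same ℬ h1
  rw [GradedRingHom.map_directSumDecompose, ha, h2]

lemma IsLocAt.exists_inv (h : IsLocAt φ f) : ∃ u ∈ ℬ 0, φ f * u = 1 := by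
  obtain ⟨u, hu⟩ := h.isUnit.exists_right_inv
  refine ⟨DirectSum.decompose ℬ u 0, SetLike.coe_mem _, ?_⟩
  have hm : φ f ∈ ℬ 0 := φ.map_mem h.mem
  have := DirectSum.coe_decompose_mul_of_left_mem_zero ℬ (b := u) (j := 0) hm
  rw [← this, hu]
  exact DirectSum.decompose_of_mem_same ℬ SetLike.GradedOne.one_mem

lemma IsLocAt.irrelevant_le (h : IsLocAt φ f) : ℬ₊ ≤ 𝒜₊.map φ := by
  rw [HomogeneousIdeal.irrelevant_le]
  intro i hi b hb
  obtain ⟨n, a, ha, hab⟩ := h.surj_graded hb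
  obtain ⟨u, hu⟩ := h.isUnit.exists_left_inv
  have : b = u ^ n * φ a := by
    rw [hab, ← mul_assoc, ← mul_pow, hu, one_pow, one_mul]
  rw [this]
  exact Ideal.mul_mem_left _ _ (Ideal.mem_map_of_mem _ (mem_irrelevant_of_mem 𝒜 hi ha))

lemma IsLocAt.isLocalization_away (h : IsLocAt φ f) {d : ℕ} {s : A} (hs : s ∈ 𝒜 d) :
    @IsLocalization.Away (Away 𝒜 s) _ (Away.mk 𝒜 hs 0 f (h.mem' d)) (Away ℬ (φ s)) _
      (Away.map φ s).toAlgebra := by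
  let := (Away.map φ s).toAlgebra
  set t : Away 𝒜 s := Away.mk 𝒜 hs 0 f (h.mem' d)
  have hval : ∀ {n : ℕ} {a : A} (ha : a ∈ 𝒜 (n • d)),
      (Away.map φ s (Away.mk 𝒜 hs n a ha)).val = Localization.mk (φ a) (⟨φ s ^ n, ⟨n, rfl⟩⟩ : Submonoid.powers (φ s)) := by
    intro n a ha
    rw [Away.map_mk, Away.val_mk]
  refine ⟨?_, ?_, ?_⟩
  · rintro ⟨_, n, rfl⟩
    change IsUnit (Away.map φ s (t ^ n))
    rw [map_pow]
    refine IsUnit.pow n ?_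
    obtain ⟨u, hu, hfu⟩ := h.exists_inv
    refine IsUnit.of_mul_eq_one (Away.mk ℬ (φ.map_mem hs) 0 u (by simpa using hu)) ?_
    ext
    rw [val_mul, hval, Away.val_mk, Localization.mk_mul, hfu, val_one, ← Localization.mk_one]
    congr 1
    ext; simp
  · intro z
    obtain ⟨n, b, hb, rfl⟩ := Away.mk_surjective ℬ (φ.map_mem hs) z
    obtain ⟨m, a, ha, hab⟩ := h.surj_graded hb
    refine ⟨⟨Away.mk 𝒜 hs n a ha, ⟨_, m, rfl⟩⟩, ?_⟩
    change _ * Away.map φ s (t ^ m) = Away.map φ s _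
    ext
    rw [val_mul, map_pow, val_pow, hval, hval, Away.val_mk, Localization.mk_pow,
      Localization.mk_mul, hab, mul_comm b]
    congr 1
    ext; simp
  · intro x y hxy
    replace hxy : Away.map φ s (x - y) = 0 := by rw [map_sub, sub_eq_zero]; exact hxy
    obtain ⟨n, a, ha, hn⟩ := Away.mk_surjective 𝒜 hs (x - y)
    rw [← hn] at hxy
    have h0 := congrArg val hxy
    rw [hval, val_zero, Localization.mk_eq_mk', IsLocalization.mk'_eq_zero_iff] at h0
    obtain ⟨⟨_, k, rfl⟩, hk⟩ := h0
    obtain ⟨j, hj⟩ := h.inj (s ^ k * a) (by rw [map_mul, map_pow]; exact hk)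
    refine ⟨⟨_, j, rfl⟩, ?_⟩
    rw [← sub_eq_zero, ← mul_sub, ← hn]
    ext
    change (t ^ j * _).val = _
    rw [val_mul, val_pow, Away.val_mk, Away.val_mk, Localization.mk_pow, Localization.mk_mul,
      val_zero, Localization.mk_eq_mk', IsLocalization.mk'_eq_zero_iff]
    exact ⟨⟨_, k, rfl⟩, by rw [← hj]; ring⟩

lemma isPullback_awayι (hφ : ℬ₊ ≤ 𝒜₊.map φ) {d : ℕ} (hd : 0 < d) {s : A} (hs : s ∈ 𝒜 d) :
    IsPullback (Spec.map (CommRingCat.ofHom (Away.map φ s))) (awayι ℬ (φ s) (φ.map_mem hs) hd)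
      (awayι 𝒜 s hs hd) (Proj.map φ hφ) := by
  apply IsOpenImmersion.isPullback
  · exact awayι_comp_map φ hφ hd s hs
  · rw [opensRange_awayι, opensRange_awayι, map_preimage_basicOpen]

lemma IsLocAt.isOpenImmersion_specMap (h : IsLocAt φ f) {d : ℕ} {s : A} (hs : s ∈ 𝒜 d) :
    IsOpenImmersion (Spec.map (CommRingCat.ofHom (Away.map φ s))) := by
  let := (Away.map φ s).toAlgebra
  have := h.isLocalization_away hs
  exact IsOpenImmersion.of_isLocalization (R := Away 𝒜 s) (S := Away ℬ (φ s))
    (Away.mk 𝒜 hs 0 f (h.mem' d))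

lemma IsLocAt.isOpenImmersion (h : IsLocAt φ f) : IsOpenImmersion (Proj.map φ h.irrelevant_le) := by
  refine (IsZariskiLocalAtTarget.iff_of_openCover (P := @IsOpenImmersion)
    (affineOpenCover 𝒜).openCover).mpr fun i => ?_
  suffices H : ∀ (d : ℕ) (hd : 0 < d) (s : A) (hs : s ∈ 𝒜 d),
      IsOpenImmersion (pullback.snd (Proj.map φ h.irrelevant_le) (awayι 𝒜 s hs hd)) from
    H _ i.1.2 _ i.2.2
  intro d hd s hs
  have hP := (isPullback_awayι h.irrelevant_le hd hs).flip
  have := h.isOpenImmersion_specMap hs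
  rw [← hP.isoPullback_inv_snd]
  infer_instance

lemma exists_awayι_eq (x : Proj 𝒜) : ∃ (d : ℕ) (hd : 0 < d) (s : A) (hs : s ∈ 𝒜 d)
    (z : Spec (.of (Away 𝒜 s))), awayι 𝒜 s hs hd z = x := by
  obtain ⟨i, z, hz⟩ := (affineOpenCover 𝒜).openCover.exists_eq x
  exact ⟨_, i.1.2, _, i.2.2, z, hz⟩

lemma awayι_mem_basicOpen_zero (hf : f ∈ 𝒜 0) {d : ℕ} (hd : 0 < d) {s : A} (hs : s ∈ 𝒜 d)
    (z : Spec (.of (Away 𝒜 s))) : awayι 𝒜 s hs hd z ∈ basicOpen 𝒜 f ↔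
      Away.mk 𝒜 hs 0 f (by simpa using hf) ∉ z.asIdeal := by
  have hsf : s * f ∈ 𝒜 d := by simpa using SetLike.mul_mem_graded hs hf
  have h0 : awayι 𝒜 s hs hd z ∈ basicOpen 𝒜 s := by
    have := opensRange_awayι 𝒜 s hs hd
    rw [← this]
    exact ⟨z, rfl⟩
  have h1 : awayι 𝒜 s hs hd z ∈ basicOpen 𝒜 f ↔
      z ∈ awayι 𝒜 s hs hd ⁻¹ᵁ basicOpen 𝒜 (s * f) := by
    rw [basicOpen_mul]
    exact ⟨fun h => ⟨h0, h⟩, fun h => h.2⟩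
  have h3 : Away.isLocalizationElem hs hsf =
      (Away.mk 𝒜 hs 0 f (by simpa using hf)) ^ d := by
    ext
    rw [Away.val_mk, val_pow, Away.val_mk, Localization.mk_pow, Localization.mk_eq_mk_iff,
      Localization.r_iff_exists]
    exact ⟨1, by simp; ring⟩
  rw [h1, awayι_preimage_basicOpen 𝒜 hs hd hsf hd]
  change Away.isLocalizationElem hs hsf ∉ z.asIdeal ↔ _
  rw [h3, not_iff_not]
  exact ⟨fun h => z.2.mem_of_pow_mem _ h, fun h => Ideal.pow_mem_of_mem _ h _ hd⟩

lemma IsLocAt.opensRange (h : IsLocAt φ f) :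
    haveI := h.isOpenImmersion
    (Proj.map φ h.irrelevant_le).opensRange = Proj.basicOpen 𝒜 f := by
  have := h.isOpenImmersion
  apply le_antisymm
  · rintro _ ⟨y, rfl⟩
    change y ∈ Proj.map φ h.irrelevant_le ⁻¹ᵁ basicOpen 𝒜 f
    rw [map_preimage_basicOpen, mem_basicOpen]
    exact fun hy => y.isPrime.ne_top (Ideal.eq_top_of_isUnit_mem _ hy h.isUnit)
  · intro x hx
    obtain ⟨d, hd, s, hs, z, rfl⟩ := exists_awayι_eq x
    rw [awayι_mem_basicOpen_zero h.mem hd hs] at hx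
    let := (Away.map φ s).toAlgebra
    have hloc := h.isLocalization_away hs
    have h2 : z ∈ Set.range (PrimeSpectrum.comap (Away.map φ s)) := by
      have := PrimeSpectrum.localization_away_comap_range (Away ℬ (φ s))
        (Away.mk 𝒜 hs 0 f (h.mem' d))
      change z ∈ Set.range (PrimeSpectrum.comap (algebraMap (Away 𝒜 s) (Away ℬ (φ s))))
      rw [this]
      exact hx
    obtain ⟨w, hw⟩ := h2
    refine ⟨awayι ℬ (φ s) (φ.map_mem hs) hd w, ?_⟩
    have h4 := awayι_comp_map φ h.irrelevant_le hd s hs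
    have h5 : ∀ w' : ↥(Spec (.of (Away ℬ (φ s)))), Proj.map φ h.irrelevant_le
        (awayι ℬ (φ s) (φ.map_mem hs) hd w') =
        awayι 𝒜 s hs hd (Spec.map (CommRingCat.ofHom (Away.map φ s)) w') := fun w' => by
      rw [← Scheme.Hom.comp_apply, ← Scheme.Hom.comp_apply, h4]
    exact (h5 w).trans (congrArg (awayι 𝒜 s hs hd) hw)

lemma toSpecZero_preimage_basicOpen (a : 𝒜 0) :
    toSpecZero 𝒜 ⁻¹ᵁ PrimeSpectrum.basicOpen a = basicOpen 𝒜 (a : A) := by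
  ext x
  obtain ⟨d, hd, s, hs, z, rfl⟩ := exists_awayι_eq x
  have h1 : awayι 𝒜 s hs hd z ∈ basicOpen 𝒜 (a : A) ↔ _ := awayι_mem_basicOpen_zero a.2 hd hs z
  refine Iff.trans ?_ h1.symm
  change toSpecZero 𝒜 (awayι 𝒜 s hs hd z) ∈ PrimeSpectrum.basicOpen a ↔ _
  rw [← Scheme.Hom.comp_apply, awayι_toSpecZero]
  change fromZeroRingHom 𝒜 _ a ∉ z.asIdeal ↔ _
  have : fromZeroRingHom 𝒜 (Submonoid.powers s) a =
      Away.mk 𝒜 hs 0 (a : A) (by simpa using a.2) := by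
    ext
    rw [Away.val_mk]
    change Localization.mk _ _ = _
    congr 1
    ext; simp
  rw [this]

lemma map_toSpecZero (hφ : ℬ₊ ≤ 𝒜₊.map φ) {R S : Type u} [CommRing R] [CommRing S]
    (α : R →+* 𝒜 0) (β : S →+* ℬ 0) (r : R →+* S) (h : ∀ x, φ (α x : A) = (β (r x) : B)) :
    Proj.map φ hφ ≫ toSpecZero 𝒜 ≫ Spec.map (CommRingCat.ofHom α) =
      (toSpecZero ℬ ≫ Spec.map (CommRingCat.ofHom β)) ≫ Spec.map (CommRingCat.ofHom r) := by
  apply (mapAffineOpenCover φ hφ).openCover.hom_ext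
  intro i
  suffices H : ∀ (d : ℕ) (hd : 0 < d) (s : A) (hs : s ∈ 𝒜 d),
      awayι ℬ (φ s) (φ.map_mem hs) hd ≫
        Proj.map φ hφ ≫ toSpecZero 𝒜 ≫ Spec.map (CommRingCat.ofHom α) =
      awayι ℬ (φ s) (φ.map_mem hs) hd ≫
        (toSpecZero ℬ ≫ Spec.map (CommRingCat.ofHom β)) ≫ Spec.map (CommRingCat.ofHom r) from
    H _ i.1.2 _ i.2.2
  intro d hd s hs
  rw [awayι_comp_map_assoc φ hφ hd s hs, Category.assoc, ← Category.assoc (awayι ℬ _ _ _) (toSpecZero ℬ),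
    ← Category.assoc (awayι 𝒜 _ _ _), awayι_toSpecZero, awayι_toSpecZero, ← Spec.map_comp,
    ← Spec.map_comp, ← Spec.map_comp, ← Spec.map_comp]
  congr 1
  ext x
  change val (Away.map φ s (fromZeroRingHom 𝒜 _ (α x))) =
    val (fromZeroRingHom ℬ _ (β (r x)))
  have h1 : fromZeroRingHom 𝒜 (Submonoid.powers s) (α x) =
      Away.mk 𝒜 hs 0 (α x : A) (by simpa using (α x).2) := by
    ext
    rw [Away.val_mk]
    change Localization.mk _ _ = _
    congr 1
    ext; simp
  have h2 : fromZeroRingHom ℬ (Submonoid.powers (φ s)) (β (r x)) =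
      Away.mk ℬ (φ.map_mem hs) 0 (β (r x) : B) (by simpa using (β (r x)).2) := by
    ext
    rw [Away.val_mk]
    change Localization.mk _ _ = _
    congr 1
    ext; simp
  rw [h1, h2, Away.map_mk, Away.val_mk, Away.val_mk]
  congr 1
  exact h x

end

end AlgebraicGeometry.Proj

namespace AlgebraicGeometry.Scheme.AffMod

open SymmetricAlgebra

variable {X : Scheme.{u}} (M : X.AffMod)

/-- The grading of `Sym M(U)`. -/
abbrev gr (U : X.AffineZariskiSite) : ℕ → Submodule Γ(X, U.toOpens) (M.Sym U) :=
  grading Γ(X, U.toOpens) (M.obj U)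

/-- The restriction maps of `Sym M` as graded ring homomorphisms. -/
abbrev grRes {U V : X.AffineZariskiSite} (h : U ≤ V) : M.gr V →+*ᵍ M.gr U :=
  gradedMap (X.ringRes h) (M.res h)

lemma isLocAt (V : X.AffineZariskiSite) (f : Γ(X, V.toOpens)) :
    Proj.IsLocAt (M.grRes (V.basicOpen_le f)) (algebraMap _ _ f) where
  mem := algebraMap_mem_grading f
  isUnit := M.isUnit_symRes V f
  surj := M.symRes_surj V f
  inj := M.symRes_inj V f

lemma grRes_irrelevant {U V : X.AffineZariskiSite} (h : U ≤ V) :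
    HomogeneousIdeal.irrelevant (M.gr U) ≤
      (HomogeneousIdeal.irrelevant (M.gr V)).map (M.grRes h) := by
  obtain ⟨f, hf⟩ := h
  obtain rfl : V.basicOpen f = U := Subtype.ext hf
  exact (M.isLocAt V f).irrelevant_le

/-- The open immersion `Proj (Sym M(U)) ⟶ Proj (Sym M(V))`. -/
def projRes {U V : X.AffineZariskiSite} (h : U ≤ V) : Proj (M.gr U) ⟶ Proj (M.gr V) :=
  Proj.map (M.grRes h) (M.grRes_irrelevant h)

/-- The structure morphism `Proj (Sym M(U)) ⟶ U`. -/
def projStr (U : X.AffineZariskiSite) : Proj (M.gr U) ⟶ U.toOpens.toScheme :=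
  Proj.toSpecZero (M.gr U) ≫
    Spec.map (CommRingCat.ofHom (algebraMap Γ(X, U.toOpens) (M.gr U 0))) ≫ U.2.isoSpec.inv

lemma projRes_refl (U : X.AffineZariskiSite) : M.projRes (le_refl U) = 𝟙 _ := by
  rw [← Proj.map_id]
  unfold projRes
  congr 1
  ext x
  exact congr($(M.symRes_refl U) x)

lemma projRes_trans {U V W : X.AffineZariskiSite} (h : U ≤ V) (h' : V ≤ W) :
    M.projRes (h.trans h') = M.projRes h ≫ M.projRes h' := by
  unfold projRes
  rw [← Proj.map_comp]
  congr 1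
  ext x
  exact congr($(M.symRes_trans h h') x)

lemma projRes_projStr {U V : X.AffineZariskiSite} (h : U ≤ V) :
    M.projRes h ≫ M.projStr V =
      M.projStr U ≫ X.homOfLE (AffineZariskiSite.toOpens_mono h) := by
  have h1 := Proj.map_toSpecZero (M.grRes_irrelevant h)
    (algebraMap Γ(X, V.toOpens) (M.gr V 0)) (algebraMap Γ(X, U.toOpens) (M.gr U 0))
    (X.ringRes h) (fun a => mapₛ_algebraMap (X.ringRes h) (M.res h) a)
  rw [← cancel_mono V.toOpens.ι, Category.assoc, Category.assoc, X.homOfLE_ι]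
  unfold projStr projRes
  have h2 : Spec.map (CommRingCat.ofHom (X.ringRes h)) ≫ V.2.fromSpec = U.2.fromSpec :=
    IsAffineOpen.map_fromSpec V.2 U.2 _
  have h3 := h1 =≫ V.2.fromSpec
  simp only [Category.assoc] at h3 ⊢
  rw [h2] at h3
  exact h3

lemma projStr_ι (V : X.AffineZariskiSite) : M.projStr V ≫ V.toOpens.ι =
    Proj.toSpecZero (M.gr V) ≫
      Spec.map (CommRingCat.ofHom (algebraMap Γ(X, V.toOpens) (M.gr V 0))) ≫ V.2.fromSpec := by
  unfold projStr
  simp only [Category.assoc]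
  rfl

lemma specMap_preimage_basicOpen {R S : Type u} [CommRing R] [CommRing S] (α : R →+* S) (f : R) :
    Spec.map (CommRingCat.ofHom α) ⁻¹ᵁ PrimeSpectrum.basicOpen f =
      PrimeSpectrum.basicOpen (α f) := rfl

lemma projStr_preimage (V : X.AffineZariskiSite) (f : Γ(X, V.toOpens)) :
    M.projStr V ⁻¹ᵁ V.toOpens.ι ⁻¹ᵁ X.basicOpen f =
      Proj.basicOpen (M.gr V) (algebraMap _ (M.Sym V) f) := by
  have h3 : V.2.fromSpec ⁻¹ᵁ X.basicOpen f = PrimeSpectrum.basicOpen f :=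
    V.2.fromSpec_preimage_basicOpen f
  have h2 := Proj.toSpecZero_preimage_basicOpen (𝒜 := M.gr V) (algebraMap _ (M.gr V 0) f)
  rw [← Scheme.Hom.comp_preimage, M.projStr_ι, Scheme.Hom.comp_preimage,
    Scheme.Hom.comp_preimage]
  refine (congrArg (fun W => Proj.toSpecZero (M.gr V) ⁻¹ᵁ
    (Spec.map (CommRingCat.ofHom (algebraMap Γ(X, V.toOpens) (M.gr V 0)))) ⁻¹ᵁ W) h3).trans ?_
  have h4 := specMap_preimage_basicOpen (algebraMap Γ(X, V.toOpens) (M.gr V 0)) f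
  have h5 := congrArg (fun W => Proj.toSpecZero (M.gr V) ⁻¹ᵁ W) h4
  exact Eq.trans h5 h2

lemma projRes_isPullback {U V : X.AffineZariskiSite} (h : U ≤ V) :
    IsPullback (M.projRes h) (M.projStr U) (M.projStr V)
      (X.homOfLE (AffineZariskiSite.toOpens_mono h)) := by
  obtain ⟨f, hf⟩ := id h
  obtain rfl : V.basicOpen f = U := Subtype.ext hf
  have : IsOpenImmersion (M.projRes h) := (M.isLocAt V f).isOpenImmersion
  refine (IsOpenImmersion.isPullback (M.projStr _) (M.projRes h)
    (X.homOfLE (AffineZariskiSite.toOpens_mono h)) (M.projStr V) (M.projRes_projStr h) ?_).flip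
  have h1 : (M.projRes h).opensRange = Proj.basicOpen (M.gr V) (algebraMap _ _ f) :=
    (M.isLocAt V f).opensRange
  rw [h1, Scheme.opensRange_homOfLE]
  exact M.projStr_preimage V f

/-- The gluing datum of the schemes `Proj (Sym M(U))`. -/
def projGluing : (AffineZariskiSite.directedCover X).RelativeGluingData where
  functor :=
    { obj := fun U => Proj (M.gr U)
      map := fun i => M.projRes i.le
      map_id := fun U => M.projRes_refl U
      map_comp := fun i j => M.projRes_trans i.le j.le }
  natTrans :=
    { app := fun U => M.projStr U
      naturality := fun _ _ i => M.projRes_projStr i.le }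
  equifibered := fun _ _ i => M.projRes_isPullback i.le

instance : (M.projGluing.functor ⋙ Scheme.forget).IsLocallyDirected :=
  Cover.RelativeGluingData.instIsLocallyDirectedI₀CompFunctorForgetOfIsThin ..

/-- The projectivized cone `P(M) = Proj (Sym M)` over `X`. -/
def proj : Scheme.{u} := M.projGluing.glued

/-- The projection `Proj (Sym M) ⟶ X`. -/
def projProj : M.proj ⟶ X := M.projGluing.toBase

/-- The open immersion `Proj (Sym M(U)) ⟶ Proj (Sym M)`. -/
def projChart (U : X.AffineZariskiSite) : Proj (M.gr U) ⟶ M.proj :=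
  colimit.ι M.projGluing.functor U

lemma projChart_res {U V : X.AffineZariskiSite} (h : U ≤ V) :
    M.projRes h ≫ M.projChart V = M.projChart U :=
  colimit.w M.projGluing.functor (homOfLE h)

variable {M} {N : X.AffMod}

/-- The graded ring homomorphism `Sym M(U) → Sym N(U)` induced by `M → N`. -/
abbrev Hom.grMap (φ : M.Hom N) (U : X.AffineZariskiSite) : M.gr U →+*ᵍ N.gr U :=
  gradedMap (RingHom.id _) (φ.app U)

lemma Hom.grMap_irrelevant (φ : M.Hom N) (hφ : ∀ U, Function.Surjective (φ.app U))
    (U : X.AffineZariskiSite) : HomogeneousIdeal.irrelevant (N.gr U) ≤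
      (HomogeneousIdeal.irrelevant (M.gr U)).map (φ.grMap U) := by
  rw [HomogeneousIdeal.irrelevant_le]
  intro i hi b hb
  obtain ⟨n, a, ha⟩ := mapₛ_surj (RingHom.id _) (φ.app U) 1 (fun b => ⟨0, b, by simp⟩)
    (fun y => ⟨0, (hφ U y).choose, by simp [(hφ U y).choose_spec]⟩) b
  have h1 : φ.grMap U a = b := by
    rw [map_one, map_one, one_pow, one_mul] at ha
    exact ha
  have h2 : φ.grMap U (DirectSum.decompose (M.gr U) a i) = b := by
    rw [GradedRingHom.map_directSumDecompose, h1]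
    exact DirectSum.decompose_of_mem_same _ hb
  rw [← h2]
  exact Ideal.mem_map_of_mem _ (HomogeneousIdeal.mem_irrelevant_of_mem _ hi (SetLike.coe_mem _))

lemma Hom.projMap_aux (φ : M.Hom N) (hφ : ∀ U, Function.Surjective (φ.app U))
    {U V : X.AffineZariskiSite} (h : U ≤ V) :
    N.projRes h ≫ Proj.map (φ.grMap V) (φ.grMap_irrelevant hφ V) ≫ M.projChart V =
      Proj.map (φ.grMap U) (φ.grMap_irrelevant hφ U) ≫ M.projChart U := by
  rw [← M.projChart_res h, ← Category.assoc, ← Category.assoc]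
  unfold projRes
  rw [← Proj.map_comp, ← Proj.map_comp]
  congr 2
  ext x
  exact congr($(φ.symMap_naturality h) x).symm

/-- The morphism `Proj (Sym N) ⟶ Proj (Sym M)` induced by a surjective map `M → N`. -/
def Hom.projMap (φ : M.Hom N) (hφ : ∀ U, Function.Surjective (φ.app U)) : N.proj ⟶ M.proj :=
  colimit.desc N.projGluing.functor
    { pt := M.proj
      ι :=
        { app := fun U => Proj.map (φ.grMap U) (φ.grMap_irrelevant hφ U) ≫ M.projChart U
          naturality := fun _ _ i => (φ.projMap_aux hφ i.le).trans (Category.comp_id _).symm } }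

end AlgebraicGeometry.Scheme.AffMod
end

noncomputable section

namespace Derivation

variable {k A B : Type*} [CommRing k] [CommRing A] [CommRing B] [Algebra k A] [Algebra k B]
  [Algebra A B] [IsScalarTower k A B]

open KaehlerDifferential

/-- A derivation extends to a localization. -/
lemma exists_localization (f : A) [IsLocalization.Away f B] (θ : Derivation k A A) :
    ∃ η : Derivation k B B, ∀ a, η (algebraMap A B a) = algebraMap A B (θ a) := by
  have := Algebra.FormallyEtale.of_isLocalization (Rₘ := B) (Submonoid.powers f)
  let g : TensorProduct A B Ω[A⁄k] →ₗ[B] B :=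
    LinearMap.liftBaseChange B ((Algebra.linearMap A B) ∘ₗ θ.liftKaehlerDifferential)
  refine ⟨(g ∘ₗ (tensorKaehlerEquivOfFormallyEtale k A B).symm.toLinearMap).compDer (D k B), ?_⟩
  intro a
  change g ((tensorKaehlerEquivOfFormallyEtale k A B).symm (D k B (algebraMap A B a))) = _
  rw [tensorKaehlerEquivOfFormallyEtale_symm_D_algebraMap]
  simp [g]

/-- A derivation of a localization is determined by its values on the original ring. -/
lemma ext_localization (f : A) [IsLocalization.Away f B] {η η' : Derivation k B B}
    (h : ∀ a, η (algebraMap A B a) = η' (algebraMap A B a)) : η = η' := by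
  ext b
  obtain ⟨⟨a, s⟩, hs⟩ := IsLocalization.surj (Submonoid.powers f) b
  have hu := IsLocalization.map_units B s
  apply hu.mul_right_cancel
  have h1 := congrArg η hs
  have h2 := congrArg η' hs
  simp only [leibniz, smul_eq_mul] at h1 h2
  rw [← h, ← h] at h2
  linear_combination h1 - h2

variable [Algebra.FiniteType k A] [IsNoetherianRing A]

lemma localization_inj (f : A) [IsLocalization.Away f B] (θ : Derivation k A A) (h : ∀ a, algebraMap A B (θ a) = 0) :
    ∃ n : ℕ, f ^ n • θ = 0 := by
  obtain ⟨S, hS⟩ := (Algebra.FiniteType.out : (⊤ : Subalgebra k A).FG)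
  have h1 : ∀ a, ∃ n : ℕ, f ^ n * θ a = 0 := by
    intro a
    obtain ⟨⟨_, n, rfl⟩, hn⟩ :=
      (IsLocalization.map_eq_zero_iff (Submonoid.powers f) B (θ a)).mp (h a)
    exact ⟨n, hn⟩
  choose m hm using h1
  refine ⟨S.sup m, ?_⟩
  refine ext_of_adjoin_eq_top (S : Set A) hS ?_
  intro a ha
  obtain ⟨c, hc⟩ := pow_dvd_pow f (Finset.le_sup (f := m) ha)
  simp only [smul_apply, smul_eq_mul, zero_apply, hc]
  rw [mul_assoc, mul_comm c, ← mul_assoc, hm, zero_mul]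

lemma localization_surj (f : A) [IsLocalization.Away f B] (η : Derivation k B B) :
    ∃ (n : ℕ) (θ : Derivation k A A),
      ∀ a, algebraMap A B (θ a) = algebraMap A B f ^ n * η (algebraMap A B a) := by
  have : Module.FinitePresentation A Ω[A⁄k] := Module.finitePresentation_of_finite A _
  let l : Ω[A⁄k] →ₗ[A] B := ((η.liftKaehlerDifferential).restrictScalars A) ∘ₗ (map k k A B)
  have hl : ∀ a, l (D k A a) = η (algebraMap A B a) := by
    intro a
    simp [l]
  obtain ⟨g, ⟨_, n, rfl⟩, hg⟩ := Module.FinitePresentation.exists_lift_of_isLocalizedModule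
    (Submonoid.powers f) (Algebra.linearMap A B) l
  refine ⟨n, g.compDer (D k A), fun a => ?_⟩
  have := congr($hg (D k A a))
  simp only [LinearMap.comp_apply] at this
  change algebraMap A B (g (D k A a)) = _
  rw [← hl, ← map_pow, ← Algebra.smul_def]
  exact this

end Derivation

open CategoryTheory CategoryTheory.Limits AlgebraicGeometry Opposite

namespace AlgebraicGeometry.Scheme

section Der

variable (k : Type u) [Field k] (X : Scheme.{u}) [X.Over (Spec (.of k))]

/-- The constants `k → Γ(X, U)` on a scheme over `k`. -/
def constHom (U : X.Opens) : k →+* Γ(X, U) :=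
  ((X ↘ Spec (.of k)).appLE ⊤ U (by simp)).hom.comp (Scheme.ΓSpecIso (.of k)).inv.hom

lemma map_constHom {U V : X.Opens} (h : U ≤ V) (c : k) :
    X.presheaf.map (homOfLE h).op (X.constHom k V c) = X.constHom k U c := by
  have h1 := Scheme.Hom.appLE_map (X ↘ Spec (.of k)) (U := ⊤) (V := V) (by simp) (homOfLE h).op
  exact congr($h1 ((Scheme.ΓSpecIso (.of k)).inv.hom c))

/-- The `k`-algebra structure of `Γ(X, U)`. -/
abbrev sectionsAlgebra (U : X.Opens) : Algebra k Γ(X, U) := (X.constHom k U).toAlgebra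

attribute [local instance] sectionsAlgebra

lemma finiteType_sections [LocallyOfFiniteType (X ↘ Spec (.of k))] (U : X.AffineZariskiSite) :
    Algebra.FiniteType k Γ(X, U.toOpens) := by
  have h1 := (X ↘ Spec (.of k)).finiteType_appLE (isAffineOpen_top _) U.2 (by simp)
  have h2 : (X.constHom k U.toOpens).FiniteType := by
    refine h1.comp ?_
    exact RingHom.FiniteType.of_surjective _
      (ConcreteCategory.bijective_of_isIso (Scheme.ΓSpecIso (.of k)).inv).2
  exact h2

lemma isNoetherianRing_sections [LocallyOfFiniteType (X ↘ Spec (.of k))]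
    (U : X.AffineZariskiSite) : IsNoetherianRing Γ(X, U.toOpens) := by
  have := X.finiteType_sections k U
  exact Algebra.FiniteType.isNoetherianRing k _

variable {X}

lemma derivation_ringRes {U V : X.AffineZariskiSite} (h : U ≤ V)
    (θ : Derivation k Γ(X, V.toOpens) Γ(X, V.toOpens)) :
    ∃ η : Derivation k Γ(X, U.toOpens) Γ(X, U.toOpens),
      ∀ a, η (X.ringRes h a) = X.ringRes h (θ a) := by
  obtain ⟨f, hf⟩ := id h
  obtain rfl : V.basicOpen f = U := Subtype.ext hf
  let := (X.ringRes h).toAlgebra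
  have : IsLocalization.Away f Γ(X, (V.basicOpen f).toOpens) := V.2.isLocalization_basicOpen f
  have : IsScalarTower k Γ(X, V.toOpens) Γ(X, (V.basicOpen f).toOpens) :=
    .of_algebraMap_eq fun c => (X.map_constHom k (AffineZariskiSite.toOpens_mono h) c).symm
  exact Derivation.exists_localization f θ

lemma derivation_ext {U V : X.AffineZariskiSite} (h : U ≤ V)
    {η η' : Derivation k Γ(X, U.toOpens) Γ(X, U.toOpens)}
    (H : ∀ a, η (X.ringRes h a) = η' (X.ringRes h a)) : η = η' := by
  obtain ⟨f, hf⟩ := id h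
  obtain rfl : V.basicOpen f = U := Subtype.ext hf
  let := (X.ringRes h).toAlgebra
  have : IsLocalization.Away f Γ(X, (V.basicOpen f).toOpens) := V.2.isLocalization_basicOpen f
  have : IsScalarTower k Γ(X, V.toOpens) Γ(X, (V.basicOpen f).toOpens) :=
    .of_algebraMap_eq fun c => (X.map_constHom k (AffineZariskiSite.toOpens_mono h) c).symm
  exact Derivation.ext_localization f H

/-- The restriction of derivations: the unique extension to the smaller affine open. -/
def derRes {U V : X.AffineZariskiSite} (h : U ≤ V) :
    Derivation k Γ(X, V.toOpens) Γ(X, V.toOpens) →ₛₗ[X.ringRes h]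
      Derivation k Γ(X, U.toOpens) Γ(X, U.toOpens) where
  toFun θ := (derivation_ringRes k h θ).choose
  map_add' θ η := derivation_ext k h fun a => by
    rw [Derivation.add_apply, (derivation_ringRes k h _).choose_spec,
      (derivation_ringRes k h _).choose_spec, (derivation_ringRes k h _).choose_spec,
      Derivation.add_apply, map_add]
  map_smul' c θ := derivation_ext k h fun a => by
    rw [Derivation.smul_apply, (derivation_ringRes k h _).choose_spec,
      (derivation_ringRes k h _).choose_spec, Derivation.smul_apply, smul_eq_mul, smul_eq_mul,
      map_mul]

lemma derRes_apply {U V : X.AffineZariskiSite} (h : U ≤ V)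
    (θ : Derivation k Γ(X, V.toOpens) Γ(X, V.toOpens)) (a : Γ(X, V.toOpens)) :
    derRes k h θ (X.ringRes h a) = X.ringRes h (θ a) :=
  (derivation_ringRes k h θ).choose_spec a

variable (X) [LocallyOfFiniteType (X ↘ Spec (.of k))]

/-- The sheaf `Der_X` of `k`-derivations of `𝒪_X`. -/
def der : X.AffMod where
  obj U := Derivation k Γ(X, U.toOpens) Γ(X, U.toOpens)
  res h := derRes k h
  res_refl U θ := derivation_ext k (le_refl U) fun a => by
    rw [derRes_apply, ringRes_refl, RingHom.id_apply, RingHom.id_apply]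
  res_trans h h' θ := derivation_ext k (h.trans h') fun a => by
    rw [derRes_apply, ringRes_trans, RingHom.comp_apply, RingHom.comp_apply, derRes_apply,
      derRes_apply]
  res_surj V f η := by
    have := X.finiteType_sections k V
    have := X.isNoetherianRing_sections k V
    let := (X.ringRes (V.basicOpen_le f)).toAlgebra
    have : IsLocalization.Away f Γ(X, (V.basicOpen f).toOpens) := V.2.isLocalization_basicOpen f
    have : IsScalarTower k Γ(X, V.toOpens) Γ(X, (V.basicOpen f).toOpens) :=
      .of_algebraMap_eq fun c =>
        (X.map_constHom k (AffineZariskiSite.toOpens_mono (V.basicOpen_le f)) c).symm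
    obtain ⟨n, θ, h⟩ := Derivation.localization_surj f η
    refine ⟨n, θ, derivation_ext k (V.basicOpen_le f) fun a => ?_⟩
    rw [derRes_apply]
    exact h a
  res_inj V f θ hθ := by
    have := X.finiteType_sections k V
    have := X.isNoetherianRing_sections k V
    let := (X.ringRes (V.basicOpen_le f)).toAlgebra
    have : IsLocalization.Away f Γ(X, (V.basicOpen f).toOpens) := V.2.isLocalization_basicOpen f
    have : IsScalarTower k Γ(X, V.toOpens) Γ(X, (V.basicOpen f).toOpens) :=
      .of_algebraMap_eq fun c =>
        (X.map_constHom k (AffineZariskiSite.toOpens_mono (V.basicOpen_le f)) c).symm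
    refine Derivation.localization_inj (B := Γ(X, (V.basicOpen f).toOpens)) f θ fun a => ?_
    have := derRes_apply k (V.basicOpen_le f) θ a
    rw [hθ] at this
    exact this.symm

end Der

end AlgebraicGeometry.Scheme

end

noncomputable section

open CategoryTheory CategoryTheory.Limits AlgebraicGeometry Opposite

namespace AlgebraicGeometry.Scheme

section Ideals

variable {X : Scheme.{u}} (D : X.IdealSheafData)

/-- The ideal `D(U) ⊆ Γ(X, U)` on an affine open. -/
abbrev IdealSheafData.aff (U : X.AffineZariskiSite) : Ideal Γ(X, U.toOpens) :=
  D.ideal ⟨U.toOpens, U.2⟩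

lemma IdealSheafData.map_aff {U V : X.AffineZariskiSite} (h : U ≤ V) :
    (D.aff V).map (X.ringRes h) = D.aff U :=
  D.map_ideal (U := ⟨U.toOpens, U.2⟩) (V := ⟨V.toOpens, V.2⟩) (AffineZariskiSite.toOpens_mono h)

lemma IdealSheafData.ringRes_mem {U V : X.AffineZariskiSite} (h : U ≤ V) {a : Γ(X, V.toOpens)}
    (ha : a ∈ D.aff V) : X.ringRes h a ∈ D.aff U := by
  rw [← D.map_aff h]
  exact Ideal.mem_map_of_mem _ ha

lemma IdealSheafData.aff_surj (V : X.AffineZariskiSite) (f : Γ(X, V.toOpens))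
    {b : Γ(X, (V.basicOpen f).toOpens)} (hb : b ∈ D.aff (V.basicOpen f)) :
    ∃ (n : ℕ) (a : Γ(X, V.toOpens)), a ∈ D.aff V ∧
      X.ringRes (V.basicOpen_le f) a = X.ringRes (V.basicOpen_le f) f ^ n * b := by
  let := (X.ringRes (V.basicOpen_le f)).toAlgebra
  have : IsLocalization.Away f Γ(X, (V.basicOpen f).toOpens) := V.2.isLocalization_basicOpen f
  rw [← D.map_aff (V.basicOpen_le f)] at hb
  obtain ⟨⟨⟨a, ha⟩, ⟨_, n, rfl⟩⟩, h⟩ :=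
    (IsLocalization.mem_map_algebraMap_iff (Submonoid.powers f) _).mp hb
  refine ⟨n, a, ha, ?_⟩
  rw [← map_pow, mul_comm]
  exact h.symm

lemma IdealSheafData.aff_inj (V : X.AffineZariskiSite) (f : Γ(X, V.toOpens))
    {a : Γ(X, V.toOpens)} (ha : X.ringRes (V.basicOpen_le f) a ∈ D.aff (V.basicOpen f)) :
    ∃ n : ℕ, f ^ n * a ∈ D.aff V := by
  obtain ⟨n, b, hb, h⟩ := D.aff_surj V f ha
  obtain ⟨m, hm⟩ := ringRes_inj V f (b - f ^ n * a) (by rw [map_sub, h, map_mul, map_pow, sub_self])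
  refine ⟨m + n, ?_⟩
  have : f ^ (m + n) * a = f ^ m * b := by
    rw [mul_sub, sub_eq_zero] at hm
    rw [hm, pow_add, mul_assoc]
  rw [this]
  exact Ideal.mul_mem_left _ _ hb

end Ideals

section Log

variable (k : Type u) [Field k] {X : Scheme.{u}} [X.Over (Spec (.of k))]
  (D : X.IdealSheafData)

attribute [local instance] sectionsAlgebra

/-- The logarithmic derivations on an affine open: `θ(D(U)) ⊆ D(U)`. -/
def derLogSubmodule (U : X.AffineZariskiSite) :
    Submodule Γ(X, U.toOpens) (Derivation k Γ(X, U.toOpens) Γ(X, U.toOpens)) where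
  carrier := { θ | ∀ a ∈ D.aff U, θ a ∈ D.aff U }
  add_mem' h h' a ha := Ideal.add_mem _ (h a ha) (h' a ha)
  zero_mem' _ _ := Ideal.zero_mem _
  smul_mem' c _ h a ha := Ideal.mul_mem_left _ c (h a ha)

lemma derRes_mem {U V : X.AffineZariskiSite} (h : U ≤ V)
    {θ : Derivation k Γ(X, V.toOpens) Γ(X, V.toOpens)} (hθ : θ ∈ derLogSubmodule k D V) :
    derRes k h θ ∈ derLogSubmodule k D U := by
  intro b hb
  rw [← D.map_aff h] at hb
  induction hb using Submodule.span_induction with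
  | mem x hx =>
    obtain ⟨a, ha, rfl⟩ := hx
    rw [derRes_apply]
    exact D.ringRes_mem h (hθ a ha)
  | zero => rw [map_zero]; exact Ideal.zero_mem _
  | add x y _ _ hx hy => rw [map_add]; exact Ideal.add_mem _ hx hy
  | smul c x hx hx' =>
    rw [smul_eq_mul, Derivation.leibniz]
    refine Ideal.add_mem _ (Ideal.mul_mem_left _ _ hx') (Ideal.mul_mem_right _ _ ?_)
    rw [← D.map_aff h]
    exact hx

/-- The `Γ(X, U)`-linear map `Der(U) → Hom(D(U), Γ(X, U)/D(U))`, `θ ↦ (h ↦ θ(h) mod D(U))`. -/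
def logMap (U : X.AffineZariskiSite) :
    Derivation k Γ(X, U.toOpens) Γ(X, U.toOpens) →ₗ[Γ(X, U.toOpens)]
      (D.aff U →ₗ[Γ(X, U.toOpens)] Γ(X, U.toOpens) ⧸ D.aff U) where
  toFun θ :=
    { toFun := fun a => Ideal.Quotient.mk _ (θ a)
      map_add' := fun a b => by simp
      map_smul' := fun c a => by
        have : Ideal.Quotient.mk (D.aff U) (a : Γ(X, U.toOpens)) = 0 :=
          Ideal.Quotient.eq_zero_iff_mem.mpr a.2
        simp [Derivation.leibniz, this, Algebra.smul_def] }
  map_add' θ η := by ext a; simp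
  map_smul' c θ := by ext a; simp [Algebra.smul_def]

lemma logMap_apply (U : X.AffineZariskiSite) (θ : Derivation k Γ(X, U.toOpens) Γ(X, U.toOpens))
    (a : D.aff U) : logMap k D U θ a = Ideal.Quotient.mk _ (θ a) := rfl

lemma logMap_eq_zero_iff (U : X.AffineZariskiSite)
    (θ : Derivation k Γ(X, U.toOpens) Γ(X, U.toOpens)) :
    logMap k D U θ = 0 ↔ θ ∈ derLogSubmodule k D U := by
  constructor
  · intro h a ha
    exact Ideal.Quotient.eq_zero_iff_mem.mp congr($h ⟨a, ha⟩)
  · intro h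
    ext a
    exact Ideal.Quotient.eq_zero_iff_mem.mpr (h a a.2)

lemma logMap_derRes_congr {U V : X.AffineZariskiSite} (h : U ≤ V)
    {θ η : Derivation k Γ(X, V.toOpens) Γ(X, V.toOpens)} (H : logMap k D V θ = logMap k D V η) :
    logMap k D U (derRes k h θ) = logMap k D U (derRes k h η) := by
  rw [← sub_eq_zero, ← map_sub, logMap_eq_zero_iff] at H ⊢
  rw [← map_sub]
  exact derRes_mem k D h H

lemma exists_logMap_derRes {U V : X.AffineZariskiSite} (h : U ≤ V)
    (x : LinearMap.range (logMap k D V)) : ∃ y : LinearMap.range (logMap k D U),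
      ∀ θ, logMap k D V θ = x → y = logMap k D U (derRes k h θ) := by
  obtain ⟨_, θ, rfl⟩ := x
  exact ⟨⟨logMap k D U (derRes k h θ), ⟨_, rfl⟩⟩, fun η hη =>
    logMap_derRes_congr k D h hη.symm⟩

/-- The restriction map of the image of `Der_X` in `Hom(D, 𝒪_X/D)`: it maps the class of `θ` to
the class of the restriction of `θ`. -/
def logQuotResFun {U V : X.AffineZariskiSite} (h : U ≤ V)
    (x : LinearMap.range (logMap k D V)) : LinearMap.range (logMap k D U) :=
  (exists_logMap_derRes k D h x).choose

lemma logQuotResFun_apply {U V : X.AffineZariskiSite} (h : U ≤ V)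
    (x : LinearMap.range (logMap k D V)) {θ : Derivation k Γ(X, V.toOpens) Γ(X, V.toOpens)}
    (hx : logMap k D V θ = x) :
    (logQuotResFun k D h x : D.aff U →ₗ[Γ(X, U.toOpens)] Γ(X, U.toOpens) ⧸ D.aff U) =
      logMap k D U (derRes k h θ) :=
  (exists_logMap_derRes k D h x).choose_spec θ hx

lemma logQuotResFun_smul {U V : X.AffineZariskiSite} (h : U ≤ V) (c : Γ(X, V.toOpens))
    (x : LinearMap.range (logMap k D V)) :
    logQuotResFun k D h (c • x) = X.ringRes h c • logQuotResFun k D h x := by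
  obtain ⟨θ, hx⟩ := x.2
  have hcx : logMap k D V (c • θ) = (c • x : LinearMap.range (logMap k D V)) :=
    (map_smul (logMap k D V) c θ).trans (congrArg (fun y => c • y) hx)
  have h1 := logQuotResFun_apply k D h x hx
  have h2 := logQuotResFun_apply k D h (c • x) hcx
  have h3 : derRes k h (c • θ) = X.ringRes h c • derRes k h θ := map_smulₛₗ (derRes k h) c θ
  have h4 := map_smul (logMap k D U) (X.ringRes h c) (derRes k h θ)
  exact Subtype.ext (h2.trans ((congrArg _ h3).trans (h4.trans
    (congrArg (fun y => X.ringRes h c • y) h1.symm))))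

/-- The restriction map of the image of `Der_X` in `Hom(D, 𝒪_X/D)`, as a semilinear map. -/
def logQuotRes {U V : X.AffineZariskiSite} (h : U ≤ V) :
    LinearMap.range (logMap k D V) →ₛₗ[X.ringRes h] LinearMap.range (logMap k D U) where
  toFun := logQuotResFun k D h
  map_add' x y := by
    obtain ⟨θ, hx⟩ := x.2
    obtain ⟨η, hy⟩ := y.2
    apply Subtype.ext
    rw [Submodule.coe_add, logQuotResFun_apply k D h x hx, logQuotResFun_apply k D h y hy,
      logQuotResFun_apply k D h (x + y) (θ := θ + η) (by rw [map_add, hx, hy]; rfl), map_add,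
      map_add]
  map_smul' c x := logQuotResFun_smul k D h c x

lemma logQuotRes_apply {U V : X.AffineZariskiSite} (h : U ≤ V)
    (θ : Derivation k Γ(X, V.toOpens) Γ(X, V.toOpens)) :
    logQuotRes k D h ⟨logMap k D V θ, ⟨θ, rfl⟩⟩ = ⟨logMap k D U (derRes k h θ), ⟨_, rfl⟩⟩ :=
  Subtype.ext (logQuotResFun_apply k D h _ rfl)

variable [LocallyOfFiniteType (X ↘ Spec (.of k))]

lemma exists_pow_smul_mem (V : X.AffineZariskiSite) (f : Γ(X, V.toOpens))
    {θ : Derivation k Γ(X, V.toOpens) Γ(X, V.toOpens)}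
    (h : derRes k (V.basicOpen_le f) θ ∈ derLogSubmodule k D (V.basicOpen f)) :
    ∃ n : ℕ, f ^ n • θ ∈ derLogSubmodule k D V := by
  have := X.isNoetherianRing_sections k V
  obtain ⟨S, hS⟩ := (IsNoetherian.noetherian (D.aff V) : (D.aff V).FG)
  have h1 : ∀ a : Γ(X, V.toOpens), ∃ n : ℕ, a ∈ S → f ^ n * θ a ∈ D.aff V := by
    intro a
    by_cases ha : a ∈ S
    · have ha' : a ∈ D.aff V := by rw [← hS]; exact Submodule.subset_span ha
      have h2 := h _ (D.ringRes_mem (V.basicOpen_le f) ha')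
      rw [derRes_apply] at h2
      obtain ⟨n, hn⟩ := D.aff_inj V f h2
      exact ⟨n, fun _ => hn⟩
    · exact ⟨0, fun h => absurd h ha⟩
  choose m hm using h1
  refine ⟨S.sup m, fun a ha => ?_⟩
  have ha0 := ha
  rw [← hS] at ha
  induction ha using Submodule.span_induction with
  | mem x hx =>
    obtain ⟨c, hc⟩ := pow_dvd_pow f (Finset.le_sup (f := m) hx)
    rw [Derivation.smul_apply, smul_eq_mul, hc, mul_comm (f ^ m x) c, mul_assoc]
    exact Ideal.mul_mem_left _ _ (hm x hx)
  | zero => rw [map_zero]; exact Ideal.zero_mem _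
  | add x y hx' hy' hx hy =>
    rw [map_add]
    exact Ideal.add_mem _ (hx (hS ▸ hx')) (hy (hS ▸ hy'))
  | smul c x hx hx' =>
    have hxm : x ∈ D.aff V := hS ▸ hx
    rw [smul_eq_mul, Derivation.leibniz]
    exact Ideal.add_mem _ (Ideal.mul_mem_left _ _ (hx' hxm)) (Ideal.mul_mem_right _ _ hxm)

/-- The sheaf `Der_X(-log D)` of logarithmic derivations. -/
def derLog : X.AffMod where
  obj U := derLogSubmodule k D U
  res h :=
    { toFun := fun θ => ⟨derRes k h θ.1, derRes_mem k D h θ.2⟩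
      map_add' := fun θ η => Subtype.ext (map_add (derRes k h) θ.1 η.1)
      map_smul' := fun c θ => Subtype.ext (map_smulₛₗ (derRes k h) c θ.1) }
  res_refl U θ := Subtype.ext ((X.der k).res_refl U θ.1)
  res_trans h h' θ := Subtype.ext ((X.der k).res_trans h h' θ.1)
  res_surj V f η := by
    obtain ⟨n, θ, h⟩ := (X.der k).res_surj V f η.1
    obtain ⟨m, hm⟩ := exists_pow_smul_mem k D V f (θ := θ) (by
      change (X.der k).res _ θ ∈ _
      rw [h]
      exact Submodule.smul_mem _ _ η.2)
    refine ⟨m + n, ⟨f ^ m • θ, hm⟩, Subtype.ext ?_⟩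
    refine (map_smulₛₗ ((X.der k).res (V.basicOpen_le f)) (f ^ m) θ).trans ?_
    rw [h, map_pow]
    refine (mul_smul _ _ η.1).symm.trans ?_
    rw [← pow_add]
    rfl
  res_inj V f θ hθ := by
    obtain ⟨n, hn⟩ := (X.der k).res_inj V f θ.1 congr(($hθ).1)
    exact ⟨n, Subtype.ext hn⟩

/-- The inclusion `Der_X(-log D) → Der_X`. -/
def derLogIncl : (derLog k D).Hom (X.der k) where
  app U := (derLogSubmodule k D U).subtype
  naturality _ _ := rfl

lemma logQuotRes_surj (V : X.AffineZariskiSite) (f : Γ(X, V.toOpens))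
    (y : LinearMap.range (logMap k D (V.basicOpen f))) :
    ∃ (n : ℕ) (x : LinearMap.range (logMap k D V)),
      logQuotRes k D (V.basicOpen_le f) x = X.ringRes (V.basicOpen_le f) f ^ n • y := by
  obtain ⟨η, hy⟩ := y.2
  obtain ⟨n, θ, h⟩ := (X.der k).res_surj V f η
  refine ⟨n, ⟨logMap k D V θ, ⟨θ, rfl⟩⟩, ?_⟩
  refine (logQuotRes_apply k D (V.basicOpen_le f) θ).trans ?_
  have h1 : derRes k (V.basicOpen_le f) θ = X.ringRes (V.basicOpen_le f) f ^ n • η := h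
  have h2 := map_smul (logMap k D (V.basicOpen f)) (X.ringRes (V.basicOpen_le f) f ^ n) η
  rw [hy] at h2
  exact Subtype.ext ((congrArg (logMap k D (V.basicOpen f)) h1).trans h2)

lemma logQuotRes_inj (V : X.AffineZariskiSite) (f : Γ(X, V.toOpens))
    (x : LinearMap.range (logMap k D V)) (hx : logQuotRes k D (V.basicOpen_le f) x = 0) :
    ∃ n : ℕ, f ^ n • x = 0 := by
  obtain ⟨θ, hθ⟩ := x.2
  obtain rfl : x = ⟨logMap k D V θ, ⟨θ, rfl⟩⟩ := Subtype.ext hθ.symm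
  rw [logQuotRes_apply] at hx
  have h1 : logMap k D (V.basicOpen f) (derRes k (V.basicOpen_le f) θ) = 0 :=
    congrArg Subtype.val hx
  obtain ⟨n, hn⟩ := exists_pow_smul_mem k D V f ((logMap_eq_zero_iff k D _ _).mp h1)
  have h2 := map_smul (logMap k D V) (f ^ n) θ
  have h3 := (logMap_eq_zero_iff k D V _).mpr hn
  exact ⟨n, Subtype.ext (h2.symm.trans h3)⟩

/-- The sheaf `i_*𝓘(D)`, where `𝓘` is the ideal of the singular subscheme in `𝒪_D`: the subsheaf
of `𝒪_D(D) = Hom(D, 𝒪_X/D)` consisting of the homomorphisms `h ↦ θ(h) mod D`, for derivations `θ`.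
See `range_logMap` for the description as `𝓘 ⋅ 𝒪_D(D)`. -/
def logQuot : X.AffMod where
  obj U := LinearMap.range (logMap k D U)
  res h := logQuotRes k D h
  res_refl U x := by
    obtain ⟨_, θ, rfl⟩ := x
    rw [logQuotRes_apply]
    congr 2
    exact (X.der k).res_refl U θ
  res_trans h h' x := by
    obtain ⟨_, θ, rfl⟩ := x
    rw [logQuotRes_apply, logQuotRes_apply, logQuotRes_apply]
    congr 2
    exact (X.der k).res_trans h h' θ
  res_surj V f x := logQuotRes_surj k D V f x
  res_inj V f x hx := logQuotRes_inj k D V f x hx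

/-- The surjection `Der_X → i_*𝓘(D)`, `θ ↦ (h ↦ θ(h) mod D)`. -/
def derToLogQuot : (X.der k).Hom (logQuot k D) where
  app U := (logMap k D U).rangeRestrict
  naturality h θ := (logQuotRes_apply k D h θ).symm

lemma derToLogQuot_surjective (U : X.AffineZariskiSite) :
    Function.Surjective ((derToLogQuot k D).app U) :=
  (logMap k D U).surjective_rangeRestrict

end Log

section Jacobian

variable (k : Type u) [Field k] {X : Scheme.{u}} [X.Over (Spec (.of k))]
  (D : X.IdealSheafData)

attribute [local instance] sectionsAlgebra

/-- The Jacobian ideal of `D` on an affine open: it is generated by `D(U)` and the derivatives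
`θ(h)` for `h ∈ D(U)`. -/
def jacobianIdeal (U : X.AffineZariskiSite) : Ideal Γ(X, U.toOpens) :=
  D.aff U ⊔ Ideal.span { b | ∃ θ : Derivation k Γ(X, U.toOpens) Γ(X, U.toOpens),
    ∃ a ∈ D.aff U, θ a = b }

/-- If `D` is principal on `U`, generated by a nonzerodivisor `h`, then the image of `Der(U)` in
`Hom(D(U), Γ(X, U)/D(U))` is `J ⋅ Hom(D(U), Γ(X, U)/D(U))` for the Jacobian ideal `J`. -/
lemma range_logMap (U : X.AffineZariskiSite) (h : Γ(X, U.toOpens))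
    (hD : D.aff U = Ideal.span {h}) (hh : h ∈ nonZeroDivisors Γ(X, U.toOpens)) :
    LinearMap.range (logMap k D U) = jacobianIdeal k D U •
      (⊤ : Submodule Γ(X, U.toOpens) (D.aff U →ₗ[Γ(X, U.toOpens)] Γ(X, U.toOpens) ⧸ D.aff U)) := by
  have hm : h ∈ D.aff U := by rw [hD]; exact Ideal.mem_span_singleton_self h
  have hext : ∀ φ ψ : D.aff U →ₗ[Γ(X, U.toOpens)] Γ(X, U.toOpens) ⧸ D.aff U,
      φ ⟨h, hm⟩ = ψ ⟨h, hm⟩ → φ = ψ := by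
    intro φ ψ H
    ext ⟨a, ha⟩
    have ha' := ha
    rw [hD, Ideal.mem_span_singleton'] at ha'
    obtain ⟨c, rfl⟩ := ha'
    have : (⟨c * h, ha⟩ : D.aff U) = c • ⟨h, hm⟩ := rfl
    rw [this, map_smul, map_smul, H]
  apply le_antisymm
  · rintro _ ⟨θ, rfl⟩
    let g : Γ(X, U.toOpens) →ₗ[Γ(X, U.toOpens)] D.aff U :=
      LinearMap.toSpanSingleton _ _ ⟨h, hm⟩
    have hg : Function.Bijective g := by
      constructor
      · rw [injective_iff_map_eq_zero]
        intro a ha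
        have : a * h = 0 := congr(($ha).1)
        exact (mem_nonZeroDivisors_iff_right.mp hh) a this
      · rintro ⟨a, ha⟩
        have ha' := ha
        rw [hD, Ideal.mem_span_singleton'] at ha'
        obtain ⟨c, rfl⟩ := ha'
        exact ⟨c, rfl⟩
    let e := LinearEquiv.ofBijective g hg
    let φ : D.aff U →ₗ[Γ(X, U.toOpens)] Γ(X, U.toOpens) ⧸ D.aff U :=
      (Submodule.mkQ (D.aff U)) ∘ₗ e.symm.toLinearMap
    have hφ : φ ⟨h, hm⟩ = Ideal.Quotient.mk _ 1 := by
      have : e.symm ⟨h, hm⟩ = 1 := by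
        rw [LinearEquiv.symm_apply_eq]
        exact Subtype.ext (one_mul h).symm
      exact congrArg (Submodule.mkQ (D.aff U)) this
    have : logMap k D U θ = θ h • φ := by
      apply hext
      rw [LinearMap.smul_apply, hφ, logMap_apply, map_one, Algebra.smul_def, mul_one]
      rfl
    rw [this]
    refine Submodule.smul_mem_smul ?_ trivial
    exact Ideal.mem_sup_right (Ideal.subset_span ⟨θ, h, hm, rfl⟩)
  · rw [Submodule.smul_le]
    intro j hj φ _
    obtain ⟨b, hb⟩ := Ideal.Quotient.mk_surjective (φ ⟨h, hm⟩)
    have h0 : ∀ a ∈ D.aff U, a • φ = 0 := by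
      intro a ha
      apply hext
      rw [LinearMap.smul_apply, ← hb, Algebra.smul_def, LinearMap.zero_apply]
      exact (map_mul _ a b).symm.trans
        (Ideal.Quotient.eq_zero_iff_mem.mpr (Ideal.mul_mem_right _ _ ha))
    have h1 : ∀ θ : Derivation k Γ(X, U.toOpens) Γ(X, U.toOpens), ∀ a ∈ D.aff U,
        θ a • φ ∈ LinearMap.range (logMap k D U) := by
      intro θ a ha
      rw [hD, Ideal.mem_span_singleton'] at ha
      obtain ⟨c, rfl⟩ := ha
      refine ⟨(c * b) • θ, ?_⟩
      rw [Derivation.leibniz, smul_eq_mul, smul_eq_mul, add_smul,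
        h0 (h * θ c) (Ideal.mul_mem_right _ _ hm), add_zero]
      apply hext
      rw [LinearMap.smul_apply, ← hb, Algebra.smul_def, logMap_apply]
      refine Eq.trans ?_ (map_mul (Ideal.Quotient.mk (D.aff U)) (c * θ h) b)
      congr 1
      change c * b * θ h = _
      ring
    have h2 : jacobianIdeal k D U ≤
        (LinearMap.range (logMap k D U)).comap (LinearMap.toSpanSingleton _ _ φ) := by
      refine sup_le ?_ (Ideal.span_le.mpr ?_)
      · intro a ha
        change a • φ ∈ LinearMap.range (logMap k D U)
        rw [h0 a ha]
        exact Submodule.zero_mem _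
      · rintro _ ⟨θ, a, ha, rfl⟩
        exact h1 θ a ha
    exact h2 hj

end Jacobian

end AlgebraicGeometry.Scheme
end

noncomputable section

open CategoryTheory CategoryTheory.Limits AlgebraicGeometry Opposite TopologicalSpace

namespace AlgebraicGeometry.Scheme

section Families

variable (Y : Scheme.{u})

/-- The restriction map of the structure sheaf. -/
abbrev oRes {W' W : Y.Opens} (h : W' ≤ W) : Γ(Y, W) →+* Γ(Y, W') :=
  (Y.presheaf.map (homOfLE h).op).hom

variable {Y}

lemma oRes_refl {W : Y.Opens} (a : Γ(Y, W)) : Y.oRes (le_refl W) a = a := by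
  change Y.presheaf.map (𝟙 _) a = a
  simp

lemma oRes_oRes {W W' W'' : Y.Opens} (h : W ≤ W') (h' : W' ≤ W'') (a : Γ(Y, W'')) :
    Y.oRes h (Y.oRes h' a) = Y.oRes (h.trans h') a := by
  change Y.presheaf.map _ (Y.presheaf.map _ a) = Y.presheaf.map _ a
  rw [← CommRingCat.comp_apply, ← Y.presheaf.map_comp]
  rfl

/-- Two sections which agree locally are equal. -/
lemma oRes_ext {W : Y.Opens} {a b : Γ(Y, W)}
    (h : ∀ x ∈ W, ∃ (W' : Y.Opens) (hW : W' ≤ W), x ∈ W' ∧ Y.oRes hW a = Y.oRes hW b) : a = b := by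
  refine TopCat.Presheaf.IsSheaf.section_ext Y.sheaf.2 fun x hx => ?_
  obtain ⟨W', hW, hx', H⟩ := h x hx
  exact ⟨W', hW, hx', H⟩

variable (Y) in
/-- The families of functions on the opens `B i ⊓ W`. -/
def Fam {I : Type u} (B : I → Y.Opens) (W : Y.Opens) : Type u := ∀ i, Γ(Y, B i ⊓ W)

namespace Fam

variable {I : Type u} {B : I → Y.Opens}

instance (W : Y.Opens) : AddCommGroup (Y.Fam B W) := Pi.addCommGroup

instance (W : Y.Opens) : Module Γ(Y, W) (Y.Fam B W) where
  smul a s := fun i => Y.oRes inf_le_right a * s i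
  one_smul s := funext fun i => by
    change Y.oRes inf_le_right 1 * s i = s i
    rw [map_one, one_mul]
  mul_smul a b s := funext fun i => by
    change Y.oRes inf_le_right (a * b) * s i = Y.oRes inf_le_right a * (Y.oRes inf_le_right b * s i)
    rw [map_mul, mul_assoc]
  smul_zero a := funext fun i => mul_zero _
  smul_add a s t := funext fun i => mul_add _ _ _
  add_smul a b s := funext fun i => by
    change Y.oRes inf_le_right (a + b) * s i =
      Y.oRes inf_le_right a * s i + Y.oRes inf_le_right b * s i
    rw [map_add, add_mul]
  zero_smul s := funext fun i => by
    change Y.oRes inf_le_right 0 * s i = 0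
    rw [map_zero, zero_mul]

lemma add_apply {W : Y.Opens} (s t : Y.Fam B W) (i : I) : (s + t) i = s i + t i := rfl

lemma zero_apply {W : Y.Opens} (i : I) : (0 : Y.Fam B W) i = 0 := rfl

lemma smul_apply {W : Y.Opens} (a : Γ(Y, W)) (s : Y.Fam B W) (i : I) :
    (a • s) i = Y.oRes inf_le_right a * s i := rfl

/-- The restriction of a family to a smaller open. -/
def res {W' W : Y.Opens} (h : W' ≤ W) (s : Y.Fam B W) : Y.Fam B W' :=
  fun i => Y.oRes (inf_le_inf_left (B i) h) (s i)

lemma res_apply {W' W : Y.Opens} (h : W' ≤ W) (s : Y.Fam B W) (i : I) :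
    res h s i = Y.oRes (inf_le_inf_left (B i) h) (s i) := rfl

end Fam

variable (Y) in
/-- A sheaf of modules whose sections over `W` are families of functions on opens `B i ⊓ W`, subject
to linear conditions of a local nature. -/
structure FamSheaf where
  /-- the index set -/
  I : Type u
  /-- the opens -/
  B : I → Y.Opens
  /-- the sections -/
  sec : ∀ W : Y.Opens, Submodule Γ(Y, W) (Y.Fam B W)
  res_mem : ∀ {W' W : Y.Opens} (h : W' ≤ W) {s : Y.Fam B W}, s ∈ sec W → Fam.res h s ∈ sec W'
  mem_of_local : ∀ {W : Y.Opens} {s : Y.Fam B W},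
    (∀ x ∈ W, ∃ (W' : Y.Opens) (h : W' ≤ W), x ∈ W' ∧ Fam.res h s ∈ sec W') → s ∈ sec W

namespace FamSheaf

variable (S : Y.FamSheaf)

/-- The presheaf of abelian groups underlying a sheaf of families. -/
def presheaf : TopCat.Presheaf Ab.{u} Y where
  obj W := .of (S.sec W.unop)
  map i := AddCommGrpCat.ofHom
    { toFun := fun s => ⟨Fam.res i.unop.le s.1, S.res_mem i.unop.le s.2⟩
      map_zero' := Subtype.ext (funext fun _ => map_zero _)
      map_add' := fun _ _ => Subtype.ext (funext fun _ => map_add _ _ _) }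
  map_id W := by
    refine AddCommGrpCat.hom_ext (AddMonoidHom.ext fun s : S.sec W.unop => ?_)
    apply Subtype.ext
    funext i
    exact oRes_refl (s.1 i)
  map_comp i j := by
    refine AddCommGrpCat.hom_ext (AddMonoidHom.ext fun s : S.sec _ => ?_)
    apply Subtype.ext
    funext l
    exact (oRes_oRes (inf_le_inf_left _ j.unop.le) (inf_le_inf_left _ i.unop.le) (s.1 l)).symm

instance (W : (Opens Y)ᵒᵖ) : Module (Y.ringCatSheaf.obj.obj W) (S.presheaf.obj W) :=
  inferInstanceAs (Module Γ(Y, W.unop) (S.sec W.unop))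

lemma res_smul {W' W : Y.Opens} (h : W' ≤ W) (a : Γ(Y, W)) (s : Y.Fam S.B W) :
    Fam.res h (a • s) = Y.oRes h a • Fam.res h s := by
  funext l
  rw [Fam.res_apply, Fam.smul_apply, Fam.smul_apply, Fam.res_apply, map_mul, oRes_oRes, oRes_oRes]

lemma presheaf_map_smul ⦃W W' : (Opens Y)ᵒᵖ⦄ (i : W ⟶ W') (a : Y.ringCatSheaf.obj.obj W)
    (s : S.presheaf.obj W) :
    S.presheaf.map i (a • s) = Y.ringCatSheaf.obj.map i a • S.presheaf.map i s := by
  exact Subtype.ext (S.res_smul i.unop.le a s.1)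

lemma isSheaf : S.presheaf.IsSheaf := by
  rw [TopCat.Presheaf.isSheaf_iff_isSheafUniqueGluing]
  intro J W sf hsf
  have hcov : ∀ l, S.B l ⊓ iSup W ≤ ⨆ j, (S.B l ⊓ W j) := fun l => (inf_iSup_eq _ _).le
  have hle : ∀ l j, S.B l ⊓ W j ≤ S.B l ⊓ iSup W :=
    fun l j => inf_le_inf_left _ (le_iSup W j)
  have hcomp : ∀ l, TopCat.Presheaf.IsCompatible Y.presheaf (fun j => S.B l ⊓ W j)
      (fun j => (sf j).1 l) := by
    intro l i j
    have h1 := congrFun (congrArg Subtype.val (hsf i j)) l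
    change Y.oRes _ ((sf i).1 l) = Y.oRes _ ((sf j).1 l) at h1
    have h2 : (S.B l ⊓ W i) ⊓ (S.B l ⊓ W j) ≤ S.B l ⊓ (W i ⊓ W j) :=
      le_inf (inf_le_left.trans inf_le_left) (inf_le_inf inf_le_right inf_le_right)
    have h3 := congrArg (Y.oRes h2) h1
    rw [oRes_oRes, oRes_oRes] at h3
    exact h3
  have hgl := fun l => Y.sheaf.existsUnique_gluing' (fun j => S.B l ⊓ W j) (S.B l ⊓ iSup W)
    (fun j => homOfLE (hle l j)) (hcov l) (fun j => (sf j).1 l) (hcomp l)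
  choose g hg hg' using hgl
  have hgr : ∀ j, Fam.res (B := S.B) (le_iSup W j) g = (sf j).1 := fun j => funext fun l => hg l j
  have hmem : (g : Y.Fam S.B (iSup W)) ∈ S.sec (iSup W) := by
    apply S.mem_of_local
    intro x hx
    obtain ⟨j, hj⟩ := Opens.mem_iSup.mp hx
    exact ⟨W j, le_iSup W j, hj, by rw [hgr]; exact (sf j).2⟩
  refine ⟨⟨g, hmem⟩, fun j => Subtype.ext (hgr j), ?_⟩
  intro t ht
  refine Subtype.ext (funext fun l => ?_)
  exact hg' l (t.1 l) fun j => congrFun (congrArg Subtype.val (ht j)) l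

/-- A sheaf of families as a sheaf of `𝒪_Y`-modules. -/
def toModules : Y.Modules where
  val := PresheafOfModules.ofPresheaf S.presheaf S.presheaf_map_smul
  isSheaf := S.isSheaf

end FamSheaf

end Families

end AlgebraicGeometry.Scheme
end

noncomputable section

open CategoryTheory CategoryTheory.Limits AlgebraicGeometry Opposite TopologicalSpace

namespace AlgebraicGeometry.Scheme

section Dual

variable {Y X : Scheme.{u}} (f : Y ⟶ X) (M : X.AffMod)

/-- The dual `(f^* M)^∨ = Hom(f^* M, 𝒪_Y)` of the pullback of a quasi-coherent module `M` under
`f : Y ⟶ X`, as a sheaf of families: a section over `W` consists of `Γ(X, V)`-linear maps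
`M(V) → Γ(Y, f⁻¹(V) ∩ W)` for the affine opens `V`, which commute with restriction. -/
def dualPullbackFam : Y.FamSheaf where
  I := Σ V : X.AffineZariskiSite, M.obj V
  B i := f ⁻¹ᵁ i.1.toOpens
  sec W :=
    { carrier := { s |
        (∀ (V : X.AffineZariskiSite) (m m' : M.obj V), s ⟨V, m + m'⟩ = s ⟨V, m⟩ + s ⟨V, m'⟩) ∧
        (∀ (V : X.AffineZariskiSite) (a : Γ(X, V.toOpens)) (m : M.obj V),
          s ⟨V, a • m⟩ = Y.oRes inf_le_left (f.app V.toOpens a) * s ⟨V, m⟩) ∧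
        (∀ (U V : X.AffineZariskiSite) (h : U ≤ V) (m : M.obj V),
          s ⟨U, M.res h m⟩ = Y.oRes (inf_le_inf_right W
            (f.preimage_mono (AffineZariskiSite.toOpens_mono h))) (s ⟨V, m⟩)) }
      add_mem' := by
        rintro s t ⟨h1, h2, h3⟩ ⟨h1', h2', h3'⟩
        refine ⟨fun V m m' => ?_, fun V a m => ?_, fun U V h m => ?_⟩
        · simp only [Fam.add_apply, h1, h1']
          exact add_add_add_comm _ _ _ _
        · simp only [Fam.add_apply, h2, h2']
          exact (mul_add _ _ _).symm
        · simp only [Fam.add_apply, h3, h3']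
          exact (map_add _ _ _).symm
      zero_mem' := by
        refine ⟨fun V m m' => ?_, fun V a m => ?_, fun U V h m => ?_⟩
        · exact (add_zero _).symm
        · exact (mul_zero _).symm
        · exact (map_zero _).symm
      smul_mem' := by
        rintro c s ⟨h1, h2, h3⟩
        refine ⟨fun V m m' => ?_, fun V a m => ?_, fun U V h m => ?_⟩
        · simp only [Fam.smul_apply, h1]
          exact mul_add _ _ _
        · simp only [Fam.smul_apply, h2]
          exact mul_left_comm _ _ _
        · simp only [Fam.smul_apply, h3]
          rw [map_mul, oRes_oRes] }
  res_mem := by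
    rintro W' W hW s ⟨h1, h2, h3⟩
    refine ⟨fun V m m' => ?_, fun V a m => ?_, fun U V h m => ?_⟩
    · simp only [Fam.res_apply, h1]
      exact map_add _ _ _
    · simp only [Fam.res_apply, h2]
      rw [map_mul, oRes_oRes]
    · simp only [Fam.res_apply, h3]
      rw [oRes_oRes, oRes_oRes]
  mem_of_local := by
    intro W s H
    refine ⟨fun V m m' => ?_, fun V a m => ?_, fun U V h m => ?_⟩
    · refine oRes_ext fun x hx => ?_
      obtain ⟨W', hW, hx', H'⟩ := H x hx.2
      refine ⟨f ⁻¹ᵁ V.toOpens ⊓ W', inf_le_inf_left _ hW, ⟨hx.1, hx'⟩, ?_⟩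
      rw [map_add]
      exact H'.1 V m m'
    · refine oRes_ext fun x hx => ?_
      obtain ⟨W', hW, hx', H'⟩ := H x hx.2
      refine ⟨f ⁻¹ᵁ V.toOpens ⊓ W', inf_le_inf_left _ hW, ⟨hx.1, hx'⟩, ?_⟩
      rw [map_mul, oRes_oRes]
      exact H'.2.1 V a m
    · refine oRes_ext fun x hx => ?_
      obtain ⟨W', hW, hx', H'⟩ := H x hx.2
      refine ⟨f ⁻¹ᵁ U.toOpens ⊓ W', inf_le_inf_left _ hW, ⟨hx.1, hx'⟩, ?_⟩
      have := H'.2.2 U V h m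
      simp only [Fam.res_apply] at this
      rw [oRes_oRes] at this ⊢
      exact this

/-- The dual `(f^* M)^∨ = Hom(f^* M, 𝒪_Y)` of the pullback of `M` under `f : Y ⟶ X`. -/
def dualPullback : Y.Modules := (dualPullbackFam f M).toModules

end Dual

/-- The sheaf of sections of the cone `Spec (Sym M)` over `X`, which is the dual of `M`. -/
def AffMod.sections {X : Scheme.{u}} (M : X.AffMod) : X.Modules := dualPullback (𝟙 X) M

/-- An ideal sheaf as a quasi-coherent module given on affine opens. -/
def IdealSheafData.toAffMod {X : Scheme.{u}} (J : X.IdealSheafData) : X.AffMod where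
  obj U := J.aff U
  res h :=
    { toFun := fun a => ⟨X.ringRes h a.1, J.ringRes_mem h a.2⟩
      map_add' := fun a b => Subtype.ext (map_add _ _ _)
      map_smul' := fun c a => Subtype.ext (map_mul _ _ _) }
  res_refl U a := Subtype.ext (by
    change X.ringRes (le_refl U) a.1 = a.1
    rw [X.ringRes_refl, RingHom.id_apply])
  res_trans h h' a := Subtype.ext (by
    change X.ringRes (h.trans h') a.1 = X.ringRes h (X.ringRes h' a.1)
    rw [X.ringRes_trans, RingHom.comp_apply])
  res_surj V f y := by
    obtain ⟨n, a, ha, h⟩ := J.aff_surj V f y.2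
    exact ⟨n, ⟨a, ha⟩, Subtype.ext h⟩
  res_inj V f a ha := by
    obtain ⟨n, h⟩ := ringRes_inj V f a.1 (congrArg Subtype.val ha)
    exact ⟨n, Subtype.ext h⟩

/-- The normal sheaf `(J/J²)^∨ = Hom(J/J², 𝒪_Y)` of a closed immersion `ι : Y ⟶ P` with ideal sheaf
`J`, where `J/J² = ι^* J`. It is the normal bundle if `ι` is a regular immersion. -/
def normalSheaf {Y P : Scheme.{u}} (ι : Y ⟶ P) : Y.Modules := dualPullback ι ι.ker.toAffMod

section Tensor

variable {Y : Scheme.{u}}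

/-- The tensor product of sheaves of `𝒪_Y`-modules. -/
def Modules.tensor (M N : Y.Modules) : Y.Modules :=
  (PresheafOfModules.sheafification (R := Y.ringCatSheaf) (𝟙 _)).obj
    (PresheafOfModules.Monoidal.tensorObj (R := Y.presheaf) M.val N.val)

end Tensor

namespace AffMod

section Twist

variable {X : Scheme.{u}} (M : X.AffMod)

instance (U : X.AffineZariskiSite) : IsOpenImmersion (M.projChart U) :=
  inferInstanceAs (IsOpenImmersion (colimit.ι M.projGluing.functor U))

/-- The open subset `D_+(m)` of `Proj (Sym M)` for a section `m` over an affine open `U`. -/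
def projBasicOpen (U : X.AffineZariskiSite) (m : M.obj U) : M.proj.Opens :=
  M.projChart U ''ᵁ Proj.basicOpen (M.gr U) (SymmetricAlgebra.ι _ _ m)

lemma projBasicOpen_res {U V : X.AffineZariskiSite} (h : U ≤ V) (m : M.obj V) :
    M.projBasicOpen U (M.res h m) ≤ M.projBasicOpen V m := by
  rintro _ ⟨x, hx, rfl⟩
  refine ⟨M.projRes h x, ?_, ?_⟩
  · change x ∈ M.projRes h ⁻¹ᵁ (Proj.basicOpen (M.gr V) (SymmetricAlgebra.ι _ _ m))
    unfold projRes
    rw [Proj.map_preimage_basicOpen]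
    have : M.grRes h (SymmetricAlgebra.ι _ _ m) = SymmetricAlgebra.ι _ _ (M.res h m) :=
      SymmetricAlgebra.mapₛ_ι _ _ m
    rw [this]
    exact hx
  · have := M.projChart_res h
    rw [← this]
    rfl

lemma ι_mem_gr (U : X.AffineZariskiSite) (m : M.obj U) :
    SymmetricAlgebra.ι _ _ m ∈ M.gr U 1 := by
  change _ ∈ LinearMap.range _ ^ 1
  rw [pow_one]
  exact ⟨m, rfl⟩

/-- The function `m/m'` on `D_+(m')`. -/
def ratio (U : X.AffineZariskiSite) (m m' : M.obj U) : Γ(M.proj, M.projBasicOpen U m') :=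
  ((M.projChart U).appIso (Proj.basicOpen (M.gr U) (SymmetricAlgebra.ι _ _ m'))).inv
    (Proj.awayToSection (M.gr U) (SymmetricAlgebra.ι _ _ m')
      (HomogeneousLocalization.Away.mk (M.gr U) (M.ι_mem_gr U m') 1 (SymmetricAlgebra.ι _ _ m)
        (by simpa using M.ι_mem_gr U m)))

/-- The twisting sheaf `𝒪(1)` on `Proj (Sym M)`, as a sheaf of families: a section `s` over `W` is
given by the functions `s/m` on `D_+(m) ∩ W`, for the sections `m` of `M` over the affine opens `U`,
subject to `s/m' = (m/m') ⋅ (s/m)`, and compatible with restriction from `V` to `U ⊆ V`. -/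
def twistFam : M.proj.FamSheaf where
  I := Σ U : X.AffineZariskiSite, M.obj U
  B i := M.projBasicOpen i.1 i.2
  sec W :=
    { carrier := { s |
        (∀ (U : X.AffineZariskiSite) (m m' : M.obj U),
          M.proj.oRes (inf_le_inf_right W (inf_le_right : M.projBasicOpen U m ⊓
            M.projBasicOpen U m' ≤ _)) (s ⟨U, m'⟩) =
          M.proj.oRes (inf_le_left.trans inf_le_right) (M.ratio U m m') *
            M.proj.oRes (inf_le_inf_right W (inf_le_left : M.projBasicOpen U m ⊓
            M.projBasicOpen U m' ≤ _)) (s ⟨U, m⟩)) ∧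
        (∀ (U V : X.AffineZariskiSite) (h : U ≤ V) (m : M.obj V),
          s ⟨U, M.res h m⟩ =
            M.proj.oRes (inf_le_inf_right W (M.projBasicOpen_res h m)) (s ⟨V, m⟩)) }
      add_mem' := by
        rintro s t ⟨h1, h2⟩ ⟨h1', h2'⟩
        refine ⟨fun U m m' => ?_, fun U V h m => ?_⟩
        · simp only [Fam.add_apply, map_add, h1 U m m', h1' U m m']
          exact (mul_add _ _ _).symm
        · simp only [Fam.add_apply, h2, h2']
          exact (map_add _ _ _).symm
      zero_mem' := by
        refine ⟨fun U m m' => ?_, fun U V h m => ?_⟩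
        · simp only [Fam.zero_apply, map_zero, mul_zero]
        · exact (map_zero _).symm
      smul_mem' := by
        rintro c s ⟨h1, h2⟩
        refine ⟨fun U m m' => ?_, fun U V h m => ?_⟩
        · simp only [Fam.smul_apply, map_mul, h1 U m m']
          rw [oRes_oRes, oRes_oRes]
          exact mul_left_comm _ _ _
        · simp only [Fam.smul_apply, h2]
          rw [map_mul, oRes_oRes] }
  res_mem := by
    rintro W' W hW s ⟨h1, h2⟩
    refine ⟨fun U m m' => ?_, fun U V h m => ?_⟩
    · simp only [Fam.res_apply]
      have := congrArg (M.proj.oRes (inf_le_inf_left (M.projBasicOpen U m ⊓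
            M.projBasicOpen U m') hW)) (h1 U m m')
      rw [map_mul, oRes_oRes, oRes_oRes, oRes_oRes] at this
      rw [oRes_oRes, oRes_oRes]
      exact this
    · simp only [Fam.res_apply, h2]
      rw [oRes_oRes, oRes_oRes]
  mem_of_local := by
    intro W s H
    refine ⟨fun U m m' => ?_, fun U V h m => ?_⟩
    · refine oRes_ext fun x hx => ?_
      obtain ⟨W', hW, hx', H'⟩ := H x hx.2
      refine ⟨(M.projBasicOpen U m ⊓ M.projBasicOpen U m') ⊓ W', inf_le_inf_left _ hW,
        ⟨hx.1, hx'⟩, ?_⟩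
      have := H'.1 U m m'
      simp only [Fam.res_apply] at this
      rw [oRes_oRes, oRes_oRes] at this
      rw [map_mul, oRes_oRes, oRes_oRes, oRes_oRes]
      exact this
    · refine oRes_ext fun x hx => ?_
      obtain ⟨W', hW, hx', H'⟩ := H x hx.2
      refine ⟨M.projBasicOpen U (M.res h m) ⊓ W', inf_le_inf_left _ hW, ⟨hx.1, hx'⟩, ?_⟩
      have := H'.2 U V h m
      simp only [Fam.res_apply] at this
      rw [oRes_oRes] at this ⊢
      exact this

/-- The twisting sheaf `𝒪(1)` on `Proj (Sym M)`. -/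
def twist : M.proj.Modules := M.twistFam.toModules

end Twist

end AffMod

end AlgebraicGeometry.Scheme
end

noncomputable section

open CategoryTheory CategoryTheory.Limits AlgebraicGeometry Opposite TopologicalSpace

/-- The canonical map `Sym(J) → Rees(J)` from the symmetric algebra of an ideal to its Rees algebra
`⨁ Jⁱ Tⁱ`, given by `a ↦ a T` for `a ∈ J`. -/
def Ideal.symToRees {A : Type*} [CommRing A] (J : Ideal A) :
    SymmetricAlgebra A J →ₐ[A] reesAlgebra J :=
  SymmetricAlgebra.lift
    (((Polynomial.monomial 1 : A →ₗ[A] Polynomial A) ∘ₗ J.subtype).codRestrict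
      (Subalgebra.toSubmodule (reesAlgebra J))
      fun a => reesAlgebra.monomial_mem.mpr (by rw [pow_one]; exact a.2))

namespace AlgebraicGeometry.Scheme

/-- A closed immersion `ι : Y ⟶ P` is regular of codimension `n` if the ideal of `Y` is locally
generated by a regular sequence of length `n`; in other words `Y` is a local complete intersection
in `P` of codimension `n`. -/
structure IsRegularClosedImmersion (n : ℕ) {Y P : Scheme.{u}} (ι : Y ⟶ P) : Prop where
  isClosedImmersion : IsClosedImmersion ι
  exists_regular : ∀ y : Y, ∃ V : P.affineOpens, ι y ∈ V.1 ∧ ∃ rs : List Γ(P, V.1),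
    rs.length = n ∧ RingTheory.Sequence.IsRegular Γ(P, V.1) rs ∧ Ideal.ofList rs = ι.ker.ideal V

/-- `D` is (the ideal sheaf of) a reduced effective Cartier divisor. -/
structure IsReducedDivisor {X : Scheme.{u}} (D : X.IdealSheafData) : Prop where
  isReduced : IsReduced D.subscheme
  locally_principal : ∀ x : X, ∃ U : X.AffineZariskiSite, x ∈ U.toOpens ∧
    ∃ h ∈ nonZeroDivisors Γ(X, U.toOpens), D.aff U = Ideal.span {h}

section

variable (k : Type u) [Field k] {X : Scheme.{u}} [X.Over (Spec (.of k))]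
  (D : X.IdealSheafData)

/-- The Jacobian ideal of `D` is of linear type: the canonical map from its symmetric algebra to its
Rees algebra is an isomorphism. -/
def IsJacobianLinearType : Prop :=
  ∀ U : X.AffineZariskiSite, Function.Bijective (jacobianIdeal k D U).symToRees

variable [LocallyOfFiniteType (X ↘ Spec (.of k))]

/-- The divisor `D` is free: `Der_X(-log D)` is locally free of rank `n`, where `n` is the dimension
of `X`. -/
def IsFreeDivisor (n : ℕ) : Prop :=
  ∀ x : X, ∃ U : X.AffineZariskiSite, x ∈ U.toOpens ∧
    Nonempty (Module.Basis (Fin n) Γ(X, U.toOpens) ((derLog k D).obj U))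

/-- The morphism `σ : E ⟶ F`, where `E = Spec (Sym Der_X)` and `F = Spec (Sym Der_X(-log D))`. -/
def logSigma : (X.der k).cone ⟶ (derLog k D).cone := (derLogIncl k D).coneMap

/-- The inclusion of the cone `C = Spec (Sym i_*𝓘(D))` in `E = Spec (Sym Der_X)`. -/
def logConeIncl : (logQuot k D).cone ⟶ (X.der k).cone := (derToLogQuot k D).coneMap

/-- The inclusion of `P(C) = Proj (Sym i_*𝓘(D))` in `P(E) = Proj (Sym Der_X)`. -/
def logProjIncl : (logQuot k D).proj ⟶ (X.der k).proj :=
  (derToLogQuot k D).projMap (derToLogQuot_surjective k D)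

end

end AlgebraicGeometry.Scheme
end

open CategoryTheory AlgebraicGeometry

/-! Write `K = Der_X(-log D)`, `M = Der_X` and `N = i_*𝓘(D)`, so that `0 → K → M → N → 0` is exact.
Symmetric algebras are right exact: the kernel of `Sym M → Sym N` is generated by `K`
(`SymmetricAlgebra.ker_mapₛ_le`). This alone gives the Cartesian square. A morphism to `E` whose
composite with `σ` factors through the zero section is one on which the linear functions `κ ∈ K`
vanish, and such a morphism lifts uniquely to `C` (`isPullback_coneMap`).

The other claims rest on one algebraic fact: locally, a basis `δ₀, …, δₙ₋₁` of `K` is a regular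
sequence in `Sym M` (`Derivation.isRegularFamily_ι_of_symToRees_injective`). Let `A` be the
coordinate ring of a small affine open, `h` an equation of `D`, and `δⱼ h = cⱼ h`. The Jacobian
ideal is the image of `A ⊕ Der` under `(a, θ) ↦ a h + θ h`, and the kernel of this map is generated
by `fⱼ = (-cⱼ, δⱼ)`. By linear type, the ideal `(f₀, …, fₙ₋₁)` is the kernel of a homomorphism from
`R = Sym (A ⊕ Der)` to a polynomial ring in one variable over the fraction field, so it is prime.

It is the top of a chain of homogeneous primes `Qᵢ` of `R`: embed `A ⊕ Der` in a vector space over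
the fraction field, divide by the span of the first `i` of the `fⱼ`, and take the kernel of the map
from `R` to the symmetric algebra of the quotient. Then `fᵢ` lies in `Qᵢ₊₁` but not in `Qᵢ`. If
`Qᵢ₊₁ = (f₀, …, fᵢ)`, primality gives `Qᵢ = (f₀, …, fᵢ₋₁) + fᵢ Qᵢ`, and graded Nakayama gives `Qᵢ =
(f₀, …, fᵢ₋₁)` (`Ideal.eq_span_image_of_chain`). So the `fⱼ` form a regular sequence. The element `ξ
= (1, 0)` is sent to `h ≠ 0`, hence is not in `Qₙ`, and the sequence stays regular modulo `ξ`
(`isRegularFamily_comp_of_chain`). But `R/ξ = Sym Der`, and `fⱼ` becomes `δⱼ`. No dimension count is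
needed.

On `D_+(m) ⊆ P(E)` the ideal of `P(C)` is generated by the functions `δⱼ/m`. Clearing denominators
carries the regularity over to them (`isRegularFamily_ratio`), which gives the local complete
intersection. The coefficients of a relation between the members of a regular sequence lie in the
ideal it generates (`IsRegularFamily.syzygy`), so the conormal sheaf is free on the classes of
`δⱼ/m`. Since `κ/m' = (m/m') (κ/m)`, the assignment `ν ↦ (κ ↦ m ν(κ/m))` is a well defined
isomorphism from the normal sheaf to `Hom(p^* K, 𝒪(1))` (`isIso_normalToHom`). Finally `p^* K^∨ ⊗
𝒪(1) ≅ Hom(p^* K, 𝒪(1))`, because `K` is locally free (`isIso_tensorToHom`). -/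

noncomputable section

open CategoryTheory CategoryTheory.Limits AlgebraicGeometry Opposite TopologicalSpace

/-! ### Sheaves of modules: sections, gluing, subsheaves. -/

namespace AlgebraicGeometry.Scheme.Modules

variable {Y : Scheme.{u}}

/-- The restriction of a section of a sheaf of modules. -/
abbrev sRes (A : Y.Modules) {W' W : Y.Opens} (h : W' ≤ W) (a : Γ(A, W)) : Γ(A, W') :=
  A.presheaf.map (homOfLE h).op a

lemma sRes_sRes (A : Y.Modules) {W W' W'' : Y.Opens} (h : W ≤ W') (h' : W' ≤ W'')
    (a : Γ(A, W'')) : A.sRes h (A.sRes h' a) = A.sRes (h.trans h') a := by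
  change A.presheaf.map _ (A.presheaf.map _ a) = A.presheaf.map _ a
  rw [← ConcreteCategory.comp_apply, ← A.presheaf.map_comp]
  rfl

lemma sRes_zero (A : Y.Modules) {W W' : Y.Opens} (h : W ≤ W') :
    A.sRes h (0 : Γ(A, W')) = 0 := map_zero _

lemma sRes_add (A : Y.Modules) {W W' : Y.Opens} (h : W ≤ W') (a b : Γ(A, W')) :
    A.sRes h (a + b) = A.sRes h a + A.sRes h b := map_add _ _ _

lemma sRes_smul (A : Y.Modules) {W W' : Y.Opens} (h : W ≤ W') (r : Γ(Y, W')) (a : Γ(A, W')) :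
    A.sRes h (r • a) = Y.oRes h r • A.sRes h a :=
  Modules.map_smul A (homOfLE h) r a

lemma app_sRes {A B : Y.Modules} (φ : A ⟶ B) {W' W : Y.Opens} (h : W' ≤ W) (a : Γ(A, W)) :
    φ.app W' (A.sRes h a) = B.sRes h (φ.app W a) :=
  congr($(φ.mapPresheaf.naturality (homOfLE h).op) a)

/-- Two sections of a sheaf of modules which agree locally are equal. -/
lemma section_ext (A : Y.Modules) {W : Y.Opens} {a b : Γ(A, W)}
    (h : ∀ x ∈ W, ∃ (W' : Y.Opens) (hW : W' ≤ W), x ∈ W' ∧ A.sRes hW a = A.sRes hW b) :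
    a = b := by
  refine TopCat.Presheaf.IsSheaf.section_ext A.isSheaf fun x hx => ?_
  obtain ⟨W', hW, hx', H⟩ := h x hx
  exact ⟨W', hW, hx', H⟩

/-- A morphism of sheaves of modules from compatible linear maps on sections. -/
def homOfSections {A B : Y.Modules} (f : ∀ W : Y.Opens, Γ(A, W) →ₗ[Γ(Y, W)] Γ(B, W))
    (hf : ∀ {W' W : Y.Opens} (h : W' ≤ W) (a : Γ(A, W)), f W' (A.sRes h a) = B.sRes h (f W a)) :
    A ⟶ B :=
  ⟨PresheafOfModules.homMk
    { app := fun W => AddCommGrpCat.ofHom (f W.unop).toAddMonoidHom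
      naturality := fun W W' i => by
        ext a
        exact hf i.unop.le a }
    fun W r a => (f W.unop).map_smul r a⟩

/-- A morphism of sheaves of modules is an isomorphism if it is injective and locally
surjective. -/
lemma isIso_of_locally {A B : Y.Modules} (φ : A ⟶ B)
    (inj : ∀ (W : Y.Opens) (a : Γ(A, W)), φ.app W a = 0 → a = 0)
    (surj : ∀ (W : Y.Opens) (b : Γ(B, W)), ∀ x ∈ W, ∃ (W' : Y.Opens) (h : W' ≤ W), x ∈ W' ∧
      ∃ a : Γ(A, W'), φ.app W' a = B.sRes h b) : IsIso φ := by
  have inj' : ∀ (W : Y.Opens) (a b : Γ(A, W)), φ.app W a = φ.app W b → a = b := by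
    intro W a b h
    rw [← sub_eq_zero]
    apply inj
    rw [map_sub, h, sub_self]
  rw [Modules.Hom.isIso_iff_isIso_app]
  intro W
  rw [ConcreteCategory.isIso_iff_bijective]
  refine ⟨fun a b h => inj' W a b h, fun b => ?_⟩
  choose W' hW hx a ha using surj W b
  have hcov : W ≤ ⨆ x : W, W' x.1 x.2 := fun x hx' => Opens.mem_iSup.mpr ⟨⟨x, hx'⟩, hx x hx'⟩
  -- Local preimages of `b` are unique by injectivity, so they agree on overlaps and glue.
  obtain ⟨s, hs, -⟩ := TopCat.Sheaf.existsUnique_gluing' ⟨A.presheaf, A.isSheaf⟩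
    (fun x : W => W' x.1 x.2) W (fun x => homOfLE (hW x.1 x.2)) hcov (fun x => a x.1 x.2) (by
      intro x y
      apply inj'
      refine (app_sRes φ inf_le_left _).trans ?_
      refine Eq.trans ?_ (app_sRes φ inf_le_right _).symm
      rw [ha, ha, sRes_sRes, sRes_sRes])
  refine ⟨s, B.section_ext fun x hx' => ⟨W' x hx', hW x hx', hx x hx', ?_⟩⟩
  rw [← app_sRes, ← ha]
  exact congrArg _ (hs ⟨x, hx'⟩)

section Submodule

variable (A : Y.Modules) (S : ∀ W : Y.Opens, Submodule Γ(Y, W) Γ(A, W))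
  (hres : ∀ {W' W : Y.Opens} (h : W' ≤ W) {a : Γ(A, W)}, a ∈ S W → A.sRes h a ∈ S W')
  (hloc : ∀ {W : Y.Opens} {a : Γ(A, W)},
    (∀ x ∈ W, ∃ (W' : Y.Opens) (h : W' ≤ W), x ∈ W' ∧ A.sRes h a ∈ S W') → a ∈ S W)

/-- The subsheaf of modules given by submodules of the sections subject to a local condition. -/
def subsheaf : Y.Modules where
  val := PresheafOfModules.Submodule.toPresheafOfModules (M := A.val)
    { obj := fun W => S W.unop
      map := fun f _ ha => hres f.unop.le ha }
  isSheaf := by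
    change TopCat.Presheaf.IsSheaf _
    rw [TopCat.Presheaf.isSheaf_iff_isSheafUniqueGluing]
    intro J W sf hsf
    obtain ⟨s, hs, hs'⟩ := TopCat.Sheaf.existsUnique_gluing ⟨A.presheaf, A.isSheaf⟩ W
      (fun j => (sf j).1) (fun i j => congrArg Subtype.val (hsf i j))
    refine ⟨⟨s, ?_⟩, fun j => Subtype.ext (hs j), fun t ht => Subtype.ext
      (hs' t.1 fun j => congrArg Subtype.val (ht j))⟩
    apply hloc
    intro x hx
    obtain ⟨j, hj⟩ := Opens.mem_iSup.mp hx
    refine ⟨W j, le_iSup W j, hj, ?_⟩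
    have : A.sRes (le_iSup W j) s = (sf j).1 := hs j
    rw [this]
    exact (sf j).2

/-- The inclusion of a subsheaf. -/
def subsheafIncl : A.subsheaf S hres hloc ⟶ A :=
  homOfSections (A := A.subsheaf S hres hloc) (fun W => (S W).subtype) fun _ _ => rfl

end Submodule

end AlgebraicGeometry.Scheme.Modules
end

/-! ### Local generators of pullbacks and tensor products of sheaves of modules. -/

noncomputable section

open CategoryTheory CategoryTheory.Limits AlgebraicGeometry Opposite TopologicalSpace

namespace AlgebraicGeometry.Scheme.Modules

section Span

variable {Y : Scheme.{u}} (A : Y.Modules) (G : ∀ W : Y.Opens, Set Γ(A, W))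

lemma span_sRes
    (hG : ∀ {W' W : Y.Opens} (h : W' ≤ W) {a : Γ(A, W)}, a ∈ G W → A.sRes h a ∈ G W')
    {W' W'' : Y.Opens} (h : W'' ≤ W') {c : Γ(A, W')}
    (hc : c ∈ Submodule.span Γ(Y, W') (G W')) :
    A.sRes h c ∈ Submodule.span Γ(Y, W'') (G W'') := by
  induction hc using Submodule.span_induction with
  | mem x hx => exact Submodule.subset_span (hG h hx)
  | zero => rw [sRes_zero]; exact Submodule.zero_mem _
  | add x y _ _ hx hy => rw [sRes_add]; exact Submodule.add_mem _ hx hy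
  | smul r x _ hx => rw [sRes_smul]; exact Submodule.smul_mem _ _ hx

variable (hG : ∀ {W' W : Y.Opens} (h : W' ≤ W) {a : Γ(A, W)}, a ∈ G W → A.sRes h a ∈ G W')

/-- The sections which are locally linear combinations of sections in `G`. -/
def locallySpan (W : Y.Opens) : Submodule Γ(Y, W) Γ(A, W) where
  carrier := { a | ∀ x ∈ W, ∃ (W' : Y.Opens) (h : W' ≤ W), x ∈ W' ∧
    A.sRes h a ∈ Submodule.span Γ(Y, W') (G W') }
  add_mem' := by
    intro a b ha hb x hx
    obtain ⟨W₁, h₁, hx₁, H₁⟩ := ha x hx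
    obtain ⟨W₂, h₂, hx₂, H₂⟩ := hb x hx
    refine ⟨W₁ ⊓ W₂, inf_le_left.trans h₁, ⟨hx₁, hx₂⟩, ?_⟩
    have e1 := A.span_sRes G hG (inf_le_left : W₁ ⊓ W₂ ≤ _) H₁
    have e2 := A.span_sRes G hG (inf_le_right : W₁ ⊓ W₂ ≤ _) H₂
    rw [sRes_sRes] at e1 e2
    rw [sRes_add]
    exact Submodule.add_mem _ e1 e2
  zero_mem' := fun x hx => ⟨W, le_rfl, hx, by rw [sRes_zero]; exact Submodule.zero_mem _⟩
  smul_mem' := by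
    intro r a ha x hx
    obtain ⟨W₁, h₁, hx₁, H₁⟩ := ha x hx
    exact ⟨W₁, h₁, hx₁, by rw [sRes_smul]; exact Submodule.smul_mem _ _ H₁⟩

lemma locallySpan_sRes {W' W : Y.Opens} (h : W' ≤ W) {a : Γ(A, W)}
    (ha : a ∈ A.locallySpan G hG W) : A.sRes h a ∈ A.locallySpan G hG W' := by
  intro x hx
  obtain ⟨W₁, h₁, hx₁, H₁⟩ := ha x (h hx)
  refine ⟨W₁ ⊓ W', inf_le_right, ⟨hx₁, hx⟩, ?_⟩
  have := A.span_sRes G hG (inf_le_left : W₁ ⊓ W' ≤ _) H₁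
  rw [sRes_sRes] at this ⊢
  exact this

lemma locallySpan_of_locally {W : Y.Opens} {a : Γ(A, W)}
    (H : ∀ x ∈ W, ∃ (W' : Y.Opens) (h : W' ≤ W), x ∈ W' ∧
      A.sRes h a ∈ A.locallySpan G hG W') : a ∈ A.locallySpan G hG W := by
  intro x hx
  obtain ⟨W₁, h₁, hx₁, H₁⟩ := H x hx
  obtain ⟨W₂, h₂, hx₂, H₂⟩ := H₁ x hx₁
  rw [sRes_sRes] at H₂
  exact ⟨W₂, h₂.trans h₁, hx₂, H₂⟩

/-- The subsheaf of modules generated by sections in `G`. -/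
def spanSubsheaf : Y.Modules :=
  A.subsheaf (A.locallySpan G hG) (A.locallySpan_sRes G hG) (A.locallySpan_of_locally G hG)

/-- The inclusion of the subsheaf generated by sections in `G`. -/
def spanSubsheafIncl : A.spanSubsheaf G hG ⟶ A :=
  A.subsheafIncl _ (A.locallySpan_sRes G hG) (A.locallySpan_of_locally G hG)

end Span

section Pullback

variable {Y X : Scheme.{u}} (p : Y ⟶ X) (A : X.Modules)

/-- The pullback of a section. -/
def pullbackSection (V : X.Opens) (a : Γ(A, V)) : Γ((pullback p).obj A, p ⁻¹ᵁ V) :=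
  ((pullbackPushforwardAdjunction p).unit.app A).app V a

lemma pullbackSection_sRes {V V' : X.Opens} (h : V' ≤ V) (a : Γ(A, V)) :
    pullbackSection p A V' (A.sRes h a) =
      ((pullback p).obj A).sRes (p.preimage_mono h) (pullbackSection p A V a) :=
  app_sRes ((pullbackPushforwardAdjunction p).unit.app A) h a

lemma pullbackSection_add {V : X.Opens} (a b : Γ(A, V)) :
    pullbackSection p A V (a + b) = pullbackSection p A V a + pullbackSection p A V b :=
  map_add _ _ _

lemma pullbackSection_smul {V : X.Opens} (r : Γ(X, V)) (a : Γ(A, V)) :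
    pullbackSection p A V (r • a) = p.app V r • pullbackSection p A V a :=
  Modules.Hom.app_smul ((pullbackPushforwardAdjunction p).unit.app A) r a

/-- Restrictions of pullbacks of sections. -/
def pullbackGenerators (W : Y.Opens) : Set Γ((pullback p).obj A, W) :=
  { t | ∃ (V : X.Opens) (h : W ≤ p ⁻¹ᵁ V) (a : Γ(A, V)),
    t = ((pullback p).obj A).sRes h (pullbackSection p A V a) }

lemma pullbackGenerators_sRes {W' W : Y.Opens} (h : W' ≤ W) {t : Γ((pullback p).obj A, W)}
    (ht : t ∈ pullbackGenerators p A W) :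
    ((pullback p).obj A).sRes h t ∈ pullbackGenerators p A W' := by
  obtain ⟨V, hV, a, rfl⟩ := ht
  exact ⟨V, h.trans hV, a, sRes_sRes _ _ _ _⟩

/-- The sections of the pullback are locally linear combinations of pullbacks of sections. -/
lemma pullback_locally_span (W : Y.Opens) (t : Γ((pullback p).obj A, W)) (x : Y) (hx : x ∈ W) :
    ∃ (W' : Y.Opens) (h : W' ≤ W), x ∈ W' ∧ ((pullback p).obj A).sRes h t ∈
      Submodule.span Γ(Y, W') (pullbackGenerators p A W') := by
  let T := (pullback p).obj A
  let T' := T.spanSubsheaf (pullbackGenerators p A) (pullbackGenerators_sRes p A)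
  let incl : T' ⟶ T := T.spanSubsheafIncl _ _
  have hmem : ∀ (V : X.Opens) (a : Γ(A, V)), pullbackSection p A V a ∈
      T.locallySpan (pullbackGenerators p A) (pullbackGenerators_sRes p A) (p ⁻¹ᵁ V) :=
    fun V a y hy => ⟨p ⁻¹ᵁ V, le_rfl, hy, Submodule.subset_span ⟨V, le_rfl, a, rfl⟩⟩
  -- The sections of `p^* A` are not explicit, so the universal property is used: the unit `A → p_*
  -- p^* A` takes values in the subsheaf `T'` generated by pulled back sections.
  let g : A ⟶ (pushforward p).obj T' :=
    homOfSections (A := A) (B := (pushforward p).obj T')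
      (fun V =>
        { toFun := fun a => (⟨pullbackSection p A V a, hmem V a⟩ :
            T.locallySpan (pullbackGenerators p A) (pullbackGenerators_sRes p A) (p ⁻¹ᵁ V))
          map_add' := fun a b => Subtype.ext (pullbackSection_add p A a b)
          map_smul' := fun r a => Subtype.ext (pullbackSection_smul p A r a) })
      (fun h a => Subtype.ext (pullbackSection_sRes p A h a))
  let r : T ⟶ T' := ((pullbackPushforwardAdjunction p).homEquiv _ _).symm g
  -- Both sides are adjoint to the unit. Hence the inclusion of `T'` is split surjective, and `T'`
  -- is everything.
  have hr : r ≫ incl = 𝟙 T := by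
    apply ((pullbackPushforwardAdjunction p).homEquiv _ _).injective
    rw [Adjunction.homEquiv_naturality_right, Equiv.apply_symm_apply, Adjunction.homEquiv_id]
    ext V a
    rfl
  have h1 : incl.app W (r.app W t) = t := by
    have := congr(Modules.Hom.app $hr W t)
    exact this
  rw [← h1]
  have h2 : incl.app W (r.app W t) ∈
    T.locallySpan (pullbackGenerators p A) (pullbackGenerators_sRes p A) W := (r.app W t).2
  exact h2 x hx

end Pullback

section Tensor

variable {Y : Scheme.{u}} (A B : Y.Modules)

/-- The presheaf tensor product. -/
abbrev preTensor : _root_.PresheafOfModules Y.ringCatSheaf.obj :=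
  PresheafOfModules.Monoidal.tensorObj (R := Y.presheaf) A.val B.val

/-- The canonical map from the presheaf tensor product to the sheaf tensor product. -/
def tensorUnit : preTensor A B ⟶ (A.tensor B).val :=
  (PresheafOfModules.sheafificationAdjunction (𝟙 Y.ringCatSheaf.obj)).unit.app (preTensor A B)

open TensorProduct in
/-- The map from the tensor product of the sections to the sections of the tensor product. -/
def tensorSec (W : Y.Opens) : Γ(A, W) ⊗[Γ(Y, W)] Γ(B, W) →ₗ[Γ(Y, W)] Γ(A.tensor B, W) where
  toFun t := (tensorUnit A B).app (op W) t
  map_add' t t' := map_add ((tensorUnit A B).app (op W)).hom t t'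
  map_smul' r t := ((tensorUnit A B).app (op W)).hom.map_smul r t

/-- The section `a ⊗ b` of the tensor product. -/
def tmul {W : Y.Opens} (a : Γ(A, W)) (b : Γ(B, W)) : Γ(A.tensor B, W) :=
  tensorSec A B W (TensorProduct.tmul Γ(Y, W) a b)

variable {A B}

lemma tmul_sRes {W' W : Y.Opens} (h : W' ≤ W) (a : Γ(A, W)) (b : Γ(B, W)) :
    (A.tensor B).sRes h (tmul A B a b) = tmul A B (A.sRes h a) (B.sRes h b) :=
  (PresheafOfModules.naturality_apply (tensorUnit A B) (homOfLE h).op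
    (TensorProduct.tmul Γ(Y, W) a b)).symm

lemma add_tmul {W : Y.Opens} (a a' : Γ(A, W)) (b : Γ(B, W)) :
    tmul A B (a + a') b = tmul A B a b + tmul A B a' b :=
  (congrArg (tensorSec A B W) (TensorProduct.add_tmul a a' b)).trans (map_add _ _ _)

lemma smul_tmul {W : Y.Opens} (r : Γ(Y, W)) (a : Γ(A, W)) (b : Γ(B, W)) :
    tmul A B (r • a) b = r • tmul A B a b :=
  (congrArg (tensorSec A B W) (TensorProduct.smul_tmul' r a b).symm).trans
    ((tensorSec A B W).map_smul r _)

lemma tmul_smul {W : Y.Opens} (r : Γ(Y, W)) (a : Γ(A, W)) (b : Γ(B, W)) :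
    tmul A B a (r • b) = r • tmul A B a b :=
  (congrArg (tensorSec A B W) (TensorProduct.tmul_smul r a b)).trans
    ((tensorSec A B W).map_smul r _)

lemma tensorSec_mem_span {W : Y.Opens} (s : TensorProduct Γ(Y, W) Γ(A, W) Γ(B, W)) :
    tensorSec A B W s ∈ Submodule.span Γ(Y, W) { s | ∃ a b, tmul A B (W := W) a b = s } := by
  induction s using TensorProduct.induction_on with
  | zero => rw [map_zero]; exact Submodule.zero_mem _
  | tmul a b => exact Submodule.subset_span ⟨a, b, rfl⟩
  | add a b ha hb => rw [map_add]; exact Submodule.add_mem _ ha hb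

/-- The sections of the tensor product are locally sums of pure tensors. -/
lemma tensor_locally_span {W : Y.Opens} (t : Γ(A.tensor B, W)) (x : Y) (hx : x ∈ W) :
    ∃ (W' : Y.Opens) (h : W' ≤ W), x ∈ W' ∧ (A.tensor B).sRes h t ∈
      Submodule.span Γ(Y, W') { s | ∃ a b, tmul A B (W := W') a b = s } := by
  -- The map from a presheaf to its sheafification is locally surjective, so `t` comes locally from
  -- an honest tensor.
  have h1 : Presheaf.IsLocallySurjective (Opens.grothendieckTopology Y)
    (CategoryTheory.toSheafify (Opens.grothendieckTopology Y) (preTensor A B).presheaf) :=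
      inferInstance
  have h2 := h1.imageSieve_mem (U := W) t
  obtain ⟨W', f, ⟨s, hs⟩, hx'⟩ := h2 x hx
  refine ⟨W', f.le, hx', ?_⟩
  have h3 : tensorSec A B W' s = (A.tensor B).sRes f.le t := hs
  rw [← h3]
  exact tensorSec_mem_span s

variable {C : Y.Modules}

/-- The morphism from the presheaf tensor product given by compatible bilinear maps on sections. -/
def preTensorLift (β : ∀ W : Y.Opens, Γ(A, W) →ₗ[Γ(Y, W)] Γ(B, W) →ₗ[Γ(Y, W)] Γ(C, W))
    (hβ : ∀ {W' W : Y.Opens} (h : W' ≤ W) (a : Γ(A, W)) (b : Γ(B, W)),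
      β W' (A.sRes h a) (B.sRes h b) = C.sRes h (β W a b)) : preTensor A B ⟶ C.val :=
  PresheafOfModules.homMk (M₁ := preTensor A B) (M₂ := C.val)
    { app := fun W => AddCommGrpCat.ofHom (TensorProduct.lift (β W.unop)).toAddMonoidHom
      naturality := fun W W' i => by
        have key : ∀ s : TensorProduct Γ(Y, W.unop) Γ(A, W.unop) Γ(B, W.unop),
            TensorProduct.lift (β W'.unop) ((preTensor A B).map i s) =
              C.sRes i.unop.le (TensorProduct.lift (β W.unop) s) := by
          intro s
          induction s using TensorProduct.induction_on with
          | zero =>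
            rw [map_zero, sRes_zero]
            exact (congrArg _ (map_zero ((preTensor A B).map i).hom)).trans (map_zero _)
          | tmul a b => exact hβ i.unop.le a b
          | add a b ha hb =>
            rw [map_add, sRes_add, ← ha, ← hb]
            exact (congrArg _ (map_add ((preTensor A B).map i).hom a b)).trans (map_add _ _ _)
        ext s
        exact key s }
    (fun W r a => (TensorProduct.lift (β W.unop)).map_smul r a)

/-- The morphism from the tensor product given by compatible bilinear maps on sections. -/
def tensorLift (β : ∀ W : Y.Opens, Γ(A, W) →ₗ[Γ(Y, W)] Γ(B, W) →ₗ[Γ(Y, W)] Γ(C, W))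
    (hβ : ∀ {W' W : Y.Opens} (h : W' ≤ W) (a : Γ(A, W)) (b : Γ(B, W)),
      β W' (A.sRes h a) (B.sRes h b) = C.sRes h (β W a b)) : A.tensor B ⟶ C :=
  ((PresheafOfModules.sheafificationAdjunction (𝟙 Y.ringCatSheaf.obj)).homEquiv
    (preTensor A B) C).symm (preTensorLift β hβ)

lemma tensorLift_tmul (β : ∀ W : Y.Opens, Γ(A, W) →ₗ[Γ(Y, W)] Γ(B, W) →ₗ[Γ(Y, W)] Γ(C, W))
    (hβ : ∀ {W' W : Y.Opens} (h : W' ≤ W) (a : Γ(A, W)) (b : Γ(B, W)),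
      β W' (A.sRes h a) (B.sRes h b) = C.sRes h (β W a b)) {W : Y.Opens} (a : Γ(A, W))
    (b : Γ(B, W)) : (tensorLift β hβ).app W (tmul A B a b) = β W a b := by
  have h1 := ((PresheafOfModules.sheafificationAdjunction (𝟙 Y.ringCatSheaf.obj)).homEquiv
    (preTensor A B) C).apply_symm_apply (preTensorLift β hβ)
  have h2 := congr($(congr(PresheafOfModules.Hom.app $h1 (op W)))
    (TensorProduct.tmul Γ(Y, W) a b))
  exact h2.trans (TensorProduct.lift.tmul (f' := β W) a b)

end Tensor

end AlgebraicGeometry.Scheme.Modules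
end

/-! ### Fractions on the open sets `D_+(m)` of a projectivized cone. -/

noncomputable section

open CategoryTheory CategoryTheory.Limits AlgebraicGeometry Opposite TopologicalSpace

namespace AlgebraicGeometry.Proj

open HomogeneousLocalization

variable {A B : Type u} [CommRing A] [CommRing B] {σ τ : Type u} [SetLike σ A]
  [AddSubgroupClass σ A] [SetLike τ B] [AddSubgroupClass τ B]
  {𝒜 : ℕ → σ} {ℬ : ℕ → τ} [GradedRing 𝒜] [GradedRing ℬ]

/-- The section `a / sⁿ` on the image of `D₊(s)` under an open immersion `Proj 𝒜 ⟶ P`. -/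
def chartFrac {P : Scheme.{u}} (c : Proj 𝒜 ⟶ P) [IsOpenImmersion c] {s : A} {d : ℕ} (hs : s ∈ 𝒜 d)
    (n : ℕ) (a : A) (ha : a ∈ 𝒜 (n • d)) : Γ(P, c ''ᵁ basicOpen 𝒜 s) :=
  (c.appIso (basicOpen 𝒜 s)).inv (awayToSection 𝒜 s (Away.mk 𝒜 hs n a ha))

/-- Serves two purposes: with `g` the identity it describes the restriction of fractions to a
smaller affine base, and with `g` a morphism between projectivized cones it describes their
pullback. In either case it comes down to the compatibility of `awayToSection` with `Proj.map`. -/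
lemma chartFrac_map {P Q : Scheme.{u}} (c : Proj 𝒜 ⟶ P) [IsOpenImmersion c] (c' : Proj ℬ ⟶ Q)
    [IsOpenImmersion c'] (g : Q ⟶ P) (φ : 𝒜 →+*ᵍ ℬ)
    (hφ : HomogeneousIdeal.irrelevant ℬ ≤ (HomogeneousIdeal.irrelevant 𝒜).map φ)
    (H : c' ≫ g = Proj.map φ hφ ≫ c) {s : A} {d : ℕ} (hs : s ∈ 𝒜 d) {s' : B} (hs' : s' ∈ ℬ d)
    (hss' : φ s = s') (n : ℕ) {a : A} (ha : a ∈ 𝒜 (n • d)) {a' : B} (ha' : a' ∈ ℬ (n • d))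
    (haa' : φ a = a') (e : c' ''ᵁ basicOpen ℬ s' ≤ g ⁻¹ᵁ c ''ᵁ basicOpen 𝒜 s) :
    g.appLE _ _ e (chartFrac c hs n a ha) = chartFrac c' hs' n a' ha' := by
  subst hss' haa'
  have key : awayToSection 𝒜 s ≫ (c.appIso _).inv ≫ g.appLE _ _ e =
      CommRingCat.ofHom (Away.map φ s) ≫ awayToSection ℬ (φ s) ≫ (c'.appIso _).inv := by
    rw [← cancel_mono (c'.appIso _).hom, Category.assoc, Category.assoc, Category.assoc,
      Category.assoc, Iso.inv_hom_id, Category.comp_id, ← awayToSection_comp_appLE φ hφ hs]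
    congr 1
    rw [Iso.inv_comp_eq, Scheme.Hom.appIso_hom', Scheme.Hom.appIso_hom',
      Scheme.Hom.appLE_comp_appLE, Scheme.Hom.appLE_comp_appLE]
    simp only [H]
  have h1 := congr($key (Away.mk 𝒜 hs n a ha))
  have h2 : Away.map φ s (Away.mk 𝒜 hs n a ha) = Away.mk ℬ hs' n (φ a) ha' := Away.map_mk ..
  refine h1.trans ?_
  change (c'.appIso _).inv (awayToSection ℬ (φ s) (Away.map φ s (Away.mk 𝒜 hs n a ha))) = _
  rw [h2]
  rfl

/-- Brings fractions with denominators `s` and `t` to the common denominator `st`. The product is a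
variable `x`, so that `st` and `ts` can be treated as the same element. -/
lemma chartFrac_res {P : Scheme.{u}} (c : Proj 𝒜 ⟶ P) [IsOpenImmersion c] {s t x : A} {d e : ℕ}
    (hs : s ∈ 𝒜 d) (ht : t ∈ 𝒜 e) (hx : x = s * t) (hst : x ∈ 𝒜 (d + e))
    (n : ℕ) {a : A} (ha : a ∈ 𝒜 (n • d)) (ha' : a * t ^ n ∈ 𝒜 (n • (d + e)))
    (h : c ''ᵁ basicOpen 𝒜 x ≤ c ''ᵁ basicOpen 𝒜 s) :
    P.oRes h (chartFrac c hs n a ha) = chartFrac c hst n (a * t ^ n) ha' := by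
  have h1 := awayMap_awayToSection 𝒜 (f := s) ht hx
  have h2 := congr($h1 (Away.mk 𝒜 hs n a ha))
  have h3 : awayMap 𝒜 ht hx (Away.mk 𝒜 hs n a ha) = Away.mk 𝒜 hst n (a * t ^ n) ha' :=
    awayMap_mk 𝒜 ht hx n hs a ha
  have h4 : (awayToSection 𝒜 x) (Away.mk 𝒜 hst n (a * t ^ n) ha') =
    (Proj 𝒜).presheaf.map (homOfLE (basicOpen_mono _ _ _ ⟨_, hx⟩)).op
      (awayToSection 𝒜 s (Away.mk 𝒜 hs n a ha)) := by
    rw [← h3]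
    exact h2
  unfold chartFrac
  rw [h4]
  exact congr($(c.appIso_inv_naturality (homOfLE (basicOpen_mono _ _ _ ⟨_, hx⟩)).op)
    (awayToSection 𝒜 s (Away.mk 𝒜 hs n a ha))).symm

lemma chartFrac_mul {P : Scheme.{u}} (c : Proj 𝒜 ⟶ P) [IsOpenImmersion c] {s : A} {d : ℕ}
    (hs : s ∈ 𝒜 d) {n n' l : ℕ} {a a' b : A} (ha : a ∈ 𝒜 (n • d)) (ha' : a' ∈ 𝒜 (n' • d))
    (hb : b ∈ 𝒜 (l • d)) (h : s ^ (n + n') * b = s ^ l * (a * a')) :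
    chartFrac c hs l b hb = chartFrac c hs n a ha * chartFrac c hs n' a' ha' := by
  unfold chartFrac
  rw [← map_mul, ← map_mul]
  congr 2
  ext
  rw [val_mul, Away.val_mk, Away.val_mk, Away.val_mk, Localization.mk_mul,
    Localization.mk_eq_mk_iff, Localization.r_iff_exists]
  exact ⟨1, by simpa [pow_add] using h⟩

end AlgebraicGeometry.Proj

namespace AlgebraicGeometry.Scheme.AffMod

open HomogeneousLocalization

variable {X : Scheme.{u}} (M : X.AffMod)

lemma projChart_projProj (U : X.AffineZariskiSite) :
    M.projChart U ≫ M.projProj = M.projStr U ≫ U.toOpens.ι :=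
  M.projGluing.ι_toBase U

lemma projChart_opensRange (U : X.AffineZariskiSite) :
    (M.projChart U).opensRange = M.projProj ⁻¹ᵁ U.toOpens := by
  have h := M.projGluing.preimage_toBase_eq_range_ι U
  apply Opens.ext
  refine h.symm.trans ?_
  change M.projProj ⁻¹' (Set.range U.toOpens.ι) = M.projProj ⁻¹' U.toOpens
  rw [Scheme.Opens.range_ι]

lemma projBasicOpen_le (U : X.AffineZariskiSite) (m : M.obj U) :
    M.projBasicOpen U m ≤ M.projProj ⁻¹ᵁ U.toOpens := by
  rw [← projChart_opensRange]
  exact (M.projChart U).image_le_opensRange _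

lemma isAffineOpen_projBasicOpen (U : X.AffineZariskiSite) (m : M.obj U) :
    IsAffineOpen (M.projBasicOpen U m) :=
  (Proj.isAffineOpen_basicOpen _ _ (M.ι_mem_gr U m) one_pos).image_of_isOpenImmersion _

/-- The function `a / mⁿ` on `D_+(m)`. -/
def frac (U : X.AffineZariskiSite) (m : M.obj U) (n : ℕ) (a : M.Sym U) (ha : a ∈ M.gr U n) :
    Γ(M.proj, M.projBasicOpen U m) :=
  Proj.chartFrac (M.projChart U) (M.ι_mem_gr U m) n a (by simpa using ha)

lemma ratio_eq_frac (U : X.AffineZariskiSite) (x m : M.obj U) :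
    M.ratio U x m = M.frac U m 1 (SymmetricAlgebra.ι _ _ x) (M.ι_mem_gr U x) := rfl

/-- The isomorphism from the degree zero part of the localization of `Sym M(U)` at `m` to the
functions on `D_+(m)`, as a ring homomorphism. -/
def awaySec (U : X.AffineZariskiSite) (m : M.obj U) :
    Away (M.gr U) (SymmetricAlgebra.ι _ _ m) →+* Γ(M.proj, M.projBasicOpen U m) :=
  ((M.projChart U).appIso (Proj.basicOpen (M.gr U) (SymmetricAlgebra.ι _ _ m))).inv.hom.comp
    (Proj.awayToSection (M.gr U) (SymmetricAlgebra.ι _ _ m)).hom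

lemma frac_eq_awaySec (U : X.AffineZariskiSite) (m : M.obj U) (n : ℕ) (a : M.Sym U)
    (ha : a ∈ M.gr U n) : M.frac U m n a ha =
      M.awaySec U m (Away.mk (M.gr U) (M.ι_mem_gr U m) n a (by simpa using ha)) := rfl

lemma awaySec_bijective (U : X.AffineZariskiSite) (m : M.obj U) :
    Function.Bijective (M.awaySec U m) := by
  have h : IsIso (Proj.awayToSection (M.gr U) (SymmetricAlgebra.ι _ _ m)) :=
    (Proj.basicOpenIsoAway (M.gr U) _ (M.ι_mem_gr U m) one_pos).isIso_hom
  have := ConcreteCategory.bijective_of_isIso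
    (Proj.awayToSection (M.gr U) (SymmetricAlgebra.ι _ _ m) ≫
      ((M.projChart U).appIso (Proj.basicOpen (M.gr U) (SymmetricAlgebra.ι _ _ m))).inv)
  exact this

lemma exists_frac (U : X.AffineZariskiSite) (m : M.obj U) (s : Γ(M.proj, M.projBasicOpen U m)) :
    ∃ (n : ℕ) (a : M.Sym U) (ha : a ∈ M.gr U n), M.frac U m n a ha = s := by
  obtain ⟨z, rfl⟩ := (M.awaySec_bijective U m).2 s
  obtain ⟨n, a, ha, rfl⟩ := Away.mk_surjective (M.gr U) (M.ι_mem_gr U m) z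
  exact ⟨n, a, by simpa using ha, rfl⟩

lemma frac_mul (U : X.AffineZariskiSite) (m : M.obj U) {n n' : ℕ} {a a' : M.Sym U}
    (ha : a ∈ M.gr U n) (ha' : a' ∈ M.gr U n') :
    M.frac U m n a ha * M.frac U m n' a' ha' =
      M.frac U m (n + n') (a * a') (SetLike.mul_mem_graded ha ha') := by
  rw [frac_eq_awaySec, frac_eq_awaySec, frac_eq_awaySec, ← map_mul]
  congr 1
  ext
  rw [val_mul, Away.val_mk, Away.val_mk, Away.val_mk, Localization.mk_mul]
  congr 1
  exact Subtype.ext (pow_add _ _ _).symm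

lemma frac_add (U : X.AffineZariskiSite) (m : M.obj U) {n : ℕ} {a a' : M.Sym U}
    (ha : a ∈ M.gr U n) (ha' : a' ∈ M.gr U n) :
    M.frac U m n a ha + M.frac U m n a' ha' = M.frac U m n (a + a') (add_mem ha ha') := by
  rw [frac_eq_awaySec, frac_eq_awaySec, frac_eq_awaySec, ← map_add]
  congr 1
  ext
  rw [val_add, Away.val_mk, Away.val_mk, Away.val_mk, Localization.add_mk_self]

lemma frac_congr (U : X.AffineZariskiSite) (m : M.obj U) {n n' : ℕ} {a a' : M.Sym U}
    (ha : a ∈ M.gr U n) (ha' : a' ∈ M.gr U n')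
    (h : ∃ k : ℕ, SymmetricAlgebra.ι _ _ m ^ k * (SymmetricAlgebra.ι _ _ m ^ n' * a) =
      SymmetricAlgebra.ι _ _ m ^ k * (SymmetricAlgebra.ι _ _ m ^ n * a')) :
    M.frac U m n a ha = M.frac U m n' a' ha' := by
  obtain ⟨k, hk⟩ := h
  rw [frac_eq_awaySec, frac_eq_awaySec]
  congr 1
  ext
  rw [Away.val_mk, Away.val_mk, Localization.mk_eq_mk_iff, Localization.r_iff_exists]
  exact ⟨⟨_, k, rfl⟩, hk⟩

/-- The power of `m` is the usual one in a localization. Every argument that lifts a relation from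
`D_+(m)` to the symmetric algebra pays for it with such a factor. -/
lemma frac_eq_zero_iff (U : X.AffineZariskiSite) (m : M.obj U) {n : ℕ} {a : M.Sym U}
    (ha : a ∈ M.gr U n) :
    M.frac U m n a ha = 0 ↔ ∃ k : ℕ, SymmetricAlgebra.ι _ _ m ^ k * a = 0 := by
  rw [frac_eq_awaySec, map_eq_zero_iff _ (M.awaySec_bijective U m).1,
    HomogeneousLocalization.ext_iff_val, Away.val_mk, val_zero, Localization.mk_eq_mk',
    IsLocalization.mk'_eq_zero_iff]
  exact ⟨fun ⟨⟨_, k, rfl⟩, hk⟩ => ⟨k, hk⟩, fun ⟨k, hk⟩ => ⟨⟨_, k, rfl⟩, hk⟩⟩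

lemma frac_res {U V : X.AffineZariskiSite} (h : U ≤ V) (m : M.obj V) (n : ℕ) {a : M.Sym V}
    (ha : a ∈ M.gr V n) (e : M.projBasicOpen U (M.res h m) ≤ M.projBasicOpen V m) :
    M.proj.oRes e (M.frac V m n a ha) =
      M.frac U (M.res h m) n (M.symRes h a) (SymmetricAlgebra.mapₛ_mem _ _ ha) := by
  have := Proj.chartFrac_map (M.projChart V) (M.projChart U) (𝟙 _) (M.grRes h)
    (M.grRes_irrelevant h) (by rw [Category.comp_id]; exact (M.projChart_res h).symm)
    (M.ι_mem_gr V m) (M.ι_mem_gr U (M.res h m)) (SymmetricAlgebra.mapₛ_ι _ _ m) n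
    (a := a) (by simpa using ha) (a' := M.symRes h a)
    (by simpa using SymmetricAlgebra.mapₛ_mem _ _ ha) rfl e
  refine Eq.trans ?_ this
  refine congrArg (fun f => f.hom (M.frac V m n a ha)) (Eq.trans ?_
    (Category.id_comp (M.proj.presheaf.map (homOfLE e).op)).symm)
  rfl

lemma ratio_res {U V : X.AffineZariskiSite} (h : U ≤ V) (x m : M.obj V)
    (e : M.projBasicOpen U (M.res h m) ≤ M.projBasicOpen V m) :
    M.proj.oRes e (M.ratio V x m) = M.ratio U (M.res h x) (M.res h m) := by
  rw [ratio_eq_frac, frac_res]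
  simp only [symRes, SymmetricAlgebra.mapₛ_ι]
  rfl

lemma ratio_self (U : X.AffineZariskiSite) (m : M.obj U) : M.ratio U m m = 1 := by
  have h : M.frac U m 0 1 SetLike.GradedOne.one_mem = 1 := by
    rw [frac_eq_awaySec]
    refine (congrArg _ ?_).trans (map_one _)
    ext
    rw [Away.val_mk, val_one, ← Localization.mk_one]
    congr 1
    exact Subtype.ext (pow_zero _)
  rw [ratio_eq_frac, ← h]
  exact M.frac_congr U m _ _ ⟨0, by simp⟩

lemma ratio_add (U : X.AffineZariskiSite) (x x' m : M.obj U) :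
    M.ratio U (x + x') m = M.ratio U x m + M.ratio U x' m := by
  rw [ratio_eq_frac, ratio_eq_frac, ratio_eq_frac, frac_add]
  simp only [map_add]

lemma projBasicOpen_inf (U : X.AffineZariskiSite) (m m' : M.obj U) :
    M.projBasicOpen U m ⊓ M.projBasicOpen U m' = M.projChart U ''ᵁ Proj.basicOpen (M.gr U)
      (SymmetricAlgebra.ι _ _ m * SymmetricAlgebra.ι _ _ m') := by
  rw [Proj.basicOpen_mul]
  apply Opens.ext
  exact (Set.image_inter (M.projChart U).isOpenEmbedding.injective).symm

/-- The quotients of sections satisfy the cocycle condition. -/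
lemma ratio_mul (U : X.AffineZariskiSite) (x m m' : M.obj U) :
    M.proj.oRes (inf_le_left : M.projBasicOpen U m ⊓ M.projBasicOpen U m' ≤ _) (M.ratio U x m) =
      M.proj.oRes inf_le_left (M.ratio U m' m) * M.proj.oRes inf_le_right (M.ratio U x m') := by
  -- The intersection equals the image of `D₊(m m')` only propositionally. With a variable open set
  -- the equality can be substituted without casts.
  suffices H : ∀ (W : M.proj.Opens) (hW : W = M.projChart U ''ᵁ Proj.basicOpen (M.gr U)
      (SymmetricAlgebra.ι _ _ m * SymmetricAlgebra.ι _ _ m')) (h₁ : W ≤ M.projBasicOpen U m)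
      (h₂ : W ≤ M.projBasicOpen U m'), M.proj.oRes h₁ (M.ratio U x m) =
        M.proj.oRes h₁ (M.ratio U m' m) * M.proj.oRes h₂ (M.ratio U x m') from
    H _ (M.projBasicOpen_inf U m m') _ _
  rintro _ rfl h₁ h₂
  have hm := M.ι_mem_gr U m
  have hm' := M.ι_mem_gr U m'
  have hp : ∀ {a b : M.Sym U}, a ∈ M.gr U 1 → b ∈ M.gr U 1 → a * b ^ 1 ∈ M.gr U (1 • (1 + 1)) :=
    fun ha hb => by simpa using SetLike.mul_mem_graded ha hb
  have hmm : SymmetricAlgebra.ι _ _ m * SymmetricAlgebra.ι _ _ m' ∈ M.gr U (1 + 1) :=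
    SetLike.mul_mem_graded hm hm'
  have e1 : ∀ y : M.obj U, M.proj.oRes h₁ (M.ratio U y m) = _ := fun y =>
    Proj.chartFrac_res (M.projChart U) hm hm' rfl hmm 1 (a := SymmetricAlgebra.ι _ _ y)
      (by simpa using M.ι_mem_gr U y) (hp (M.ι_mem_gr U y) hm') h₁
  have e2 : ∀ y : M.obj U, M.proj.oRes h₂ (M.ratio U y m') = _ := fun y =>
    Proj.chartFrac_res (M.projChart U) hm' hm (mul_comm _ _) hmm 1
      (a := SymmetricAlgebra.ι _ _ y) (by simpa using M.ι_mem_gr U y) (hp (M.ι_mem_gr U y) hm) h₂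
  rw [e1, e1, e2]
  apply Proj.chartFrac_mul
  ring

/-- The symmetric algebra is generated in degree one, so a homogeneous prime containing all of
`M(U)` would contain the irrelevant ideal. -/
lemma exists_mem_projBasicOpen (U : X.AffineZariskiSite) (y : M.proj)
    (hy : y ∈ M.projProj ⁻¹ᵁ U.toOpens) : ∃ m : M.obj U, y ∈ M.projBasicOpen U m := by
  rw [← projChart_opensRange] at hy
  obtain ⟨z, rfl⟩ := hy
  by_contra! H
  apply z.not_irrelevant_le
  rw [HomogeneousIdeal.irrelevant_le]
  have h1 : ∀ m : M.obj U, SymmetricAlgebra.ι _ _ m ∈ z.asHomogeneousIdeal := by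
    intro m
    by_contra hm
    exact H m ⟨z, hm, rfl⟩
  intro i hi a ha
  obtain ⟨i, rfl⟩ := Nat.exists_eq_succ_of_ne_zero hi.ne'
  change a ∈ LinearMap.range _ ^ (i + 1) at ha
  rw [pow_succ'] at ha
  induction ha using Submodule.mul_induction_on' with
  | mem_mul_mem x hx y hy =>
    obtain ⟨m, rfl⟩ := hx
    exact Ideal.mul_mem_right _ _ (h1 m)
  | add x _ y _ hx hy => exact Ideal.add_mem _ hx hy

/-- Converse to `projBasicOpen_res`: shrinking the base loses no points of `D_+(m)` over it. This is
what allows sets `D_+` over different affine opens to be compared near a point. -/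
lemma mem_projBasicOpen_res {U V : X.AffineZariskiSite} (h : U ≤ V) (m : M.obj V) (y : M.proj)
    (hy : y ∈ M.projBasicOpen V m) (hy' : y ∈ M.projProj ⁻¹ᵁ U.toOpens) :
    y ∈ M.projBasicOpen U (M.res h m) := by
  rw [← projChart_opensRange] at hy'
  obtain ⟨z, rfl⟩ := hy'
  obtain ⟨w, hw, hwz⟩ := hy
  have h1 : M.projChart V (M.projRes h z) = M.projChart U z := by
    rw [← M.projChart_res h]
    rfl
  obtain rfl := (M.projChart V).isOpenEmbedding.injective (hwz.trans h1.symm)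
  refine ⟨z, ?_, rfl⟩
  have h2 : z ∈ M.projRes h ⁻¹ᵁ Proj.basicOpen (M.gr V) (SymmetricAlgebra.ι _ _ m) := hw
  unfold projRes at h2
  rw [Proj.map_preimage_basicOpen] at h2
  have h3 : M.grRes h (SymmetricAlgebra.ι _ _ m) = SymmetricAlgebra.ι _ _ (M.res h m) :=
    SymmetricAlgebra.mapₛ_ι _ _ m
  rw [h3] at h2
  exact h2

end AlgebraicGeometry.Scheme.AffMod
end

/-! ### The closed immersion `Proj (Sym N) ⟶ Proj (Sym M)` of a surjection `M → N`. -/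

noncomputable section

open CategoryTheory CategoryTheory.Limits AlgebraicGeometry Opposite TopologicalSpace

namespace AlgebraicGeometry

namespace Proj

open HomogeneousLocalization

variable {A : Type u} [CommRing A] {σ : Type u} [SetLike σ A]
  [AddSubgroupClass σ A] {𝒜 : ℕ → σ} [GradedRing 𝒜]

lemma fromSpec_basicOpen {s : A} {d : ℕ} (hd : 0 < d) (hs : s ∈ 𝒜 d) :
    (isAffineOpen_basicOpen 𝒜 s hs hd).fromSpec =
      Spec.map (awayToSection 𝒜 s) ≫ awayι 𝒜 s hs hd := by
  have h1 : (basicOpen 𝒜 s).ι = (basicOpenIsoSpec 𝒜 s hs hd).hom ≫ awayι 𝒜 s hs hd := by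
    rw [awayι, Iso.hom_inv_id_assoc]
  rw [IsAffineOpen.fromSpec, h1, basicOpenIsoSpec_hom, basicOpenToSpec, Category.assoc,
    Iso.inv_comp_eq, IsAffineOpen.isoSpec_hom]

end Proj

namespace Scheme.AffMod

open HomogeneousLocalization

variable {X : Scheme.{u}} (M : X.AffMod)

/-- Checked on spectra: after composition with the monomorphism `U.2.fromSpec` both sides become the
projection of `D_+(m)` to `X`. -/
lemma appLE_projProj_comp (U : X.AffineZariskiSite) (m : M.obj U) :
    M.projProj.appLE U.toOpens (M.projBasicOpen U m) (M.projBasicOpen_le U m) ≫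
      ((M.projChart U).appIso _).hom =
    CommRingCat.ofHom (algebraMap Γ(X, U.toOpens) (M.gr U 0)) ≫
      CommRingCat.ofHom (fromZeroRingHom (M.gr U) (Submonoid.powers (SymmetricAlgebra.ι _ _ m))) ≫
      Proj.awayToSection (M.gr U) (SymmetricAlgebra.ι _ _ m) := by
  have hU : IsAffineOpen U.toOpens := U.2
  apply Spec.map_injective
  rw [← cancel_mono hU.fromSpec]
  have h0 := IsAffineOpen.SpecMap_appLE_fromSpec M.projProj hU (M.isAffineOpen_projBasicOpen U m)
    (M.projBasicOpen_le U m)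
  have h1 := IsAffineOpen.SpecMap_appLE_fromSpec (M.projChart U)
    (M.isAffineOpen_projBasicOpen U m)
    (Proj.isAffineOpen_basicOpen _ _ (M.ι_mem_gr U m) one_pos)
    ((M.projChart U).preimage_image_eq _).ge
  have h2 := (M.projChart U).appIso_hom' (Proj.basicOpen (M.gr U) (SymmetricAlgebra.ι _ _ m))
  refine (congrArg (· ≫ hU.fromSpec) (Spec.map_comp _ _)).trans ?_
  refine (Category.assoc _ _ _).trans ((congrArg (Spec.map _ ≫ ·) h0).trans ?_)
  refine (Category.assoc _ _ _).symm.trans ((congrArg (· ≫ M.projProj)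
    ((congrArg (fun t => Spec.map t ≫ (M.isAffineOpen_projBasicOpen U m).fromSpec) h2).trans
      h1)).trans ?_)
  rw [Category.assoc, projChart_projProj, projStr_ι,
    Proj.fromSpec_basicOpen one_pos (M.ι_mem_gr U m), Category.assoc,
    Proj.awayι_toSpecZero_assoc, Spec.map_comp, Spec.map_comp, Category.assoc, Category.assoc]

lemma appLE_projProj (U : X.AffineZariskiSite) (m : M.obj U) (r : Γ(X, U.toOpens)) :
    M.projProj.appLE U.toOpens (M.projBasicOpen U m) (M.projBasicOpen_le U m) r =
      M.frac U m 0 (algebraMap _ _ r) (SymmetricAlgebra.algebraMap_mem_grading r) := by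
  have h := M.appLE_projProj_comp U m
  have h1 := (Iso.eq_comp_inv _).mpr h
  refine (congr($h1 r)).trans ?_
  change ((M.projChart U).appIso _).inv (Proj.awayToSection (M.gr U) _
    (fromZeroRingHom (M.gr U) _ (algebraMap Γ(X, U.toOpens) (M.gr U 0) r))) = _
  refine congrArg (M.awaySec U m) ?_
  ext
  rw [Away.val_mk]
  change Localization.mk _ _ = _
  congr 1
  exact Subtype.ext (pow_zero _).symm

lemma ratio_smul (U : X.AffineZariskiSite) (r : Γ(X, U.toOpens)) (x m : M.obj U) :
    M.ratio U (r • x) m = M.projProj.appLE U.toOpens (M.projBasicOpen U m)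
      (M.projBasicOpen_le U m) r * M.ratio U x m := by
  rw [appLE_projProj, ratio_eq_frac, ratio_eq_frac, frac_mul]
  apply M.frac_congr
  exact ⟨0, by rw [map_smul, Algebra.smul_def, zero_add]⟩

variable {M} {N : X.AffMod} (φ : M.Hom N) (hφ : ∀ U, Function.Surjective (φ.app U))

lemma projChart_projMap (U : X.AffineZariskiSite) : N.projChart U ≫ φ.projMap hφ =
    Proj.map (φ.grMap U) (φ.grMap_irrelevant hφ U) ≫ M.projChart U :=
  colimit.ι_desc _ _

lemma projMap_projProj : φ.projMap hφ ≫ M.projProj = N.projProj := by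
  refine colimit.hom_ext fun U => ?_
  change N.projChart U ≫ _ = N.projChart U ≫ _
  have h1 := Proj.map_toSpecZero (φ.grMap_irrelevant hφ U)
    (algebraMap Γ(X, U.toOpens) (M.gr U 0)) (algebraMap Γ(X, U.toOpens) (N.gr U 0))
    (RingHom.id _) (fun a => SymmetricAlgebra.mapₛ_algebraMap (RingHom.id _) (φ.app U) a)
  rw [← Category.assoc, projChart_projMap, Category.assoc, projChart_projProj, projChart_projProj,
    projStr_ι, projStr_ι]
  have h2 := h1 =≫ U.2.fromSpec
  have h3 : Spec.map (CommRingCat.ofHom (RingHom.id Γ(X, U.toOpens))) = 𝟙 _ := Spec.map_id _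
  simp only [Category.assoc] at h2
  rw [h2, h3, Category.id_comp]

lemma projMap_preimage_preimage (U : X.Opens) :
    φ.projMap hφ ⁻¹ᵁ M.projProj ⁻¹ᵁ U = N.projProj ⁻¹ᵁ U := by
  rw [← Scheme.Hom.comp_preimage, projMap_projProj]

/-- Since the preimages of the affine sets `D_+(m)` are again of this form, all local questions
about `projMap` become questions about fractions. -/
lemma projMap_preimage (U : X.AffineZariskiSite) (m : M.obj U) :
    φ.projMap hφ ⁻¹ᵁ M.projBasicOpen U m = N.projBasicOpen U (φ.app U m) := by
  have h3 : φ.grMap U (SymmetricAlgebra.ι _ _ m) = SymmetricAlgebra.ι _ _ (φ.app U m) :=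
    SymmetricAlgebra.mapₛ_ι _ _ m
  have h4 : ∀ z, φ.projMap hφ (N.projChart U z) =
      M.projChart U (Proj.map (φ.grMap U) (φ.grMap_irrelevant hφ U) z) := fun z => by
    rw [← Scheme.Hom.comp_apply, projChart_projMap]
    rfl
  apply le_antisymm
  · intro y hy
    have h1 : y ∈ N.projProj ⁻¹ᵁ U.toOpens := by
      rw [← projMap_preimage_preimage φ hφ]
      exact M.projBasicOpen_le U m hy
    rw [← projChart_opensRange] at h1
    obtain ⟨z, rfl⟩ := h1
    obtain ⟨w, hw, hwz⟩ := hy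
    rw [h4] at hwz
    obtain rfl := (M.projChart U).isOpenEmbedding.injective hwz
    refine ⟨z, ?_, rfl⟩
    have h2 : z ∈ Proj.map (φ.grMap U) (φ.grMap_irrelevant hφ U) ⁻¹ᵁ
      Proj.basicOpen (M.gr U) (SymmetricAlgebra.ι _ _ m) := hw
    rw [Proj.map_preimage_basicOpen, h3] at h2
    exact h2
  · rintro _ ⟨z, hz, rfl⟩
    change φ.projMap hφ (N.projChart U z) ∈ M.projBasicOpen U m
    rw [h4]
    refine ⟨_, ?_, rfl⟩
    have h2 : z ∈ Proj.map (φ.grMap U) (φ.grMap_irrelevant hφ U) ⁻¹ᵁ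
        Proj.basicOpen (M.gr U) (SymmetricAlgebra.ι _ _ m) := by
      rw [Proj.map_preimage_basicOpen, h3]
      exact hz
    exact h2

lemma frac_map (U : X.AffineZariskiSite) (m : M.obj U) (n : ℕ) {a : M.Sym U}
    (ha : a ∈ M.gr U n) :
    (φ.projMap hφ).appLE (M.projBasicOpen U m) (N.projBasicOpen U (φ.app U m))
      (projMap_preimage φ hφ U m).ge (M.frac U m n a ha) =
      N.frac U (φ.app U m) n (φ.symMap U a) (SymmetricAlgebra.mapₛ_mem _ _ ha) :=
  Proj.chartFrac_map (M.projChart U) (N.projChart U) (φ.projMap hφ) (φ.grMap U)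
    (φ.grMap_irrelevant hφ U) (projChart_projMap φ hφ U)
    (M.ι_mem_gr U m) (N.ι_mem_gr U (φ.app U m)) (SymmetricAlgebra.mapₛ_ι _ _ m) n
    (a := a) (by simpa using ha) (a' := φ.symMap U a)
    (by simpa using SymmetricAlgebra.mapₛ_mem _ _ ha) rfl _

lemma ratio_map (U : X.AffineZariskiSite) (x m : M.obj U) :
    (φ.projMap hφ).appLE (M.projBasicOpen U m) (N.projBasicOpen U (φ.app U m))
      (projMap_preimage φ hφ U m).ge (M.ratio U x m) = N.ratio U (φ.app U x) (φ.app U m) := by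
  rw [ratio_eq_frac, frac_map]
  simp only [SymmetricAlgebra.mapₛ_ι]
  rfl

lemma iSup_projBasicOpen : ⨆ i : (Σ U : X.AffineZariskiSite, M.obj U), M.projBasicOpen i.1 i.2 =
    ⊤ := by
  rw [eq_top_iff]
  intro y _
  obtain ⟨U, hU, hy, -⟩ := (Opens.isBasis_iff_nbhd.mp X.isBasis_affineOpens)
    (show M.projProj y ∈ (⊤ : X.Opens) from trivial)
  obtain ⟨m, hm⟩ := M.exists_mem_projBasicOpen ⟨U, hU⟩ y hy
  exact Opens.mem_iSup.mpr ⟨⟨⟨U, hU⟩, m⟩, hm⟩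

lemma symMap_surjective (U : X.AffineZariskiSite) (hφ : Function.Surjective (φ.app U)) :
    Function.Surjective (φ.symMap U) := by
  intro b
  -- The localization statement at the element `1`, where the powers disappear.
  obtain ⟨n, a, ha⟩ := SymmetricAlgebra.mapₛ_surj (RingHom.id _) (φ.app U) 1
    (fun b => ⟨0, b, by simp⟩)
    (fun y => ⟨0, (hφ y).choose, by simp [(hφ y).choose_spec]⟩) b
  exact ⟨a, by simpa using ha⟩

lemma symMap_surjective_graded (U : X.AffineZariskiSite) (hφ : Function.Surjective (φ.app U))
    {n : ℕ} {b : N.Sym U} (hb : b ∈ N.gr U n) : ∃ a ∈ M.gr U n, φ.symMap U a = b := by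
  obtain ⟨a, ha⟩ := symMap_surjective φ U hφ b
  refine ⟨DirectSum.decompose (M.gr U) a n, SetLike.coe_mem _, ?_⟩
  have h2 : φ.grMap U (DirectSum.decompose (M.gr U) a n) = b := by
    rw [GradedRingHom.map_directSumDecompose]
    have : φ.grMap U a = b := ha
    rw [this]
    exact DirectSum.decompose_of_mem_same _ hb
  exact h2

lemma appLE_projMap_surjective (U : X.AffineZariskiSite) (m : M.obj U) : Function.Surjective
    ((φ.projMap hφ).appLE (M.projBasicOpen U m) (N.projBasicOpen U (φ.app U m))
      (projMap_preimage φ hφ U m).ge) := by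
  intro s
  obtain ⟨n, b, hb, rfl⟩ := N.exists_frac U _ s
  obtain ⟨a, ha, rfl⟩ := symMap_surjective_graded φ U (hφ U) hb
  exact ⟨M.frac U m n a ha, frac_map φ hφ U m n ha⟩

/-- Tested on the affine cover by the sets `D_+(m)`: the preimages are affine, and functions lift
because the numerator `b` of a fraction `b/φ(m)ⁿ` lifts to an element of the same degree. -/
lemma isClosedImmersion_projMap : IsClosedImmersion (φ.projMap hφ) := by
  have inst := IsClosedImmersion.hasAffineProperty.{u}
  refine inst.of_iSup_eq_top
    (fun i : (Σ U : X.AffineZariskiSite, M.obj U) =>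
      (⟨M.projBasicOpen i.1 i.2, M.isAffineOpen_projBasicOpen i.1 i.2⟩ : M.proj.affineOpens))
    M.iSup_projBasicOpen ?_
  rintro ⟨U, m⟩
  refine ⟨?_, ?_⟩
  · change IsAffine (φ.projMap hφ ⁻¹ᵁ M.projBasicOpen U m).toScheme
    rw [projMap_preimage]
    exact N.isAffineOpen_projBasicOpen U _
  · rw [morphismRestrict_appTop]
    -- The open set that occurs for the restricted morphism is `D_+(m)` only up to a propositional
    -- equality.
    have H : ∀ V : M.proj.Opens, V = M.projBasicOpen U m →
        Function.Surjective ((φ.projMap hφ).app V) := by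
      rintro _ rfl s
      obtain ⟨t, ht⟩ := appLE_projMap_surjective φ hφ U m
        (N.proj.oRes (projMap_preimage φ hφ U m).ge s)
      refine ⟨t, ?_⟩
      have h1 : Function.Injective (N.proj.oRes (projMap_preimage φ hφ U m).ge) := by
        intro a b hab
        have := congrArg (N.proj.oRes (projMap_preimage φ hφ U m).le) hab
        rw [oRes_oRes, oRes_oRes] at this
        exact (oRes_refl a).symm.trans (this.trans (oRes_refl b))
      exact h1 ht
    have h2 := H ((M.projBasicOpen U m).ι ''ᵁ ⊤) (by simp)
    have h3 := (ConcreteCategory.bijective_of_isIso (N.proj.presheaf.map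
      (eqToHom (image_morphismRestrict_preimage (φ.projMap hφ) (M.projBasicOpen U m) ⊤)).op)).2
    exact h3.comp h2

end Scheme.AffMod

end AlgebraicGeometry
end

/-! ### Regular sequences, and the kernel of a surjection of symmetric algebras. -/

noncomputable section

open CategoryTheory CategoryTheory.Limits AlgebraicGeometry Opposite TopologicalSpace

section RegularSequences

variable {R : Type*} [CommRing R] {n : ℕ}

/-- Coefficients are indexed by all of `ι` and vanish outside `S`, so that relations among initial
parts of a family become sums over a fixed index set. -/
lemma Ideal.mem_span_image_iff {ι : Type*} [Fintype ι] (f : ι → R) (S : Set ι) (z : R) :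
    z ∈ Ideal.span (f '' S) ↔ ∃ d : ι → R, (∀ j ∉ S, d j = 0) ∧ ∑ j, d j * f j = z := by
  classical
  constructor
  · intro hz
    induction hz using Submodule.span_induction with
    | mem x hx =>
      obtain ⟨j, hj, rfl⟩ := hx
      refine ⟨Pi.single j 1, fun i hi => Pi.single_eq_of_ne (by rintro rfl; exact hi hj) _, ?_⟩
      rw [Finset.sum_eq_single j (fun i _ hi => by rw [Pi.single_eq_of_ne hi, zero_mul])
        (fun h => absurd (Finset.mem_univ j) h), Pi.single_eq_same, one_mul]
    | zero => exact ⟨0, fun _ _ => rfl, by simp⟩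
    | add x y _ _ hx hy =>
      obtain ⟨d, hd, rfl⟩ := hx
      obtain ⟨d', hd', rfl⟩ := hy
      exact ⟨d + d', fun j hj => by simp [hd j hj, hd' j hj],
        by simp [add_mul, Finset.sum_add_distrib]⟩
    | smul c x _ hx =>
      obtain ⟨d, hd, rfl⟩ := hx
      exact ⟨c • d, fun j hj => by simp [hd j hj], by simp [Finset.mul_sum, mul_assoc]⟩
  · rintro ⟨d, hd, rfl⟩
    refine Ideal.sum_mem _ fun j _ => ?_
    by_cases hj : j ∈ S
    · exact Ideal.mul_mem_left _ _ (Ideal.subset_span ⟨j, hj, rfl⟩)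
    · rw [hd j hj, zero_mul]
      exact Ideal.zero_mem _

/-- A family `f 0, …, f (n - 1)` in which every element is a nonzerodivisor modulo the previous
ones. -/
def IsRegularFamily (f : Fin n → R) : Prop :=
  ∀ (i : Fin n) (z : R), z * f i ∈ Ideal.span (f '' { j | j < i }) →
    z ∈ Ideal.span (f '' { j | j < i })

lemma Ideal.ofList_take_ofFn (f : Fin n → R) (i : ℕ) :
    Ideal.ofList ((List.ofFn f).take i) = Ideal.span (f '' { j | (j : ℕ) < i }) := by
  unfold Ideal.ofList
  congr 1
  ext x
  simp only [Set.mem_ofPred_eq, Set.mem_image, List.mem_take_iff_getElem, List.getElem_ofFn,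
    List.length_ofFn]
  constructor
  · rintro ⟨j, hj, rfl⟩
    exact ⟨⟨j, by omega⟩, by simp; omega, rfl⟩
  · rintro ⟨j, hj, rfl⟩
    exact ⟨j, by have := j.2; omega, rfl⟩

/-- Only weak regularity, as `IsRegularFamily` does not ask the ideal to be proper. Properness comes
later, from a point of the subscheme. -/
lemma isWeaklyRegular_ofFn_iff (f : Fin n → R) :
    RingTheory.Sequence.IsWeaklyRegular R (List.ofFn f) ↔ IsRegularFamily f := by
  rw [RingTheory.Sequence.isWeaklyRegular_iff]
  have key : ∀ (I : Ideal R) (r : R), IsSMulRegular (R ⧸ (I • ⊤ : Submodule R R)) r ↔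
      ∀ z, z * r ∈ I → z ∈ I := by
    intro I r
    have hI : (I • ⊤ : Submodule R R) = I := by simp
    rw [hI, isSMulRegular_iff_right_eq_zero_of_smul]
    constructor
    · intro H z hz
      have := H (Ideal.Quotient.mk I z) (by
        refine (Ideal.Quotient.eq_zero_iff_mem (a := r * z)).mpr ?_
        rwa [mul_comm])
      exact Ideal.Quotient.eq_zero_iff_mem.mp this
    · intro H z hz
      obtain ⟨z, rfl⟩ := Ideal.Quotient.mk_surjective z
      rw [Ideal.Quotient.eq_zero_iff_mem]
      apply H
      rw [mul_comm]
      exact (Ideal.Quotient.eq_zero_iff_mem (a := r * z)).mp hz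
  constructor
  · intro H i z hz
    have h1 := H i (by simp)
    rw [key, Ideal.ofList_take_ofFn, List.getElem_ofFn] at h1
    exact h1 z hz
  · intro H i hi
    rw [key, Ideal.ofList_take_ofFn, List.getElem_ofFn]
    rw [List.length_ofFn] at hi
    exact H ⟨i, hi⟩

/-- The generators are thus independent modulo the square of their ideal: this is the freeness of
the conormal module. The proof removes the last nonzero coefficient by adding a trivial Koszul
relation, so the induction is on the length of the relation. -/
lemma IsRegularFamily.syzygy {f : Fin n → R} (hf : IsRegularFamily f) (c : Fin n → R)
    (hc : ∑ j, c j * f j = 0) (j : Fin n) : c j ∈ Ideal.span (Set.range f) := by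
  suffices H : ∀ (k : ℕ) (c : Fin n → R), (∀ j : Fin n, k ≤ j → c j = 0) →
      ∑ j, c j * f j = 0 → ∀ j, c j ∈ Ideal.span (Set.range f) from
    H n c (fun j hj => absurd j.2 hj.not_gt) hc j
  clear hc j c
  intro k
  induction k with
  | zero =>
    intro c hc _ j
    rw [hc j (Nat.zero_le _)]
    exact Ideal.zero_mem _
  | succ k ih =>
    intro c hc hs
    by_cases hk : k < n
    · let K : Fin n := ⟨k, hk⟩
      -- The relation reads `c_K f_K = -∑_{j<K} c_j f_j`, so regularity at `K` applies.
      have h1 : c K ∈ Ideal.span (f '' { j | j < K }) := by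
        apply hf
        rw [Ideal.mem_span_image_iff]
        refine ⟨fun j => if j = K then 0 else - c j, ?_, ?_⟩
        · intro j hj
          by_cases hjK : j = K
          · simp [hjK]
          · simp only [hjK, if_false, neg_eq_zero]
            apply hc
            simp only [Set.mem_ofPred_eq, not_lt] at hj
            have : K < j := lt_of_le_of_ne hj (Ne.symm hjK)
            exact this
        · rw [Fintype.sum_eq_add_sum_compl K] at hs ⊢
          simp only [if_true, zero_mul, zero_add]
          rw [add_eq_zero_iff_eq_neg, ← Finset.sum_neg_distrib] at hs
          rw [hs]
          refine Finset.sum_congr rfl fun j hj => ?_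
          rw [if_neg (by simpa using hj), neg_mul]
      obtain ⟨d, hd, hdK⟩ := (Ideal.mem_span_image_iff f _ _).mp h1
      -- With `c_K = ∑ d_j f_j`, the term `c_K f_K` is distributed over the earlier indices. The
      -- coefficients change by multiples of `f_K` only, hence not modulo the ideal.
      have h2 := ih (fun j => (if j = K then 0 else c j) + f K * d j) ?_ ?_
      · intro j
        by_cases hj : j = K
        · rw [hj]
          exact Ideal.span_mono (Set.image_subset_range _ _) h1
        · have h3 := h2 j
          simp only [hj, if_false] at h3
          have h4 : f K * d j ∈ Ideal.span (Set.range f) :=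
            Ideal.mul_mem_right _ _ (Ideal.subset_span ⟨K, rfl⟩)
          exact (Ideal.add_mem_iff_left _ h4).mp h3
      · intro j hj
        have h5 : d j = 0 := hd j (by simpa [K] using (show K ≤ j from hj))
        by_cases hjK : j = K
        · simp [hjK ▸ h5, hjK]
        · have : k ≠ j := fun h => hjK (Fin.ext h.symm)
          simp [hjK, h5, hc j (by omega)]
      · simp only [add_mul, Finset.sum_add_distrib]
        have h6 : ∑ j, f K * d j * f j = f K * c K := by
          rw [← hdK, Finset.mul_sum]
          simp only [mul_assoc]
        rw [h6, Fintype.sum_eq_add_sum_compl K]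
        simp only [if_true, zero_mul, zero_add]
        rw [Fintype.sum_eq_add_sum_compl K] at hs
        rw [← hs, mul_comm (f K), add_comm]
        congr 1
        refine Finset.sum_congr rfl fun j hj => ?_
        rw [if_neg (by simpa using hj)]
    · exact ih c (fun j hj => absurd j.2 (by omega)) hs

end RegularSequences

namespace SymmetricAlgebra

variable {A : Type*} [CommRing A] {M N : Type*} [AddCommGroup M] [Module A M]
  [AddCommGroup N] [Module A N]

/-- The kernel of the homomorphism of symmetric algebras induced by a surjection. -/
lemma ker_mapₛ_le (g : M →ₗ[A] N) (hg : Function.Surjective g) :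
    RingHom.ker (mapₛ (RingHom.id A) g) ≤ Ideal.span (ι A M '' (LinearMap.ker g : Set M)) := by
  set I := Ideal.span (ι A M '' (LinearMap.ker g : Set M)) with hI
  let q : SymmetricAlgebra A M →ₐ[A] SymmetricAlgebra A M ⧸ I := Ideal.Quotient.mkₐ A I
  let l : (M ⧸ LinearMap.ker g) →ₗ[A] SymmetricAlgebra A M ⧸ I :=
    (LinearMap.ker g).liftQ (q.toLinearMap ∘ₗ ι A M) fun x hx => by
      rw [LinearMap.mem_ker]
      exact Ideal.Quotient.eq_zero_iff_mem.mpr (Ideal.subset_span ⟨x, hx, rfl⟩)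
  let e := g.quotKerEquivOfSurjective hg
  -- Since `N = M / ker g`, the map `M → Sym M / I` descends to `N`. Its extension `Ψ` composed with
  -- `Sym g` is the quotient map, so an element killed by `Sym g` lies in `I`.
  let Ψ : SymmetricAlgebra A N →ₐ[A] SymmetricAlgebra A M ⧸ I := lift (l ∘ₗ e.symm.toLinearMap)
  have key : Ψ.toRingHom.comp (mapₛ (RingHom.id A) g) = q.toRingHom := by
    apply ringHom_ext'
    · intro a
      rw [RingHom.comp_apply, mapₛ_algebraMap]
      exact (Ψ.commutes a).trans (q.commutes a).symm
    · intro m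
      rw [RingHom.comp_apply, mapₛ_ι]
      refine (lift_ι_apply (l ∘ₗ e.symm.toLinearMap) (g m)).trans ?_
      have : e.symm (g m) = Submodule.Quotient.mk m := by
        rw [LinearEquiv.symm_apply_eq]
        rfl
      change l (e.symm (g m)) = _
      rw [this]
      rfl
  intro x hx
  have h1 := congr($key x)
  rw [RingHom.comp_apply, hx, map_zero] at h1
  exact Ideal.Quotient.eq_zero_iff_mem.mp h1.symm

/-- Take the components of degree `e` of the coefficients. Homogeneous coefficients can then be
divided by powers of `m`, and vanishing coefficients stay zero, which keeps track of the index set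
`j < i`. -/
lemma exists_homogeneous_coeff {ι' : Type*} [Fintype ι'] {f : ι' → SymmetricAlgebra A M}
    (hf : ∀ j, f j ∈ grading A M 1) {d : ι' → SymmetricAlgebra A M} {e : ℕ}
    {a : SymmetricAlgebra A M} (ha : a ∈ grading A M (e + 1)) (h : ∑ j, d j * f j = a) :
    ∃ s : ι' → grading A M e, (∀ j, d j = 0 → s j = 0) ∧
      ∑ j, (s j : SymmetricAlgebra A M) * f j = a := by
  refine ⟨fun j => DirectSum.decompose (grading A M) (d j) e, fun j hj => by simp [hj], ?_⟩
  rw [← DirectSum.decompose_of_mem_same (grading A M) ha, ← h, DirectSum.decompose_sum,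
    DirectSum.sum_apply, AddSubmonoidClass.coe_finsetSum]
  refine Finset.sum_congr rfl fun j _ => ?_
  rw [DirectSum.coe_decompose_mul_add_of_right_mem _ (hf j)]

end SymmetricAlgebra
end

/-! ### Regular sequences on `D_+(m)`, and the local complete intersection. -/

noncomputable section

open CategoryTheory CategoryTheory.Limits AlgebraicGeometry Opposite TopologicalSpace

namespace AlgebraicGeometry.Scheme.AffMod

variable {X : Scheme.{u}}

section Frac

variable (M : X.AffMod) (U : X.AffineZariskiSite) (m : M.obj U)

/-- The additive map `a ↦ a / mⁿ` on elements of degree `n`. -/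
def fracHom (n : ℕ) : M.gr U n →+ Γ(M.proj, M.projBasicOpen U m) :=
  AddMonoidHom.mk' (fun a => M.frac U m n a.1 a.2) fun a b => (M.frac_add U m a.2 b.2).symm

lemma fracHom_apply (n : ℕ) (a : M.gr U n) : M.fracHom U m n a = M.frac U m n a.1 a.2 := rfl

lemma pow_ι_mul_mem (k : ℕ) {n : ℕ} {a : M.Sym U} (ha : a ∈ M.gr U n) :
    SymmetricAlgebra.ι _ _ m ^ k * a ∈ M.gr U (k + n) := by
  have := SetLike.mul_mem_graded (SetLike.pow_mem_graded k (M.ι_mem_gr U m)) ha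
  simpa using this

/-- The passage from homogeneous relations in the symmetric algebra to relations between the
functions `xⱼ/m`: divide by `m ^ (e + 1)`. -/
lemma frac_sum_mul_ι {J : Type*} [Fintype J] (x : J → M.obj U) {e : ℕ} (s : J → M.gr U e)
    {a : M.Sym U} (ha : a ∈ M.gr U (e + 1))
    (h : ∑ j, (s j : M.Sym U) * SymmetricAlgebra.ι _ _ (x j) = a) :
    M.frac U m (e + 1) a ha = ∑ j, M.frac U m e (s j).1 (s j).2 * M.ratio U (x j) m := by
  have h1 : (⟨a, ha⟩ : M.gr U (e + 1)) = ∑ j, ⟨(s j : M.Sym U) * SymmetricAlgebra.ι _ _ (x j),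
      SetLike.mul_mem_graded (s j).2 (M.ι_mem_gr U (x j))⟩ := by
    apply Subtype.ext
    rw [AddSubmonoidClass.coe_finsetSum]
    exact h.symm
  rw [← M.fracHom_apply U m (e + 1) ⟨a, ha⟩, h1, map_sum]
  refine Finset.sum_congr rfl fun j _ => ?_
  rw [ratio_eq_frac, frac_mul]
  rfl

/-- Finitely many functions on `D_+(m)` have a common denominator. -/
lemma exists_common_frac {J : Type*} [Finite J] (s : J → Γ(M.proj, M.projBasicOpen U m)) :
    ∃ (e : ℕ) (a : J → M.gr U e), ∀ j, M.frac U m e (a j).1 (a j).2 = s j := by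
  have := Fintype.ofFinite J
  choose n a ha h using fun j => M.exists_frac U m (s j)
  refine ⟨∑ j, n j, fun j => ⟨SymmetricAlgebra.ι _ _ m ^ (∑ j, n j - n j) * a j, ?_⟩, fun j => ?_⟩
  · have h1 := M.pow_ι_mul_mem U m (∑ j, n j - n j) (ha j)
    rwa [Nat.sub_add_cancel (Finset.single_le_sum (fun _ _ => Nat.zero_le _)
      (Finset.mem_univ j))] at h1
  · rw [← h j]
    refine M.frac_congr U m _ _ ⟨0, ?_⟩
    rw [pow_zero, one_mul, one_mul, ← mul_assoc, ← pow_add, Nat.add_sub_cancel'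
      (Finset.single_le_sum (fun _ _ => Nat.zero_le _) (Finset.mem_univ j))]

/-- Dehomogenization preserves regularity. Clear denominators in a relation on `D_+(m)`, multiply by
a power of `m` to get a relation in the symmetric algebra, use regularity there, and divide again.
-/
lemma isRegularFamily_ratio {n : ℕ} (x : Fin n → M.obj U)
    (hx : IsRegularFamily fun j => SymmetricAlgebra.ι Γ(X, U.toOpens) (M.obj U) (x j)) :
    IsRegularFamily fun j => M.ratio U (x j) m := by
  intro i z hz
  rw [Ideal.mem_span_image_iff] at hz ⊢
  obtain ⟨d, hd, hz⟩ := hz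
  -- The index `none` carries `z` and `some j` the coefficient `d j`, so that all of them get the
  -- same denominator.
  obtain ⟨e, a, ha⟩ := M.exists_common_frac U m (fun o : Option (Fin n) => o.elim z d)
  have hz' : M.frac U m e (a none).1 (a none).2 = z := ha none
  have hd' : ∀ j, M.frac U m e (a (some j)).1 (a (some j)).2 = d j := fun j => ha (some j)
  let s : Fin n → M.gr U e := fun j =>
    (if j < i then a (some j) else 0) - (if j = i then a none else 0)
  have hsum : ∑ j, M.frac U m e (s j).1 (s j).2 * M.ratio U (x j) m = 0 := by
    have h1 : ∀ j, M.frac U m e (s j).1 (s j).2 = d j - (if j = i then z else 0) := by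
      intro j
      rw [← M.fracHom_apply U m e (s j), map_sub]
      congr 1
      · split_ifs with h
        · exact hd' j
        · rw [map_zero, hd j h]
      · split_ifs with h
        · exact hz'
        · rw [map_zero]
    simp only [h1, sub_mul, Finset.sum_sub_distrib, ite_mul, zero_mul, Finset.sum_ite_eq',
      Finset.mem_univ, if_true]
    rw [sub_eq_zero]
    exact hz
  have hmem : ∑ j, (s j : M.Sym U) * SymmetricAlgebra.ι _ _ (x j) ∈ M.gr U (e + 1) :=
    sum_mem fun j _ => SetLike.mul_mem_graded (s j).2 (M.ι_mem_gr U (x j))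
  rw [← M.frac_sum_mul_ι U m x s hmem rfl, frac_eq_zero_iff] at hsum
  obtain ⟨k, hk⟩ := hsum
  set μ := SymmetricAlgebra.ι Γ(X, U.toOpens) (M.obj U) m with hμ
  -- The exponent is `k + 1` and not `k`, so that the element has positive degree and homogeneous
  -- coefficients of one degree less exist.
  have h2 : (μ ^ (k + 1) * (a none : M.Sym U)) ∈ Ideal.span
      ((fun j => SymmetricAlgebra.ι Γ(X, U.toOpens) (M.obj U) (x j)) '' { j | j < i }) := by
    apply hx
    rw [Ideal.mem_span_image_iff]
    refine ⟨fun j => μ ^ (k + 1) * (if j < i then (a (some j) : M.Sym U) else 0),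
      fun j hj => by
        have hj' : ¬ j < i := hj
        simp [hj'], ?_⟩
    have h3 : μ ^ (k + 1) * ∑ j, (s j : M.Sym U) * SymmetricAlgebra.ι _ _ (x j) = 0 := by
      rw [pow_succ', mul_assoc, hk, mul_zero]
    have h4 : ∀ j, (s j : M.Sym U) = (if j < i then (a (some j) : M.Sym U) else 0) -
        (if j = i then (a none : M.Sym U) else 0) := by
      intro j
      simp only [s]
      split_ifs <;> simp
    simp only [h4, sub_mul, Finset.sum_sub_distrib, mul_sub, sub_eq_zero, ite_mul, zero_mul,
      Finset.sum_ite_eq', Finset.mem_univ, if_true] at h3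
    rw [mul_assoc, ← h3, Finset.mul_sum]
    refine Finset.sum_congr rfl fun j _ => ?_
    by_cases h : j < i <;> simp [h, mul_assoc]
  rw [Ideal.mem_span_image_iff] at h2
  obtain ⟨c, hc, hc'⟩ := h2
  have h5 : μ ^ (k + 1) * (a none : M.Sym U) ∈ M.gr U ((k + e) + 1) := by
    have := M.pow_ι_mul_mem U m (k + 1) (a none).2
    rwa [add_right_comm] at this
  obtain ⟨t, ht, ht'⟩ := SymmetricAlgebra.exists_homogeneous_coeff
    (fun j => M.ι_mem_gr U (x j)) h5 hc'
  refine ⟨fun j => M.frac U m (k + e) (t j).1 (t j).2, fun j hj => ?_, ?_⟩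
  · change M.fracHom U m (k + e) (t j) = 0
    rw [ht j (hc j hj), map_zero]
  · rw [← M.frac_sum_mul_ι U m x t h5 ht', ← hz']
    exact (M.frac_congr U m _ _ ⟨0, by ring⟩)

end Frac

section Exact

variable {K M N : X.AffMod} (i : K.Hom M) (φ : M.Hom N)
  (hφ : ∀ U, Function.Surjective (φ.app U))
  (hex : ∀ U m, φ.app U m = 0 ↔ ∃ κ, i.app U κ = m)

/-- Right exactness of the symmetric algebra, in terms of generators of the kernel module. -/
lemma ker_symMap_le (hex : ∀ U m, φ.app U m = 0 ↔ ∃ κ, i.app U κ = m) {J : Type*}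
    (U : X.AffineZariskiSite) (hφ : Function.Surjective (φ.app U)) (b : J → K.obj U)
    (hb : Submodule.span Γ(X, U.toOpens) (Set.range b) = ⊤) : RingHom.ker (φ.symMap U) ≤
      Ideal.span (Set.range fun j => SymmetricAlgebra.ι Γ(X, U.toOpens) _ (i.app U (b j))) := by
  refine (SymmetricAlgebra.ker_mapₛ_le (φ.app U) hφ).trans ?_
  rw [Ideal.span_le]
  rintro _ ⟨m, hm, rfl⟩
  obtain ⟨κ, rfl⟩ := (hex U m).mp hm
  have h : κ ∈ Submodule.span Γ(X, U.toOpens) (Set.range b) := by rw [hb]; trivial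
  induction h using Submodule.span_induction with
  | mem x hx =>
    obtain ⟨j, rfl⟩ := hx
    exact Ideal.subset_span ⟨j, rfl⟩
  | zero => rw [map_zero, map_zero]; exact Ideal.zero_mem _
  | add x y _ _ hx hy =>
    rw [map_add, map_add]
    exact Ideal.add_mem _ (hx ((hex U _).mpr ⟨_, rfl⟩)) (hy ((hex U _).mpr ⟨_, rfl⟩))
  | smul r x _ hx =>
    rw [map_smul, map_smul, Algebra.smul_def]
    exact Ideal.mul_mem_left _ _ (hx ((hex U _).mpr ⟨_, rfl⟩))

lemma ratio_zero (M : X.AffMod) (U : X.AffineZariskiSite) (m : M.obj U) : M.ratio U 0 m = 0 := by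
  have := M.ratio_add U 0 0 m
  simpa using this

lemma appLE_ratio_eq_zero (hex : ∀ U m, φ.app U m = 0 ↔ ∃ κ, i.app U κ = m)
    (U : X.AffineZariskiSite) (κ : K.obj U) (m : M.obj U) :
    (φ.projMap hφ).appLE (M.projBasicOpen U m) (N.projBasicOpen U (φ.app U m))
      (projMap_preimage φ hφ U m).ge (M.ratio U (i.app U κ) m) = 0 := by
  rw [ratio_map, (hex U _).mpr ⟨κ, rfl⟩, ratio_zero]

/-- The ideal of `P(N)` in `P(M)` is generated on `D_+(m)` by the functions `κ / m`. -/
lemma mem_span_ratio (hex : ∀ U m, φ.app U m = 0 ↔ ∃ κ, i.app U κ = m)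
    {J : Type*} [Fintype J] (U : X.AffineZariskiSite) (b : J → K.obj U)
    (hb : Submodule.span Γ(X, U.toOpens) (Set.range b) = ⊤) (m : M.obj U)
    (s : Γ(M.proj, M.projBasicOpen U m))
    (hs : (φ.projMap hφ).appLE (M.projBasicOpen U m) (N.projBasicOpen U (φ.app U m))
      (projMap_preimage φ hφ U m).ge s = 0) :
    s ∈ Ideal.span (Set.range fun j => M.ratio U (i.app U (b j)) m) := by
  obtain ⟨d, a, ha, rfl⟩ := M.exists_frac U m s
  rw [frac_map, frac_eq_zero_iff] at hs
  obtain ⟨k, hk⟩ := hs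
  set μ := SymmetricAlgebra.ι Γ(X, U.toOpens) (M.obj U) m with hμ
  -- The factor `μ ^ k` makes the image vanish before localization. One further factor makes the
  -- degree positive.
  have h1 : μ ^ (k + 1) * a ∈ RingHom.ker (φ.symMap U) := by
    rw [RingHom.mem_ker, map_mul, map_pow, SymmetricAlgebra.mapₛ_ι, pow_succ', mul_assoc, hk,
      mul_zero]
  have h2 := ker_symMap_le i φ hex U (hφ U) b hb h1
  rw [← Set.image_univ, Ideal.mem_span_image_iff] at h2 ⊢
  obtain ⟨c, hc, hc'⟩ := h2
  have h5 : μ ^ (k + 1) * a ∈ M.gr U ((k + d) + 1) := by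
    have := M.pow_ι_mul_mem U m (k + 1) ha
    rwa [add_right_comm] at this
  obtain ⟨t, ht, ht'⟩ := SymmetricAlgebra.exists_homogeneous_coeff
    (fun j => M.ι_mem_gr U (i.app U (b j))) h5 hc'
  refine ⟨fun j => M.frac U m (k + d) (t j).1 (t j).2, fun j hj => (hj trivial).elim, ?_⟩
  rw [← M.frac_sum_mul_ι U m (fun j => i.app U (b j)) t h5 ht']
  exact (M.frac_congr U m _ _ ⟨0, by ring⟩)

/-- The two maps differ by restriction along the equality of open sets `projMap_preimage`. The left
one is computed by fractions, the right one defines the kernel ideal sheaf. -/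
lemma appLE_eq_zero_iff (U : X.AffineZariskiSite) (m : M.obj U)
    (s : Γ(M.proj, M.projBasicOpen U m)) :
    (φ.projMap hφ).appLE (M.projBasicOpen U m) (N.projBasicOpen U (φ.app U m))
      (projMap_preimage φ hφ U m).ge s = 0 ↔ (φ.projMap hφ).app (M.projBasicOpen U m) s = 0 := by
  constructor
  · intro h
    have h1 := congrArg (N.proj.oRes (projMap_preimage φ hφ U m).le) h
    rw [map_zero] at h1
    refine Eq.trans ?_ h1
    exact ((oRes_oRes _ _ _).trans (oRes_refl _)).symm
  · intro h
    exact (congrArg (N.proj.oRes (projMap_preimage φ hφ U m).ge) h).trans (map_zero _)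

/-- `P(N)` is a local complete intersection in `P(M)` if the kernel of `M → N` is locally generated
by a regular sequence in the symmetric algebra of `M`. -/
lemma isRegularClosedImmersion_projMap {n : ℕ}
    (hex : ∀ U m, φ.app U m = 0 ↔ ∃ κ, i.app U κ = m)
    (hreg : ∀ x : X, ∃ U : X.AffineZariskiSite, x ∈ U.toOpens ∧ ∃ b : Fin n → K.obj U,
      Submodule.span Γ(X, U.toOpens) (Set.range b) = ⊤ ∧
      IsRegularFamily fun j => SymmetricAlgebra.ι Γ(X, U.toOpens) _ (i.app U (b j))) :
    IsRegularClosedImmersion n (φ.projMap hφ) where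
  isClosedImmersion := isClosedImmersion_projMap φ hφ
  exists_regular y := by
    have := isClosedImmersion_projMap φ hφ
    obtain ⟨U, hU, b, hb, hr⟩ := hreg (N.projProj y)
    have hy : φ.projMap hφ y ∈ M.projProj ⁻¹ᵁ U.toOpens := by
      change y ∈ φ.projMap hφ ⁻¹ᵁ M.projProj ⁻¹ᵁ U.toOpens
      rw [projMap_preimage_preimage]
      exact hU
    obtain ⟨m, hm⟩ := M.exists_mem_projBasicOpen U _ hy
    have hker : Ideal.ofList (List.ofFn fun j => M.ratio U (i.app U (b j)) m) =
        (φ.projMap hφ).ker.ideal ⟨M.projBasicOpen U m, M.isAffineOpen_projBasicOpen U m⟩ := by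
      rw [Scheme.Hom.ker_apply]
      have h0 : Ideal.ofList (List.ofFn fun j => M.ratio U (i.app U (b j)) m) =
          Ideal.span (Set.range fun j => M.ratio U (i.app U (b j)) m) := by
        unfold Ideal.ofList
        congr 1
        ext x
        simp [List.mem_ofFn]
      rw [h0]
      apply le_antisymm
      · rw [Ideal.span_le]
        rintro _ ⟨j, rfl⟩
        exact (appLE_eq_zero_iff φ hφ U m _).mp (appLE_ratio_eq_zero i φ hφ hex U _ m)
      · intro s hs
        exact mem_span_ratio i φ hφ hex U b hb m s ((appLE_eq_zero_iff φ hφ U m _).mpr hs)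
    refine ⟨⟨M.projBasicOpen U m, M.isAffineOpen_projBasicOpen U m⟩, hm, _, List.length_ofFn,
      ⟨(isWeaklyRegular_ofFn_iff _).mpr (M.isRegularFamily_ratio U m _ hr), ?_⟩, hker⟩
    -- The ideal is proper because `y` is a point of the subscheme in `D_+(m)`: otherwise `1 = 0` on
    -- its nonempty preimage.
    rw [hker, smul_eq_mul, Ideal.mul_top, Scheme.Hom.ker_apply]
    intro h
    have h1 : (1 : Γ(M.proj, M.projBasicOpen U m)) ∈
        RingHom.ker ((φ.projMap hφ).app (M.projBasicOpen U m)).hom := by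
      rw [← h]; trivial
    rw [RingHom.mem_ker, map_one] at h1
    have h2 : Nontrivial Γ(N.proj, φ.projMap hφ ⁻¹ᵁ M.projBasicOpen U m) := by
      have : Nonempty ↥(φ.projMap hφ ⁻¹ᵁ M.projBasicOpen U m) := ⟨⟨y, hm⟩⟩
      infer_instance
    exact one_ne_zero h1

end Exact

end AlgebraicGeometry.Scheme.AffMod
end

/-! ### The kernel cone as the inverse image of the zero section. -/

noncomputable section

open CategoryTheory CategoryTheory.Limits AlgebraicGeometry Opposite TopologicalSpace

namespace AlgebraicGeometry

/-- Test schemes are arbitrary, so a morphism to an affine scheme is recovered from its ring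
homomorphism into the global functions. -/
lemma Scheme.eq_toSpecΓ_SpecMap {T : Scheme.{u}} {R : CommRingCat.{u}} (f : T ⟶ Spec R) :
    f = T.toSpecΓ ≫ Spec.map ((Scheme.ΓSpecIso R).inv ≫ f.appTop) := by
  rw [Spec.map_comp, ← Category.assoc, ← Scheme.toSpecΓ_naturality, Category.assoc,
    toSpecΓ_SpecMap_ΓSpecIso_inv, Category.comp_id]

/-- A morphism lifts along the closed immersion given by a surjection `g` if the kernel of `g`
vanishes on global sections. -/
lemma Scheme.exists_lift_SpecMap {T : Scheme.{u}} {R S : Type u} [CommRing R] [CommRing S]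
    (g : R →+* S) (hg : Function.Surjective g) (f : T ⟶ Spec (.of R))
    (hf : ∀ r, g r = 0 → f.appTop ((Scheme.ΓSpecIso (.of R)).inv r) = 0) :
    ∃ l : T ⟶ Spec (.of S), l ≫ Spec.map (CommRingCat.ofHom g) = f := by
  let ρ : R →+* Γ(T, ⊤) := ((Scheme.ΓSpecIso (.of R)).inv ≫ f.appTop).hom
  let e := RingHom.quotientKerEquivOfSurjective hg
  let l₀ : R ⧸ RingHom.ker g →+* Γ(T, ⊤) := Ideal.Quotient.lift _ ρ hf
  let l : S →+* Γ(T, ⊤) := l₀.comp e.symm.toRingHom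
  have hl : l.comp g = ρ := by
    ext r
    change l₀ (e.symm (g r)) = ρ r
    have : e.symm (g r) = Ideal.Quotient.mk _ r := by
      rw [RingEquiv.symm_apply_eq]
      rfl
    rw [this]
    rfl
  refine ⟨T.toSpecΓ ≫ Spec.map (CommRingCat.ofHom l), ?_⟩
  rw [Category.assoc, ← Spec.map_comp, ← CommRingCat.ofHom_comp, hl]
  exact (Scheme.eq_toSpecΓ_SpecMap f).symm

lemma Scheme.appTop_eq_of_comp_SpecMap_eq {T : Scheme.{u}} {R S : Type u} [CommRing R] [CommRing S]
    {f g : R →+* S} (a : T ⟶ Spec (.of S)) (h : a ≫ Spec.map (CommRingCat.ofHom f) =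
      a ≫ Spec.map (CommRingCat.ofHom g)) (r : R) :
    a.appTop ((Scheme.ΓSpecIso (.of S)).inv (f r)) =
      a.appTop ((Scheme.ΓSpecIso (.of S)).inv (g r)) := by
  have key : ∀ f : R →+* S, CommRingCat.ofHom f ≫ (Scheme.ΓSpecIso (.of S)).inv ≫ a.appTop =
      (Scheme.ΓSpecIso (.of R)).inv ≫ (a ≫ Spec.map (CommRingCat.ofHom f)).appTop := by
    intro f
    rw [Scheme.Hom.comp_appTop, ← Category.assoc, Scheme.ΓSpecIso_inv_naturality, Category.assoc]
  have h1 := key f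
  rw [h, ← key g] at h1
  exact congr($h1 r)

namespace Scheme.AffMod

variable {X : Scheme.{u}}

section

variable (M : X.AffMod)

instance (U : X.AffineZariskiSite) : IsOpenImmersion (M.coneChart U) :=
  inferInstanceAs (IsOpenImmersion (colimit.ι M.coneGluing.functor U))

lemma coneChart_coneProj (U : X.AffineZariskiSite) : M.coneChart U ≫ M.coneProj =
    Spec.map (CommRingCat.ofHom (algebraMap Γ(X, U.toOpens) (M.Sym U))) ≫ U.2.fromSpec :=
  (M.coneGluing.ι_toBase U).trans (Category.assoc _ _ _)

lemma coneChart_opensRange (U : X.AffineZariskiSite) :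
    (M.coneChart U).opensRange = M.coneProj ⁻¹ᵁ U.toOpens := by
  have h := M.coneGluing.preimage_toBase_eq_range_ι U
  apply Opens.ext
  refine h.symm.trans ?_
  change M.coneProj ⁻¹' (Set.range U.toOpens.ι) = M.coneProj ⁻¹' U.toOpens
  rw [Scheme.Opens.range_ι]

lemma fromSpec_zeroSection (U : X.AffineZariskiSite) : U.2.fromSpec ≫ M.zeroSection =
    Spec.map (CommRingCat.ofHom (M.symZero U)) ≫ M.coneChart U :=
  (AffineZariskiSite.isColimitCocone X).fac _ U

lemma cone_hom_ext {T : Scheme.{u}} {f g : M.cone ⟶ T}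
    (h : ∀ U : X.AffineZariskiSite, M.coneChart U ≫ f = M.coneChart U ≫ g) : f = g :=
  colimit.hom_ext h

lemma zeroSection_coneProj : M.zeroSection ≫ M.coneProj = 𝟙 X := by
  refine (AffineZariskiSite.isColimitCocone X).hom_ext fun U => ?_
  change U.2.fromSpec ≫ _ = U.2.fromSpec ≫ _
  rw [← Category.assoc, fromSpec_zeroSection, Category.assoc, coneChart_coneProj,
    Category.comp_id, ← Category.assoc, ← Spec.map_comp, ← CommRingCat.ofHom_comp]
  have : (M.symZero U).comp (algebraMap Γ(X, U.toOpens) (M.Sym U)) = RingHom.id _ :=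
    RingHom.ext fun a => SymmetricAlgebra.algebraMap_leftInverse (M.obj U) a
  rw [this]
  exact (congrArg (· ≫ U.2.fromSpec) (Spec.map_id _)).trans (Category.id_comp _)

end

variable {M N : X.AffMod} (φ : M.Hom N)

lemma coneChart_coneMap (U : X.AffineZariskiSite) : N.coneChart U ≫ φ.coneMap =
    Spec.map (CommRingCat.ofHom (φ.symMap U)) ≫ M.coneChart U :=
  colimit.ι_desc _ _

lemma coneMap_coneProj : φ.coneMap ≫ M.coneProj = N.coneProj := by
  refine N.cone_hom_ext fun U => ?_
  rw [← Category.assoc, coneChart_coneMap, Category.assoc, coneChart_coneProj, coneChart_coneProj,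
    ← Category.assoc, ← Spec.map_comp, ← CommRingCat.ofHom_comp]
  congr 3
  exact RingHom.ext fun a => SymmetricAlgebra.mapₛ_algebraMap _ _ a

/-- The cover of a scheme over `X` by the preimages of the affine opens of `X`. -/
def baseCover {T : Scheme.{u}} (b : T ⟶ X) : T.OpenCover :=
  T.openCoverOfIsOpenCover (fun U : X.AffineZariskiSite => b ⁻¹ᵁ U.toOpens) (by
    rw [IsOpenCover, eq_top_iff]
    intro y _
    obtain ⟨U, hU, hy, -⟩ := (Opens.isBasis_iff_nbhd.mp X.isBasis_affineOpens)
      (show b y ∈ (⊤ : X.Opens) from trivial)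
    exact Opens.mem_iSup.mpr ⟨⟨U, hU⟩, hy⟩)

lemma baseCover_hom_ext {T Z : Scheme.{u}} (b : T ⟶ X) {f g : T ⟶ Z}
    (h : ∀ U : X.AffineZariskiSite, (b ⁻¹ᵁ U.toOpens).ι ≫ f = (b ⁻¹ᵁ U.toOpens).ι ≫ g) : f = g :=
  (baseCover b).hom_ext _ _ h

/-- The chart over `U` is the whole part of the cone over `U`, so the part of `T` over `U` lands in
it. -/
lemma exists_coneChart_lift {T : Scheme.{u}} (a : T ⟶ M.cone) (b : T ⟶ X)
    (hb : a ≫ M.coneProj = b) (U : X.AffineZariskiSite) :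
    ∃ a' : (b ⁻¹ᵁ U.toOpens).toScheme ⟶ Spec (.of (M.Sym U)),
      a' ≫ M.coneChart U = (b ⁻¹ᵁ U.toOpens).ι ≫ a := by
  subst hb
  refine ⟨IsOpenImmersion.lift (M.coneChart U) _ ?_, IsOpenImmersion.lift_fac _ _ _⟩
  have h : Set.range (M.coneChart U) = M.coneProj ⁻¹' U.toOpens :=
    congrArg (fun W : M.cone.Opens => (W : Set M.cone)) (M.coneChart_opensRange U)
  rw [h]
  rintro _ ⟨y, rfl⟩
  exact y.2

/-- Over an affine open of `X` the morphism of cones is the closed immersion given by a surjection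
of symmetric algebras, hence a monomorphism. -/
lemma coneMap_mono (hφ : ∀ U, Function.Surjective (φ.app U)) {T : Scheme.{u}}
    {l l' : T ⟶ N.cone} (h : l ≫ φ.coneMap = l' ≫ φ.coneMap) : l = l' := by
  -- The two morphisms have the same projection to `X`, so one cover of `T` serves both.
  have hb : l' ≫ N.coneProj = l ≫ N.coneProj := by
    rw [← coneMap_coneProj φ, ← Category.assoc, ← h, Category.assoc]
  refine baseCover_hom_ext (l ≫ N.coneProj) fun U => ?_
  obtain ⟨a, ha⟩ := exists_coneChart_lift l _ rfl U
  obtain ⟨a', ha'⟩ := exists_coneChart_lift l' _ hb U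
  rw [← ha, ← ha']
  congr 1
  have : Mono (Spec.map (CommRingCat.ofHom (φ.symMap U))) := by
    have : IsClosedImmersion (Spec.map (CommRingCat.ofHom (φ.symMap U))) :=
      IsClosedImmersion.spec_of_surjective _ (symMap_surjective φ U (hφ U))
    infer_instance
  rw [← cancel_mono (Spec.map (CommRingCat.ofHom (φ.symMap U))), ← cancel_mono (M.coneChart U),
    Category.assoc, Category.assoc, ← coneChart_coneMap, ← Category.assoc, ha, ← Category.assoc,
    ha', Category.assoc, Category.assoc, h]

variable {K : X.AffMod} (i : K.Hom M)

/-- On charts both composites are given by the homomorphism `Sym K(U) → Sym N(U)` that kills `K(U)`.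
-/
lemma coneMap_comm (hex : ∀ U m, φ.app U m = 0 ↔ ∃ κ, i.app U κ = m) :
    φ.coneMap ≫ i.coneMap = N.coneProj ≫ K.zeroSection := by
  refine N.cone_hom_ext fun U => ?_
  rw [← Category.assoc, coneChart_coneMap, Category.assoc, coneChart_coneMap, ← Category.assoc,
    ← Category.assoc, coneChart_coneProj]
  simp only [Category.assoc]
  rw [fromSpec_zeroSection, ← Spec.map_comp_assoc, ← Spec.map_comp_assoc,
    ← CommRingCat.ofHom_comp, ← CommRingCat.ofHom_comp]
  congr 3
  apply SymmetricAlgebra.ringHom_ext'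
  · intro r
    rw [RingHom.comp_apply, RingHom.comp_apply, SymmetricAlgebra.mapₛ_algebraMap,
      SymmetricAlgebra.mapₛ_algebraMap]
    exact congrArg _ (SymmetricAlgebra.algebraMap_leftInverse (K.obj U) r).symm
  · intro κ
    rw [RingHom.comp_apply, RingHom.comp_apply, SymmetricAlgebra.mapₛ_ι,
      SymmetricAlgebra.mapₛ_ι, (hex U _).mpr ⟨κ, rfl⟩, map_zero]
    refine Eq.trans (map_zero _).symm (congrArg _ ?_)
    exact (SymmetricAlgebra.algebraMapInv_ι κ).symm

/-- The condition on `a` says that the linear functions from `K` vanish on `T`. They generate the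
ideal of the cone of `N`, so local lifts exist; by `coneMap_mono` they are unique and glue. -/
lemma exists_lift_coneMap (hφ : ∀ U, Function.Surjective (φ.app U))
    (hex : ∀ U m, φ.app U m = 0 ↔ ∃ κ, i.app U κ = m) {T : Scheme.{u}} (a : T ⟶ M.cone)
    (b : T ⟶ X) (w : a ≫ i.coneMap = b ≫ K.zeroSection) :
    ∃ l : T ⟶ N.cone, l ≫ φ.coneMap = a ∧ l ≫ N.coneProj = b := by
  have hb : a ≫ M.coneProj = b := by
    rw [← coneMap_coneProj i, ← Category.assoc, w, Category.assoc, zeroSection_coneProj,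
      Category.comp_id]
  have hloc : ∀ U : X.AffineZariskiSite, ∃ l : (b ⁻¹ᵁ U.toOpens).toScheme ⟶ N.cone,
      l ≫ φ.coneMap = (b ⁻¹ᵁ U.toOpens).ι ≫ a := by
    intro U
    obtain ⟨a', ha'⟩ := exists_coneChart_lift a b hb U
    -- The equation `w` on the chart: composed with `a'`, the map `Sym K → Sym M` cannot be
    -- distinguished from the one that sends `K` to zero.
    have h1 : a' ≫ Spec.map (CommRingCat.ofHom (i.symMap U)) = a' ≫ Spec.map (CommRingCat.ofHom
        ((algebraMap Γ(X, U.toOpens) (M.Sym U)).comp (K.symZero U))) := by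
      have h2 : (b ⁻¹ᵁ U.toOpens).ι ≫ b = a' ≫ Spec.map (CommRingCat.ofHom
          (algebraMap Γ(X, U.toOpens) (M.Sym U))) ≫ U.2.fromSpec := by
        rw [← coneChart_coneProj, ← Category.assoc, ha', Category.assoc, hb]
      rw [← cancel_mono (K.coneChart U), Category.assoc, ← coneChart_coneMap, ← Category.assoc,
        ha', Category.assoc, w, ← Category.assoc, h2, CommRingCat.ofHom_comp, Spec.map_comp]
      simp only [Category.assoc]
      rw [fromSpec_zeroSection]
    have h3 : ∀ κ, a'.appTop ((Scheme.ΓSpecIso (.of (M.Sym U))).inv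
        (SymmetricAlgebra.ι _ _ (i.app U κ))) = 0 := by
      intro κ
      have h4 := Scheme.appTop_eq_of_comp_SpecMap_eq a' h1 (SymmetricAlgebra.ι _ _ κ)
      have h5 : K.symZero U (SymmetricAlgebra.ι _ _ κ) = 0 := SymmetricAlgebra.algebraMapInv_ι κ
      rw [SymmetricAlgebra.mapₛ_ι, RingHom.comp_apply, h5, map_zero, map_zero, map_zero] at h4
      exact h4
    obtain ⟨l, hl⟩ := Scheme.exists_lift_SpecMap (φ.symMap U) (symMap_surjective φ U (hφ U)) a' (by
      intro r hr
      have h6 : RingHom.ker (φ.symMap U) ≤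
          RingHom.ker ((Scheme.ΓSpecIso (.of (M.Sym U))).inv ≫ a'.appTop).hom := by
        refine (SymmetricAlgebra.ker_mapₛ_le (φ.app U) (hφ U)).trans (Ideal.span_le.mpr ?_)
        rintro _ ⟨m, hm, rfl⟩
        obtain ⟨κ, rfl⟩ := (hex U m).mp hm
        exact h3 κ
      exact h6 hr)
    refine ⟨l ≫ N.coneChart U, ?_⟩
    rw [Category.assoc, coneChart_coneMap, ← Category.assoc, hl, ha']
  choose l hl using hloc
  let L : T ⟶ N.cone := (baseCover b).glueMorphisms l fun U V => by
    apply coneMap_mono φ hφ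
    refine (Category.assoc _ _ _).trans (Eq.trans ?_ (Category.assoc _ _ _).symm)
    refine (congrArg (pullback.fst _ _ ≫ ·) (hl U)).trans
      (Eq.trans ?_ (congrArg (pullback.snd _ _ ≫ ·) (hl V)).symm)
    exact pullback.condition_assoc a
  have hL : L ≫ φ.coneMap = a := by
    refine baseCover_hom_ext b fun U => ?_
    rw [← hl U, ← Category.assoc]
    exact congrArg (· ≫ φ.coneMap) ((baseCover b).ι_glueMorphisms l _ U)
  exact ⟨L, hL, by rw [← coneMap_coneProj φ, ← Category.assoc, hL, hb]⟩

/-- The cone of a quotient `N = M / K` is the inverse image of the zero section of the cone of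
`K`. -/
lemma isPullback_coneMap (hφ : ∀ U, Function.Surjective (φ.app U))
    (hex : ∀ U m, φ.app U m = 0 ↔ ∃ κ, i.app U κ = m) :
    IsPullback φ.coneMap N.coneProj i.coneMap K.zeroSection :=
  ⟨⟨coneMap_comm φ i hex⟩, ⟨PullbackCone.IsLimit.mk _
    (fun s => (exists_lift_coneMap φ i hφ hex s.fst s.snd s.condition).choose)
    (fun s => (exists_lift_coneMap φ i hφ hex s.fst s.snd s.condition).choose_spec.1)
    (fun s => (exists_lift_coneMap φ i hφ hex s.fst s.snd s.condition).choose_spec.2)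
    (fun s _ h _ => coneMap_mono φ hφ (h.trans
      (exists_lift_coneMap φ i hφ hex s.fst s.snd s.condition).choose_spec.1.symm))⟩⟩

end Scheme.AffMod

end AlgebraicGeometry
end

/-! ### Gluing functions, restriction of generators, sections of dual sheaves. -/

noncomputable section

open CategoryTheory CategoryTheory.Limits AlgebraicGeometry Opposite TopologicalSpace

namespace AlgebraicGeometry.Scheme

/-- If a property determines functions uniquely, and functions with this property exist locally,
then they glue. -/
lemma exists_glue {Y : Scheme.{u}} (W : Y.Opens) (Pr : ∀ W' : Y.Opens, Γ(Y, W') → Prop)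
    (res : ∀ {W' W'' : Y.Opens} (h : W'' ≤ W') (t : Γ(Y, W')), Pr W' t → Pr W'' (Y.oRes h t))
    (uniq : ∀ (W' : Y.Opens) (t t' : Γ(Y, W')), Pr W' t → Pr W' t' → t = t')
    (loc : ∀ x ∈ W, ∃ W' ≤ W, x ∈ W' ∧ ∃ t, Pr W' t) :
    ∃ s : Γ(Y, W), ∀ (W' : Y.Opens) (h : W' ≤ W) (t : Γ(Y, W')), Pr W' t → Y.oRes h s = t := by
  choose O hO hx t ht using loc
  have hcov : W ≤ ⨆ x : W, O x.1 x.2 := fun x hx' => Opens.mem_iSup.mpr ⟨⟨x, hx'⟩, hx x hx'⟩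
  obtain ⟨s, hs⟩ : ∃ s : Γ(Y, W), ∀ x : W, Y.oRes (hO x.1 x.2) s = t x.1 x.2 := by
    -- Uniqueness makes the chosen local functions agree on overlaps, with no separate cocycle
    -- check.
    obtain ⟨s, hs, -⟩ := Y.sheaf.existsUnique_gluing' (fun x : W => O x.1 x.2) W
      (fun x => homOfLE (hO x.1 x.2)) hcov (fun x => t x.1 x.2) (by
        intro x y
        exact uniq _ _ _ (res inf_le_left _ (ht x.1 x.2)) (res inf_le_right _ (ht y.1 y.2)))
    exact ⟨s, hs⟩
  refine ⟨s, fun W' h t' ht' => oRes_ext fun x hx' => ?_⟩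
  refine ⟨W' ⊓ O x (h hx'), inf_le_left, ⟨hx', hx x (h hx')⟩, ?_⟩
  refine uniq _ _ _ ?_ (res _ _ ht')
  have h1 : Y.oRes (hO x (h hx')) s = t x (h hx') := hs ⟨x, h hx'⟩
  have h2 := res (inf_le_right : W' ⊓ O x (h hx') ≤ _) _ (ht x (h hx'))
  rw [← h1, oRes_oRes] at h2
  rw [oRes_oRes]
  exact h2

/-- The relation `U ≤ V` means that `U` is a basic open subset of `V`, and only for such pairs are
there restriction maps. Two affine opens are therefore compared on a set that is basic in both. -/
lemma exists_affine_le_inter {X : Scheme.{u}} (V V' : X.AffineZariskiSite) (x : X)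
    (hx : x ∈ V.toOpens) (hx' : x ∈ V'.toOpens) :
    ∃ U : X.AffineZariskiSite, U ≤ V ∧ U ≤ V' ∧ x ∈ U.toOpens := by
  obtain ⟨f, g, hfg, hxf⟩ := exists_basicOpen_le_affine_inter V.2 V'.2 x ⟨hx, hx'⟩
  refine ⟨V.basicOpen f, V.basicOpen_le f, ⟨g, hfg.symm⟩, hxf⟩

lemma exists_affine_mem {X : Scheme.{u}} (O : X.Opens) (x : X) (hx : x ∈ O) :
    ∃ U : X.AffineZariskiSite, U.toOpens ≤ O ∧ x ∈ U.toOpens := by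
  obtain ⟨U, hU, hxU, hUO⟩ := (Opens.isBasis_iff_nbhd.mp X.isBasis_affineOpens) hx
  exact ⟨⟨U, hU⟩, hUO, hxU⟩

lemma exists_affine_le {X : Scheme.{u}} (V V' : X.AffineZariskiSite) (O : X.Opens) (x : X)
    (hx : x ∈ V.toOpens) (hx' : x ∈ V'.toOpens) (hO : x ∈ O) :
    ∃ U : X.AffineZariskiSite, U ≤ V ∧ U ≤ V' ∧ U.toOpens ≤ O ∧ x ∈ U.toOpens := by
  obtain ⟨U₁, h₁, hx₁⟩ := exists_affine_mem O x hO
  obtain ⟨U₂, h₂, h₂', hx₂⟩ := exists_affine_le_inter V U₁ x hx hx₁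
  obtain ⟨U₃, h₃, h₃', hx₃⟩ := exists_affine_le_inter U₂ V' x hx₂ hx'
  exact ⟨U₃, h₃.trans h₂, h₃', (AffineZariskiSite.toOpens_mono (h₃.trans h₂')).trans h₁, hx₃⟩

namespace AffMod

variable {X : Scheme.{u}} (K : X.AffMod)

/-- Every section over `D(f)` becomes a restricted one after multiplication by a power of the unit
`f`. -/
lemma span_res {U V : X.AffineZariskiSite} (h : U ≤ V) {J : Type*} (b : J → K.obj V)
    (hb : Submodule.span Γ(X, V.toOpens) (Set.range b) = ⊤) :
    Submodule.span Γ(X, U.toOpens) (Set.range fun j => K.res h (b j)) = ⊤ := by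
  obtain ⟨f, hf⟩ := id h
  obtain rfl : V.basicOpen f = U := Subtype.ext hf
  have key : ∀ κ : K.obj V, K.res h κ ∈
      Submodule.span Γ(X, (V.basicOpen f).toOpens) (Set.range fun j => K.res h (b j)) := by
    intro κ
    have hκ : κ ∈ Submodule.span Γ(X, V.toOpens) (Set.range b) := by rw [hb]; trivial
    induction hκ using Submodule.span_induction with
    | mem x hx =>
      obtain ⟨j, rfl⟩ := hx
      exact Submodule.subset_span ⟨j, rfl⟩
    | zero => rw [map_zero]; exact Submodule.zero_mem _
    | add x y _ _ hx hy => rw [map_add]; exact Submodule.add_mem _ hx hy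
    | smul r x _ hx => rw [map_smulₛₗ]; exact Submodule.smul_mem _ _ hx
  rw [eq_top_iff]
  intro y _
  obtain ⟨n, x, hx⟩ := K.res_surj V f y
  have h1 := key x
  have h2 : K.res h x = X.ringRes h f ^ n • y := hx
  rw [h2] at h1
  exact (Submodule.smul_mem_iff_of_isUnit _ ((isUnit_ringRes V f).pow n)).mp h1

/-- Clear the denominators of the coefficients by a common power of `f`. A further power makes the
relation hold over `V`, and powers of `f` are units on the smaller set. -/
lemma linearIndependent_res {U V : X.AffineZariskiSite} (h : U ≤ V) {J : Type*} [Fintype J]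
    (b : J → K.obj V) (hb : LinearIndependent Γ(X, V.toOpens) b) (a : J → Γ(X, U.toOpens))
    (ha : ∑ j, a j • K.res h (b j) = 0) (j : J) : a j = 0 := by
  obtain ⟨f, hf⟩ := id h
  obtain rfl : V.basicOpen f = U := Subtype.ext hf
  have hu := isUnit_ringRes V f
  choose n c hc using fun j => ringRes_surj V f (a j)
  let d : J → Γ(X, V.toOpens) := fun j => f ^ (∑ j, n j - n j) * c j
  have hd : ∀ j, X.ringRes h (d j) = X.ringRes h f ^ (∑ j, n j) * a j := by
    intro j
    have h1 : X.ringRes h (c j) = X.ringRes h f ^ n j * a j := hc j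
    rw [map_mul, map_pow, h1, ← mul_assoc, ← pow_add, Nat.sub_add_cancel
      (Finset.single_le_sum (fun _ _ => Nat.zero_le _) (Finset.mem_univ j))]
  have h2 : K.res h (∑ j, d j • b j) = 0 := by
    rw [map_sum]
    simp only [map_smulₛₗ, hd, mul_smul]
    rw [← Finset.smul_sum, ha, smul_zero]
  obtain ⟨N, hN⟩ := K.res_inj V f _ h2
  rw [Finset.smul_sum] at hN
  simp only [smul_smul] at hN
  have h3 := Fintype.linearIndependent_iff.mp hb _ hN j
  have h4 := congrArg (X.ringRes h) h3
  rw [map_mul, hd, map_zero, map_pow, ← mul_assoc, ← pow_add] at h4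
  exact (hu.pow _).mul_right_eq_zero.mp h4

end AffMod

section Dual

variable {Y X : Scheme.{u}} (f : Y ⟶ X)

lemma appLE_res {U V : X.Opens} {W : Y.Opens} (hUV : U ≤ V) (hW : W ≤ f ⁻¹ᵁ U)
    (h : W ≤ f ⁻¹ᵁ V) (c : Γ(X, V)) :
    f.appLE U W hW (X.oRes hUV c) = f.appLE V W h c := by
  have := Scheme.Hom.map_appLE f hW (homOfLE hUV).op
  exact congr($this c)

lemma oRes_appLE {V : X.Opens} {W W' : Y.Opens} (hW' : W' ≤ W)
    (h : W ≤ f ⁻¹ᵁ V) (c : Γ(X, V)) :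
    Y.oRes hW' (f.appLE V W h c) = f.appLE V W' (hW'.trans h) c := by
  have := Scheme.Hom.appLE_map f h (homOfLE hW').op
  exact congr($this c)

lemma oRes_app {V : X.Opens} {W' : Y.Opens} (hW' : W' ≤ f ⁻¹ᵁ V) (c : Γ(X, V)) :
    Y.oRes hW' (f.app V c) = f.appLE V W' hW' c := rfl


section Eval

variable {f} {M : X.AffMod} {W : Y.Opens}

/-- The value of a section of `Hom(f^* M, 𝒪_Y)` at a section of `M`. -/
def dualEval (ν : Γ(dualPullback f M, W)) (V : X.AffineZariskiSite) (m : M.obj V) :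
    Γ(Y, f ⁻¹ᵁ V.toOpens ⊓ W) :=
  Subtype.val (p := fun s => s ∈ (dualPullbackFam f M).sec W) ν ⟨V, m⟩

lemma dualEval_add (ν : Γ(dualPullback f M, W)) (V : X.AffineZariskiSite) (m m' : M.obj V) :
    dualEval ν V (m + m') = dualEval ν V m + dualEval ν V m' :=
  (Subtype.property (p := fun s => s ∈ (dualPullbackFam f M).sec W) ν).1 V m m'

lemma dualEval_smul (ν : Γ(dualPullback f M, W)) (V : X.AffineZariskiSite) (a : Γ(X, V.toOpens))
    (m : M.obj V) :
    dualEval ν V (a • m) = f.appLE V.toOpens _ inf_le_left a * dualEval ν V m :=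
  (Subtype.property (p := fun s => s ∈ (dualPullbackFam f M).sec W) ν).2.1 V a m

lemma dualEval_res (ν : Γ(dualPullback f M, W)) {U V : X.AffineZariskiSite} (h : U ≤ V)
    (m : M.obj V) :
    dualEval ν U (M.res h m) = Y.oRes (inf_le_inf_right W
      (f.preimage_mono (AffineZariskiSite.toOpens_mono h))) (dualEval ν V m) :=
  (Subtype.property (p := fun s => s ∈ (dualPullbackFam f M).sec W) ν).2.2 U V h m

lemma dualEval_zero (ν : Γ(dualPullback f M, W)) (V : X.AffineZariskiSite) :
    dualEval ν V (0 : M.obj V) = 0 := by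
  have := dualEval_add ν V (0 : M.obj V) 0
  rwa [add_zero, left_eq_add] at this

lemma dualEval_sum (ν : Γ(dualPullback f M, W)) (V : X.AffineZariskiSite) {J : Type*}
    (T : Finset J) (m : J → M.obj V) :
    dualEval ν V (∑ j ∈ T, m j) = ∑ j ∈ T, dualEval ν V (m j) := by
  classical
  induction T using Finset.induction_on with
  | empty => exact dualEval_zero ν V
  | insert j T hj ih => rw [Finset.sum_insert hj, Finset.sum_insert hj, ← ih, dualEval_add]

lemma add_dualEval (ν ν' : Γ(dualPullback f M, W)) (V : X.AffineZariskiSite) (m : M.obj V) :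
    dualEval (ν + ν') V m = dualEval ν V m + dualEval ν' V m := rfl

lemma smul_dualEval (r : Γ(Y, W)) (ν : Γ(dualPullback f M, W)) (V : X.AffineZariskiSite)
    (m : M.obj V) : dualEval (r • ν) V m = Y.oRes inf_le_right r * dualEval ν V m := rfl

lemma sRes_dualEval {W' : Y.Opens} (h : W' ≤ W) (ν : Γ(dualPullback f M, W))
    (V : X.AffineZariskiSite) (m : M.obj V) :
    dualEval ((dualPullback f M).sRes h ν) V m = Y.oRes (inf_le_inf_left _ h) (dualEval ν V m) :=
  rfl

lemma dualEval_ext {ν ν' : Γ(dualPullback f M, W)}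
    (h : ∀ (V : X.AffineZariskiSite) (m : M.obj V), dualEval ν V m = dualEval ν' V m) : ν = ν' :=
  Subtype.ext (p := fun s => s ∈ (dualPullbackFam f M).sec W) (funext fun i => h i.1 i.2)

/-- A section of `Hom(f^* M, 𝒪_Y)` from its values. -/
def dualMk (s : ∀ V : X.AffineZariskiSite, M.obj V → Γ(Y, f ⁻¹ᵁ V.toOpens ⊓ W))
    (h1 : ∀ V m m', s V (m + m') = s V m + s V m')
    (h2 : ∀ V a m, s V (a • m) = f.appLE V.toOpens _ inf_le_left a * s V m)
    (h3 : ∀ {U V : X.AffineZariskiSite} (h : U ≤ V) (m : M.obj V),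
      s U (M.res h m) = Y.oRes (inf_le_inf_right W
        (f.preimage_mono (AffineZariskiSite.toOpens_mono h))) (s V m)) :
    Γ(dualPullback f M, W) :=
  Subtype.mk (p := fun s => s ∈ (dualPullbackFam f M).sec W) (fun i => s i.1 i.2)
    ⟨h1, h2, fun _ _ h m => h3 h m⟩

variable {D : X.IdealSheafData}

/-- The section of an ideal sheaf over an affine open given by a function. -/
def idealSection {V : X.AffineZariskiSite} (a : Γ(X, V.toOpens)) (ha : a ∈ D.aff V) :
    D.toAffMod.obj V := Subtype.mk (p := fun a => a ∈ D.aff V) a ha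

/-- A section of `Hom(f^* J, 𝒪_Y)` for an ideal sheaf `J` is linear for local functions. -/
lemma dualEval_local (ν : Γ(dualPullback f D.toAffMod, W))
    {V V' : X.AffineZariskiSite} (O : X.Opens) (hO : O ≤ V.toOpens) (hO' : O ≤ V'.toOpens)
    {J : Type*} [Fintype J] (a : Γ(X, V.toOpens)) (ha : a ∈ D.aff V) (a' : J → Γ(X, V'.toOpens))
    (ha' : ∀ j, a' j ∈ D.aff V') (c : J → Γ(X, O))
    (h : X.oRes hO a = ∑ j, c j * X.oRes hO' (a' j)) (O' : Y.Opens) (hO'' : O' ≤ f ⁻¹ᵁ O)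
    (e : O' ≤ f ⁻¹ᵁ V.toOpens ⊓ W) (e' : O' ≤ f ⁻¹ᵁ V'.toOpens ⊓ W) :
    Y.oRes e (dualEval ν V (idealSection a ha)) =
      ∑ j, f.appLE O O' hO'' (c j) * Y.oRes e' (dualEval ν V' (idealSection (a' j) (ha' j))) := by
  refine oRes_ext fun y hy => ?_
  -- Linearity and restriction are available only along `≤`, so the relation over the arbitrary open
  -- set `O` is tested on affine opens inside `O` that are basic in both `V` and `V'`.
  obtain ⟨U, hU, hU', hUO, hyU⟩ := exists_affine_le V V' O (f y) (e hy).1 (e' hy).1 (hO'' hy)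
  have i1 : f ⁻¹ᵁ U.toOpens ⊓ O' ≤ O' := inf_le_right
  have i2 : f ⁻¹ᵁ U.toOpens ⊓ O' ≤ f ⁻¹ᵁ U.toOpens ⊓ W := inf_le_inf_left _ (e.trans inf_le_right)
  refine ⟨f ⁻¹ᵁ U.toOpens ⊓ O', i1, ⟨hyU, hy⟩, ?_⟩
  have e1 : Y.oRes i1 (Y.oRes e (dualEval ν V (idealSection a ha))) =
      Y.oRes i2 (dualEval ν U (D.toAffMod.res hU (idealSection a ha))) := by
    rw [dualEval_res, oRes_oRes, oRes_oRes]
  have e3 : ∀ j, Y.oRes i1 (Y.oRes e' (dualEval ν V' (idealSection (a' j) (ha' j)))) =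
      Y.oRes i2 (dualEval ν U (D.toAffMod.res hU' (idealSection (a' j) (ha' j)))) := by
    intro j
    rw [dualEval_res, oRes_oRes, oRes_oRes]
  have e2 : D.toAffMod.res hU (idealSection a ha) =
      ∑ j, X.oRes hUO (c j) • D.toAffMod.res hU' (idealSection (a' j) (ha' j)) := by
    have h4 := congrArg (X.oRes hUO) h
    rw [map_sum, oRes_oRes] at h4
    apply Subtype.ext
    refine Eq.trans h4 (Eq.trans (Finset.sum_congr rfl fun j _ => ?_)
      (map_sum (D.aff U).subtype _ _).symm)
    rw [map_mul, oRes_oRes]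
    rfl
  rw [e1, e2, dualEval_sum, map_sum, map_sum]
  refine Finset.sum_congr rfl fun j _ => ?_
  rw [dualEval_smul, map_mul, map_mul, e3, oRes_appLE, oRes_appLE, appLE_res]

end Eval

end Dual

end AlgebraicGeometry.Scheme
end

/-! ### The sheaf `Hom(p^* K, 𝒪(1))`. -/

noncomputable section

open CategoryTheory CategoryTheory.Limits AlgebraicGeometry Opposite TopologicalSpace

namespace AlgebraicGeometry.Scheme.AffMod

section HomTwist

variable {X : Scheme.{u}} (K N : X.AffMod)

/-- The sheaf `Hom(p^* K, 𝒪(1))` on `p : Proj (Sym N) ⟶ X`, as a sheaf of families: a section `s`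
over `W` is given by the functions `s(κ)/m` on `D_+(m) ∩ W`. -/
def homTwistFam : N.proj.FamSheaf where
  I := Σ U : X.AffineZariskiSite, K.obj U × N.obj U
  B i := N.projBasicOpen i.1 i.2.2
  sec W :=
    { carrier := { s |
        (∀ (U : X.AffineZariskiSite) (κ κ' : K.obj U) (m : N.obj U),
          s ⟨U, κ + κ', m⟩ = s ⟨U, κ, m⟩ + s ⟨U, κ', m⟩) ∧
        (∀ (U : X.AffineZariskiSite) (a : Γ(X, U.toOpens)) (κ : K.obj U) (m : N.obj U),
          s ⟨U, a • κ, m⟩ = N.proj.oRes inf_le_left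
            (N.projProj.appLE U.toOpens _ (N.projBasicOpen_le U m) a) * s ⟨U, κ, m⟩) ∧
        (∀ (U : X.AffineZariskiSite) (κ : K.obj U) (m m' : N.obj U),
          N.proj.oRes (inf_le_inf_right W (inf_le_right : N.projBasicOpen U m ⊓
            N.projBasicOpen U m' ≤ _)) (s ⟨U, κ, m'⟩) =
          N.proj.oRes (inf_le_left.trans inf_le_right) (N.ratio U m m') *
            N.proj.oRes (inf_le_inf_right W (inf_le_left : N.projBasicOpen U m ⊓
            N.projBasicOpen U m' ≤ _)) (s ⟨U, κ, m⟩)) ∧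
        (∀ (U V : X.AffineZariskiSite) (h : U ≤ V) (κ : K.obj V) (m : N.obj V),
          s ⟨U, K.res h κ, N.res h m⟩ =
            N.proj.oRes (inf_le_inf_right W (N.projBasicOpen_res h m)) (s ⟨V, κ, m⟩)) }
      add_mem' := by
        rintro s t ⟨h1, h2, h3, h4⟩ ⟨h1', h2', h3', h4'⟩
        refine ⟨fun U κ κ' m => ?_, fun U a κ m => ?_, fun U κ m m' => ?_, fun U V h κ m => ?_⟩
        · simp only [Fam.add_apply, h1, h1']
          exact add_add_add_comm _ _ _ _
        · simp only [Fam.add_apply, h2, h2']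
          exact (mul_add _ _ _).symm
        · simp only [Fam.add_apply, map_add, h3 U κ m m', h3' U κ m m']
          exact (mul_add _ _ _).symm
        · simp only [Fam.add_apply, h4, h4']
          exact (map_add _ _ _).symm
      zero_mem' := by
        refine ⟨fun U κ κ' m => ?_, fun U a κ m => ?_, fun U κ m m' => ?_, fun U V h κ m => ?_⟩
        · exact (add_zero _).symm
        · exact (mul_zero _).symm
        · simp only [Fam.zero_apply, map_zero, mul_zero]
        · exact (map_zero _).symm
      smul_mem' := by
        rintro c s ⟨h1, h2, h3, h4⟩
        refine ⟨fun U κ κ' m => ?_, fun U a κ m => ?_, fun U κ m m' => ?_, fun U V h κ m => ?_⟩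
        · simp only [Fam.smul_apply, h1]
          exact mul_add _ _ _
        · simp only [Fam.smul_apply, h2]
          exact mul_left_comm _ _ _
        · simp only [Fam.smul_apply, map_mul, h3 U κ m m']
          rw [oRes_oRes, oRes_oRes]
          exact mul_left_comm _ _ _
        · simp only [Fam.smul_apply, h4]
          rw [map_mul, oRes_oRes] }
  res_mem := by
    rintro W' W hW s ⟨h1, h2, h3, h4⟩
    refine ⟨fun U κ κ' m => ?_, fun U a κ m => ?_, fun U κ m m' => ?_, fun U V h κ m => ?_⟩
    · simp only [Fam.res_apply, h1]
      exact map_add _ _ _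
    · simp only [Fam.res_apply, h2]
      rw [map_mul, oRes_oRes]
    · simp only [Fam.res_apply]
      have := congrArg (N.proj.oRes (inf_le_inf_left (N.projBasicOpen U m ⊓
            N.projBasicOpen U m') hW)) (h3 U κ m m')
      rw [map_mul, oRes_oRes, oRes_oRes, oRes_oRes] at this
      rw [oRes_oRes, oRes_oRes]
      exact this
    · simp only [Fam.res_apply, h4]
      rw [oRes_oRes, oRes_oRes]
  mem_of_local := by
    intro W s H
    refine ⟨fun U κ κ' m => ?_, fun U a κ m => ?_, fun U κ m m' => ?_, fun U V h κ m => ?_⟩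
    · refine oRes_ext fun x hx => ?_
      obtain ⟨W', hW, hx', H'⟩ := H x hx.2
      refine ⟨N.projBasicOpen U m ⊓ W', inf_le_inf_left _ hW, ⟨hx.1, hx'⟩, ?_⟩
      rw [map_add]
      exact H'.1 U κ κ' m
    · refine oRes_ext fun x hx => ?_
      obtain ⟨W', hW, hx', H'⟩ := H x hx.2
      refine ⟨N.projBasicOpen U m ⊓ W', inf_le_inf_left _ hW, ⟨hx.1, hx'⟩, ?_⟩
      rw [map_mul, oRes_oRes]
      exact H'.2.1 U a κ m
    · refine oRes_ext fun x hx => ?_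
      obtain ⟨W', hW, hx', H'⟩ := H x hx.2
      refine ⟨(N.projBasicOpen U m ⊓ N.projBasicOpen U m') ⊓ W', inf_le_inf_left _ hW,
        ⟨hx.1, hx'⟩, ?_⟩
      have := H'.2.2.1 U κ m m'
      simp only [Fam.res_apply] at this
      rw [oRes_oRes, oRes_oRes] at this
      rw [map_mul, oRes_oRes, oRes_oRes, oRes_oRes]
      exact this
    · refine oRes_ext fun x hx => ?_
      obtain ⟨W', hW, hx', H'⟩ := H x hx.2
      refine ⟨N.projBasicOpen U (N.res h m) ⊓ W', inf_le_inf_left _ hW, ⟨hx.1, hx'⟩, ?_⟩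
      have := H'.2.2.2 U V h κ m
      simp only [Fam.res_apply] at this
      rw [oRes_oRes] at this ⊢
      exact this

/-- The sheaf `Hom(p^* K, 𝒪(1))` on `p : Proj (Sym N) ⟶ X`. -/
def homTwist : N.proj.Modules := (homTwistFam K N).toModules

variable {K N} {W : N.proj.Opens}

/-- The function `s(κ)/m` for a section `s` of `Hom(p^* K, 𝒪(1))`. -/
def homEval (s : Γ(homTwist K N, W)) (U : X.AffineZariskiSite) (κ : K.obj U) (m : N.obj U) :
    Γ(N.proj, N.projBasicOpen U m ⊓ W) :=
  Subtype.val (p := fun s => s ∈ (homTwistFam K N).sec W) s ⟨U, κ, m⟩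

lemma homEval_add (s : Γ(homTwist K N, W)) (U : X.AffineZariskiSite) (κ κ' : K.obj U)
    (m : N.obj U) : homEval s U (κ + κ') m = homEval s U κ m + homEval s U κ' m :=
  (Subtype.property (p := fun s => s ∈ (homTwistFam K N).sec W) s).1 U κ κ' m

lemma homEval_smul (s : Γ(homTwist K N, W)) (U : X.AffineZariskiSite) (a : Γ(X, U.toOpens))
    (κ : K.obj U) (m : N.obj U) : homEval s U (a • κ) m = N.proj.oRes inf_le_left
      (N.projProj.appLE U.toOpens _ (N.projBasicOpen_le U m) a) * homEval s U κ m :=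
  (Subtype.property (p := fun s => s ∈ (homTwistFam K N).sec W) s).2.1 U a κ m

lemma homEval_mul (s : Γ(homTwist K N, W)) (U : X.AffineZariskiSite) (κ : K.obj U)
    (m m' : N.obj U) : N.proj.oRes (inf_le_inf_right W (inf_le_right : N.projBasicOpen U m ⊓
            N.projBasicOpen U m' ≤ _)) (homEval s U κ m') =
          N.proj.oRes (inf_le_left.trans inf_le_right) (N.ratio U m m') *
            N.proj.oRes (inf_le_inf_right W (inf_le_left : N.projBasicOpen U m ⊓
            N.projBasicOpen U m' ≤ _)) (homEval s U κ m) :=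
  (Subtype.property (p := fun s => s ∈ (homTwistFam K N).sec W) s).2.2.1 U κ m m'

lemma homEval_res (s : Γ(homTwist K N, W)) {U V : X.AffineZariskiSite} (h : U ≤ V) (κ : K.obj V)
    (m : N.obj V) : homEval s U (K.res h κ) (N.res h m) =
      N.proj.oRes (inf_le_inf_right W (N.projBasicOpen_res h m)) (homEval s V κ m) :=
  (Subtype.property (p := fun s => s ∈ (homTwistFam K N).sec W) s).2.2.2 U V h κ m

lemma add_homEval (s s' : Γ(homTwist K N, W)) (U : X.AffineZariskiSite) (κ : K.obj U)
    (m : N.obj U) : homEval (s + s') U κ m = homEval s U κ m + homEval s' U κ m := rfl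

lemma zero_homEval (U : X.AffineZariskiSite) (κ : K.obj U) (m : N.obj U) :
    homEval (0 : Γ(homTwist K N, W)) U κ m = 0 := rfl

lemma smul_homEval (r : Γ(N.proj, W)) (s : Γ(homTwist K N, W)) (U : X.AffineZariskiSite)
    (κ : K.obj U) (m : N.obj U) :
    homEval (r • s) U κ m = N.proj.oRes inf_le_right r * homEval s U κ m := rfl

lemma sRes_homEval {W' : N.proj.Opens} (h : W' ≤ W) (s : Γ(homTwist K N, W))
    (U : X.AffineZariskiSite) (κ : K.obj U) (m : N.obj U) :
    homEval ((homTwist K N).sRes h s) U κ m =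
      N.proj.oRes (inf_le_inf_left _ h) (homEval s U κ m) := rfl

lemma homEval_ext {s s' : Γ(homTwist K N, W)}
    (h : ∀ (U : X.AffineZariskiSite) (κ : K.obj U) (m : N.obj U),
      homEval s U κ m = homEval s' U κ m) : s = s' :=
  Subtype.ext (p := fun s => s ∈ (homTwistFam K N).sec W) (funext fun i => h i.1 i.2.1 i.2.2)

lemma homEval_zero (s : Γ(homTwist K N, W)) (U : X.AffineZariskiSite) (m : N.obj U) :
    homEval s U (0 : K.obj U) m = 0 := by
  have := homEval_add s U (0 : K.obj U) 0 m
  rwa [add_zero, left_eq_add] at this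

/-- A section of `Hom(p^* K, 𝒪(1))` from its values. -/
def homMk (s : ∀ U : X.AffineZariskiSite, K.obj U → ∀ m : N.obj U,
      Γ(N.proj, N.projBasicOpen U m ⊓ W))
    (h1 : ∀ U κ κ' m, s U (κ + κ') m = s U κ m + s U κ' m)
    (h2 : ∀ U a κ m, s U (a • κ) m = N.proj.oRes inf_le_left
      (N.projProj.appLE U.toOpens _ (N.projBasicOpen_le U m) a) * s U κ m)
    (h3 : ∀ U κ m m', N.proj.oRes (inf_le_inf_right W (inf_le_right : N.projBasicOpen U m ⊓
            N.projBasicOpen U m' ≤ _)) (s U κ m') =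
          N.proj.oRes (inf_le_left.trans inf_le_right) (N.ratio U m m') *
            N.proj.oRes (inf_le_inf_right W (inf_le_left : N.projBasicOpen U m ⊓
            N.projBasicOpen U m' ≤ _)) (s U κ m))
    (h4 : ∀ {U V : X.AffineZariskiSite} (h : U ≤ V) (κ : K.obj V) (m : N.obj V),
      s U (K.res h κ) (N.res h m) =
        N.proj.oRes (inf_le_inf_right W (N.projBasicOpen_res h m)) (s V κ m)) :
    Γ(homTwist K N, W) :=
  Subtype.mk (p := fun s => s ∈ (homTwistFam K N).sec W) (fun i => s i.1 i.2.1 i.2.2)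
    ⟨h1, h2, h3, fun _ _ h m => h4 h m⟩

/-- A section of `Hom(p^* K, 𝒪(1))` over an open subset of `D_+(m)` is determined by its values at
`m` on generators of `K`. -/
lemma homEval_eq_zero (s : Γ(homTwist K N, W)) (U : X.AffineZariskiSite) {J : Type*} [Finite J]
    (b : J → K.obj U) (hb : Submodule.span Γ(X, U.toOpens) (Set.range b) = ⊤) (m : N.obj U)
    (hW : W ≤ N.projBasicOpen U m) (h : ∀ j, homEval s U (b j) m = 0) : s = 0 := by
  refine homEval_ext fun U' κ' m' => oRes_ext fun y hy => ?_
  obtain ⟨U'', h', h'', hy'⟩ := exists_affine_le_inter U U' (N.projProj y)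
    (N.projBasicOpen_le U m (hW hy.2)) (N.projBasicOpen_le U' m' hy.1)
  have hym := N.mem_projBasicOpen_res h' m y (hW hy.2) hy'
  have hym' := N.mem_projBasicOpen_res h'' m' y hy.1 hy'
  have key : ∀ κ : K.obj U'', homEval s U'' κ (N.res h' m) = 0 := by
    intro κ
    have hκ : κ ∈ Submodule.span Γ(X, U''.toOpens) (Set.range fun j => K.res h' (b j)) := by
      rw [K.span_res h' b hb]; trivial
    induction hκ using Submodule.span_induction with
    | mem x hx =>
      obtain ⟨j, rfl⟩ := hx
      simp only
      rw [homEval_res, h, map_zero]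
    | zero => exact homEval_zero _ _ _
    | add x y _ _ hx hy => rw [homEval_add, hx, hy, add_zero]
    | smul r x _ hx => rw [homEval_smul, hx, mul_zero]
  -- The cocycle rule carries the vanishing at `m` over to an arbitrary `m'`.
  have h1 := homEval_mul s U'' (K.res h'' κ') (N.res h' m) (N.res h'' m')
  rw [key, map_zero, mul_zero, homEval_res, oRes_oRes] at h1
  refine ⟨N.projBasicOpen U'' (N.res h' m) ⊓ N.projBasicOpen U'' (N.res h'' m') ⊓ W, _,
    ⟨⟨hym, hym'⟩, hy.2⟩, h1.trans ?_⟩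
  rw [zero_homEval, map_zero]

end HomTwist

end AlgebraicGeometry.Scheme.AffMod
end

/-! ### Local coefficients and relations in the ideal of `P(N)` in `P(M)`. -/

noncomputable section

open CategoryTheory CategoryTheory.Limits AlgebraicGeometry Opposite TopologicalSpace

namespace AlgebraicGeometry.Scheme

/-- The coefficients of local relations between a regular family in an ideal lie in the ideal. -/
lemma IdealSheafData.exists_mem_of_syzygy {P : Scheme.{u}} (I : P.IdealSheafData)
    (D : P.AffineZariskiSite) {n : ℕ} (δ : Fin n → Γ(P, D.toOpens)) (hr : IsRegularFamily δ)
    (hδ : ∀ j, δ j ∈ I.aff D) (O : P.Opens) (hO : O ≤ D.toOpens) (c : Fin n → Γ(P, O))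
    (hc : ∑ j, c j * P.oRes hO (δ j) = 0) (z : P) (hz : z ∈ O) :
    ∃ (O' : P.AffineZariskiSite) (hO' : O'.toOpens ≤ O), z ∈ O'.toOpens ∧
      ∀ j, P.oRes hO' (c j) ∈ I.aff O' := by
  -- Regularity is known only for functions on all of `D`. So the relation on `O` is restricted to a
  -- basic open `D(g) ⊆ O`, and its coefficients are extended to `D` after multiplication by powers
  -- of `g`.
  obtain ⟨O₁, hO₁, hzO₁⟩ := exists_affine_mem O z hz
  obtain ⟨O₂, hO₂, h₂₁, hz⟩ := exists_affine_le_inter D O₁ z (hO hz) hzO₁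
  have hO₂O : O₂.toOpens ≤ O := (AffineZariskiSite.toOpens_mono h₂₁).trans hO₁
  obtain ⟨g, hg⟩ := id hO₂
  obtain rfl : D.basicOpen g = O₂ := Subtype.ext hg
  refine ⟨D.basicOpen g, hO₂O, hz, fun j => ?_⟩
  have hu := isUnit_ringRes D g
  choose N' d hd using fun j => ringRes_surj D g (P.oRes hO₂O (c j))
  let S := ∑ j, N' j
  let d' : Fin n → Γ(P, D.toOpens) := fun j => g ^ (S - N' j) * d j
  have hd' : ∀ j, P.ringRes hO₂ (d' j) = P.ringRes hO₂ g ^ S * P.oRes hO₂O (c j) := by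
    intro j
    have h1 : P.ringRes hO₂ (d j) = P.ringRes hO₂ g ^ N' j * P.oRes hO₂O (c j) := hd j
    rw [map_mul, h1, map_pow, ← mul_assoc, ← pow_add, Nat.sub_add_cancel
      (Finset.single_le_sum (fun _ _ => Nat.zero_le _) (Finset.mem_univ j))]
  have h2 : P.ringRes hO₂ (∑ j, d' j * δ j) = 0 := by
    have h3 := congrArg (fun t => P.ringRes hO₂ g ^ S * P.oRes hO₂O t) hc
    simp only [map_zero, mul_zero, map_sum, Finset.mul_sum] at h3
    rw [map_sum]
    refine Eq.trans (Finset.sum_congr rfl fun j _ => ?_) h3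
    rw [map_mul, hd', map_mul, oRes_oRes, ← mul_assoc]
  obtain ⟨k, hk⟩ := ringRes_inj D g _ h2
  simp only [Finset.mul_sum, ← mul_assoc] at hk
  -- The relation now holds on `D`, so the modified coefficients lie in the ideal. On `D(g)` they
  -- differ from the original ones by units.
  have h4 := hr.syzygy _ hk j
  have h5 : g ^ k * d' j ∈ I.aff D := by
    refine Ideal.span_le.mpr ?_ h4
    rintro _ ⟨l, rfl⟩
    exact hδ l
  have h6 := I.ringRes_mem hO₂ h5
  have h7 : P.ringRes hO₂ (g ^ k * d' j) = P.ringRes hO₂ g ^ (k + S) * P.oRes hO₂O (c j) := by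
    rw [map_mul, hd', map_pow, pow_add, mul_assoc]
  rw [h7, (Ideal.unit_mul_mem_iff_mem _ (hu.pow _))] at h6
  exact h6

namespace AffMod

variable {X : Scheme.{u}}

/-- The open subset `D_+(m)` of `Proj (Sym M)` as an affine open. -/
def projBasicAffine (M : X.AffMod) (U : X.AffineZariskiSite) (m : M.obj U) :
    M.proj.AffineZariskiSite :=
  ⟨M.projBasicOpen U m, M.isAffineOpen_projBasicOpen U m⟩

variable {K M N : X.AffMod} (i : K.Hom M) (φ : M.Hom N)
  (hφ : ∀ U, Function.Surjective (φ.app U))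

lemma mem_ker_aff_iff (V : M.proj.AffineZariskiSite) (a : Γ(M.proj, V.toOpens)) :
    a ∈ (φ.projMap hφ).ker.aff V ↔ (φ.projMap hφ).app V.toOpens a = 0 := by
  have := isClosedImmersion_projMap φ hφ
  rw [IdealSheafData.aff, Scheme.Hom.ker_apply]
  rfl

lemma mem_ker_projBasicAffine_iff (U : X.AffineZariskiSite) (m : M.obj U)
    (a : Γ(M.proj, M.projBasicOpen U m)) :
    a ∈ (φ.projMap hφ).ker.aff (M.projBasicAffine U m) ↔
    (φ.projMap hφ).appLE (M.projBasicOpen U m) (N.projBasicOpen U (φ.app U m))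
      (projMap_preimage φ hφ U m).ge a = 0 :=
  (mem_ker_aff_iff φ hφ (M.projBasicAffine U m) a).trans (appLE_eq_zero_iff φ hφ U m a).symm

lemma ratio_mem_ker (hex : ∀ U m, φ.app U m = 0 ↔ ∃ κ, i.app U κ = m)
    (U : X.AffineZariskiSite) (κ : K.obj U) (m : M.obj U) :
    M.ratio U (i.app U κ) m ∈ (φ.projMap hφ).ker.aff (M.projBasicAffine U m) :=
  (mem_ker_projBasicAffine_iff φ hφ U m _).mpr (appLE_ratio_eq_zero i φ hφ hex U κ m)

/-- The sections of the ideal of `P(N)` in `P(M)` are locally combinations of functions `κ/m`. -/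
lemma exists_local_coeff (hex : ∀ U m, φ.app U m = 0 ↔ ∃ κ, i.app U κ = m)
    {J : Type*} [Fintype J] (U : X.AffineZariskiSite) (b : J → K.obj U)
    (hb : Submodule.span Γ(X, U.toOpens) (Set.range b) = ⊤) (m : M.obj U)
    (V : M.proj.AffineZariskiSite) (a : Γ(M.proj, V.toOpens))
    (ha : a ∈ (φ.projMap hφ).ker.aff V) (z : M.proj) (hz : z ∈ V.toOpens)
    (hz' : z ∈ M.projBasicOpen U m) :
    ∃ (O : M.proj.Opens) (hO : O ≤ V.toOpens) (hO' : O ≤ M.projBasicOpen U m), z ∈ O ∧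
      ∃ c : J → Γ(M.proj, O), M.proj.oRes hO a =
        ∑ j, c j * M.proj.oRes hO' (M.ratio U (i.app U (b j)) m) := by
  let D := M.projBasicAffine U m
  obtain ⟨O, hO, hOV, hzO⟩ := exists_affine_le_inter D V z hz' hz
  obtain ⟨g, hg⟩ := id hO
  obtain rfl : D.basicOpen g = O := Subtype.ext hg
  have h1 := (φ.projMap hφ).ker.ringRes_mem hOV ha
  obtain ⟨n, a', ha', h2⟩ := (φ.projMap hφ).ker.aff_surj D g h1
  -- Up to a power of `g`, the function `a` comes from an element `a'` of the ideal on `D_+(m)`,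
  -- whose generators are known.
  have h3 := mem_span_ratio i φ hφ hex U b hb m a'
    ((mem_ker_projBasicAffine_iff φ hφ U m a').mp ha')
  obtain ⟨d, hd⟩ := (Ideal.mem_span_range_iff_exists_fun).mp h3
  obtain ⟨v, hv⟩ := ((isUnit_ringRes D g).pow n).exists_left_inv
  refine ⟨(D.basicOpen g).toOpens, AffineZariskiSite.toOpens_mono hOV,
    AffineZariskiSite.toOpens_mono hO, hzO, fun j => v * M.proj.ringRes hO (d j), ?_⟩
  have h4 : M.proj.ringRes hOV a = v * M.proj.ringRes hO a' := by
    rw [h2, ← mul_assoc, hv, one_mul]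
  refine h4.trans ?_
  rw [← hd]
  refine (congrArg (v * ·) (map_sum (M.proj.ringRes hO) _ _)).trans ?_
  rw [Finset.mul_sum]
  refine Finset.sum_congr rfl fun j _ => ?_
  rw [mul_assoc]
  exact congrArg (v * ·) (map_mul (M.proj.ringRes hO) _ _)

/-- The coefficients of relations between the functions `κ/m` for a regular family vanish on
`P(N)`. -/
lemma appLE_syzygy (hex : ∀ U m, φ.app U m = 0 ↔ ∃ κ, i.app U κ = m)
    {n : ℕ} (U : X.AffineZariskiSite) (b : Fin n → K.obj U)
    (hr : IsRegularFamily fun j => SymmetricAlgebra.ι Γ(X, U.toOpens) _ (i.app U (b j)))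
    (m : M.obj U) (O : M.proj.Opens) (hO : O ≤ M.projBasicOpen U m) (c : Fin n → Γ(M.proj, O))
    (hc : ∑ j, c j * M.proj.oRes hO (M.ratio U (i.app U (b j)) m) = 0) (W : N.proj.Opens)
    (hW : W ≤ φ.projMap hφ ⁻¹ᵁ O) (j : Fin n) : (φ.projMap hφ).appLE O W hW (c j) = 0 := by
  refine oRes_ext fun y hy => ?_
  obtain ⟨O', hO', hz, h⟩ := (φ.projMap hφ).ker.exists_mem_of_syzygy (M.projBasicAffine U m)
    (fun j => M.ratio U (i.app U (b j)) m) (M.isRegularFamily_ratio U m _ hr)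
    (fun j => ratio_mem_ker i φ hφ hex U (b j) m) O hO c hc (φ.projMap hφ y) (hW hy)
  refine ⟨φ.projMap hφ ⁻¹ᵁ O'.toOpens ⊓ W, inf_le_right, ⟨hz, hy⟩, ?_⟩
  have h6 := (mem_ker_aff_iff φ hφ _ _).mp (h j)
  rw [map_zero, oRes_appLE]
  have h8 := congrArg (N.proj.oRes (inf_le_left : φ.projMap hφ ⁻¹ᵁ O'.toOpens ⊓ W ≤ _)) h6
  rw [map_zero, oRes_app, appLE_res] at h8
  exact h8

end AffMod

end AlgebraicGeometry.Scheme
end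

/-! ### From the normal sheaf to `Hom(p^* K, 𝒪(1))`. -/

noncomputable section

open CategoryTheory CategoryTheory.Limits AlgebraicGeometry Opposite TopologicalSpace

namespace AlgebraicGeometry.Scheme.AffMod

variable {X : Scheme.{u}} {K M N : X.AffMod} (i : K.Hom M) (φ : M.Hom N)
  (hφ : ∀ U, Function.Surjective (φ.app U))
  (hex : ∀ U m, φ.app U m = 0 ↔ ∃ κ, i.app U κ = m)

/-- The function `κ/m` as a section of the ideal of `P(N)` in `P(M)`. -/
def ratioSection (U : X.AffineZariskiSite) (κ : K.obj U) (m : M.obj U) :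
    (φ.projMap hφ).ker.toAffMod.obj (M.projBasicAffine U m) :=
  idealSection (M.ratio U (i.app U κ) m) (ratio_mem_ker i φ hφ hex U κ m)

lemma ratioSection_add (U : X.AffineZariskiSite) (κ κ' : K.obj U) (m : M.obj U) :
    ratioSection i φ hφ hex U (κ + κ') m =
      ratioSection i φ hφ hex U κ m + ratioSection i φ hφ hex U κ' m := by
  apply Subtype.ext
  refine Eq.trans ?_ (M.ratio_add U (i.app U κ) (i.app U κ') m)
  rw [← map_add]
  rfl

lemma ratioSection_smul (U : X.AffineZariskiSite) (a : Γ(X, U.toOpens)) (κ : K.obj U)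
    (m : M.obj U) : ratioSection i φ hφ hex U (a • κ) m =
      (show Γ(M.proj, (M.projBasicAffine U m).toOpens) from
        M.projProj.appLE U.toOpens (M.projBasicOpen U m) (M.projBasicOpen_le U m) a) •
        ratioSection i φ hφ hex U κ m := by
  apply Subtype.ext
  refine Eq.trans ?_ (M.ratio_smul U a (i.app U κ) m)
  rw [← map_smul]
  rfl

lemma appLE_appLE {A B C : Scheme.{u}} (f : A ⟶ B) (g : B ⟶ C) (h : A ⟶ C) (e : f ≫ g = h)
    (U : C.Opens) (V : B.Opens) (W : A.Opens) (h₁ : V ≤ g ⁻¹ᵁ U) (h₂ : W ≤ f ⁻¹ᵁ V)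
    (h₃ : W ≤ h ⁻¹ᵁ U) (a : Γ(C, U)) : f.appLE V W h₂ (g.appLE U V h₁ a) = h.appLE U W h₃ a := by
  subst e
  exact congr($(Scheme.Hom.appLE_comp_appLE f g U V W h₁ h₂) a)

section Val

variable {W : N.proj.Opens} (ν : Γ(dualPullback (φ.projMap hφ) (φ.projMap hφ).ker.toAffMod, W))

/-- The value of a section of the normal sheaf at the function `κ/m`. -/
def normalVal (U : X.AffineZariskiSite) (κ : K.obj U) (m : M.obj U) :
    Γ(N.proj, φ.projMap hφ ⁻¹ᵁ M.projBasicOpen U m ⊓ W) :=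
  dualEval ν (M.projBasicAffine U m) (ratioSection i φ hφ hex U κ m)

lemma normalVal_add (U : X.AffineZariskiSite) (κ κ' : K.obj U) (m : M.obj U) :
    normalVal i φ hφ hex ν U (κ + κ') m =
      normalVal i φ hφ hex ν U κ m + normalVal i φ hφ hex ν U κ' m := by
  unfold normalVal
  rw [ratioSection_add]
  exact dualEval_add ν _ _ _

lemma normalVal_smul (U : X.AffineZariskiSite) (a : Γ(X, U.toOpens)) (κ : K.obj U) (m : M.obj U)
    (h : φ.projMap hφ ⁻¹ᵁ M.projBasicOpen U m ⊓ W ≤ N.projProj ⁻¹ᵁ U.toOpens) :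
    normalVal i φ hφ hex ν U (a • κ) m =
      N.projProj.appLE U.toOpens _ h a * normalVal i φ hφ hex ν U κ m := by
  unfold normalVal
  rw [ratioSection_smul]
  refine (dualEval_smul ν _ _ _).trans ?_
  congr 1
  exact appLE_appLE _ _ _ (projMap_projProj φ hφ) _ _ _ (M.projBasicOpen_le U m) inf_le_left h a

/-- This is where `𝒪(1)` enters: from `κ/m' = (m/m') (κ/m)` and linearity, the values of `ν`
transform like the quotients `s/m` of a section `s` of `𝒪(1)`. -/
lemma normalVal_mul (U : X.AffineZariskiSite) (κ : K.obj U) (m m' : M.obj U) {n n' : N.obj U}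
    (hn : φ.app U m = n) (hn' : φ.app U m' = n') (O : N.proj.Opens)
    (e : O ≤ φ.projMap hφ ⁻¹ᵁ M.projBasicOpen U m ⊓ W)
    (e' : O ≤ φ.projMap hφ ⁻¹ᵁ M.projBasicOpen U m' ⊓ W)
    (e'' : O ≤ N.projBasicOpen U n') :
    N.proj.oRes e' (normalVal i φ hφ hex ν U κ m') =
      N.proj.oRes e'' (N.ratio U n n') *
        N.proj.oRes e (normalVal i φ hφ hex ν U κ m) := by
  subst hn hn'
  have h1 := M.ratio_mul U (i.app U κ) m' m
  have h2 : O ≤ φ.projMap hφ ⁻¹ᵁ (M.projBasicOpen U m' ⊓ M.projBasicOpen U m) :=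
    fun y hy => ⟨(e' hy).1, (e hy).1⟩
  have h3 := dualEval_local ν (V := M.projBasicAffine U m') (V' := M.projBasicAffine U m)
    (M.projBasicOpen U m' ⊓ M.projBasicOpen U m) inf_le_left inf_le_right (J := Unit)
    (M.ratio U (i.app U κ) m') (ratio_mem_ker i φ hφ hex U κ m')
    (fun _ => M.ratio U (i.app U κ) m) (fun _ => ratio_mem_ker i φ hφ hex U κ m)
    (fun _ => M.proj.oRes inf_le_left (M.ratio U m m')) (by
      refine h1.trans ?_
      rw [Fintype.sum_unique]
      rfl) O h2 e' e
  rw [Fintype.sum_unique] at h3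
  refine h3.trans ?_
  rw [← ratio_map φ hφ, oRes_appLE, appLE_res _ _ _ fun y hy => (e' hy).1]
  rfl

/-- The function `κ/m` over `V` restricts to the corresponding one over `U`, so `dualEval_local`
applies with the single coefficient `1`. -/
lemma normalVal_res {U V : X.AffineZariskiSite} (h : U ≤ V) (κ : K.obj V) (m : M.obj V)
    (O : N.proj.Opens) (e : O ≤ φ.projMap hφ ⁻¹ᵁ M.projBasicOpen U (M.res h m) ⊓ W)
    (e' : O ≤ φ.projMap hφ ⁻¹ᵁ M.projBasicOpen V m ⊓ W) :
    N.proj.oRes e (normalVal i φ hφ hex ν U (K.res h κ) (M.res h m)) =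
      N.proj.oRes e' (normalVal i φ hφ hex ν V κ m) := by
  have h3 := dualEval_local ν (V := M.projBasicAffine U (M.res h m)) (V' := M.projBasicAffine V m)
    (M.projBasicOpen U (M.res h m)) le_rfl (M.projBasicOpen_res h m) (J := Unit)
    (M.ratio U (i.app U (K.res h κ)) (M.res h m)) (ratio_mem_ker i φ hφ hex U _ _)
    (fun _ => M.ratio V (i.app V κ) m) (fun _ => ratio_mem_ker i φ hφ hex V κ m)
    (fun _ => 1) (by
      rw [Fintype.sum_unique, one_mul]
      refine (oRes_refl _).trans (Eq.trans ?_ (M.ratio_res h (i.app V κ) m _).symm)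
      rw [i.naturality]) O (e.trans inf_le_left) e e'
  rw [Fintype.sum_unique, map_one, one_mul] at h3
  exact h3

lemma projBasicOpen_inf_le (U : X.AffineZariskiSite) (m : M.obj U) {n : N.obj U}
    (hn : φ.app U m = n) (W : N.proj.Opens) :
    N.projBasicOpen U n ⊓ W ≤ φ.projMap hφ ⁻¹ᵁ M.projBasicOpen U m ⊓ W := by
  subst hn
  rw [projMap_preimage]

/-- A section of the normal sheaf as a homomorphism to the twisting sheaf. -/
def normalToHomSection : Γ(homTwist K N, W) :=
  -- Sections `n` of `N` are lifted to `M` by an arbitrary choice. The value does not depend on it,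
  -- since for two lifts of the same `n` the factor in `normalVal_mul` is `n/n = 1`.
  homMk (fun U κ n => N.proj.oRes
      (projBasicOpen_inf_le φ hφ U (Function.surjInv (hφ U) n) (Function.surjInv_eq (hφ U) n) W)
      (normalVal i φ hφ hex ν U κ (Function.surjInv (hφ U) n)))
    (fun U κ κ' n => by rw [normalVal_add, map_add])
    (fun U a κ n => by
      rw [normalVal_smul i φ hφ hex ν U a κ _ (inf_le_left.trans
        (by rw [projMap_preimage]; exact N.projBasicOpen_le U _)), map_mul, oRes_appLE, oRes_appLE])
    (fun U κ n n' => by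
      rw [oRes_oRes, oRes_oRes]
      exact normalVal_mul i φ hφ hex ν U κ _ _ (Function.surjInv_eq (hφ U) n)
        (Function.surjInv_eq (hφ U) n') _ _ _ _)
    (fun {U V} h κ n => by
      have hm := Function.surjInv_eq (hφ V) n
      have h1 : φ.app U (M.res h (Function.surjInv (hφ V) n)) = N.res h n := by
        rw [φ.naturality, hm]
      have h2 := projBasicOpen_inf_le φ hφ U _ h1 W
      rw [oRes_oRes, ← normalVal_res i φ hφ hex ν h κ _ _ h2]
      refine (normalVal_mul i φ hφ hex ν U _ _ _ h1 (Function.surjInv_eq (hφ U) _) _ h2 _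
        inf_le_left).trans ?_
      rw [ratio_self, map_one, one_mul])

/-- Frees the construction from the chosen lift: any `m` over the given section computes the value.
-/
lemma normalToHomSection_eval (U : X.AffineZariskiSite) (κ : K.obj U) (m : M.obj U) :
    homEval (normalToHomSection i φ hφ hex ν) U κ (φ.app U m) =
      N.proj.oRes (projBasicOpen_inf_le φ hφ U m rfl W) (normalVal i φ hφ hex ν U κ m) := by
  refine (normalVal_mul i φ hφ hex ν U κ m _ rfl (Function.surjInv_eq (hφ U) (φ.app U m)) _
    (projBasicOpen_inf_le φ hφ U m rfl W) _ inf_le_left).trans ?_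
  rw [ratio_self, map_one, one_mul]

end Val

/-- The morphism from the normal sheaf of `P(N)` in `P(M)` to `Hom(p^* K, 𝒪(1))`. -/
def normalToHom : normalSheaf (φ.projMap hφ) ⟶ homTwist K N :=
  Modules.homOfSections (A := dualPullback (φ.projMap hφ) (φ.projMap hφ).ker.toAffMod)
    (fun _ =>
      { toFun := fun ν => normalToHomSection i φ hφ hex ν
        map_add' := fun _ _ => homEval_ext fun _ _ _ => map_add _ _ _
        map_smul' := fun _ _ => homEval_ext fun _ _ _ =>
          (map_mul _ _ _).trans (congrArg (· * _) (oRes_oRes _ _ _)) })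
    (fun _ _ => homEval_ext fun _ _ _ => (oRes_oRes _ _ _).trans (oRes_oRes _ _ _).symm)

end AlgebraicGeometry.Scheme.AffMod
end

/-! ### Extending values on a regular family to a section of the normal sheaf. -/

noncomputable section

open CategoryTheory CategoryTheory.Limits AlgebraicGeometry Opposite TopologicalSpace

namespace AlgebraicGeometry.Scheme.AffMod

variable {X : Scheme.{u}} {K M N : X.AffMod} (i : K.Hom M) (φ : M.Hom N)
  (hφ : ∀ U, Function.Surjective (φ.app U))
  (hex : ∀ U m, φ.app U m = 0 ↔ ∃ κ, i.app U κ = m)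

section Extend

variable {n : ℕ} (U : X.AffineZariskiSite) (b : Fin n → K.obj U) (m : M.obj U) {W : N.proj.Opens}
  (s : Fin n → Γ(N.proj, W))

/-- A function `t` on `W'` is the value at `a` of the homomorphism to `𝒪` which maps the functions
`b j / m` to `s j`. -/
def IsNormalValue (V : M.proj.AffineZariskiSite) (a : Γ(M.proj, V.toOpens)) (W' : N.proj.Opens)
    (t : Γ(N.proj, W')) : Prop :=
  ∃ (O : M.proj.Opens) (hO : O ≤ V.toOpens) (hO' : O ≤ M.projBasicOpen U m)
    (e : W' ≤ φ.projMap hφ ⁻¹ᵁ O) (e' : W' ≤ W) (c : Fin n → Γ(M.proj, O)),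
    M.proj.oRes hO a = ∑ j, c j * M.proj.oRes hO' (M.ratio U (i.app U (b j)) m) ∧
    t = ∑ j, (φ.projMap hφ).appLE O W' e (c j) * N.proj.oRes e' (s j)

variable {i φ hφ U b m s}

lemma IsNormalValue.oRes {V : M.proj.AffineZariskiSite} {a : Γ(M.proj, V.toOpens)}
    {W' W'' : N.proj.Opens} (h : W'' ≤ W') {t : Γ(N.proj, W')}
    (ht : IsNormalValue i φ hφ U b m s V a W' t) :
    IsNormalValue i φ hφ U b m s V a W'' (N.proj.oRes h t) := by
  obtain ⟨O, hO, hO', e, e', c, h1, h2⟩ := ht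
  refine ⟨O, hO, hO', h.trans e, h.trans e', c, h1, ?_⟩
  simp only [h2, map_sum, map_mul, oRes_oRes, oRes_appLE]

/-- Replace the open subset by a smaller one. -/
lemma IsNormalValue.shrink {V : M.proj.AffineZariskiSite} {a : Γ(M.proj, V.toOpens)}
    {W' : N.proj.Opens} {O O₁ : M.proj.Opens} (h : O₁ ≤ O) (hO : O ≤ V.toOpens)
    (hO' : O ≤ M.projBasicOpen U m) (e : W' ≤ φ.projMap hφ ⁻¹ᵁ O₁) (e' : W' ≤ W)
    (c : Fin n → Γ(M.proj, O))
    (h1 : M.proj.oRes hO a = ∑ j, c j * M.proj.oRes hO' (M.ratio U (i.app U (b j)) m)) :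
    M.proj.oRes (h.trans hO) a = ∑ j, M.proj.oRes h (c j) *
      M.proj.oRes (h.trans hO') (M.ratio U (i.app U (b j)) m) ∧
    ∑ j, (φ.projMap hφ).appLE O W' (e.trans ((φ.projMap hφ).preimage_mono h)) (c j) *
      N.proj.oRes e' (s j) =
    ∑ j, (φ.projMap hφ).appLE O₁ W' e (M.proj.oRes h (c j)) * N.proj.oRes e' (s j) := by
  constructor
  · have := congrArg (M.proj.oRes h) h1
    simpa only [map_sum, map_mul, oRes_oRes] using this
  · refine Finset.sum_congr rfl fun j _ => ?_
    rw [appLE_res]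

/-- Two expressions of `a` by the generators differ by a relation between them, and by regularity
the coefficients of such a relation vanish on `P(N)`. So the value depends on `a` alone. -/
lemma IsNormalValue.unique (hex : ∀ U m, φ.app U m = 0 ↔ ∃ κ, i.app U κ = m)
    (hr : IsRegularFamily fun j => SymmetricAlgebra.ι Γ(X, U.toOpens) _ (i.app U (b j)))
    {V : M.proj.AffineZariskiSite} {a : Γ(M.proj, V.toOpens)}
    {W' : N.proj.Opens} {t t' : Γ(N.proj, W')}
    (ht : IsNormalValue i φ hφ U b m s V a W' t) (ht' : IsNormalValue i φ hφ U b m s V a W' t') :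
    t = t' := by
  obtain ⟨O, hO, hO', e, e', c, h1, h2⟩ := ht
  obtain ⟨O₁, hO₁, hO₁', e₁, e₁', c₁, h1', h2'⟩ := ht'
  have e₂ : W' ≤ φ.projMap hφ ⁻¹ᵁ (O ⊓ O₁) := fun y hy => ⟨e hy, e₁ hy⟩
  obtain ⟨h3, h4⟩ := IsNormalValue.shrink (s := s) inf_le_left hO hO' e₂ e' c h1
  obtain ⟨h3', h4'⟩ := IsNormalValue.shrink (s := s) inf_le_right hO₁ hO₁' e₂ e' c₁ h1'
  rw [h2, h2', h4, h4', ← sub_eq_zero, ← Finset.sum_sub_distrib]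
  refine Finset.sum_eq_zero fun j _ => ?_
  rw [← sub_mul, ← map_sub]
  have h5 := h3.symm.trans h3'
  rw [← sub_eq_zero, ← Finset.sum_sub_distrib] at h5
  simp only [← sub_mul] at h5
  rw [appLE_syzygy i φ hφ hex U b hr m (O ⊓ O₁) (inf_le_left.trans hO') _ h5 W' e₂ j, zero_mul]

lemma exists_isNormalValue (hex : ∀ U m, φ.app U m = 0 ↔ ∃ κ, i.app U κ = m)
    (hb : Submodule.span Γ(X, U.toOpens) (Set.range b) = ⊤)
    (hW : W ≤ N.projBasicOpen U (φ.app U m))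
    (V : M.proj.AffineZariskiSite) (a : Γ(M.proj, V.toOpens))
    (ha : a ∈ (φ.projMap hφ).ker.aff V) (y : N.proj) (hy : y ∈ φ.projMap hφ ⁻¹ᵁ V.toOpens ⊓ W) :
    ∃ W' ≤ φ.projMap hφ ⁻¹ᵁ V.toOpens ⊓ W, y ∈ W' ∧ ∃ t, IsNormalValue i φ hφ U b m s V a W' t := by
  have hy' : φ.projMap hφ y ∈ M.projBasicOpen U m := by
    change y ∈ φ.projMap hφ ⁻¹ᵁ M.projBasicOpen U m
    rw [projMap_preimage]
    exact hW hy.2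
  obtain ⟨O, hO, hO', hz, c, hc⟩ := exists_local_coeff i φ hφ hex U b hb m V a ha _ hy.1 hy'
  exact ⟨φ.projMap hφ ⁻¹ᵁ O ⊓ W, inf_le_inf_right _ ((φ.projMap hφ).preimage_mono hO), ⟨hz, hy.2⟩,
    _, O, hO, hO', inf_le_left, inf_le_right, c, hc, rfl⟩

/-- A section of the normal sheaf with given values at a regular family of generators. -/
lemma exists_normal_section (hex : ∀ U m, φ.app U m = 0 ↔ ∃ κ, i.app U κ = m)
    (hb : Submodule.span Γ(X, U.toOpens) (Set.range b) = ⊤)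
    (hr : IsRegularFamily fun j => SymmetricAlgebra.ι Γ(X, U.toOpens) _ (i.app U (b j)))
    (hW : W ≤ N.projBasicOpen U (φ.app U m)) :
    ∃ ν : Γ(dualPullback (φ.projMap hφ) (φ.projMap hφ).ker.toAffMod, W),
      ∀ (V : M.proj.AffineZariskiSite) (a : Γ(M.proj, V.toOpens))
        (ha : a ∈ (φ.projMap hφ).ker.aff V) (W' : N.proj.Opens)
        (h : W' ≤ φ.projMap hφ ⁻¹ᵁ V.toOpens ⊓ W) (t : Γ(N.proj, W')),
        IsNormalValue i φ hφ U b m s V a W' t →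
          N.proj.oRes h (dualEval ν V (idealSection a ha)) = t := by
  have key : ∀ (V : M.proj.AffineZariskiSite) (a : (φ.projMap hφ).ker.toAffMod.obj V),
      ∃ r : Γ(N.proj, φ.projMap hφ ⁻¹ᵁ V.toOpens ⊓ W), ∀ (W' : N.proj.Opens)
        (h : W' ≤ φ.projMap hφ ⁻¹ᵁ V.toOpens ⊓ W) (t : Γ(N.proj, W')),
        IsNormalValue i φ hφ U b m s V a.1 W' t → N.proj.oRes h r = t := by
    intro V a
    -- Expressions by the generators exist only locally. Uniqueness of the resulting values lets
    -- them glue to a function.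
    exact exists_glue _ (fun W' t => IsNormalValue i φ hφ U b m s V a.1 W' t)
      (fun h t ht => ht.oRes h) (fun W' t t' ht ht' => ht.unique hex hr ht')
      (fun y hy => exists_isNormalValue hex hb hW V a.1 a.2 y hy)
  choose r hr' using key
  have hloc : ∀ (V : M.proj.AffineZariskiSite) (a : (φ.projMap hφ).ker.toAffMod.obj V) (y : N.proj)
      (_ : y ∈ φ.projMap hφ ⁻¹ᵁ V.toOpens ⊓ W), ∃ (O : M.proj.Opens) (hO : O ≤ V.toOpens)
      (hO' : O ≤ M.projBasicOpen U m), φ.projMap hφ y ∈ O ∧ ∃ (c : Fin n → Γ(M.proj, O)),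
    M.proj.oRes hO a.1 = ∑ j, c j * M.proj.oRes hO' (M.ratio U (i.app U (b j)) m) := by
    intro V a y hy
    obtain ⟨W', -, hy', t, O, hO, hO', e, e', c, h1, h2⟩ := exists_isNormalValue (s := s) hex hb hW
      V a.1 a.2 y hy
    exact ⟨O, hO, hO', e hy', c, h1⟩
  -- Additivity, linearity and compatibility with restriction are checked locally. In each case an
  -- evident expression by the generators is exhibited, and `hr'` identifies its value.
  refine ⟨dualMk r ?_ ?_ ?_, fun V a ha W' h t ht => hr' V (idealSection a ha) W' h t ht⟩
  · intro V a a'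
    refine oRes_ext fun y hy => ?_
    obtain ⟨O, hO, hO', hz, c, h1⟩ := hloc V a y hy
    obtain ⟨O₁, hO₁, hO₁', hz₁, c₁, h1'⟩ := hloc V a' y hy
    let W' := φ.projMap hφ ⁻¹ᵁ (O ⊓ O₁) ⊓ W
    have e₂ : W' ≤ φ.projMap hφ ⁻¹ᵁ (O ⊓ O₁) := inf_le_left
    have e' : W' ≤ W := inf_le_right
    have e : W' ≤ φ.projMap hφ ⁻¹ᵁ V.toOpens ⊓ W := fun y hy => ⟨hO hy.1.1, hy.2⟩
    obtain ⟨h3, -⟩ := IsNormalValue.shrink (s := s) inf_le_left hO hO' e₂ e' c h1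
    obtain ⟨h3', -⟩ := IsNormalValue.shrink (s := s) inf_le_right hO₁ hO₁' e₂ e' c₁ h1'
    refine ⟨W', e, ⟨⟨hz, hz₁⟩, hy.2⟩, ?_⟩
    rw [map_add, hr' V a W' e _ ⟨_, _, _, e₂, e', _, h3, rfl⟩,
      hr' V a' W' e _ ⟨_, _, _, e₂, e', _, h3', rfl⟩, ← Finset.sum_add_distrib]
    refine hr' V (a + a') W' e _ ⟨_, inf_le_left.trans hO, inf_le_left.trans hO', e₂, e', _, ?_,
      Finset.sum_congr rfl fun j _ =>
      (((congrArg (· * _) (map_add _ _ _)).trans (add_mul _ _ _)).symm)⟩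
    refine (map_add _ _ _).trans ?_
    rw [h3, h3', ← Finset.sum_add_distrib]
    exact Finset.sum_congr rfl fun j _ => (add_mul _ _ _).symm
  · intro V q a
    refine oRes_ext fun y hy => ?_
    obtain ⟨O, hO, hO', hz, c, h1⟩ := hloc V a y hy
    let W' := φ.projMap hφ ⁻¹ᵁ O ⊓ W
    have e : W' ≤ φ.projMap hφ ⁻¹ᵁ V.toOpens ⊓ W := fun y hy => ⟨hO hy.1, hy.2⟩
    refine ⟨W', e, ⟨hz, hy.2⟩, ?_⟩
    rw [map_mul, hr' V a W' e _ ⟨_, _, _, inf_le_left, inf_le_right, _, h1, rfl⟩, Finset.mul_sum]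
    refine hr' V (q • a) W' e _ ⟨_, hO, hO', inf_le_left, inf_le_right,
      fun j => M.proj.oRes hO q * c j, ?_, Finset.sum_congr rfl fun j _ => ?_⟩
    · refine (map_mul (M.proj.oRes hO) q a.1).trans ?_
      rw [h1, Finset.mul_sum]
      exact Finset.sum_congr rfl fun j _ => (mul_assoc _ _ _).symm
    · rw [map_mul, oRes_appLE, appLE_res, mul_assoc]
  · intro V V' h a
    refine oRes_ext fun y hy => ?_
    obtain ⟨O, hO, hO', hz, c, h1⟩ := hloc V ((φ.projMap hφ).ker.toAffMod.res h a) y hy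
    let W' := φ.projMap hφ ⁻¹ᵁ O ⊓ W
    have e : W' ≤ φ.projMap hφ ⁻¹ᵁ V.toOpens ⊓ W := fun y hy => ⟨hO hy.1, hy.2⟩
    refine ⟨W', e, ⟨hz, hy.2⟩, ?_⟩
    rw [hr' V _ W' e _ ⟨_, _, _, inf_le_left, inf_le_right, _, h1, rfl⟩, oRes_oRes]
    refine (hr' V' a W' _ _ ⟨O, hO.trans (AffineZariskiSite.toOpens_mono h), hO', inf_le_left,
      inf_le_right, c, ?_, rfl⟩).symm
    rw [← h1]
    exact (oRes_oRes _ _ _).symm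

end Extend

/-- The normal sheaf of `P(N)` in `P(M)` is `Hom(p^* K, 𝒪(1))` if the kernel `K` of `M → N` is
locally generated by a regular sequence in the symmetric algebra of `M`. -/
lemma isIso_normalToHom {n : ℕ}
    (hreg : ∀ x : X, ∃ U : X.AffineZariskiSite, x ∈ U.toOpens ∧ ∃ b : Fin n → K.obj U,
      Submodule.span Γ(X, U.toOpens) (Set.range b) = ⊤ ∧
      IsRegularFamily fun j => SymmetricAlgebra.ι Γ(X, U.toOpens) _ (i.app U (b j))) :
    IsIso (normalToHom i φ hφ hex) := by
  have hloc : ∀ y : N.proj, ∃ (U : X.AffineZariskiSite) (b : Fin n → K.obj U) (m : M.obj U),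
      y ∈ N.projBasicOpen U (φ.app U m) ∧
      Submodule.span Γ(X, U.toOpens) (Set.range b) = ⊤ ∧
      IsRegularFamily fun j => SymmetricAlgebra.ι Γ(X, U.toOpens) _ (i.app U (b j)) := by
    intro y
    obtain ⟨U, hU, b, hb, hr⟩ := hreg (N.projProj y)
    obtain ⟨n, hn⟩ := N.exists_mem_projBasicOpen U y hU
    obtain ⟨m, rfl⟩ := hφ U n
    exact ⟨U, b, m, hn, hb, hr⟩
  refine Modules.isIso_of_locally _ ?_ ?_
  -- Injectivity: near each point elements of the ideal are combinations of the functions `bⱼ/m`, so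
  -- `ν` vanishes as soon as it vanishes on these.
  · intro W ν hν
    change normalToHomSection i φ hφ hex ν = 0 at hν
    refine dualEval_ext (f := φ.projMap hφ) (M := (φ.projMap hφ).ker.toAffMod) fun V a => ?_
    refine oRes_ext fun y hy => ?_
    obtain ⟨U, b, m, hym, hb, hr⟩ := hloc y
    have hym' : φ.projMap hφ y ∈ M.projBasicOpen U m := by
      change y ∈ φ.projMap hφ ⁻¹ᵁ M.projBasicOpen U m
      rw [projMap_preimage]
      exact hym
    obtain ⟨O, hO, hO', hz, c, hc⟩ := exists_local_coeff i φ hφ hex U b hb m V a.1 a.2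
      (φ.projMap hφ y) hy.1 hym'
    have e : φ.projMap hφ ⁻¹ᵁ O ⊓ W ≤ φ.projMap hφ ⁻¹ᵁ V.toOpens ⊓ W :=
      inf_le_inf_right _ ((φ.projMap hφ).preimage_mono hO)
    have e' : φ.projMap hφ ⁻¹ᵁ O ⊓ W ≤ φ.projMap hφ ⁻¹ᵁ M.projBasicOpen U m ⊓ W :=
      inf_le_inf_right _ ((φ.projMap hφ).preimage_mono hO')
    refine ⟨φ.projMap hφ ⁻¹ᵁ O ⊓ W, e, ⟨hz, hy.2⟩, ?_⟩
    refine (dualEval_local (f := φ.projMap hφ) (D := (φ.projMap hφ).ker) ν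
      (V' := M.projBasicAffine U m) O hO hO' a.1 a.2 _
      (fun j => ratio_mem_ker i φ hφ hex U (b j) m) c hc _ inf_le_left e e').trans ?_
    refine Eq.trans ?_ (map_zero _).symm
    refine Finset.sum_eq_zero fun j _ => ?_
    have h1 : normalVal i φ hφ hex ν U (b j) m = 0 := by
      have h2 := normalToHomSection_eval i φ hφ hex ν U (b j) m
      rw [hν, zero_homEval] at h2
      have h3 : φ.projMap hφ ⁻¹ᵁ M.projBasicOpen U m ⊓ W ≤ N.projBasicOpen U (φ.app U m) ⊓ W := by
        rw [projMap_preimage]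
      have h4 := congrArg (N.proj.oRes h3) h2
      rw [map_zero, oRes_oRes, oRes_refl] at h4
      exact h4.symm
    refine (congrArg (_ * ·) ?_).trans (mul_zero _)
    exact (congrArg (N.proj.oRes e') h1).trans (map_zero _)
  · intro W h y hy
    obtain ⟨U, b, m, hym, hb, hr⟩ := hloc y
    -- Local surjectivity: the value at `bⱼ/m` is prescribed to be the function `h(bⱼ)/m`.
    obtain ⟨ν, hν⟩ := exists_normal_section (hφ := hφ) (s := fun j => homEval h U (b j) (φ.app U m))
      hex hb hr inf_le_left
    refine ⟨N.projBasicOpen U (φ.app U m) ⊓ W, inf_le_right, ⟨hym, hy⟩, ν, ?_⟩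
    change normalToHomSection i φ hφ hex ν = _
    rw [← sub_eq_zero, sub_eq_add_neg, ← neg_one_smul Γ(N.proj, N.projBasicOpen U (φ.app U m) ⊓ W)]
    refine homEval_eq_zero _ U b hb (φ.app U m) inf_le_left fun j => ?_
    rw [add_homEval, smul_homEval, normalToHomSection_eval, sRes_homEval, map_neg, map_one,
      neg_one_mul, add_neg_eq_zero]
    -- The generator `bⱼ/m` is expressed by the generators with the `j`-th unit vector as
    -- coefficients.
    refine (hν (M.projBasicAffine U m) _ (ratio_mem_ker i φ hφ hex U (b j) m) _ _ _
      ⟨M.projBasicOpen U m, le_rfl, le_rfl, ?_, inf_le_right, Pi.single j 1, ?_, ?_⟩)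
    · rw [projMap_preimage]; exact inf_le_left
    · rw [Finset.sum_eq_single j (fun l _ hl => by rw [Pi.single_eq_of_ne hl, zero_mul])
        (fun h => absurd (Finset.mem_univ j) h), Pi.single_eq_same, one_mul]
      rfl
    · rw [Finset.sum_eq_single j (fun l _ hl => by rw [Pi.single_eq_of_ne hl, map_zero, zero_mul])
        (fun h => absurd (Finset.mem_univ j) h), Pi.single_eq_same, map_one, one_mul]

end AlgebraicGeometry.Scheme.AffMod
end

/-! ### Dual bases, and the local generator of `𝒪(1)`. -/

noncomputable section

open CategoryTheory CategoryTheory.Limits AlgebraicGeometry Opposite TopologicalSpace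

namespace AlgebraicGeometry.Scheme

section Dual

variable {Y X : Scheme.{u}} {f : Y ⟶ X} {K : X.AffMod}

/-- A section of `Hom(f^* K, 𝒪_Y)` over an open subset of `f⁻¹(U)` is determined by its values on
generators of `K` over `U`. -/
lemma dualEval_ext_of_span {W : Y.Opens} {s s' : Γ(dualPullback f K, W)} (U : X.AffineZariskiSite)
    {J : Type*} (b : J → K.obj U) (hb : Submodule.span Γ(X, U.toOpens) (Set.range b) = ⊤)
    (hW : W ≤ f ⁻¹ᵁ U.toOpens) (h : ∀ j, dualEval s U (b j) = dualEval s' U (b j)) : s = s' := by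
  refine dualEval_ext fun U' κ' => oRes_ext fun y hy => ?_
  obtain ⟨U'', h', h'', hy'⟩ := exists_affine_le_inter U U' (f y) (hW hy.2) hy.1
  have key : ∀ κ : K.obj U'', dualEval s U'' κ = dualEval s' U'' κ := by
    intro κ
    have hκ : κ ∈ Submodule.span Γ(X, U''.toOpens) (Set.range fun j => K.res h' (b j)) := by
      rw [K.span_res h' b hb]; trivial
    induction hκ using Submodule.span_induction with
    | mem x hx =>
      obtain ⟨j, rfl⟩ := hx
      simp only
      rw [dualEval_res, dualEval_res, h]
    | zero => rw [dualEval_zero, dualEval_zero]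
    | add x y _ _ hx hy => rw [dualEval_add, dualEval_add, hx, hy]
    | smul r x _ hx => rw [dualEval_smul, dualEval_smul, hx]
  have h1 := key (K.res h'' κ')
  rw [dualEval_res, dualEval_res] at h1
  exact ⟨f ⁻¹ᵁ U''.toOpens ⊓ W, _, ⟨hy', hy.2⟩, h1⟩

section Basis

variable (f) {n : ℕ} (U : X.AffineZariskiSite) (b : Fin n → K.obj U) (j : Fin n)

/-- The function `t` on `W` is the pullback of the `j`-th coordinate of `κ`. -/
def IsCoordinate (V : X.AffineZariskiSite) (κ : K.obj V) (W : Y.Opens) (t : Γ(Y, W)) : Prop :=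
  ∃ (U' : X.AffineZariskiSite) (h : U' ≤ U) (h' : U' ≤ V) (e : W ≤ f ⁻¹ᵁ U'.toOpens)
    (c : Fin n → Γ(X, U'.toOpens)), K.res h' κ = ∑ l, c l • K.res h (b l) ∧
    t = f.appLE U'.toOpens W e (c j)

variable {f U b j}

lemma IsCoordinate.oRes {V : X.AffineZariskiSite} {κ : K.obj V} {W W' : Y.Opens} (h : W' ≤ W)
    {t : Γ(Y, W)} (ht : IsCoordinate f U b j V κ W t) :
    IsCoordinate f U b j V κ W' (Y.oRes h t) := by
  obtain ⟨U', h₁, h₂, e, c, hc, rfl⟩ := ht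
  exact ⟨U', h₁, h₂, h.trans e, c, hc, oRes_appLE _ _ _ _⟩

lemma res_eq_sum {V U' U'' : X.AffineZariskiSite} {κ : K.obj V} (h : U' ≤ U) (h' : U' ≤ V)
    (h'' : U'' ≤ U') {c : Fin n → Γ(X, U'.toOpens)}
    (hc : K.res h' κ = ∑ l, c l • K.res h (b l)) :
    K.res (h''.trans h') κ = ∑ l, X.ringRes h'' (c l) • K.res (h''.trans h) (b l) := by
  rw [K.res_trans h'' h', hc, map_sum]
  refine Finset.sum_congr rfl fun l _ => ?_
  rw [map_smulₛₗ, ← K.res_trans]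

/-- The two expressions are compared on an affine open that is basic in both, where the restricted
basis is still independent. -/
lemma IsCoordinate.unique (hb : LinearIndependent Γ(X, U.toOpens) b) {V : X.AffineZariskiSite}
    {κ : K.obj V} {W : Y.Opens} {t t' : Γ(Y, W)} (ht : IsCoordinate f U b j V κ W t)
    (ht' : IsCoordinate f U b j V κ W t') : t = t' := by
  obtain ⟨U₁, h₁, h₁', e₁, c, hc, rfl⟩ := ht
  obtain ⟨U₂, h₂, h₂', e₂, d, hd, rfl⟩ := ht'
  refine oRes_ext fun y hy => ?_
  obtain ⟨U₃, h₃, h₃', hy'⟩ := exists_affine_le_inter U₁ U₂ (f y) (e₁ hy) (e₂ hy)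
  refine ⟨f ⁻¹ᵁ U₃.toOpens ⊓ W, inf_le_right, ⟨hy', hy⟩, ?_⟩
  have h4 := (res_eq_sum h₁ h₁' h₃ hc).symm.trans (res_eq_sum h₂ h₂' h₃' hd)
  have h5 := K.linearIndependent_res (h₃.trans h₁) b hb
    (fun l => X.ringRes h₃ (c l) - X.ringRes h₃' (d l)) (by
      simp only [sub_smul, Finset.sum_sub_distrib]
      rw [sub_eq_zero]
      exact h4) j
  have h6 := congrArg (f.appLE U₃.toOpens (f ⁻¹ᵁ U₃.toOpens ⊓ W) inf_le_left)
    (sub_eq_zero.mp h5)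
  rw [oRes_appLE, oRes_appLE]
  exact ((appLE_res f _ _ _ _).symm.trans h6).trans (appLE_res f _ _ _ _)

lemma exists_coordinates (hs : Submodule.span Γ(X, U.toOpens) (Set.range b) = ⊤)
    (V : X.AffineZariskiSite) (κ : K.obj V) (x : X) (hx : x ∈ U.toOpens) (hx' : x ∈ V.toOpens) :
    ∃ (U' : X.AffineZariskiSite) (h : U' ≤ U) (h' : U' ≤ V), x ∈ U'.toOpens ∧
    ∃ (c : Fin n → Γ(X, U'.toOpens)), K.res h' κ = ∑ l, c l • K.res h (b l) := by
  obtain ⟨U', h, h', hxU⟩ := exists_affine_le_inter U V x hx hx'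
  have h1 : K.res h' κ ∈ Submodule.span Γ(X, U'.toOpens) (Set.range fun j => K.res h (b j)) := by
    rw [K.span_res h b hs]; trivial
  obtain ⟨c, hc⟩ := (Submodule.mem_span_range_iff_exists_fun _).mp h1
  exact ⟨U', h, h', hxU, c, hc.symm⟩

variable (f j) in
/-- The dual basis. -/
lemma exists_dualBasis (hs : Submodule.span Γ(X, U.toOpens) (Set.range b) = ⊤)
    (hb : LinearIndependent Γ(X, U.toOpens) b) :
    ∃ s : Γ(dualPullback f K, f ⁻¹ᵁ U.toOpens), ∀ l, dualEval s U (b l) = if l = j then 1 else 0 := by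
  have key : ∀ (V : X.AffineZariskiSite) (κ : K.obj V),
      ∃ r : Γ(Y, f ⁻¹ᵁ V.toOpens ⊓ f ⁻¹ᵁ U.toOpens), ∀ (W : Y.Opens)
        (h : W ≤ f ⁻¹ᵁ V.toOpens ⊓ f ⁻¹ᵁ U.toOpens) (t : Γ(Y, W)),
        IsCoordinate f U b j V κ W t → Y.oRes h r = t := by
    intro V κ
    -- A section over an arbitrary affine open `V` has coordinates only near points of `U ∩ V`; they
    -- glue by uniqueness.
    refine exists_glue _ (fun W t => IsCoordinate f U b j V κ W t)
      (fun h t ht => ht.oRes h) (fun W t t' ht ht' => ht.unique hb ht') (fun y hy => ?_)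
    obtain ⟨U', h, h', hyU, c, hc⟩ := exists_coordinates hs V κ (f y) hy.2 hy.1
    exact ⟨f ⁻¹ᵁ U'.toOpens, le_inf (f.preimage_mono (AffineZariskiSite.toOpens_mono h'))
      (f.preimage_mono (AffineZariskiSite.toOpens_mono h)), hyU, _, U', h, h', le_rfl, c, hc, rfl⟩
  choose r hr using key
  refine ⟨dualMk r ?_ ?_ ?_, fun l => ?_⟩
  · intro V κ κ'
    refine oRes_ext fun y hy => ?_
    obtain ⟨U₁, h₁, h₁', hy₁, c, hc⟩ := exists_coordinates hs V κ (f y) hy.2 hy.1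
    obtain ⟨U₂, h₂, h₂', hy₂, d, hd⟩ := exists_coordinates hs V κ' (f y) hy.2 hy.1
    obtain ⟨U₃, h₃, h₃', hy₃⟩ := exists_affine_le_inter U₁ U₂ (f y) hy₁ hy₂
    have hc' := res_eq_sum h₁ h₁' h₃ hc
    have hd' := res_eq_sum h₂ h₂' h₃' hd
    have e : f ⁻¹ᵁ U₃.toOpens ≤ f ⁻¹ᵁ V.toOpens ⊓ f ⁻¹ᵁ U.toOpens :=
      le_inf (f.preimage_mono (AffineZariskiSite.toOpens_mono (h₃.trans h₁')))
      (f.preimage_mono (AffineZariskiSite.toOpens_mono (h₃.trans h₁)))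
    refine ⟨f ⁻¹ᵁ U₃.toOpens, e, hy₃, ?_⟩
    rw [map_add, hr V κ _ e _ ⟨U₃, h₃.trans h₁, _, le_rfl, _, hc', rfl⟩,
      hr V κ' _ e _ ⟨U₃, h₃.trans h₁, _, le_rfl, _, hd', rfl⟩, ← map_add]
    refine hr V (κ + κ') _ e _ ⟨U₃, h₃.trans h₁, h₃.trans h₁', le_rfl,
      fun l => X.ringRes h₃ (c l) + X.ringRes h₃' (d l), ?_, rfl⟩
    rw [map_add, hc', hd', ← Finset.sum_add_distrib]
    simp only [add_smul]
  · intro V a κ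
    refine oRes_ext fun y hy => ?_
    obtain ⟨U₁, h₁, h₁', hy₁, c, hc⟩ := exists_coordinates hs V κ (f y) hy.2 hy.1
    have e : f ⁻¹ᵁ U₁.toOpens ≤ f ⁻¹ᵁ V.toOpens ⊓ f ⁻¹ᵁ U.toOpens :=
      le_inf (f.preimage_mono (AffineZariskiSite.toOpens_mono h₁'))
      (f.preimage_mono (AffineZariskiSite.toOpens_mono h₁))
    refine ⟨f ⁻¹ᵁ U₁.toOpens, e, hy₁, ?_⟩
    rw [map_mul, hr V κ _ e _ ⟨U₁, h₁, _, le_rfl, _, hc, rfl⟩, oRes_appLE,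
      ← appLE_res f (AffineZariskiSite.toOpens_mono h₁') le_rfl, ← map_mul]
    refine hr V (a • κ) _ e _ ⟨U₁, h₁, h₁', le_rfl, fun l => X.ringRes h₁' a * c l, ?_, rfl⟩
    rw [map_smulₛₗ, hc, Finset.smul_sum]
    simp only [mul_smul]
  · intro V V' h κ
    refine oRes_ext fun y hy => ?_
    obtain ⟨U₁, h₁, h₁', hy₁, c, hc⟩ := exists_coordinates hs V (K.res h κ) (f y) hy.2 hy.1
    have e : f ⁻¹ᵁ U₁.toOpens ≤ f ⁻¹ᵁ V.toOpens ⊓ f ⁻¹ᵁ U.toOpens :=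
      le_inf (f.preimage_mono (AffineZariskiSite.toOpens_mono h₁'))
      (f.preimage_mono (AffineZariskiSite.toOpens_mono h₁))
    refine ⟨f ⁻¹ᵁ U₁.toOpens, e, hy₁, ?_⟩
    rw [hr V _ _ e _ ⟨U₁, h₁, _, le_rfl, _, hc, rfl⟩, oRes_oRes]
    refine (hr V' κ _ _ _ ⟨U₁, h₁, h₁'.trans h, le_rfl, c, ?_, rfl⟩).symm
    rw [K.res_trans h₁' h, hc]
  · change r U (b l) = _
    rw [← oRes_refl (r U (b l))]
    -- The coordinates of `b l` are those of the `l`-th unit vector.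
    refine (hr U (b l) _ _ _ ⟨U, le_rfl, le_rfl, inf_le_left, Pi.single l 1, ?_, rfl⟩).trans ?_
    · rw [Finset.sum_eq_single l (fun l' _ hl => by rw [Pi.single_eq_of_ne hl, zero_smul])
        (fun h => absurd (Finset.mem_univ l) h), Pi.single_eq_same, one_smul]
    · by_cases hl : l = j
      · subst hl
        rw [Pi.single_eq_same, map_one, if_pos rfl]
      · rw [Pi.single_eq_of_ne (Ne.symm hl), map_zero, if_neg hl]

end Basis

end Dual

namespace AffMod

section Twist

variable {X : Scheme.{u}} {N : X.AffMod} {W : N.proj.Opens}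

/-- The function `s/m` for a section `s` of `𝒪(1)`. -/
def twistEval (s : Γ(N.twist, W)) (U : X.AffineZariskiSite) (m : N.obj U) :
    Γ(N.proj, N.projBasicOpen U m ⊓ W) :=
  Subtype.val (p := fun s => s ∈ N.twistFam.sec W) s ⟨U, m⟩

lemma twistEval_mul (s : Γ(N.twist, W)) (U : X.AffineZariskiSite)
    (m m' : N.obj U) : N.proj.oRes (inf_le_inf_right W (inf_le_right : N.projBasicOpen U m ⊓
            N.projBasicOpen U m' ≤ _)) (twistEval s U m') =
          N.proj.oRes (inf_le_left.trans inf_le_right) (N.ratio U m m') *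
            N.proj.oRes (inf_le_inf_right W (inf_le_left : N.projBasicOpen U m ⊓
            N.projBasicOpen U m' ≤ _)) (twistEval s U m) :=
  (Subtype.property (p := fun s => s ∈ N.twistFam.sec W) s).1 U m m'

lemma twistEval_res (s : Γ(N.twist, W)) {U V : X.AffineZariskiSite} (h : U ≤ V)
    (m : N.obj V) : twistEval s U (N.res h m) =
      N.proj.oRes (inf_le_inf_right W (N.projBasicOpen_res h m)) (twistEval s V m) :=
  (Subtype.property (p := fun s => s ∈ N.twistFam.sec W) s).2 U V h m

lemma add_twistEval (s s' : Γ(N.twist, W)) (U : X.AffineZariskiSite)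
    (m : N.obj U) : twistEval (s + s') U m = twistEval s U m + twistEval s' U m := rfl

lemma smul_twistEval (r : Γ(N.proj, W)) (s : Γ(N.twist, W)) (U : X.AffineZariskiSite)
    (m : N.obj U) :
    twistEval (r • s) U m = N.proj.oRes inf_le_right r * twistEval s U m := rfl

lemma sRes_twistEval {W' : N.proj.Opens} (h : W' ≤ W) (s : Γ(N.twist, W))
    (U : X.AffineZariskiSite) (m : N.obj U) :
    twistEval (N.twist.sRes h s) U m =
      N.proj.oRes (inf_le_inf_left _ h) (twistEval s U m) := rfl

lemma twistEval_ext {s s' : Γ(N.twist, W)}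
    (h : ∀ (U : X.AffineZariskiSite) (m : N.obj U), twistEval s U m = twistEval s' U m) :
    s = s' :=
  Subtype.ext (p := fun s => s ∈ N.twistFam.sec W) (funext fun i => h i.1 i.2)

/-- A section of `𝒪(1)` over an open subset of `D_+(m)` is determined by its value at `m`. -/
lemma twistEval_ext_of_le {s s' : Γ(N.twist, W)} (U : X.AffineZariskiSite) (m : N.obj U)
    (hW : W ≤ N.projBasicOpen U m) (h : twistEval s U m = twistEval s' U m) : s = s' := by
  refine twistEval_ext fun U' m' => oRes_ext fun y hy => ?_
  obtain ⟨U'', h', h'', hy'⟩ := exists_affine_le_inter U U' (N.projProj y)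
    (N.projBasicOpen_le U m (hW hy.2)) (N.projBasicOpen_le U' m' hy.1)
  have hym := N.mem_projBasicOpen_res h' m y (hW hy.2) hy'
  have hym' := N.mem_projBasicOpen_res h'' m' y hy.1 hy'
  -- The function `s/m'` is `(m/m') (s/m)`, so the value at `m` determines it.
  have h1 := twistEval_mul s U'' (N.res h' m) (N.res h'' m')
  rw [twistEval_res s h', h, ← twistEval_res s' h', ← twistEval_mul s', twistEval_res,
    twistEval_res, oRes_oRes, oRes_oRes] at h1
  exact ⟨N.projBasicOpen U'' (N.res h' m) ⊓ N.projBasicOpen U'' (N.res h'' m') ⊓ W, _,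
    ⟨⟨hym, hym'⟩, hy.2⟩, h1⟩

variable (U : X.AffineZariskiSite) (m : N.obj U)

/-- The function `t` on `W` is the quotient `m/m'`. -/
def IsRatio (V : X.AffineZariskiSite) (m' : N.obj V) (W : N.proj.Opens) (t : Γ(N.proj, W)) : Prop :=
  ∃ (U' : X.AffineZariskiSite) (h : U' ≤ U) (h' : U' ≤ V)
    (e : W ≤ N.projBasicOpen U' (N.res h' m')),
    t = N.proj.oRes e (N.ratio U' (N.res h m) (N.res h' m'))

variable {U m}

/-- A quotient lives on an open set that depends on its denominator. Equal arguments are therefore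
exchanged after restriction to a fixed open set. -/
lemma oRes_ratio_congr {V : X.AffineZariskiSite} {x y z w : N.obj V} (hxy : x = y) (hzw : z = w)
    {W : N.proj.Opens} (e₁ : W ≤ N.projBasicOpen V z) (e₂ : W ≤ N.projBasicOpen V w) :
    N.proj.oRes e₁ (N.ratio V x z) = N.proj.oRes e₂ (N.ratio V y w) := by
  subst hxy hzw; rfl

lemma IsRatio.shrink {V U' U'' : X.AffineZariskiSite} {m' : N.obj V} (h : U' ≤ U) (h' : U' ≤ V)
    (h'' : U'' ≤ U') {W : N.proj.Opens} (e : W ≤ N.projBasicOpen U' (N.res h' m'))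
    (e' : W ≤ N.projBasicOpen U'' (N.res (h''.trans h') m')) :
    N.proj.oRes e (N.ratio U' (N.res h m) (N.res h' m')) =
      N.proj.oRes e' (N.ratio U'' (N.res (h''.trans h) m) (N.res (h''.trans h') m')) := by
  have h1 := N.ratio_res h'' (N.res h m) (N.res h' m') (N.projBasicOpen_res h'' _)
  have h2 : W ≤ N.projBasicOpen U'' (N.res h'' (N.res h' m')) := by
    rw [← N.res_trans]; exact e'
  have h3 := congrArg (N.proj.oRes h2) h1
  rw [oRes_oRes] at h3
  refine h3.trans ?_
  exact oRes_ratio_congr (N.res_trans _ _ _).symm (N.res_trans _ _ _).symm _ _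

lemma IsRatio.oRes {V : X.AffineZariskiSite} {m' : N.obj V} {W W' : N.proj.Opens} (h : W' ≤ W)
    {t : Γ(N.proj, W)} (ht : IsRatio U m V m' W t) : IsRatio U m V m' W' (N.proj.oRes h t) := by
  obtain ⟨U', h₁, h₂, e, rfl⟩ := ht
  exact ⟨U', h₁, h₂, h.trans e, oRes_oRes _ _ _⟩

lemma IsRatio.unique {V : X.AffineZariskiSite} {m' : N.obj V} {W : N.proj.Opens}
    {t t' : Γ(N.proj, W)} (ht : IsRatio U m V m' W t) (ht' : IsRatio U m V m' W t') : t = t' := by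
  obtain ⟨U₁, h₁, h₁', e₁, rfl⟩ := ht
  obtain ⟨U₂, h₂, h₂', e₂, rfl⟩ := ht'
  refine oRes_ext fun y hy => ?_
  obtain ⟨U₃, h₃, h₃', hy'⟩ := exists_affine_le_inter U₁ U₂ (N.projProj y)
    (N.projBasicOpen_le _ _ (e₁ hy)) (N.projBasicOpen_le _ _ (e₂ hy))
  have hym := N.mem_projBasicOpen_res h₃ _ y (e₁ hy) hy'
  rw [← N.res_trans] at hym
  refine ⟨N.projBasicOpen U₃ (N.res (h₃.trans h₁') m') ⊓ W, inf_le_right, ⟨hym, hy⟩, ?_⟩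
  rw [oRes_oRes, oRes_oRes, IsRatio.shrink h₁ h₁' h₃ _ inf_le_left,
    IsRatio.shrink h₂ h₂' h₃' _ inf_le_left]

variable (U m) in
/-- The section `m` of `𝒪(1)` over `D_+(m)`. -/
lemma exists_twistSection :
    ∃ s : Γ(N.twist, N.projBasicOpen U m), twistEval s U m = 1 := by
  have hloc : ∀ (V : X.AffineZariskiSite) (m' : N.obj V) (y : N.proj)
      (_ : y ∈ N.projBasicOpen V m' ⊓ N.projBasicOpen U m), ∃ (U' : X.AffineZariskiSite)
      (h : U' ≤ U) (h' : U' ≤ V), y ∈ N.projBasicOpen U' (N.res h m) ∧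
        y ∈ N.projBasicOpen U' (N.res h' m') := by
    intro V m' y hy
    obtain ⟨U', h, h', hyU⟩ := exists_affine_le_inter U V (N.projProj y)
      (N.projBasicOpen_le U m hy.2) (N.projBasicOpen_le V m' hy.1)
    exact ⟨U', h, h', N.mem_projBasicOpen_res h m y hy.2 hyU,
      N.mem_projBasicOpen_res h' m' y hy.1 hyU⟩
  have key : ∀ (V : X.AffineZariskiSite) (m' : N.obj V),
      ∃ r : Γ(N.proj, N.projBasicOpen V m' ⊓ N.projBasicOpen U m), ∀ (W : N.proj.Opens)
        (h : W ≤ N.projBasicOpen V m' ⊓ N.projBasicOpen U m) (t : Γ(N.proj, W)),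
        IsRatio U m V m' W t → N.proj.oRes h r = t := by
    intro V m'
    refine exists_glue _ (fun W t => IsRatio U m V m' W t)
      (fun h t ht => ht.oRes h) (fun W t t' ht ht' => ht.unique ht') (fun y hy => ?_)
    obtain ⟨U', h, h', hy₁, hy₂⟩ := hloc V m' y hy
    exact ⟨N.projBasicOpen U' (N.res h' m') ⊓ N.projBasicOpen U' (N.res h m),
      inf_le_inf (N.projBasicOpen_res h' m') (N.projBasicOpen_res h m), ⟨hy₂, hy₁⟩,
      _, U', h, h', inf_le_left, rfl⟩
  choose r hr using key
  refine ⟨Subtype.mk (p := fun s => s ∈ N.twistFam.sec (N.projBasicOpen U m))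
    (fun i => r i.1 i.2) ⟨fun V m₁ m₂ => ?_, fun V V' h m' => ?_⟩, ?_⟩
  · refine oRes_ext fun y hy => ?_
    obtain ⟨U', h, h', hy₁, hy₂⟩ := hloc V m₁ y ⟨hy.1.1, hy.2⟩
    have hy₃ := N.mem_projBasicOpen_res h' m₂ y hy.1.2 (N.projBasicOpen_le _ _ hy₁)
    let O := (N.projBasicOpen U' (N.res h' m₂) ⊓ N.projBasicOpen U' (N.res h' m₁)) ⊓
      N.projBasicOpen U' (N.res h m)
    have e : O ≤ N.projBasicOpen V m₁ ⊓ N.projBasicOpen V m₂ ⊓ N.projBasicOpen U m :=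
      fun z hz => ⟨⟨N.projBasicOpen_res h' m₁ hz.1.2, N.projBasicOpen_res h' m₂ hz.1.1⟩,
        N.projBasicOpen_res h m hz.2⟩
    refine ⟨O, e, ⟨⟨hy₃, hy₂⟩, hy₁⟩, ?_⟩
    rw [map_mul, oRes_oRes, oRes_oRes, oRes_oRes]
    have e₁ : O ≤ N.projBasicOpen U' (N.res h' m₁) := inf_le_left.trans inf_le_right
    have e₂ : O ≤ N.projBasicOpen U' (N.res h' m₂) := inf_le_left.trans inf_le_left
    refine (hr V m₂ O _ _ ⟨U', h, h', e₂, rfl⟩).trans ?_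
    refine Eq.trans ?_ (congrArg (_ * ·) (hr V m₁ O _ _ ⟨U', h, h', e₁, rfl⟩)).symm
    -- The rule that defines `𝒪(1)` holds for the family `m/m'` because `m/m₂ = (m₁/m₂) (m/m₁)`.
    have h1 := N.ratio_mul U' (N.res h m) (N.res h' m₂) (N.res h' m₁)
    have h2 := congrArg (N.proj.oRes (inf_le_left : O ≤ _)) h1
    rw [map_mul, oRes_oRes, oRes_oRes, oRes_oRes] at h2
    refine h2.trans (congrArg (· * _) ?_)
    rw [← N.ratio_res h' m₁ m₂ (N.projBasicOpen_res h' m₂), oRes_oRes]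
  · refine oRes_ext fun y hy => ?_
    obtain ⟨U', h₁, h₂, hy₁, hy₂⟩ := hloc V (N.res h m') y hy
    let O := N.projBasicOpen U' (N.res h₂ (N.res h m')) ⊓ N.projBasicOpen U' (N.res h₁ m)
    have e : O ≤ N.projBasicOpen V (N.res h m') ⊓ N.projBasicOpen U m :=
      inf_le_inf (N.projBasicOpen_res h₂ _) (N.projBasicOpen_res h₁ _)
    refine ⟨O, e, ⟨hy₂, hy₁⟩, ?_⟩
    rw [oRes_oRes]
    refine (hr V (N.res h m') O e _ ⟨U', h₁, h₂, inf_le_left, rfl⟩).trans ?_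
    refine (hr V' m' O _ _ ⟨U', h₁, h₂.trans h, ?_, ?_⟩).symm
    · rw [N.res_trans h₂ h]; exact inf_le_left
    · exact oRes_ratio_congr rfl (N.res_trans h₂ h m').symm _ _
  · change r U m = 1
    rw [← oRes_refl (r U m)]
    refine (hr U m _ _ _ ⟨U, le_rfl, le_rfl, ?_, rfl⟩).trans ?_
    · rw [N.res_refl]; exact inf_le_left
    · rw [ratio_self, map_one]

end Twist

end AffMod

end AlgebraicGeometry.Scheme
end

/-! ### The comparison morphism from `p^* K^∨ ⊗ 𝒪(1)` to `Hom(p^* K, 𝒪(1))`. -/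

noncomputable section

open CategoryTheory CategoryTheory.Limits AlgebraicGeometry Opposite TopologicalSpace

namespace AlgebraicGeometry.Scheme

/-- Morphisms out of a pullback are constructed by adjunction. This computes them on pulled back
sections, which by `pullback_locally_span` locally generate. -/
lemma Modules.pullbackLift_pullbackSection {Y X : Scheme.{u}} (p : Y ⟶ X) {A : X.Modules}
    {B : Y.Modules} (g : A ⟶ (Modules.pushforward p).obj B) (V : X.Opens) (a : Γ(A, V)) :
    (((Modules.pullbackPushforwardAdjunction p).homEquiv _ _).symm g).app (p ⁻¹ᵁ V)
      (Modules.pullbackSection p A V a) = g.app V a := by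
  have h := ((Modules.pullbackPushforwardAdjunction p).homEquiv _ _).apply_symm_apply g
  rw [Adjunction.homEquiv_unit] at h
  exact congr(Modules.Hom.app $h V a)

section Sections

variable {Y X : Scheme.{u}} (p : Y ⟶ X) (K : X.AffMod)

variable {K} in
lemma appLE_dualEval_id_le (V' : X.AffineZariskiSite) (V : X.Opens) :
    p ⁻¹ᵁ V'.toOpens ⊓ p ⁻¹ᵁ V ≤ p ⁻¹ᵁ (𝟙 X ⁻¹ᵁ V'.toOpens ⊓ V) := le_rfl

variable {K} in
/-- The pullback of a section of the dual. -/
def pullbackDual {V : X.Opens} (s : Γ(dualPullback (𝟙 X) K, V)) :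
    Γ(dualPullback p K, p ⁻¹ᵁ V) :=
  dualMk (f := p) (M := K) (W := p ⁻¹ᵁ V)
    (fun V' κ => p.appLE (𝟙 X ⁻¹ᵁ V'.toOpens ⊓ V) (p ⁻¹ᵁ V'.toOpens ⊓ p ⁻¹ᵁ V)
      (appLE_dualEval_id_le p V' V) (dualEval s V' κ))
    (fun V' κ κ' => by rw [dualEval_add, map_add])
    (fun V' a κ => by
      rw [dualEval_smul, map_mul]
      exact congrArg (· * _) (AffMod.appLE_appLE p (𝟙 X) p (Category.comp_id p) _ _ _ _ _ _ _))
    (fun {V₁ V₂} h κ => by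
      rw [dualEval_res]
      exact (appLE_res p _ _ (le_inf (inf_le_left.trans (p.preimage_mono
        (AffineZariskiSite.toOpens_mono h))) inf_le_right) _).trans (oRes_appLE p _ _ _).symm)

variable {K} in
lemma dualEval_pullbackDual {V : X.Opens} (s : Γ(dualPullback (𝟙 X) K, V))
    (V' : X.AffineZariskiSite) (κ : K.obj V') :
    dualEval (pullbackDual p s) V' κ =
      p.appLE (𝟙 X ⁻¹ᵁ V'.toOpens ⊓ V) (p ⁻¹ᵁ V'.toOpens ⊓ p ⁻¹ᵁ V)
      (appLE_dualEval_id_le p V' V) (dualEval s V' κ) := rfl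

/-- The pullback of sections of the dual. -/
def sectionsToPushforward : K.sections ⟶ (Modules.pushforward p).obj (dualPullback p K) :=
  Modules.homOfSections (A := dualPullback (𝟙 X) K)
    (B := (Modules.pushforward p).obj (dualPullback p K))
    (fun V =>
      { toFun := fun s => pullbackDual p s
        map_add' := fun s s' => dualEval_ext (f := p) (M := K) fun V' κ => by
          rw [dualEval_pullbackDual, add_dualEval, map_add]
          rfl
        map_smul' := fun r s => dualEval_ext (f := p) (M := K) fun V' κ => by
          rw [dualEval_pullbackDual, smul_dualEval, map_mul, appLE_res p _ _ inf_le_right]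
          exact congrArg (· * _) (oRes_app p (V := V) inf_le_right r).symm })
    (fun h s => dualEval_ext (f := p) (M := K) fun V' κ => by
      refine (dualEval_pullbackDual p _ V' κ).trans ?_
      rw [sRes_dualEval, appLE_res p _ _
        (le_inf inf_le_left (inf_le_right.trans (p.preimage_mono h)))]
      exact (oRes_appLE p _ _ _).symm)

/-- The comparison morphism from the pullback of the dual to the dual of the pullback. -/
def pullbackSectionsTo : (Modules.pullback p).obj K.sections ⟶ dualPullback p K :=
  ((Modules.pullbackPushforwardAdjunction p).homEquiv _ _).symm (sectionsToPushforward p K)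

lemma dualEval_pullbackSectionsTo {W : Y.Opens} {V : X.Opens} (h : W ≤ p ⁻¹ᵁ V)
    (s : Γ(dualPullback (𝟙 X) K, V)) (V' : X.AffineZariskiSite) (κ : K.obj V')
    (e : p ⁻¹ᵁ V'.toOpens ⊓ W ≤ p ⁻¹ᵁ (𝟙 X ⁻¹ᵁ V'.toOpens ⊓ V)) :
    dualEval ((pullbackSectionsTo p K).app W (((Modules.pullback p).obj K.sections).sRes h
      (Modules.pullbackSection p K.sections V s))) V' κ =
      p.appLE (𝟙 X ⁻¹ᵁ V'.toOpens ⊓ V) _ e (dualEval s V' κ) := by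
  rw [Modules.app_sRes, sRes_dualEval]
  have h1 : (pullbackSectionsTo p K).app (p ⁻¹ᵁ V)
      (Modules.pullbackSection p K.sections V s) = pullbackDual p s :=
    Modules.pullbackLift_pullbackSection p (sectionsToPushforward p K) V s
  refine (congrArg (fun ν => Y.oRes _ (dualEval ν V' κ)) h1).trans ?_
  rw [dualEval_pullbackDual]
  exact oRes_appLE p _ _ _

end Sections

namespace AffMod

variable {X : Scheme.{u}} (K N : X.AffMod)

lemma projBasicOpen_inf_le_preimage (U : X.AffineZariskiSite) (m : N.obj U) (W : N.proj.Opens) :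
    N.projBasicOpen U m ⊓ W ≤ N.projProj ⁻¹ᵁ U.toOpens ⊓ W :=
  inf_le_inf_right _ (N.projBasicOpen_le U m)

variable {K N} in
/-- The product of a section of the dual of `p^* K` and a section of `𝒪(1)`. -/
def dualMulTwist {W : N.proj.Opens} (g : Γ(dualPullback N.projProj K, W)) (l : Γ(N.twist, W)) :
    Γ(homTwist K N, W) :=
  homMk (fun U κ m => N.proj.oRes (N.projBasicOpen_inf_le_preimage U m W) (dualEval g U κ) *
      twistEval l U m)
    (fun U κ κ' m => by rw [dualEval_add, map_add, add_mul])
    (fun U a κ m => by rw [dualEval_smul, map_mul, mul_assoc, oRes_appLE, oRes_appLE])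
    (fun U κ m m' => by
      rw [map_mul, map_mul, twistEval_mul, oRes_oRes, oRes_oRes]
      exact mul_left_comm _ _ _)
    (fun {U V} h κ m => by
      rw [dualEval_res, twistEval_res, map_mul, oRes_oRes, oRes_oRes])

lemma homEval_dualMulTwist {W : N.proj.Opens} (g : Γ(dualPullback N.projProj K, W))
    (l : Γ(N.twist, W)) (U : X.AffineZariskiSite) (κ : K.obj U) (m : N.obj U) :
    homEval (dualMulTwist g l) U κ m =
      N.proj.oRes (N.projBasicOpen_inf_le_preimage U m W) (dualEval g U κ) * twistEval l U m := rfl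

/-- The bilinear map defining the morphism from the tensor product to `Hom(p^* K, 𝒪(1))`. -/
def tensorToHomBilin (W : N.proj.Opens) :
    Γ((Modules.pullback N.projProj).obj K.sections, W) →ₗ[Γ(N.proj, W)]
      Γ(N.twist, W) →ₗ[Γ(N.proj, W)] Γ(homTwist K N, W) :=
  LinearMap.mk₂ Γ(N.proj, W)
    (fun a l => dualMulTwist ((pullbackSectionsTo N.projProj K).app W a) l)
    (fun a a' l => homEval_ext fun U κ m => by
      rw [map_add, add_homEval, homEval_dualMulTwist, homEval_dualMulTwist,
        homEval_dualMulTwist, add_dualEval, map_add, add_mul])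
    (fun r a l => homEval_ext fun U κ m => by
      rw [Modules.Hom.app_smul, smul_homEval, homEval_dualMulTwist,
        homEval_dualMulTwist, smul_dualEval, map_mul, oRes_oRes, mul_assoc])
    (fun a l l' => homEval_ext fun U κ m => by
      rw [add_homEval, homEval_dualMulTwist, homEval_dualMulTwist,
        homEval_dualMulTwist, add_twistEval, mul_add])
    (fun r a l => homEval_ext fun U κ m => by
      rw [smul_homEval, homEval_dualMulTwist, homEval_dualMulTwist, smul_twistEval]
      exact mul_left_comm _ _ _)

lemma tensorToHomBilin_sRes {W' W : N.proj.Opens} (h : W' ≤ W)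
    (a : Γ((Modules.pullback N.projProj).obj K.sections, W)) (l : Γ(N.twist, W)) :
    tensorToHomBilin K N W' (((Modules.pullback N.projProj).obj K.sections).sRes h a)
      (N.twist.sRes h l) = (homTwist K N).sRes h (tensorToHomBilin K N W a l) := by
  refine homEval_ext fun U κ m => ?_
  change homEval (dualMulTwist ((pullbackSectionsTo N.projProj K).app _ _) _) U κ m =
    homEval ((homTwist K N).sRes h
      (dualMulTwist ((pullbackSectionsTo N.projProj K).app _ _) _)) U κ m
  rw [sRes_homEval, homEval_dualMulTwist, homEval_dualMulTwist, Modules.app_sRes,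
    sRes_dualEval, sRes_twistEval, map_mul, oRes_oRes, oRes_oRes]

/-- The morphism from the tensor product to `Hom(p^* K, 𝒪(1))`. -/
def tensorToHom : ((Modules.pullback N.projProj).obj K.sections).tensor N.twist ⟶ homTwist K N :=
  Modules.tensorLift (tensorToHomBilin K N) (tensorToHomBilin_sRes K N)

lemma tensorToHom_tmul {W : N.proj.Opens} (a : Γ((Modules.pullback N.projProj).obj K.sections, W))
    (l : Γ(N.twist, W)) : (tensorToHom K N).app W (Modules.tmul _ _ a l) =
      dualMulTwist ((pullbackSectionsTo N.projProj K).app W a) l :=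
  Modules.tensorLift_tmul (tensorToHomBilin K N) (tensorToHomBilin_sRes K N) a l

end AffMod

end AlgebraicGeometry.Scheme
end

/-! ### The comparison morphism is an isomorphism for locally free `K`. -/

noncomputable section

open CategoryTheory CategoryTheory.Limits AlgebraicGeometry Opposite TopologicalSpace

namespace AlgebraicGeometry.Scheme

lemma sum_dualEval {Y X : Scheme.{u}} {f : Y ⟶ X} {K : X.AffMod} {W : Y.Opens} {J : Type*}
    (T : Finset J) (ν : J → Γ(dualPullback f K, W)) (V : X.AffineZariskiSite) (m : K.obj V) :
    dualEval (∑ j ∈ T, ν j) V m = ∑ j ∈ T, dualEval (ν j) V m := by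
  classical
  induction T using Finset.induction_on with
  | empty => rfl
  | insert j T hj ih => rw [Finset.sum_insert hj, Finset.sum_insert hj, ← ih, add_dualEval]

namespace AffMod

variable {X : Scheme.{u}} {K N : X.AffMod}

lemma sum_homEval {W : N.proj.Opens} {J : Type*} (T : Finset J) (s : J → Γ(homTwist K N, W))
    (U : X.AffineZariskiSite) (κ : K.obj U) (m : N.obj U) :
    homEval (∑ j ∈ T, s j) U κ m = ∑ j ∈ T, homEval (s j) U κ m := by
  classical
  induction T using Finset.induction_on with
  | empty => rfl
  | insert j T hj ih => rw [Finset.sum_insert hj, Finset.sum_insert hj, ← ih, add_homEval]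

section Local

variable {n : ℕ} (U : X.AffineZariskiSite) (b : Fin n → K.obj U)
  (e : Fin n → Γ(dualPullback (𝟙 X) K, U.toOpens))

/-- A section of the dual is a combination of the dual basis. -/
lemma mem_span_dualBasis (hb : Submodule.span Γ(X, U.toOpens) (Set.range b) = ⊤)
    (he : ∀ j l, dualEval (e j) U (b l) = if l = j then 1 else 0)
    {V : X.Opens} (hV : V ≤ U.toOpens) (s : Γ(dualPullback (𝟙 X) K, V)) :
    s ∈ Submodule.span Γ(X, V) (Set.range fun j => (dualPullback (𝟙 X) K).sRes hV (e j)) := by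
  have hV' : V ≤ 𝟙 X ⁻¹ᵁ U.toOpens ⊓ V := le_inf hV le_rfl
  -- The coefficients with respect to the dual basis are the values on the basis.
  have h1 : s = ∑ j, X.oRes hV' (dualEval s U (b j)) • (dualPullback (𝟙 X) K).sRes hV (e j) := by
    refine dualEval_ext_of_span U b hb hV fun l => ?_
    rw [sum_dualEval]
    simp only [smul_dualEval, sRes_dualEval, he, oRes_oRes]
    rw [Finset.sum_eq_single l (fun j _ hj => by rw [if_neg (Ne.symm hj), map_zero, mul_zero])
      (fun h => absurd (Finset.mem_univ l) h), if_pos rfl, map_one, mul_one, oRes_refl]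
  rw [h1]
  exact Submodule.sum_mem _ fun j _ => Submodule.smul_mem _ _ (Submodule.subset_span ⟨j, rfl⟩)

variable (m : N.obj U) (l₀ : Γ(N.twist, N.projBasicOpen U m))

/-- The local generators of the tensor product. -/
def tensorGen (j : Fin n) :
    Γ(((Modules.pullback N.projProj).obj K.sections).tensor N.twist, N.projBasicOpen U m) :=
  Modules.tmul _ _ (((Modules.pullback N.projProj).obj K.sections).sRes (N.projBasicOpen_le U m)
    (Modules.pullbackSection N.projProj K.sections U.toOpens (e j))) l₀

/-- The local generators go to a family dual to the basis, so the coefficients of a combination of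
generators can be read off from its image. Injectivity and surjectivity both come from this. -/
lemma homEval_tensorGen (he : ∀ j l, dualEval (e j) U (b l) = if l = j then 1 else 0)
    (hl₀ : twistEval l₀ U m = 1) (j l : Fin n) :
    homEval ((tensorToHom K N).app _ (tensorGen U e m l₀ j)) U (b l) m = if l = j then 1 else 0 := by
  rw [tensorGen, tensorToHom_tmul, homEval_dualMulTwist, hl₀, mul_one]
  refine (congrArg _ (dualEval_pullbackSectionsTo N.projProj K (N.projBasicOpen_le U m) (e j) U (b l)
    (fun y hy => ⟨hy.1, hy.1⟩))).trans ?_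
  rw [he]
  split_ifs
  · rw [map_one, map_one]
  · rw [map_zero, map_zero]

/-- The section is given over an arbitrary `V`; restricted to `V ∩ U` it is a combination of the
dual basis, and pullback respects such combinations. -/
lemma pullbackSection_mem_span (hb : Submodule.span Γ(X, U.toOpens) (Set.range b) = ⊤)
    (he : ∀ j l, dualEval (e j) U (b l) = if l = j then 1 else 0) {W : N.proj.Opens}
    (hW : W ≤ N.projProj ⁻¹ᵁ U.toOpens) (V : X.Opens) (h : W ≤ N.projProj ⁻¹ᵁ V)
    (s : Γ(K.sections, V)) :
    ((Modules.pullback N.projProj).obj K.sections).sRes h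
      (Modules.pullbackSection N.projProj K.sections V s) ∈ Submodule.span Γ(N.proj, W)
      (Set.range fun j => ((Modules.pullback N.projProj).obj K.sections).sRes hW
        (Modules.pullbackSection N.projProj K.sections U.toOpens (e j))) := by
  have hW' : W ≤ N.projProj ⁻¹ᵁ (V ⊓ U.toOpens) := le_inf h hW
  have h1 : ((Modules.pullback N.projProj).obj K.sections).sRes h
      (Modules.pullbackSection N.projProj K.sections V s) =
      ((Modules.pullback N.projProj).obj K.sections).sRes hW'
      (Modules.pullbackSection N.projProj K.sections (V ⊓ U.toOpens)
        (K.sections.sRes inf_le_left s)) := by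
    rw [Modules.pullbackSection_sRes, Modules.sRes_sRes]
  rw [h1]
  have h2 : K.sections.sRes inf_le_left s ∈ Submodule.span Γ(X, V ⊓ U.toOpens)
    (Set.range fun j => K.sections.sRes inf_le_right (show Γ(K.sections, U.toOpens) from e j)) :=
    mem_span_dualBasis U b e hb he inf_le_right _
  generalize K.sections.sRes inf_le_left s = s' at h2
  induction h2 using Submodule.span_induction with
  | mem x hx =>
    obtain ⟨j, rfl⟩ := hx
    refine Submodule.subset_span ⟨j, ?_⟩
    refine ((congrArg _ (Modules.pullbackSection_sRes N.projProj K.sections inf_le_right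
      (e j))).trans (Modules.sRes_sRes _ _ _ _)).symm
  | zero =>
    have : Modules.pullbackSection N.projProj K.sections (V ⊓ U.toOpens) 0 = 0 := map_zero _
    rw [this, Modules.sRes_zero]
    exact Submodule.zero_mem _
  | add x y _ _ hx hy =>
    rw [Modules.pullbackSection_add, Modules.sRes_add]
    exact Submodule.add_mem _ hx hy
  | smul r x _ hx =>
    rw [Modules.pullbackSection_smul, Modules.sRes_smul]
    exact Submodule.smul_mem _ _ hx

/-- The restrictions of the local generators. -/
def tensorGens (W : N.proj.Opens) :
    Set Γ(((Modules.pullback N.projProj).obj K.sections).tensor N.twist, W) :=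
  { t | ∃ (h : W ≤ N.projBasicOpen U m) (j : Fin n),
    t = (((Modules.pullback N.projProj).obj K.sections).tensor N.twist).sRes h
      (tensorGen U e m l₀ j) }

lemma tensorGens_sRes {W' W : N.proj.Opens} (h : W' ≤ W)
    {t : Γ(((Modules.pullback N.projProj).obj K.sections).tensor N.twist, W)}
    (ht : t ∈ tensorGens U e m l₀ W) :
    (((Modules.pullback N.projProj).obj K.sections).tensor N.twist).sRes h t ∈
      tensorGens U e m l₀ W' := by
  obtain ⟨hW, j, rfl⟩ := ht
  exact ⟨h.trans hW, j, Modules.sRes_sRes _ _ _ _⟩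

lemma twist_eq_smul (hl₀ : twistEval l₀ U m = 1) {W : N.proj.Opens}
    (hW : W ≤ N.projBasicOpen U m) (l : Γ(N.twist, W)) :
    l = N.proj.oRes (le_inf hW le_rfl) (twistEval l U m) • N.twist.sRes hW l₀ := by
  refine twistEval_ext_of_le U m hW ?_
  rw [smul_twistEval, sRes_twistEval, hl₀, map_one, mul_one, oRes_oRes, oRes_refl]

/-- The sections of the tensor product over open subsets of `D_+(m)` are locally combinations of the
local generators. -/
lemma mem_locallySpan_tensorGens (hb : Submodule.span Γ(X, U.toOpens) (Set.range b) = ⊤)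
    (he : ∀ j l, dualEval (e j) U (b l) = if l = j then 1 else 0)
    (hl₀ : twistEval l₀ U m = 1) {W : N.proj.Opens} (hW : W ≤ N.projBasicOpen U m)
    (t : Γ(((Modules.pullback N.projProj).obj K.sections).tensor N.twist, W)) :
    t ∈ Modules.locallySpan _ (tensorGens U e m l₀) (tensorGens_sRes U e m l₀) W := by
  -- Pure tensors suffice. The second factor is a multiple of the generator `l₀` of `𝒪(1)`, and the
  -- first is locally a combination of pulled back dual basis elements.
  have h1 : ∀ (W : N.proj.Opens) (hW : W ≤ N.projBasicOpen U m)
      (a : Γ((Modules.pullback N.projProj).obj K.sections, W)) (l : Γ(N.twist, W)),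
      Modules.tmul _ _ a l ∈
        Modules.locallySpan _ (tensorGens U e m l₀) (tensorGens_sRes U e m l₀) W := by
    intro W hW a l y hy
    obtain ⟨W', h, hy', ha⟩ := Modules.pullback_locally_span N.projProj K.sections W a y hy
    refine ⟨W', h, hy', ?_⟩
    rw [Modules.tmul_sRes, twist_eq_smul U m l₀ hl₀ (h.trans hW) (N.twist.sRes h l),
      Modules.tmul_smul]
    apply Submodule.smul_mem
    have h2 : ((Modules.pullback N.projProj).obj K.sections).sRes h a ∈
        Submodule.span Γ(N.proj, W') (Set.range fun j =>
          ((Modules.pullback N.projProj).obj K.sections).sRes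
            ((h.trans hW).trans (N.projBasicOpen_le U m))
            (Modules.pullbackSection N.projProj K.sections U.toOpens (e j))) := by
      refine Submodule.span_le.mpr ?_ ha
      rintro _ ⟨V, hV, s, rfl⟩
      exact pullbackSection_mem_span U b e hb he _ V hV s
    generalize ((Modules.pullback N.projProj).obj K.sections).sRes h a = a' at h2
    induction h2 using Submodule.span_induction with
    | mem x hx =>
      obtain ⟨j, rfl⟩ := hx
      refine Submodule.subset_span ⟨h.trans hW, j, ?_⟩
      rw [tensorGen, Modules.tmul_sRes, Modules.sRes_sRes]
    | zero =>
      have := Modules.smul_tmul (A := (Modules.pullback N.projProj).obj K.sections)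
        (0 : Γ(N.proj, W')) 0 (N.twist.sRes (h.trans hW) l₀)
      rw [zero_smul, zero_smul] at this
      rw [this]
      exact Submodule.zero_mem _
    | add x y _ _ hx hy =>
      rw [Modules.add_tmul]
      exact Submodule.add_mem _ hx hy
    | smul r x _ hx =>
      rw [Modules.smul_tmul]
      exact Submodule.smul_mem _ _ hx
  apply Modules.locallySpan_of_locally
  intro y hy
  obtain ⟨W', h, hy', ht⟩ := Modules.tensor_locally_span t y hy
  refine ⟨W', h, hy', Submodule.span_le.mpr ?_ ht⟩
  rintro _ ⟨a, l, rfl⟩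
  exact h1 W' (h.trans hW) a l

end Local

/-- The morphism from `p^* K^∨ ⊗ 𝒪(1)` to `Hom(p^* K, 𝒪(1))` is an isomorphism if `K` is locally
free. -/
lemma isIso_tensorToHom {n : ℕ}
    (hfree : ∀ x : X, ∃ U : X.AffineZariskiSite, x ∈ U.toOpens ∧ ∃ b : Fin n → K.obj U,
      Submodule.span Γ(X, U.toOpens) (Set.range b) = ⊤ ∧ LinearIndependent Γ(X, U.toOpens) b) :
    IsIso (tensorToHom K N) := by
  have hloc : ∀ y : N.proj, ∃ (U : X.AffineZariskiSite) (b : Fin n → K.obj U) (m : N.obj U)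
      (e : Fin n → Γ(dualPullback (𝟙 X) K, U.toOpens)) (l₀ : Γ(N.twist, N.projBasicOpen U m)),
      y ∈ N.projBasicOpen U m ∧ Submodule.span Γ(X, U.toOpens) (Set.range b) = ⊤ ∧
      (∀ j l, dualEval (e j) U (b l) = if l = j then 1 else 0) ∧ twistEval l₀ U m = 1 := by
    intro y
    obtain ⟨U, hU, b, hb, hi⟩ := hfree (N.projProj y)
    obtain ⟨m, hm⟩ := N.exists_mem_projBasicOpen U y hU
    choose e he using fun j => exists_dualBasis (𝟙 X) j hb hi
    obtain ⟨l₀, hl₀⟩ := exists_twistSection U m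
    exact ⟨U, b, m, e, l₀, hm, hb, he, hl₀⟩
  -- The value at `b l` and `m` of the image of a combination of generators is its `l`-th
  -- coefficient.
  have hval : ∀ (U : X.AffineZariskiSite) (b : Fin n → K.obj U) (m : N.obj U)
      (e : Fin n → Γ(dualPullback (𝟙 X) K, U.toOpens)) (l₀ : Γ(N.twist, N.projBasicOpen U m))
      (_ : ∀ j l, dualEval (e j) U (b l) = if l = j then 1 else 0) (_ : twistEval l₀ U m = 1)
      (W : N.proj.Opens) (hW : W ≤ N.projBasicOpen U m) (c : Fin n → Γ(N.proj, W)) (l : Fin n),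
      homEval ((tensorToHom K N).app W (∑ j, c j • (((Modules.pullback N.projProj).obj
        K.sections).tensor N.twist).sRes hW (tensorGen U e m l₀ j))) U (b l) m =
        N.proj.oRes inf_le_right (c l) := by
    intro U b m e l₀ he hl₀ W hW c l
    rw [map_sum, sum_homEval, Finset.sum_eq_single l]
    · rw [Modules.Hom.app_smul, smul_homEval, Modules.app_sRes, sRes_homEval,
        homEval_tensorGen U b e m l₀ he hl₀, if_pos rfl, map_one, mul_one]
    · intro j _ hj
      rw [Modules.Hom.app_smul, smul_homEval, Modules.app_sRes, sRes_homEval,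
        homEval_tensorGen U b e m l₀ he hl₀, if_neg (Ne.symm hj), map_zero, mul_zero]
    · exact fun h => absurd (Finset.mem_univ l) h
  refine Modules.isIso_of_locally _ ?_ ?_
  · intro W t ht
    refine Modules.section_ext _ fun y hy => ?_
    obtain ⟨U, b, m, e, l₀, hym, hb, he, hl₀⟩ := hloc y
    have h1 := mem_locallySpan_tensorGens U b e m l₀ hb he hl₀
      (inf_le_left : N.projBasicOpen U m ⊓ W ≤ _) (Modules.sRes _ inf_le_right t)
    obtain ⟨W', h, hy', ht'⟩ := h1 y ⟨hym, hy⟩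
    refine ⟨W', h.trans inf_le_right, hy', ?_⟩
    rw [Modules.sRes_sRes] at ht'
    rw [Modules.sRes_zero]
    have hW' := h.trans inf_le_left
    have h2 : Submodule.span Γ(N.proj, W') (tensorGens U e m l₀ W') ≤ Submodule.span Γ(N.proj, W')
        (Set.range fun j => (((Modules.pullback N.projProj).obj
        K.sections).tensor N.twist).sRes hW' (tensorGen U e m l₀ j)) := by
      refine Submodule.span_mono ?_
      rintro _ ⟨_, j, rfl⟩
      exact ⟨j, rfl⟩
    obtain ⟨c, hc⟩ := (Submodule.mem_span_range_iff_exists_fun _).mp (h2 ht')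
    rw [← hc]
    refine Finset.sum_eq_zero fun j _ => ?_
    -- Injectivity: if the image vanishes, so do all coefficients.
    have h3 := hval U b m e l₀ he hl₀ W' hW' c j
    rw [hc, Modules.app_sRes, ht, Modules.sRes_zero, zero_homEval] at h3
    have h4 := congrArg (N.proj.oRes (le_inf hW' le_rfl)) h3
    rw [map_zero, oRes_oRes, oRes_refl] at h4
    rw [← h4, zero_smul]
  · intro W h y hy
    obtain ⟨U, b, m, e, l₀, hym, hb, he, hl₀⟩ := hloc y
    -- Surjectivity: take the values of the given homomorphism at the basis as coefficients.
    refine ⟨N.projBasicOpen U m ⊓ W, inf_le_right, ⟨hym, hy⟩,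
      ∑ j, homEval h U (b j) m • Modules.sRes _ inf_le_left (tensorGen U e m l₀ j), ?_⟩
    rw [← sub_eq_zero, sub_eq_add_neg, ← neg_one_smul Γ(N.proj, N.projBasicOpen U m ⊓ W)]
    refine homEval_eq_zero _ U b hb m inf_le_left fun l => ?_
    rw [add_homEval, smul_homEval, hval U b m e l₀ he hl₀, sRes_homEval, map_neg, map_one,
      neg_one_mul, add_neg_eq_zero]

end AffMod

end AlgebraicGeometry.Scheme
end

/-! ### Chains of homogeneous primes and regular families. -/

noncomputable section

open CategoryTheory CategoryTheory.Limits AlgebraicGeometry Opposite TopologicalSpace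

section GradedChain

variable {A R : Type*} [CommRing A] [CommRing R] [Algebra A R] {𝒜 : ℕ → Submodule A R}
  [GradedAlgebra 𝒜]

/-- A form of Nakayama's lemma for homogeneous ideals of an `ℕ`-graded ring. -/
lemma Ideal.IsHomogeneous.le_of_le_sup_mul {I Q : Ideal R} (hI : I.IsHomogeneous 𝒜)
    (hQ : Q.IsHomogeneous 𝒜) {f : R} (hf : f ∈ 𝒜 1)
    (h : ∀ q ∈ Q, ∃ a ∈ I, ∃ r ∈ Q, q = a + f * r) : Q ≤ I := by
  have key : ∀ (d : ℕ), ∀ q ∈ Q, q ∈ 𝒜 d → q ∈ I := by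
    intro d
    induction d with
    | zero =>
      intro q hq hqd
      obtain ⟨a, ha, r, hr, e⟩ := h q hq
      -- In degree zero the term `f * r` does not contribute, as `f` has degree one.
      rw [← DirectSum.decompose_of_mem_same 𝒜 hqd, e, DirectSum.decompose_add, DirectSum.add_apply,
        Submodule.coe_add, DirectSum.coe_decompose_mul_of_left_mem_of_not_le 𝒜 hf (by simp),
        add_zero]
      exact hI 0 ha
    | succ d ih =>
      intro q hq hqd
      obtain ⟨a, ha, r, hr, e⟩ := h q hq
      -- In degree `d + 1` the contribution of `f * r` is `f` times the component of `r` of degree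
      -- `d`, which lies in `Q` by homogeneity and hence in `I` by induction.
      rw [← DirectSum.decompose_of_mem_same 𝒜 hqd, e, DirectSum.decompose_add, DirectSum.add_apply,
        Submodule.coe_add, DirectSum.coe_decompose_mul_of_left_mem_of_le 𝒜 hf (by simp)]
      exact I.add_mem (hI _ ha) (I.mul_mem_left _ (ih _ (hQ _ hr) (SetLike.coe_mem _)))
  intro q hq
  classical
  rw [← DirectSum.sum_support_decompose 𝒜 q]
  exact I.sum_mem fun i _ => key i _ (hQ i hq) (SetLike.coe_mem _)

variable {n : ℕ} {f : Fin n → R} {Q : ℕ → Ideal R}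

lemma Ideal.exists_of_mem_span_image_succ (i : Fin n) {q : R}
    (hq : q ∈ Ideal.span (f '' {j | (j : ℕ) < i + 1})) :
    ∃ a ∈ Ideal.span (f '' {j | (j : ℕ) < i}), ∃ r, q = a + f i * r := by
  have : {j : Fin n | (j : ℕ) < i + 1} = insert i {j : Fin n | (j : ℕ) < i} := by
    ext j
    simp only [Set.mem_ofPred_eq, Set.mem_insert_iff, Fin.ext_iff]
    omega
  rw [this, Set.image_insert_eq, Ideal.span_insert, Submodule.mem_sup] at hq
  obtain ⟨y, hy, a, ha, rfl⟩ := hq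
  obtain ⟨r, rfl⟩ := Ideal.mem_span_singleton.mp hy
  exact ⟨a, ha, r, add_comm _ _⟩

/-- If the ideal generated by forms `f₀, …, fₙ₋₁` of degree one is the last term of a chain of
homogeneous primes `Q₀ ≤ ⋯ ≤ Qₙ` with `fⱼ ∈ Qᵢ` exactly for `j < i`, then
`Qᵢ = (f₀, …, fᵢ₋₁)` for all `i`. -/
lemma Ideal.eq_span_image_of_chain (hf : ∀ j, f j ∈ 𝒜 1) (hQ : ∀ i, (Q i).IsPrime)
    (hQh : ∀ i, (Q i).IsHomogeneous 𝒜) (hQm : Monotone Q) (hfQ : ∀ j : Fin n, f j ∉ Q j)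
    (hfQ' : ∀ (i : ℕ) (j : Fin n), (j : ℕ) < i → f j ∈ Q i)
    (hn : Q n ≤ Ideal.span (Set.range f)) (i : ℕ) (hi : i ≤ n) :
    Q i = Ideal.span (f '' {j | (j : ℕ) < i}) := by
  have hle : ∀ i, Ideal.span (f '' {j | (j : ℕ) < i}) ≤ Q i := by
    intro i
    rw [Ideal.span_le]
    rintro _ ⟨j, hj, rfl⟩
    exact hfQ' i j hj
  induction hi using Nat.decreasingInduction with
  | self =>
    refine le_antisymm (hn.trans (Ideal.span_mono ?_)) (hle n)
    rintro _ ⟨j, rfl⟩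
    exact ⟨j, j.2, rfl⟩
  | of_succ i hi ih =>
    refine le_antisymm (Ideal.IsHomogeneous.le_of_le_sup_mul (𝒜 := 𝒜) ?_ (hQh i) (hf ⟨i, hi⟩) ?_)
      (hle i)
    · refine Ideal.homogeneous_span 𝒜 _ ?_
      rintro _ ⟨j, -, rfl⟩
      exact ⟨1, hf j⟩
    · intro q hq
      have hq' := hQm (Nat.le_succ i) hq
      rw [Nat.succ_eq_add_one, ih] at hq'
      obtain ⟨a, ha, r, e⟩ := Ideal.exists_of_mem_span_image_succ ⟨i, hi⟩ hq'
      refine ⟨a, ha, r, ?_, e⟩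
      -- As `fᵢ` is not in the prime `Qᵢ`, the cofactor `r` is. So `Qᵢ = (f₀, …, fᵢ₋₁) + fᵢ Qᵢ`, and
      -- Nakayama applies.
      have h1 : f ⟨i, hi⟩ * r ∈ Q i := by
        rw [← sub_eq_iff_eq_add'.mpr e]
        exact (Q i).sub_mem hq (hle i ha)
      exact ((hQ i).mem_or_mem h1).resolve_left (hfQ ⟨i, hi⟩)

/-- In the situation of `Ideal.eq_span_image_of_chain`, the family `f` remains regular modulo an
element that is not contained in `Qₙ`. -/
lemma isRegularFamily_comp_of_chain {S : Type*} [CommRing S] (π : R →+* S)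
    (hπ : Function.Surjective π) {ξ : R} (hξ : RingHom.ker π = Ideal.span {ξ})
    (hQ : ∀ i, (Q i).IsPrime) (hQm : Monotone Q) (hfQ : ∀ j : Fin n, f j ∉ Q j) (hξQ : ξ ∉ Q n)
    (hQf : ∀ i ≤ n, Q i = Ideal.span (f '' {j | (j : ℕ) < i})) :
    IsRegularFamily fun j => π (f j) := by
  intro i z hz
  have himg : Ideal.span ((fun j => π (f j)) '' {j | j < i}) =
      (Ideal.span (f '' {j | (j : ℕ) < i})).map π := by
    rw [Ideal.map_span, ← Set.image_comp]
    rfl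
  rw [himg] at hz ⊢
  obtain ⟨z, rfl⟩ := hπ z
  rw [← map_mul, ← Ideal.mem_comap, Ideal.comap_map_of_surjective' π hπ, hξ,
    Submodule.mem_sup] at hz
  obtain ⟨a, ha, y, hy, e⟩ := hz
  obtain ⟨w, rfl⟩ := Ideal.mem_span_singleton.mp hy
  have hi : (i : ℕ) + 1 ≤ n := i.2
  have hiQ := hQf i i.2.le
  have hfi : f i ∈ Q (i + 1) := by
    rw [hQf _ hi]
    exact Ideal.subset_span ⟨i, Nat.lt_succ_self _, rfl⟩
  -- Upstairs, `z fᵢ = a + ξ w` with `a ∈ Qᵢ`. Modulo the prime `Qᵢ₊₁`, which contains `fᵢ` and `a`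
  -- but not `ξ`, this forces `w` to vanish.
  have hw : w ∈ Q (i + 1) := by
    have h1 : ξ * w ∈ Q (i + 1) := by
      rw [← sub_eq_iff_eq_add'.mpr e.symm]
      exact Ideal.sub_mem _ (Ideal.mul_mem_left _ _ hfi) (hQm (Nat.le_succ _) (hiQ ▸ ha))
    exact ((hQ _).mem_or_mem h1).resolve_left fun h => hξQ (hQm hi h)
  rw [hQf _ hi] at hw
  obtain ⟨q, hq, r, rfl⟩ := Ideal.exists_of_mem_span_image_succ i hw
  -- With `w = q + fᵢ r` and `q ∈ Qᵢ` the relation becomes `fᵢ (z - ξ r) = a + q ξ`. Since `fᵢ ∉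
  -- Qᵢ`, the element `z - ξ r`, which has the same image as `z` modulo `ξ`, lies in `Qᵢ`.
  have h2 : f i * (z - ξ * r) ∈ Q i := by
    have : f i * (z - ξ * r) = a + q * ξ := by linear_combination -e
    rw [this, hiQ]
    exact Ideal.add_mem _ ha (Ideal.mul_mem_right _ _ hq)
  have h3 := ((hQ i).mem_or_mem h2).resolve_left (hfQ i)
  rw [hiQ] at h3
  have h4 := Ideal.mem_map_of_mem π h3
  have h5 : π ξ = 0 := by
    rw [← RingHom.mem_ker, hξ]
    exact Ideal.mem_span_singleton_self ξ
  rwa [map_sub, map_mul, h5, zero_mul, sub_zero] at h4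

end GradedChain

/-! ### Regular families from vector space quotients. -/

namespace SymmetricAlgebra

section Field

variable {K V : Type*} [Field K] [AddCommGroup V] [Module K V]

/-- A choice of basis gives a polynomial ring, possibly in infinitely many variables. This is why
the kernels `Q i` below are prime. -/
instance isDomain_of_field : IsDomain (SymmetricAlgebra K V) :=
  (equivMvPolynomial (Module.Basis.ofVectorSpace K V)).toMulEquiv.isDomain

/-- Every linear functional extends to the symmetric algebra, and functionals separate vectors. -/
lemma eq_zero_of_ι_eq_zero {x : V} (h : ι K V x = 0) : x = 0 := by
  rw [← Module.forall_dual_apply_eq_zero_iff K]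
  intro g
  rw [← lift_ι_apply (R := K) (A := K) g x, h, map_zero]

end Field

section Ker

variable {A B M N : Type*} [CommRing A] [CommRing B] [AddCommGroup M] [Module A M] [AddCommGroup N]
  [Module B N] {φ : A →+* B}

lemma isHomogeneous_ker_mapₛ (g : M →ₛₗ[φ] N) :
    (RingHom.ker (mapₛ φ g)).IsHomogeneous (grading A M) := by
  intro i x hx
  rw [RingHom.mem_ker] at hx ⊢
  rw [← gradedMap_apply, GradedRingHom.map_directSumDecompose, gradedMap_apply, hx,
    DirectSum.decompose_zero]
  rfl

/-- Gives both the monotonicity of the chain of primes and the comparison of its last term with the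
kernel of the map to `Sym L`. -/
lemma ker_mapₛ_le_comp {L : Type*} [AddCommGroup L] [Module B L] (g : M →ₛₗ[φ] N)
    (e : N →ₗ[B] L) : RingHom.ker (mapₛ φ g) ≤ RingHom.ker (mapₛ φ (e.comp g)) := by
  have : mapₛ φ (e.comp g) = (mapₛ (RingHom.id B) e).comp (mapₛ φ g) :=
    ringHom_ext' (fun a => by simp) fun m => by simp
  intro x hx
  rw [RingHom.mem_ker] at hx ⊢
  rw [this, RingHom.comp_apply, hx, map_zero]

end Ker

variable {A K M N V L : Type*} [CommRing A] [Field K] [AddCommGroup M] [Module A M]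
  [AddCommGroup N] [Module A N] [AddCommGroup V] [Module K V] [AddCommGroup L] [Module K L]
  {φ : A →+* K}

/-- Let `f₀, …, fₙ₋₁ ∈ M` become linearly independent over a field `K`, and suppose that they
generate the kernel of the map `Sym_A M → Sym_K L` induced by a map that factors through `V`. Then
they form a regular family in `Sym_A (M / m₀)` for every `m₀` that does not vanish in `L`. -/
lemma isRegularFamily_ι {n : ℕ} {f : Fin n → M} (v : M →ₛₗ[φ] V)
    (hv : LinearIndependent K fun j => v (f j)) (e : V →ₗ[K] L) (he : ∀ j, e (v (f j)) = 0)
    (hker : RingHom.ker (mapₛ φ (e.comp v)) ≤ Ideal.span (Set.range fun j => ι A M (f j)))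
    {m₀ : M} (hm₀ : e (v m₀) ≠ 0) (p : M →ₗ[A] N) (hp : Function.Surjective p)
    (hpm : LinearMap.ker p = Submodule.span A {m₀}) :
    IsRegularFamily fun j => ι A N (p (f j)) := by
  -- The primes are kernels of the maps to `Sym_K (V / Wᵢ)`. By independence `v (f i)` is not in
  -- `Wᵢ`, so `f i` is not in the `i`-th prime.
  let W : ℕ → Submodule K V := fun i => Submodule.span K ((fun j => v (f j)) '' {j | (j : ℕ) < i})
  have hWm : Monotone W := fun i i' h =>
    Submodule.span_mono (Set.image_mono fun j (hj : (j : ℕ) < i) => hj.trans_le h)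
  have hWe : ∀ i, W i ≤ LinearMap.ker e := by
    intro i
    rw [Submodule.span_le]
    rintro _ ⟨j, -, rfl⟩
    exact he j
  let g : ∀ i, M →ₛₗ[φ] V ⧸ W i := fun i => (W i).mkQ.comp v
  let Q : ℕ → Ideal (SymmetricAlgebra A M) := fun i => RingHom.ker (mapₛ φ (g i))
  have hQ : ∀ i, (Q i).IsPrime := fun i => RingHom.ker_isPrime _
  have hQm : Monotone Q := by
    intro i i' h
    refine (ker_mapₛ_le_comp (g i) (Submodule.factor (hWm h))).trans (le_of_eq ?_)
    change _ = RingHom.ker (mapₛ φ (g i'))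
    congr 2
  have hQι : ∀ i m, ι A M m ∈ Q i ↔ v m ∈ W i := by
    intro i m
    rw [RingHom.mem_ker, mapₛ_ι, ← Submodule.Quotient.mk_eq_zero]
    exact ⟨fun h => eq_zero_of_ι_eq_zero h, fun h => (congrArg (ι K _) h).trans (map_zero _)⟩
  have hfQ : ∀ j : Fin n, ι A M (f j) ∉ Q j := by
    intro j
    rw [hQι]
    exact hv.notMem_span_image (lt_irrefl (j : ℕ))
  -- As `e` kills `Wₙ`, it factors through `V / Wₙ`. Together with `hker` this shows that the last
  -- prime is contained in the ideal of the `f j`.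
  have hQe : Q n ≤ RingHom.ker (mapₛ φ (e.comp v)) := by
    refine (ker_mapₛ_le_comp (g n) ((W n).liftQ e (hWe n))).trans (le_of_eq ?_)
    congr 2
  have hQf := Ideal.eq_span_image_of_chain (𝒜 := grading A M) (f := fun j => ι A M (f j)) (Q := Q)
    (fun j => ?_) hQ (fun i => isHomogeneous_ker_mapₛ _) hQm hfQ
    (fun i j hj => (hQι i _).mpr (Submodule.subset_span ⟨j, hj, rfl⟩)) (hQe.trans hker)
  · have hπ : ∀ j, ι A N (p (f j)) = mapₛ (RingHom.id A) p (ι A M (f j)) := fun j => by simp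
    simp only [hπ]
    refine isRegularFamily_comp_of_chain (Q := Q) (ξ := ι A M m₀) (mapₛ (RingHom.id A) p) ?_ ?_ hQ
      hQm hfQ ?_ hQf
    · intro y
      induction y using SymmetricAlgebra.induction with
      | algebraMap r => exact ⟨algebraMap A _ r, by simp⟩
      | ι x =>
        obtain ⟨m, rfl⟩ := hp x
        exact ⟨ι A M m, by simp⟩
      | mul a b ha hb =>
        obtain ⟨a, rfl⟩ := ha
        obtain ⟨b, rfl⟩ := hb
        exact ⟨a * b, map_mul _ _ _⟩
      | add a b ha hb =>
        obtain ⟨a, rfl⟩ := ha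
        obtain ⟨b, rfl⟩ := hb
        exact ⟨a + b, map_add _ _ _⟩
    · refine le_antisymm ((ker_mapₛ_le p hp).trans ?_) ?_
      · rw [Ideal.span_le]
        rintro _ ⟨m, hm, rfl⟩
        rw [SetLike.mem_coe, hpm, Submodule.mem_span_singleton] at hm
        obtain ⟨a, rfl⟩ := hm
        rw [map_smul, Algebra.smul_def]
        exact Ideal.mul_mem_left _ _ (Ideal.mem_span_singleton_self _)
      · rw [Ideal.span_singleton_le_iff_mem, RingHom.mem_ker, mapₛ_ι]
        have : m₀ ∈ LinearMap.ker p := hpm ▸ Submodule.mem_span_singleton_self m₀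
        rw [LinearMap.mem_ker.mp this, map_zero]
    -- If `m₀` were in the last prime, `v m₀` would lie in `Wₙ` and be killed by `e`.
    · exact fun h => hm₀ (hWe n ((hQι n _).mp h))
  · rw [grading, pow_one]
    exact ⟨_, rfl⟩

end SymmetricAlgebra
end

/-! ### Logarithmic derivations and Jacobian ideals of linear type. -/

noncomputable section

open CategoryTheory CategoryTheory.Limits AlgebraicGeometry Opposite TopologicalSpace

section Jacobian

variable {k A : Type*} [CommRing k] [CommRing A] [IsDomain A] [Algebra k A] {n : ℕ}

/-- Let `h ≠ 0` be an element of a domain, and `J = (h, θ h)` its Jacobian ideal. If `J` is of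
linear type, and the logarithmic derivations along `h` are free with basis `δ`, then the `δⱼ` form
a regular family in the symmetric algebra of the module of derivations. -/
lemma Derivation.isRegularFamily_ι_of_symToRees_injective {h : A} (hh : h ≠ 0) (J : Ideal A)
    (hJ : J = Ideal.span {h} ⊔ Ideal.span {b | ∃ θ : Derivation k A A, θ h = b})
    (hlin : Function.Injective J.symToRees) (δ : Fin n → Derivation k A A)
    (hδ : LinearIndependent A δ)
    (hspan : ∀ θ : Derivation k A A, h ∣ θ h ↔ θ ∈ Submodule.span A (Set.range δ)) :
    IsRegularFamily fun j => SymmetricAlgebra.ι A (Derivation k A A) (δ j) := by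
  let K := FractionRing A
  have hhJ : h ∈ J := by
    rw [hJ]
    exact Ideal.mem_sup_left (Ideal.mem_span_singleton_self h)
  have hθJ : ∀ θ : Derivation k A A, θ h ∈ J := by
    intro θ
    rw [hJ]
    exact Ideal.mem_sup_right (Ideal.subset_span ⟨θ, rfl⟩)
  -- The factor `A` accounts for the generator `h` of the Jacobian ideal. Without it one would reach
  -- only the ideal of the derivatives.
  let t : A × Derivation k A A →ₗ[A] J :=
    { toFun := fun m => ⟨m.1 * h + m.2 h, J.add_mem (J.mul_mem_left _ hhJ) (hθJ _)⟩
      map_add' := fun x y => Subtype.ext (by simp; ring)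
      map_smul' := fun a x => Subtype.ext (by simp; ring) }
  have ht : Function.Surjective t := by
    have : J ≤ LinearMap.range (J.subtype ∘ₗ t) := by
      conv_lhs => rw [hJ]
      refine sup_le ?_ (Ideal.span_le.mpr ?_)
      · rw [Ideal.span_singleton_le_iff_mem]
        exact ⟨(1, 0), by simp [t]⟩
      · rintro _ ⟨θ, rfl⟩
        exact ⟨(0, θ), by simp [t]⟩
    intro x
    obtain ⟨m, hm⟩ := this x.2
    exact ⟨m, Subtype.ext hm⟩
  choose c hc using fun j => (hspan (δ j)).mpr (Submodule.subset_span ⟨j, rfl⟩)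
  let f : Fin n → A × Derivation k A A := fun j => (-c j, δ j)
  have htf : ∀ j, t (f j) = 0 := fun j => Subtype.ext (by simp [t, f, hc]; ring)
  -- If `a h + θ h = 0`, then `θ` is logarithmic, hence a combination of the `δⱼ`. The component `a`
  -- is then determined by `θ`, as `h` can be cancelled.
  have hkt : (LinearMap.ker t : Set (A × Derivation k A A)) ⊆
      Submodule.span A (Set.range f) := by
    rintro ⟨a, θ⟩ hm
    have hm' : a * h + θ h = 0 := congrArg Subtype.val (LinearMap.mem_ker.mp hm)
    have hθ := (hspan θ).mp ⟨-a, by linear_combination hm'⟩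
    obtain ⟨b, rfl⟩ := (Submodule.mem_span_range_iff_exists_fun A).mp hθ
    refine (Submodule.mem_span_range_iff_exists_fun A).mpr ⟨b, ?_⟩
    have h2 : (∑ j, b j • f j).2 = ∑ j, b j • δ j := by simp [f, Prod.snd_sum]
    have h3 : t (∑ j, b j • f j) = 0 := by simp [htf]
    have h4 : (∑ j, b j • f j).1 * h + (∑ j, b j • f j).2 h = 0 := congrArg Subtype.val h3
    rw [h2] at h4
    refine Prod.ext (mul_right_cancel₀ hh ?_) h2
    linear_combination h4 - hm'
  -- Derivations are embedded in a `K`-vector space as functions `A → K`. Only injectivity matters: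
  -- it carries independence over `A` to independence over `K`.
  let v : A × Derivation k A A →ₗ[A] K × (A → K) :=
    { toFun := fun m => (algebraMap A K m.1, fun x => algebraMap A K (m.2 x))
      map_add' := fun x y => Prod.ext (by simp) (funext fun z => by simp)
      map_smul' := fun a x => Prod.ext (by simp [Algebra.smul_def])
        (funext fun z => by simp [Algebra.smul_def]) }
  have hv : Function.Injective v := by
    intro x y hxy
    refine Prod.ext ?_ (Derivation.ext fun z => ?_)
    · exact FaithfulSMul.algebraMap_injective A K (congrArg Prod.fst hxy)
    · exact FaithfulSMul.algebraMap_injective A K (congrFun (congrArg Prod.snd hxy) z)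
  let v' : A × Derivation k A A →ₛₗ[algebraMap A K] K × (A → K) :=
    { toFun := v
      map_add' := v.map_add
      map_smul' := fun a x => (v.map_smul a x).trans (algebraMap_smul K a (v x)).symm }
  -- The map `t` after extension to `K`: evaluate the derivation at `h` and add the multiple of `h`.
  let e : K × (A → K) →ₗ[K] K :=
    { toFun := fun y => y.1 * algebraMap A K h + y.2 h
      map_add' := fun x y => by simp; ring
      map_smul' := fun a x => by simp; ring }
  have hev : ∀ m, e (v' m) = algebraMap A K (t m) := fun m => by simp [e, v', v, t]
  have hf : LinearIndependent A f := LinearIndependent.of_comp (LinearMap.snd A _ _) hδ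
  have hfK : LinearIndependent K fun j => v' (f j) :=
    (LinearIndependent.iff_fractionRing A K).mp (hf.map' v (LinearMap.ker_eq_bot.mpr hv))
  refine SymmetricAlgebra.isRegularFamily_ι (f := f) v' hfK e (fun j => by rw [hev, htf]; simp) ?_
    (m₀ := (1, 0)) ?_ (LinearMap.snd A _ _) LinearMap.snd_surjective ?_
  -- An element killed by the map to `Sym_K K` is killed in `Sym J`, because `Sym J` embeds in `A[T]
  -- ⊆ K[T]` by linear type. So it lies in the ideal generated by `ker t`, which is generated by the
  -- `fⱼ`.
  · intro x hx
    rw [RingHom.mem_ker] at hx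
    have h1 : x ∈ RingHom.ker (SymmetricAlgebra.mapₛ (RingHom.id A) t) := by
      rw [RingHom.mem_ker]
      apply hlin
      apply Subtype.ext
      apply Polynomial.map_injective _ (FaithfulSMul.algebraMap_injective A K)
      let F₁ : SymmetricAlgebra A (A × Derivation k A A) →+* Polynomial K :=
        (Polynomial.mapRingHom (algebraMap A K)).comp
          ((reesAlgebra J).val.toRingHom.comp (J.symToRees.toRingHom.comp
            (SymmetricAlgebra.mapₛ (RingHom.id A) t)))
      let F₂ : SymmetricAlgebra A (A × Derivation k A A) →+* Polynomial K :=
        (SymmetricAlgebra.lift (Polynomial.monomial 1 : K →ₗ[K] Polynomial K)).toRingHom.comp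
          (SymmetricAlgebra.mapₛ (algebraMap A K) (e.comp v'))
      -- Both homomorphisms to `K[T]` are the natural one on `A` and send a linear element `m` to
      -- `t(m) T`.
      have hF : F₁ = F₂ := by
        refine SymmetricAlgebra.ringHom_ext' (fun a => ?_) fun m => ?_
        · simp [F₁, F₂]
        · simp only [F₁, F₂, Ideal.symToRees, RingHom.comp_apply, SymmetricAlgebra.mapₛ_ι,
            AlgHom.toRingHom_eq_coe, RingHom.coe_coe, SymmetricAlgebra.lift_ι_apply,
            LinearMap.comp_apply, hev]
          exact Polynomial.map_monomial _
      have h2 : F₁ x = 0 := by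
        rw [hF]
        exact (congrArg _ hx).trans (map_zero _)
      simpa [F₁] using h2
    refine (SymmetricAlgebra.ker_mapₛ_le t ht).trans ?_ h1
    rw [Ideal.span_le]
    rintro _ ⟨m, hm, rfl⟩
    obtain ⟨b, rfl⟩ := (Submodule.mem_span_range_iff_exists_fun A).mp (hkt hm)
    rw [map_sum]
    refine Ideal.sum_mem _ fun j _ => ?_
    rw [_root_.map_smul, Algebra.smul_def]
    exact Ideal.mul_mem_left _ _ (Ideal.subset_span ⟨j, rfl⟩)
  -- The element `(1, 0)` is mapped to `h`, which is nonzero.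
  · rw [hev]
    simpa [t] using hh
  · ext ⟨a, θ⟩
    rw [LinearMap.mem_ker, Submodule.mem_span_singleton]
    constructor
    · intro h0
      exact ⟨a, Prod.ext (by simp) (by simpa using (show θ = 0 from h0).symm)⟩
    · rintro ⟨b, hb⟩
      simpa using (congrArg Prod.snd hb).symm

end Jacobian
lemma Submodule.span_range_coe_of_span_eq_top {R M ι : Type*} [CommRing R] [AddCommGroup M]
    [Module R M] {S : Submodule R M} {b : ι → S} (hb : Submodule.span R (Set.range b) = ⊤) :
    Submodule.span R (Set.range fun j => (b j : M)) = S := by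
  have : (Set.range fun j => (b j : M)) = S.subtype '' Set.range b := by
    rw [← Set.range_comp]
    rfl
  rw [this, ← Submodule.map_span, hb, Submodule.map_top, Submodule.range_subtype]

/-! ### Local regular bases of `Der_X(-log D)`. -/

namespace AlgebraicGeometry.Scheme

variable (k : Type u) [Field k] {X : Scheme.{u}} [X.Over (Spec (.of k))]
  (D : X.IdealSheafData)

attribute [local instance] sectionsAlgebra

/-- By the Leibniz rule `θ(h c) = h θ(c) + c θ(h)`, so only the generator has to be tested. -/
lemma mem_derLogSubmodule_iff_dvd {U : X.AffineZariskiSite} {h : Γ(X, U.toOpens)}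
    (hD : D.aff U = Ideal.span {h}) (θ : Derivation k Γ(X, U.toOpens) Γ(X, U.toOpens)) :
    θ ∈ derLogSubmodule k D U ↔ h ∣ θ h := by
  have hmem : ∀ a, a ∈ D.aff U ↔ h ∣ a := fun a => by rw [hD, Ideal.mem_span_singleton]
  constructor
  · exact fun hθ => (hmem _).mp (hθ h ((hmem h).mpr dvd_rfl))
  · intro hθ a ha
    obtain ⟨c, rfl⟩ := (hmem a).mp ha
    rw [hmem, Derivation.leibniz]
    exact dvd_add (dvd_mul_right h _) (dvd_mul_of_dvd_right hθ c)

lemma jacobianIdeal_eq {U : X.AffineZariskiSite} {h : Γ(X, U.toOpens)}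
    (hD : D.aff U = Ideal.span {h}) : jacobianIdeal k D U = Ideal.span {h} ⊔
      Ideal.span {b | ∃ θ : Derivation k Γ(X, U.toOpens) Γ(X, U.toOpens), θ h = b} := by
  have hmem : ∀ a, a ∈ D.aff U ↔ h ∣ a := fun a => by rw [hD, Ideal.mem_span_singleton]
  refine le_antisymm (sup_le (hD ▸ le_sup_left) (Ideal.span_le.mpr ?_))
    (sup_le (hD ▸ le_sup_left) (Ideal.span_le.mpr ?_))
  · rintro _ ⟨θ, a, ha, rfl⟩
    obtain ⟨c, rfl⟩ := (hmem a).mp ha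
    rw [Derivation.leibniz, SetLike.mem_coe]
    refine Ideal.add_mem _ (Ideal.mem_sup_left ?_) (Ideal.mem_sup_right ?_)
    · exact Ideal.mul_mem_right _ _ (Ideal.mem_span_singleton_self h)
    · exact Ideal.mul_mem_left _ _ (Ideal.subset_span ⟨θ, rfl⟩)
  · rintro _ ⟨θ, rfl⟩
    exact Ideal.mem_sup_right (Ideal.subset_span ⟨θ, h, (hmem h).mpr dvd_rfl, rfl⟩)

variable {D} [LocallyOfFiniteType (X ↘ Spec (.of k))] [IsIntegral X] {n : ℕ}

/-- Locally `Der(-log D)` has a basis that is a regular family in `Sym Der`. -/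
lemma exists_regular_basis_derLog (hD : IsReducedDivisor D) (hfree : IsFreeDivisor k D n)
    (hlin : IsJacobianLinearType k D) (x : X) :
    ∃ U : X.AffineZariskiSite, x ∈ U.toOpens ∧ ∃ b : Fin n → (derLog k D).obj U,
      Submodule.span Γ(X, U.toOpens) (Set.range b) = ⊤ ∧
      LinearIndependent Γ(X, U.toOpens) b ∧ IsRegularFamily fun j =>
        SymmetricAlgebra.ι Γ(X, U.toOpens) _ ((derLogIncl k D).app U (b j)) := by
  obtain ⟨V, hxV, ⟨β⟩⟩ := hfree x
  obtain ⟨V', hxV', h, hh, hDh⟩ := hD.locally_principal x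
  -- The basis and the local equation live on different affine opens. Both are restricted to one
  -- that is basic in each.
  obtain ⟨U, hUV, hUV', hxU⟩ := exists_affine_le_inter V V' x hxV hxV'
  have : Nonempty U.toOpens := ⟨⟨x, hxU⟩⟩
  have : Nonempty V'.toOpens := ⟨⟨x, hxV'⟩⟩
  let b : Fin n → (derLog k D).obj U := fun j => (derLog k D).res hUV (β j)
  have hbs : Submodule.span Γ(X, U.toOpens) (Set.range b) = ⊤ :=
    AffMod.span_res _ hUV β β.span_eq
  have hbi : LinearIndependent Γ(X, U.toOpens) b :=
    Fintype.linearIndependent_iff.mpr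
      (AffMod.linearIndependent_res _ hUV β β.linearIndependent)
  refine ⟨U, hxU, b, hbs, hbi, ?_⟩
  have hDU : D.aff U = Ideal.span {X.ringRes hUV' h} := by
    rw [← D.map_aff hUV', hDh, Ideal.map_span, Set.image_singleton]
  -- On an integral scheme restriction between nonempty opens is injective, so the equation stays
  -- nonzero.
  have hh0 : X.ringRes hUV' h ≠ 0 := fun h0 =>
    nonZeroDivisors.ne_zero hh (map_injective_of_isIntegral X
      (homOfLE (AffineZariskiSite.toOpens_mono hUV')) (h0.trans (map_zero _).symm))
  refine Derivation.isRegularFamily_ι_of_symToRees_injective (k := k) hh0 (jacobianIdeal k D U)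
    (jacobianIdeal_eq k D hDU) (hlin U).1 (fun j => (b j).1) ?_ fun θ => ?_
  · exact hbi.map' (derLogSubmodule k D U).subtype (Submodule.ker_subtype _)
  · rw [← mem_derLogSubmodule_iff_dvd k D hDU]
    exact (SetLike.ext_iff.mp
      (Submodule.span_range_coe_of_span_eq_top (S := derLogSubmodule k D U) (b := b) hbs) θ).symm

end AlgebraicGeometry.Scheme
end

/-! ### The theorem, for `0 → Der_X(-log D) → Der_X → i_*𝓘(D) → 0`. -/

theorem mainTheorem3 (k : Type u) [Field k] [IsAlgClosed k] [CharZero k]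
    (X : Scheme.{u}) [X.Over (Spec (.of k))] [IsIntegral X] [IsSeparated (X ↘ Spec (.of k))]
    [LocallyOfFiniteType (X ↘ Spec (.of k))] [QuasiCompact (X ↘ Spec (.of k))]
    (n : ℕ) [SmoothOfRelativeDimension n (X ↘ Spec (.of k))]
    (D : X.IdealSheafData) (hD : Scheme.IsReducedDivisor D)
    (hfree : Scheme.IsFreeDivisor k D n) (hlin : Scheme.IsJacobianLinearType k D) :
    Scheme.logProjIncl k D ≫ (X.der k).projProj = (Scheme.logQuot k D).projProj ∧
    Scheme.IsRegularClosedImmersion n (Scheme.logProjIncl k D) ∧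
    Nonempty (Scheme.normalSheaf (Scheme.logProjIncl k D) ≅
      ((Scheme.Modules.pullback (Scheme.logQuot k D).projProj).obj
        (Scheme.derLog k D).sections).tensor (Scheme.logQuot k D).twist) ∧
    IsPullback (Scheme.logConeIncl k D) (Scheme.logQuot k D).coneProj
      (Scheme.logSigma k D) (Scheme.derLog k D).zeroSection := by
  have hφ := Scheme.derToLogQuot_surjective k D
  -- Exactness in the middle: the derivations with zero class in `i_*𝓘(D)` are the logarithmic ones.
  have hex : ∀ (U : X.AffineZariskiSite) (θ : (X.der k).obj U),
      (Scheme.derToLogQuot k D).app U θ = 0 ↔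
        ∃ κ : (Scheme.derLog k D).obj U, (Scheme.derLogIncl k D).app U κ = θ := by
    intro U θ
    refine Subtype.ext_iff.trans ((Scheme.logMap_eq_zero_iff k D U θ).trans ?_)
    constructor
    · exact fun h => ⟨⟨θ, h⟩, rfl⟩
    · rintro ⟨κ, rfl⟩
      exact κ.2
  have hreg := Scheme.exists_regular_basis_derLog k hD hfree hlin
  refine ⟨Scheme.AffMod.projMap_projProj _ hφ, ?_, ?_, ?_⟩
  · refine Scheme.AffMod.isRegularClosedImmersion_projMap (Scheme.derLogIncl k D) _ hφ hex ?_
    intro x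
    obtain ⟨U, hx, b, hs, -, hr⟩ := hreg x
    exact ⟨U, hx, b, hs, hr⟩
  · have h₁ := Scheme.AffMod.isIso_normalToHom (Scheme.derLogIncl k D) _ hφ hex (by
      intro x
      obtain ⟨U, hx, b, hs, -, hr⟩ := hreg x
      exact ⟨U, hx, b, hs, hr⟩)
    have h₂ := Scheme.AffMod.isIso_tensorToHom (K := Scheme.derLog k D) (N := Scheme.logQuot k D) (by
      intro x
      obtain ⟨U, hx, b, hs, hb, -⟩ := hreg x
      exact ⟨U, hx, b, hs, hb⟩)
    -- Both sheaves are identified with `Hom(p^* Der_X(-log D), 𝒪(1))`.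
    exact ⟨@asIso _ _ _ _ _ h₁ ≪≫ (@asIso _ _ _ _ _ h₂).symm⟩
  · exact Scheme.AffMod.isPullback_coneMap _ _ hφ hex
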